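/- **Setting.** Let $X$ be a complex manifold of positive dimension, $D\subset X$ a (locally) normal crossing divisor, and $\Phi$ a log-symplectic form with polar divisor $D$: a closed section of $\Omega^2_X\langle\log D\rangle$ inducing a nondegenerate pairing on $T_X\langle-\log D\rangle$. Let $f_1:X_1\to X$ be the normalization of $D$ (a point of $X_1$ is a point $p\in D$ with a branch of $D$ through $p$), $D_1\subset X_1$ the induced normal crossing divisor (the trace of the other branches), and $N_{f_1}=f_1^*T_X/T_{X_1}$ the branch normal bundle; if $x_1$ is a branch equation, $N_{f_1}$ is locally $x_1^{-1}\mathcal O_X/\mathcal O_X$. *The piece $\mathcal G_1$.* Put $\Omega^1_X\langle\log^+D\rangle=\langle\Phi,T_X\rangle\supset\Omega^1_X\langle\log D\rangle$ and $\Omega^k_X\langle\log^+D\rangle=\Lambda^k\,\Omega^1_X\langle\log^+D\rangle$, $k>0$ (meromorphic forms, with the exterior derivative). Let $\mathcal F_i\Omega^k_X\langle\log^+D\rangle$ be generated by the products of at most $i$ log-plus $1$-forms and a log form, and let $\mathcal G_1^\bullet=(\mathcal F_1/\mathcal F_0)[1]$, so $\mathcal G_1^k=\mathcal F_1\Omega^{k+1}_X\langle\log^+D\rangle/\Omega^{k+1}_X\langle\log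 D\rangle$ for $k\ge0$. *The complex $\mathcal E_1$.* Let $v_1=x_1\partial_{x_1}$ be the canonical generator of the kernel of $f_1^*T_X\langle-\log D\rangle\to T_{X_1}\langle-\log D_1\rangle$, let $\psi_1=\langle\Phi,v_1\rangle$, a closed section of $\Omega^1_{X_1}\langle\log D_1\rangle\subset f_1^*\Omega^1_X\langle\log D\rangle$, and let $R_1'=\mathcal O_{X_1}\psi_1$. Let $\mathcal E_1^k=N_{f_1}\otimes Q_1^k$, $k\ge0$, where $Q_1^k=\Lambda^k\big(f_1^*\Omega^1_X\langle\log D\rangle/\mathcal O_{X_1}\psi_1\big)$, with the differential induced by $d(\omega/x_1)=(d\omega)/x_1-\operatorname{dlog}(x_1)\wedge\omega/x_1$. *Principal parts.* For a line bundle $L$ on $X_1$ let $P_0(L)\langle\log D_1\rangle$ be the normalized log principal parts bundle: it is generated by $\Omega^1_{X_1}\langle\log D_1\rangle$ and the $\operatorname{dlog}u$, $u$ a local generator of $L$, with $\operatorname{dlog}(gu)=\operatorname{dlog}u+dg/g$, and $P_0(L)\langle\log D_1\rangle=\Omega^1_{X_1}\langle\log D_1\rangle\oplus\mathcal O\operatorname{dlog}u$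 locally. Let $P^\bullet_{R_1'}(L)$ be the complex with terms $\Lambda^k\big(P_0(L)\langle\log D_1\rangle/R_1'\big)\otimes L$, $k\ge 0$, and differential induced by $d(c\otimes u)=(dc+\operatorname{dlog}u\wedge c)\otimes u$, where $d(\operatorname{dlog}u)=0$. **Proposition.** The differentials above are well defined and make $\mathcal G_1^\bullet$, $\mathcal E_1^\bullet$ and $P^\bullet_{R_1'}(N_{f_1})$ complexes of sheaves of complex vector spaces. The complex $\mathcal G_1^\bullet$ is isomorphic to the direct image $f_{1*}\mathcal E_1^\bullet$, by a termwise $\mathcal O_X$-linear isomorphism of complexes, and $$\mathcal E_1^\bullet\cong P^\bullet_{R_1'}(N_{f_1})$$ by a termwise $\mathcal O_{X_1}$-linear isomorphism of complexes. Moreover $\mathcal E_1^\bullet$ is null-homotopic (as a complex of sheaves of complex vector spaces) and exact, and $\mathcal G_1^\bullet$ is exact. -/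

import Mathlib

open scoped Manifold ContDiff Topology
open CategoryTheory TopologicalSpace Opposite

noncomputable section

namespace LogSymp

/-! ### Sheaves of subquotients

A sheaf of complex vector spaces on `Y` whose stalk at `y` is a subquotient `num y / den y` of a
fixed ambient vector space `Amb` (below: the space of all differential forms, where `num y` and
`den y` are conditions on the germ at `y`), and whose sections are the families of elements of the
stalks which are, locally, represented by one element of `Amb`. In other words, it is the
quotient sheaf of the two sheaves of germs. -/

structure Subquot (Y : Type) where
  Amb : Type
  [acg : AddCommGroup Amb]
  [mod : Module ℂ Amb]
  num : Y → Submodule ℂ Amb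
  den : Y → Submodule ℂ Amb

namespace Subquot

attribute [instance] Subquot.acg Subquot.mod

variable {Y : Type} [TopologicalSpace Y]

/-- The stalk `num y / den y` (strictly: `num y / (num y ∩ den y)`). -/
abbrev Stalk (S : Subquot Y) (y : Y) : Type :=
  S.num y ⧸ (S.den y).submoduleOf (S.num y)

/-- The element `t` of the stalk at `y` is the class of `a`. -/
def IsClass (S : Subquot Y) (y : Y) (t : S.Stalk y) (a : S.Amb) : Prop :=
  ∃ h : a ∈ S.num y, t = Submodule.Quotient.mk ⟨a, h⟩

/-- The sections over the open set `V`. -/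
def Sec (S : Subquot Y) (V : Opens Y) : Submodule ℂ (∀ y : V, S.Stalk y) where
  carrier := {s | ∀ y : V, ∃ W : Opens Y, y.1 ∈ W ∧ ∃ a : S.Amb,
    ∀ z : V, z.1 ∈ W → S.IsClass z (s z) a}
  zero_mem' := fun y => ⟨V, y.2, 0, fun z _ => ⟨(S.num z).zero_mem, rfl⟩⟩
  add_mem' := by
    intro s t hs ht y
    obtain ⟨W, hW, a, ha⟩ := hs y
    obtain ⟨W', hW', b, hb⟩ := ht y
    refine ⟨W ⊓ W', ⟨hW, hW'⟩, a + b, fun z hz => ?_⟩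
    obtain ⟨h, e⟩ := ha z hz.1
    obtain ⟨h', e'⟩ := hb z hz.2
    exact ⟨(S.num z).add_mem h h', by rw [Pi.add_apply, e, e']; rfl⟩
  smul_mem' := by
    intro c s hs y
    obtain ⟨W, hW, a, ha⟩ := hs y
    refine ⟨W, hW, c • a, fun z hz => ?_⟩
    obtain ⟨h, e⟩ := ha z hz
    exact ⟨(S.num z).smul_mem c h, by rw [Pi.smul_apply, e]; rfl⟩

/-- The section `s` is represented at the point `y` by `a`. -/
def Rep (S : Subquot Y) {V : Opens Y} (s : S.Sec V) (y : V) (a : S.Amb) : Prop :=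
  S.IsClass y (s.1 y) a

/-- Restriction of sections. -/
def res (S : Subquot Y) {U V : Opens Y} (h : U ≤ V) : S.Sec V →ₗ[ℂ] S.Sec U where
  toFun s := ⟨fun y => s.1 ⟨y.1, h y.2⟩, fun y => by
    obtain ⟨W, hW, a, ha⟩ := s.2 ⟨y.1, h y.2⟩
    exact ⟨W, hW, a, fun z hz => ha ⟨z.1, h z.2⟩ hz⟩⟩
  map_add' _ _ := rfl
  map_smul' _ _ := rfl

/-- The presheaf of sections. -/
def presheaf (S : Subquot Y) : TopCat.Presheaf (ModuleCat.{0} ℂ) (TopCat.of Y) where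
  obj V := ModuleCat.of ℂ (S.Sec V.unop)
  map i := ModuleCat.ofHom (S.res i.unop.le)

/-- Being a section is a local condition. -/
def localPredicate (S : Subquot Y) :
    TopCat.LocalPredicate (X := TopCat.of Y) (fun y => S.Stalk y) where
  pred {V} s := s ∈ S.Sec V
  res {_ _} i s hs := (S.res i.le ⟨s, hs⟩).2
  locality {V} s w := by
    intro y
    obtain ⟨V', hy, i, hs⟩ := w y
    obtain ⟨W, hW, a, ha⟩ := hs ⟨y.1, hy⟩
    exact ⟨W ⊓ V', ⟨hW, hy⟩, a, fun z hz => ha ⟨z.1, hz.2⟩ hz.1⟩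

/-- The underlying presheaf of sets consists of the families satisfying the local condition. -/
def presheafForget (S : Subquot Y) :
    TopCat.subpresheafToTypes S.localPredicate.toPrelocalPredicate ≅
      S.presheaf ⋙ CategoryTheory.forget (ModuleCat.{0} ℂ) :=
  NatIso.ofComponents fun _ => Iso.refl _

/-- The sheaf of sections, as a sheaf of complex vector spaces. -/
def sheaf (S : Subquot Y) : TopCat.Sheaf (ModuleCat.{0} ℂ) (TopCat.of Y) :=
  ⟨S.presheaf, (TopCat.Presheaf.isSheaf_iff_isSheaf_comp (CategoryTheory.forget _) _).mpr
    (TopCat.Presheaf.isSheaf_of_iso S.presheafForget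
      (TopCat.subpresheafToTypes.isSheaf S.localPredicate))⟩

end Subquot

namespace Subquot

variable {Y : Type} [TopologicalSpace Y]

/-- The effect of a morphism of sheaves on sections. -/
def onSec {S S' : Subquot Y} (φ : S.sheaf ⟶ S'.sheaf) (V : Opens Y) : S.Sec V →ₗ[ℂ] S'.Sec V :=
  (φ.hom.app (op V)).hom

/-- The morphism of sheaves `φ` is the one induced by the map `δ` of representatives:
`φ [a] = [δ a]`. There is at most one such `φ`. -/
def Induced {S S' : Subquot Y} (φ : S.sheaf ⟶ S'.sheaf) (δ : S.Amb → S'.Amb) : Prop :=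
  ∀ (V : Opens Y) (s : S.Sec V) (y : V) (a : S.Amb), S.Rep s y a → S'.Rep (onSec φ V s) y (δ a)

end Subquot

/-! ### Differential forms on complex manifolds -/

/-- The model space `ℂᵐ`. -/
abbrev Cn (m : ℕ) : Type := Fin m → ℂ

section Forms

variable {m : ℕ} {Y : Type} [TopologicalSpace Y] [ChartedSpace (Cn m) Y]

/-- A (set-theoretic) differential `k`-form on `Y`: its value at `y` is an alternating form
on the tangent space `T_y Y`, which Mathlib identifies with `ℂᵐ`. Below, forms on `Y` are only
looked at outside of a divisor `D`, and their values on `D` are irrelevant. -/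
abbrev Form (m k : ℕ) (Y : Type) : Type := Y → (Cn m) [⋀^Fin k]→L[ℂ] ℂ

/-- The differential at `z` of the inverse of a chart. -/
def chartInvDeriv (e : OpenPartialHomeomorph Y (Cn m)) (z : Cn m) : Cn m →L[ℂ] Cn m :=
  mfderiv 𝓘(ℂ, Cn m) 𝓘(ℂ, Cn m) e.symm z

/-- The differential at `y` of a chart. -/
def chartDeriv (e : OpenPartialHomeomorph Y (Cn m)) (y : Y) : Cn m →L[ℂ] Cn m :=
  mfderiv 𝓘(ℂ, Cn m) 𝓘(ℂ, Cn m) e y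

/-- A form on `Y` written in the coordinates of a chart (pullback under the inverse chart). -/
def inChart {k : ℕ} (e : OpenPartialHomeomorph Y (Cn m)) (α : Form m k Y) :
    Cn m → (Cn m) [⋀^Fin k]→L[ℂ] ℂ :=
  fun z => (α (e.symm z)).compContinuousLinearMap (chartInvDeriv e z)

/-- The exterior derivative, computed at each point in the preferred chart at that point. -/
def dForm {k : ℕ} (α : Form m k Y) : Form m (k + 1) Y := fun y =>
  (extDeriv (inChart (chartAt (Cn m) y) α) (chartAt (Cn m) y y)).compContinuousLinearMap
    (chartDeriv (chartAt (Cn m) y) y)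

/-- The wedge product of a `1`-form and a `k`-form on a vector space:
`(θ ∧ a) (v₀, …, v_k) = ∑ (-1) ^ i θ(v_i) a(v₀, …, v̂_i, …, v_k)`. -/
def wedge {E : Type*} [NormedAddCommGroup E] [NormedSpace ℂ E] {k : ℕ}
    (θ : E [⋀^Fin 1]→L[ℂ] ℂ) (a : E [⋀^Fin k]→L[ℂ] ℂ) : E [⋀^Fin (k + 1)]→L[ℂ] ℂ :=
  ContinuousAlternatingMap.alternatizeUncurryFin
    (((ContinuousAlternatingMap.ofSubsingleton ℂ E ℂ (0 : Fin 1)).symm θ).smulRight a)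

/-- The function `g` is holomorphic near `y`. -/
def HolFun (m : ℕ) {Y : Type} [TopologicalSpace Y] [ChartedSpace (Cn m) Y] (g : Y → ℂ)
    (y : Y) : Prop :=
  ∀ᶠ z in 𝓝 y, MDifferentiableAt 𝓘(ℂ, Cn m) 𝓘(ℂ) g z

/-- The differential of a function. -/
def dFun (m : ℕ) {Y : Type} [TopologicalSpace Y] [ChartedSpace (Cn m) Y] (g : Y → ℂ)
    (y : Y) : Cn m →L[ℂ] ℂ := mfderiv 𝓘(ℂ, Cn m) 𝓘(ℂ) g y

/-- The vector field `ξ` is holomorphic near `y`. -/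
def HolField [IsManifold 𝓘(ℂ, Cn m) ω Y] (ξ : Y → Cn m) (y : Y) : Prop :=
  haveI : IsManifold 𝓘(ℂ, Cn m) 1 Y := IsManifold.of_le (n := ω) le_top
  ∀ᶠ z in 𝓝 y, MDifferentiableAt 𝓘(ℂ, Cn m) 𝓘(ℂ, Cn m).tangent
    (fun x => (⟨x, ξ x⟩ : TangentBundle 𝓘(ℂ, Cn m) Y)) z

/-- `(e, S)` is an adapted chart at `y`: `e` is a holomorphic chart around `y` in which `D` is
the union of the coordinate hyperplanes `x_i = 0`, `i ∈ S`. -/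
def Adapted (D : Set Y) (e : OpenPartialHomeomorph Y (Cn m)) (S : Finset (Fin m)) (y : Y) : Prop :=
  e ∈ IsManifold.maximalAtlas 𝓘(ℂ, Cn m) ω Y ∧ y ∈ e.source ∧
    ∀ z ∈ e.source, z ∈ D ↔ ∃ i ∈ S, e z i = 0

/-- `D` is a (reduced, locally) normal crossing divisor. -/
def IsNormalCrossing (D : Set Y) : Prop :=
  IsClosed D ∧ ∀ y : Y, ∃ e S, Adapted (m := m) D e S y

/-- The log frame `x_i ∂_i` (`i ∈ S`), `∂_j` (`j ∉ S`) at the point `z` of `ℂᵐ`, as the linear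
map that sends the standard basis to it. -/
def logFrame (S : Finset (Fin m)) (z : Cn m) : Cn m →L[ℂ] Cn m :=
  ContinuousLinearMap.pi fun i =>
    (if i ∈ S then z i else 1) • (ContinuousLinearMap.proj i : Cn m →L[ℂ] ℂ)

/-- Near `y`, the form `α` is regular outside of `D` and `h` gives its coefficients with respect
to the log coframe `dlog x_i` (`i ∈ S`), `dx_j` (`j ∉ S`) of the adapted chart; these
coefficients are holomorphic, also along `D`. -/
def LogCoeff {k : ℕ} (D : Set Y) (e : OpenPartialHomeomorph Y (Cn m)) (S : Finset (Fin m))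
    (α : Form m k Y) (y : Y) (h : Cn m → (Cn m) [⋀^Fin k]→L[ℂ] ℂ) : Prop :=
  (∀ᶠ z in 𝓝 (e y), DifferentiableAt ℂ h z) ∧
    ∀ᶠ z in 𝓝 (e y), e.symm z ∉ D →
      (inChart e α z).compContinuousLinearMap (logFrame S z) = h z

/-- The germs at `y` of log forms: the stalk of `Ω^k⟨log D⟩`, consisting of the forms whose
coefficients in adapted charts are holomorphic. For `D = ∅` these are the holomorphic forms. -/
def logForms (D : Set Y) (k : ℕ) (y : Y) : Submodule ℂ (Form m k Y) where
  carrier := {α | ∀ e S, Adapted D e S y → ∃ h, LogCoeff D e S α y h}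
  zero_mem' := fun e S _ => ⟨0, Filter.Eventually.of_forall fun _ => differentiableAt_const _,
    Filter.Eventually.of_forall fun _ _ => rfl⟩
  add_mem' := by
    intro α β hα hβ e S he
    obtain ⟨h, h1, h2⟩ := hα e S he
    obtain ⟨h', h1', h2'⟩ := hβ e S he
    refine ⟨h + h', ?_, ?_⟩
    · filter_upwards [h1, h1'] with z a b using a.add b
    · filter_upwards [h2, h2'] with z a b hz
      rw [show (h + h') z = h z + h' z from rfl, ← a hz, ← b hz]
      rfl
  smul_mem' := by
    intro c α hα e S he
    obtain ⟨h, h1, h2⟩ := hα e S he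
    refine ⟨c • h, ?_, ?_⟩
    · filter_upwards [h1] with z a using a.const_smul c
    · filter_upwards [h2] with z a hz
      rw [show (c • h) z = c • h z from rfl, ← a hz]
      rfl

/-- A log-symplectic form with polar divisor `D`: a closed log `2`-form which is nondegenerate as
a log form, i.e. its matrix of coefficients in the log coframe is invertible at every point. -/
structure IsLogSymplectic (D : Set Y) (Φ : Form m 2 Y) : Prop where
  log : ∀ y, Φ ∈ logForms D 2 y
  closed : ∀ y, y ∉ D → dForm Φ y = 0
  nondegenerate : ∀ y e S h, Adapted D e S y → LogCoeff D e S Φ y h →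
    ∀ v : Cn m, v ≠ 0 → ∃ w : Cn m, h (e y) ![v, w] ≠ 0

/-- Interior multiplication of `Φ` by the vector field `ξ`, `⟨Φ, ξ⟩ = Φ(ξ, ·)`. -/
def interior (Φ : Form m 2 Y) (ξ : Y → Cn m) : Form m 1 Y := fun y => (Φ y).curryLeft (ξ y)

/-! ### The log-plus complex and its filtration -/

/-- The germs at `y` of `Ω^1⟨log⁺ D⟩ = ⟨Φ, T_X⟩`. -/
def logPlusOne [IsManifold 𝓘(ℂ, Cn m) ω Y] (D : Set Y) (Φ : Form m 2 Y) (y : Y) : Set (Form m 1 Y) :=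
  {θ | ∃ ξ : Y → Cn m, HolField ξ y ∧ ∀ᶠ z in 𝓝[Dᶜ] y, θ z = interior Φ ξ z}

/-- The stalk at `y` of the `i`-th step `𝓕_i Ω^k⟨log⁺ D⟩` of the filtration of the log-plus complex
`Ω^k⟨log⁺ D⟩ = Λ^k Ω^1⟨log⁺ D⟩` induced by `Ω^1⟨log D⟩ ⊆ Ω^1⟨log⁺ D⟩`: the meromorphic `k`-forms which
are sums of products of at most `i` log-plus `1`-forms and a log form. (The step `i = k` is all
of `Ω^k⟨log⁺ D⟩`, and the step `i = 0` is `Ω^k⟨log D⟩`.) -/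
def filt [IsManifold 𝓘(ℂ, Cn m) ω Y] (D : Set Y) (Φ : Form m 2 Y) : ∀ (_i k : ℕ) (_y : Y), Submodule ℂ (Form m k Y)
  | 0, k, y => logForms D k y
  | _ + 1, 0, y => logForms D 0 y
  | i + 1, k + 1, y => filt D Φ i (k + 1) y ⊔ Submodule.span ℂ
      {γ | ∃ θ ∈ logPlusOne D Φ y, ∃ α ∈ filt D Φ i k y, γ = fun z => wedge (θ z) (α z)}

/-- The `k`-th term of `𝓖_i = (𝓕_i / 𝓕_{i-1})[i]`, for `i = 1`: the sheaf
`𝓕_1 Ω^{k+1}⟨log⁺ D⟩ / 𝓕_0 Ω^{k+1}⟨log⁺ D⟩`. -/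
def grOne [IsManifold 𝓘(ℂ, Cn m) ω Y] (D : Set Y) (Φ : Form m 2 Y) (k : ℕ) : Subquot Y where
  Amb := Form m (k + 1) Y
  num := filt D Φ 1 (k + 1)
  den := filt D Φ 0 (k + 1)

end Forms

/-! ### The normalization of the divisor and the branch normal bundle -/

section Normalization

variable {m : ℕ} {X X₁ : Type} [TopologicalSpace X] [ChartedSpace (Cn (m + 1)) X]
  [TopologicalSpace X₁] [ChartedSpace (Cn m) X₁]

/-- `f : X₁ → X` is the normalization of the normal crossing divisor `D`: locally on `X`, in an
adapted chart where `D` is the union of the hyperplanes `x_i = 0`, `i ∈ S`, the inverse image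
in `X₁` is the disjoint union of open pieces, one for each `i ∈ S`, and `f` maps the `i`-th piece
isomorphically to the hyperplane `x_i = 0`, so that the `x_j ∘ f`, `j ≠ i`, are coordinates on
the piece. -/
def IsNormalization (D : Set X) (f : X₁ → X) : Prop :=
  ∀ p : X, ∃ (e : OpenPartialHomeomorph X (Cn (m + 1))) (S : Finset (Fin (m + 1)))
    (c : Fin (m + 1) → OpenPartialHomeomorph X₁ (Cn m)),
    Adapted D e S p ∧
    (∀ i ∈ S, c i ∈ IsManifold.maximalAtlas 𝓘(ℂ, Cn m) ω X₁) ∧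
    (∀ i ∈ S, ∀ j ∈ S, i ≠ j → Disjoint (c i).source (c j).source) ∧
    (f ⁻¹' e.source = ⋃ i ∈ S, (c i).source) ∧
    (∀ i ∈ S, ∀ q ∈ (c i).source, e (f q) i = 0 ∧ c i q = i.removeNth (e (f q))) ∧
    (∀ i ∈ S, ∀ z ∈ e.source, e z i = 0 → ∃ q ∈ (c i).source, f q = z)

/-- The differential of `f`. -/
def dMap (f : X₁ → X) (q : X₁) : Cn m →L[ℂ] Cn (m + 1) :=
  mfderiv 𝓘(ℂ, Cn m) 𝓘(ℂ, Cn (m + 1)) f q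

/-- The induced divisor `D₁` on `X₁`: the points `q` such that another branch of `D` than that
of `q` passes through `f q`. -/
def inducedDivisor (f : X₁ → X) : Set X₁ := {q | ∃ q', q' ≠ q ∧ f q' = f q}

/-- The fibre `T_{f(q)} X / T_q X₁` at `q` of the normal bundle `N_f`. -/
abbrev NormalFibre (f : X₁ → X) (q : X₁) : Type :=
  Cn (m + 1) ⧸ (LinearMap.range (dMap (m := m) f q).toLinearMap)

/-- The section `s` of the normal bundle `N_f` is holomorphic near `q`: it is the class of a
holomorphic vector field on `X`. -/
def HolNormal [IsManifold 𝓘(ℂ, Cn (m + 1)) ω X] (f : X₁ → X) (s : ∀ q, NormalFibre (m := m) f q) (q : X₁) : Prop :=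
  ∃ ξ : X → Cn (m + 1), HolField ξ (f q) ∧ ∀ᶠ q' in 𝓝 q, s q' = Submodule.Quotient.mk (ξ (f q'))

/-- `x` is an equation of the branch of `D` belonging to `q`, near `f q`: a generator of the kernel
of `f⁻¹ 𝓞_X → 𝓞_{X₁}` at `q`. -/
def BranchEq (f : X₁ → X) (q : X₁) (x : X → ℂ) : Prop :=
  HolFun (m + 1) x (f q) ∧ (∀ᶠ q' in 𝓝 q, x (f q') = 0) ∧ dFun (m + 1) x (f q) ≠ 0

/-- The co-residue fields at `q`, i.e. the germs of vector fields on `X` which are tangent to `D`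
(sections of `T_X⟨-log D⟩`) and vanish along the branch of `q`. In `f^* T_X⟨-log D⟩` they form the kernel
of the map to `T_{X₁}⟨-log D₁⟩`, which is generated by the co-residue `v₁ = x₁ ∂_{x₁}`. -/
def coresidueFields [IsManifold 𝓘(ℂ, Cn (m + 1)) ω X] (f : X₁ → X) (q : X₁) : Set (X → Cn (m + 1)) :=
  {v | HolField v (f q) ∧
    (∀ᶠ q' in (𝓝 (f q)).comap f, v (f q') ∈ LinearMap.range (dMap (m := m) f q').toLinearMap) ∧
    ∀ᶠ q' in 𝓝 q, v (f q') = 0}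

/-! ### The complex `𝓔₁` -/

/-- The stalk at `q` of `Ω^k_X⟨log D⟩(B) = x₁⁻¹ Ω^k_X⟨log D⟩`, where `B` is the branch of `q` and `x₁` is
its equation. -/
def polarForms (D : Set X) (f : X₁ → X) (k : ℕ) (q : X₁) :
    Submodule ℂ (Form (m + 1) k X) where
  carrier := {α | ∀ x, BranchEq (m := m) f q x → (fun z => x z • α z) ∈ logForms D k (f q)}
  zero_mem' := fun x _ => by
    convert! (logForms (m := m + 1) D k (f q)).zero_mem using 1
    funext z
    simp
  add_mem' := by
    intro α β hα hβ x hx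
    convert! (logForms D k (f q)).add_mem (hα x hx) (hβ x hx) using 1
    funext z
    simp
  smul_mem' := by
    intro c α hα x hx
    convert! (logForms D k (f q)).smul_mem c (hα x hx) using 1
    funext z
    simp [smul_comm c]

/-- The forms on `X`, at `q`, which vanish in `N_f ⊗ Λ^k (f^* Ω^1_X⟨log D⟩ / 𝓞 ψ₁)`: the sums of
a log form and of products `⟨Φ, v⟩ ∧ α` of a multiple of `ψ₁ = ⟨Φ, v₁⟩` and
`α ∈ x₁⁻¹ Ω^{k-1}_X⟨log D⟩`. -/
def psiForms [IsManifold 𝓘(ℂ, Cn (m + 1)) ω X] (D : Set X)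
    (Φ : Form (m + 1) 2 X) (f : X₁ → X) :
    ∀ (k : ℕ) (_q : X₁), Submodule ℂ (Form (m + 1) k X)
  | 0, q => logForms D 0 (f q)
  | k + 1, q => logForms D (k + 1) (f q) ⊔ Submodule.span ℂ
      {γ | ∃ v ∈ coresidueFields (m := m) f q, ∃ α ∈ polarForms (m := m) D f k q,
        γ = fun z => wedge (interior Φ v z) (α z)}

/-- The `k`-th term of `𝓔₁`, the sheaf `N_f ⊗ Q₁^k` with `Q₁^k = Λ^k (f^* Ω^1_X⟨log D⟩ / 𝓞 ψ₁)`. Here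
`N_f = 𝓞_X(B)/𝓞_X = x₁⁻¹ 𝓞_X / 𝓞_X` (the dual of `J = K/K²`, where `K` is the kernel of
`f⁻¹ 𝓞_X → 𝓞_{X₁}`), so that
`N_f ⊗ f^* Ω^k_X⟨log D⟩ = x₁⁻¹ Ω^k_X⟨log D⟩ / Ω^k_X⟨log D⟩`, and the differential
`d (ω / x₁) = (dω) / x₁ - dlog x₁ ∧ ω / x₁` is the one induced by the exterior derivative on `X`. -/
def calE [IsManifold 𝓘(ℂ, Cn (m + 1)) ω X] (D : Set X)
    (Φ : Form (m + 1) 2 X) (f : X₁ → X) (k : ℕ) : Subquot X₁ where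
  Amb := Form (m + 1) k X
  num := polarForms (m := m) D f k
  den := psiForms (m := m) D Φ f k

/-- The germs at `q` of `R₁' = 𝓞 ψ₁ ⊆ Ω^1_{X₁}⟨log D₁⟩`: the restrictions to `X₁` of the forms
`⟨Φ, v⟩`, `v` a co-residue field (these have no pole along the branch of `q`, i.e. outside of the
other branches they extend to holomorphic forms, whose pullback to `X₁` is taken). -/
def psiFoliation [IsManifold 𝓘(ℂ, Cn (m + 1)) ω X] (D : Set X)
    (Φ : Form (m + 1) 2 X) (f : X₁ → X) (q : X₁) :
    Set (Form m 1 X₁) :=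
  {β | ∃ v ∈ coresidueFields (m := m) f q, ∀ᶠ q' in 𝓝[(inducedDivisor f)ᶜ] q,
    ∃ α : Form (m + 1) 1 X, α ∈ logForms ∅ 1 (f q') ∧
      (∀ᶠ z in 𝓝[Dᶜ] (f q'), α z = interior Φ v z) ∧
      β q' = (α (f q')).compContinuousLinearMap (dMap f q')}

end Normalization

/-! ### Foliated principal parts complexes

Let `L` be a line bundle on the manifold `Y`. A local frame `u` of `L` gives a splitting
`P₀(L)⟨log D⟩ = Ω^1_Y⟨log D⟩ ⊕ 𝓞 · dlog u`, where `dlog u = d_L u ⊗ u⁻¹`, and for another frame `u' = g u`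
one has `dlog u' = dlog u + g⁻¹ dg` since `d_L` is a derivation. So in the frame `u` a section of
`Λ^k P₀(L)⟨log D⟩` is an alternating form on `T_y Y ⊕ ℂ`, whose second projection is `dlog u`, and a
section of `Λ^k P₀(L)⟨log D⟩ ⊗ L^j` is `c_u ⊗ u^j` with such a form `c_u`. -/

section PrincipalParts

variable {m : ℕ} {Y : Type} [TopologicalSpace Y] [ChartedSpace (Cn m) Y]

/-- Alternating forms on `T_y Y ⊕ ℂ`. -/
abbrev ExtForm (m k : ℕ) (Y : Type) : Type := Y → (Cn m × ℂ) [⋀^Fin k]→L[ℂ] ℂ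

/-- An extended form in the coordinates of a chart. -/
def extInChart {k : ℕ} (e : OpenPartialHomeomorph Y (Cn m)) (c : ExtForm m k Y) :
    Cn m → (Cn m × ℂ) [⋀^Fin k]→L[ℂ] ℂ :=
  fun z => (c (e.symm z)).compContinuousLinearMap
    ((chartInvDeriv e z).prodMap (ContinuousLinearMap.id ℂ ℂ))

/-- The exterior derivative of an extended form `α + dlog u ∧ β`, which is `dα - dlog u ∧ dβ`. -/
def dExt {k : ℕ} (c : ExtForm m k Y) : ExtForm m (k + 1) Y := fun y =>
  (extDeriv (fun p : Cn m × ℂ => extInChart (chartAt (Cn m) y) c p.1)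
    (chartAt (Cn m) y y, 0)).compContinuousLinearMap
      ((chartDeriv (chartAt (Cn m) y) y).prodMap (ContinuousLinearMap.id ℂ ℂ))

/-- `dlog u`, as the second projection `T_y Y ⊕ ℂ → ℂ`. -/
def dlogFrame (m : ℕ) : (Cn m × ℂ) [⋀^Fin 1]→L[ℂ] ℂ :=
  ContinuousAlternatingMap.ofSubsingleton ℂ (Cn m × ℂ) ℂ (0 : Fin 1)
    (ContinuousLinearMap.snd ℂ (Cn m) ℂ)

/-- A `k`-form on `Y` as an extended form. -/
def toExt {k : ℕ} (α : Form m k Y) : ExtForm m k Y := fun y =>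
  (α y).compContinuousLinearMap (ContinuousLinearMap.fst ℂ (Cn m) ℂ)

/-- The germs at `y` of sections of `Λ^k (Ω^1_Y⟨log D⟩ ⊕ 𝓞 · dlog u)`. -/
def extLogForms (D : Set Y) (k : ℕ) (y : Y) : Submodule ℂ (ExtForm m k Y) where
  carrier := {c | ∀ e S, Adapted D e S y → ∃ h : Cn m → (Cn m × ℂ) [⋀^Fin k]→L[ℂ] ℂ,
    (∀ᶠ z in 𝓝 (e y), DifferentiableAt ℂ h z) ∧
    ∀ᶠ z in 𝓝 (e y), e.symm z ∉ D →
      (extInChart e c z).compContinuousLinearMap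
        ((logFrame S z).prodMap (ContinuousLinearMap.id ℂ ℂ)) = h z}
  zero_mem' := fun e S _ => ⟨0, Filter.Eventually.of_forall fun _ => differentiableAt_const _,
    Filter.Eventually.of_forall fun _ _ => rfl⟩
  add_mem' := by
    intro α β hα hβ e S he
    obtain ⟨h, h1, h2⟩ := hα e S he
    obtain ⟨h', h1', h2'⟩ := hβ e S he
    refine ⟨h + h', ?_, ?_⟩
    · filter_upwards [h1, h1'] with z a b using a.add b
    · filter_upwards [h2, h2'] with z a b hz
      rw [show (h + h') z = h z + h' z from rfl, ← a hz, ← b hz]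
      rfl
  smul_mem' := by
    intro c α hα e S he
    obtain ⟨h, h1, h2⟩ := hα e S he
    refine ⟨c • h, ?_, ?_⟩
    · filter_upwards [h1] with z a using a.const_smul c
    · filter_upwards [h2] with z a hz
      rw [show (c • h) z = c • h z from rfl, ← a hz]
      rfl

/-- The extended forms whose germ at `y` (outside of `D`) is zero. -/
def zeroGerms (D : Set Y) (k : ℕ) (y : Y) : Submodule ℂ (ExtForm m k Y) where
  carrier := {c | ∀ᶠ z in 𝓝[Dᶜ] y, c z = 0}
  zero_mem' := by
    change ∀ᶠ z in 𝓝[Dᶜ] y, (0 : ExtForm m k Y) z = 0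
    exact Filter.Eventually.of_forall fun _ => rfl
  add_mem' := by
    intro a b ha hb
    change ∀ᶠ z in 𝓝[Dᶜ] y, (a + b) z = 0
    filter_upwards [ha, hb] with z h h'
    rw [Pi.add_apply, h, h', add_zero]
  smul_mem' := by
    intro r a ha
    change ∀ᶠ z in 𝓝[Dᶜ] y, (r • a) z = 0
    filter_upwards [ha] with z h
    rw [Pi.smul_apply, h]
    ext v
    simp

/-- The germs at `y` of the ideal generated by `F ⊆ Ω^1_Y⟨log D⟩` in the exterior algebra
of `Ω^1_Y⟨log D⟩ ⊕ 𝓞 · dlog u`; here `F y` is the set of germs at `y` of sections of `F`. -/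
def extIdeal (D : Set Y) (F : Y → Set (Form m 1 Y)) :
    ∀ (k : ℕ) (_y : Y), Submodule ℂ (ExtForm m k Y)
  | 0, y => zeroGerms D 0 y
  | k + 1, y => zeroGerms D (k + 1) y ⊔ Submodule.span ℂ
      {c | ∃ θ ∈ F y, ∃ b ∈ extLogForms D k y, c = fun z => wedge (toExt θ z) (b z)}

/-- The substitution `dlog u ↦ dlog u + g⁻¹ dg` in an extended form. -/
def twist {k : ℕ} (g : Y → ℂ) (c : ExtForm m k Y) : ExtForm m k Y := fun y =>
  (c y).compContinuousLinearMap ((ContinuousLinearMap.fst ℂ (Cn m) ℂ).prod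
    (ContinuousLinearMap.snd ℂ (Cn m) ℂ +
      (g y)⁻¹ • (dFun m g y).comp (ContinuousLinearMap.fst ℂ (Cn m) ℂ)))

/-- A local frame near `y` of the line bundle with fibres `L y`, whose holomorphic sections
are given by `hol`. -/
def IsFrame {L : Y → Type} [∀ y, AddCommGroup (L y)] (hol : (∀ y, L y) → Y → Prop)
    (u : ∀ y, L y) (y : Y) : Prop :=
  hol u y ∧ u y ≠ 0

/-- The `k`-th term `Λ^k (P₀(L)⟨log D⟩ / F) ⊗ L^j` of the `j`-th foliated log principal parts complex
`P^•_{j,F}(L)⟨log D⟩` of the line bundle `L`. An element of its stalk is a family of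
`c_u ∈ Λ^k (Ω^1_Y⟨log D⟩ ⊕ 𝓞 · dlog u)` modulo the ideal of `F`, for all local frames `u` of `L`, such
that `c_u ⊗ u^j` does not depend on `u`: if `u' = g u` then `c_u` is obtained from `g^j c_{u'}` by
the substitution `dlog u' = dlog u + g⁻¹ dg`. -/
def principalParts (D : Set Y) (F : Y → Set (Form m 1 Y)) {L : Y → Type}
    [∀ y, AddCommGroup (L y)] [∀ y, Module ℂ (L y)] (hol : (∀ y, L y) → Y → Prop)
    (j k : ℕ) : Subquot Y where
  Amb := (∀ y, L y) → ExtForm m k Y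
  num y :=
    { carrier := {C | ∀ u, IsFrame hol u y → C u ∈ extLogForms D k y ∧
        ∀ u', IsFrame hol u' y → ∀ g : Y → ℂ, HolFun m g y → (∀ᶠ z in 𝓝 y, u' z = g z • u z) →
          (C u - fun z => g z ^ j • twist g (C u') z) ∈ extIdeal D F k y}
      zero_mem' := by
        refine fun u _ => ⟨(extLogForms D k y).zero_mem, fun u' _ g _ _ => ?_⟩
        convert! (extIdeal D F k y).zero_mem using 1
        ext z v
        simp [twist]
      add_mem' := by
        intro a b ha hb u hu
        refine ⟨(extLogForms D k y).add_mem (ha u hu).1 (hb u hu).1, fun u' hu' g hg h => ?_⟩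
        convert! (extIdeal D F k y).add_mem ((ha u hu).2 u' hu' g hg h)
          ((hb u hu).2 u' hu' g hg h) using 1
        ext z v
        simp [twist]
        ring
      smul_mem' := by
        intro r a ha u hu
        refine ⟨(extLogForms D k y).smul_mem r (ha u hu).1, fun u' hu' g hg h => ?_⟩
        convert! (extIdeal D F k y).smul_mem r ((ha u hu).2 u' hu' g hg h) using 1
        ext z v
        simp [twist]
        ring }
  den y :=
    { carrier := {C | ∀ u, IsFrame hol u y → C u ∈ extIdeal D F k y}
      zero_mem' := fun _ _ => (extIdeal D F k y).zero_mem
      add_mem' := fun ha hb u hu => (extIdeal D F k y).add_mem (ha u hu) (hb u hu)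
      smul_mem' := fun r _ ha u hu => (extIdeal D F k y).smul_mem r (ha u hu) }

/-- The differential of the `j`-th principal parts complex, on representatives:
`d (c ⊗ u^j) = (dc + j dlog u ∧ c) ⊗ u^j`. -/
def dPrincipalParts {L : Y → Type} (j : ℕ) {k : ℕ} (C : (∀ y, L y) → ExtForm m k Y) :
    (∀ y, L y) → ExtForm m (k + 1) Y :=
  fun u y => dExt (C u) y + (j : ℂ) • wedge (dlogFrame m) (C u y)

/-- `t = g s` for sections `s`, `t` of a principal parts complex and a function `g` on `Y`. -/
def IsMulPP {D : Set Y} {F : Y → Set (Form m 1 Y)} {L : Y → Type}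
    [∀ y, AddCommGroup (L y)] [∀ y, Module ℂ (L y)] {hol : (∀ y, L y) → Y → Prop} {j k : ℕ}
    {V : Opens Y} (g : Y → ℂ) (s t : (principalParts D F hol j k).Sec V) : Prop :=
  ∀ y : V, ∃ C : (∀ y, L y) → ExtForm m k Y,
    (principalParts D F hol j k).Rep s y C ∧
      (principalParts D F hol j k).Rep t y (fun u z => g z • C u z)

end PrincipalParts

/-! ### The complexes in question -/

section Complexes

variable {m : ℕ} {X X₁ : Type} [TopologicalSpace X] [ChartedSpace (Cn (m + 1)) X]
  [IsManifold 𝓘(ℂ, Cn (m + 1)) ω X] [TopologicalSpace X₁] [ChartedSpace (Cn m) X₁]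

/-- The `k`-th term of `P^•_{R₁'}(N_f)`, the first principal parts complex of the branch normal bundle
`N_f` on `X₁`, with log poles along `D₁`, foliated by `R₁' = 𝓞 ψ₁`:
`Λ^k (P₀(N_f)⟨log D₁⟩ / R₁') ⊗ N_f`. -/
def calP (D : Set X) (Φ : Form (m + 1) 2 X) (f : X₁ → X) (k : ℕ) : Subquot X₁ :=
  principalParts (inducedDivisor f) (psiFoliation D Φ f) (HolNormal (m := m) f) 1 k

/-- `t = g s` for sections `s`, `t` of `𝓖₁` and a function `g` on `X`. -/
def IsMulG {D : Set X} {Φ : Form (m + 1) 2 X} {k : ℕ} {U : Opens X} (g : X → ℂ)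
    (s t : (grOne D Φ k).Sec U) : Prop :=
  ∀ p : U, ∃ a : Form (m + 1) (k + 1) X,
    (grOne D Φ k).Rep s p a ∧ (grOne D Φ k).Rep t p (fun z => g z • a z)

/-- `t = g s` for sections `s`, `t` of `𝓔₁` and a function `g` on `X₁`: representatives are
multiplied by a local holomorphic extension of `g` to `X`. -/
def IsMulE {D : Set X} {Φ : Form (m + 1) 2 X} {f : X₁ → X} {k : ℕ} {V : Opens X₁} (g : X₁ → ℂ)
    (s t : (calE (m := m) D Φ f k).Sec V) : Prop :=
  ∀ q : V, ∃ G : X → ℂ, HolFun (m + 1) G (f q) ∧ (∀ᶠ q' in 𝓝 q.1, G (f q') = g q') ∧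
    ∃ a : Form (m + 1) k X, (calE (m := m) D Φ f k).Rep s q a ∧
      (calE (m := m) D Φ f k).Rep t q (fun z => G z • a z)

/-- The direct image under `f`. -/
abbrev directImage (f : C(X₁, X)) :
    TopCat.Sheaf (ModuleCat.{0} ℂ) (TopCat.of X₁) ⥤ TopCat.Sheaf (ModuleCat.{0} ℂ) (TopCat.of X) :=
  TopCat.Sheaf.pushforward (ModuleCat.{0} ℂ) (TopCat.ofHom f)

/-- The effect on sections of a morphism from a sheaf on `X` to a direct image sheaf. -/
def onSecDirect {S : Subquot X} {S' : Subquot X₁} {f : C(X₁, X)}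
    (φ : S.sheaf ⟶ (directImage f).obj S'.sheaf) (U : Opens X) :
    S.Sec U →ₗ[ℂ] S'.Sec (U.comap f) :=
  (φ.hom.app (op U)).hom

end Complexes
end LogSymp

end

set_option linter.unusedSectionVars false

open scoped Manifold ContDiff Topology
open CategoryTheory TopologicalSpace Opposite

noncomputable section

namespace LogSymp

/-! ### Sections of subquotient sheaves and their representatives -/

namespace Subquot

variable {Y Y' : Type} [TopologicalSpace Y] [TopologicalSpace Y']

/-! Everything is local on `X`. In an adapted chart `D` is the union of the hyperplanes `x_i = 0`,
`i ∈ S`, the log frame consists of `v_i = x_i ∂_i` (`i ∈ S`) and `∂_j` (`j ∉ S`), and `Φ` has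
holomorphic coefficients in the dual coframe. Put `ψ_i = ⟨Φ, v_i⟩`. This is a log form, it vanishes
nowhere as a log form because `Φ` is nondegenerate, and it satisfies `ψ_i(v_i) = 0`.

The comparison of `𝓖₁` with `𝓔₁`. Since `∂_i = x_i⁻¹ v_i`, the only log-plus forms beyond the log
forms come from `x_i⁻¹ ψ_i`. Hence `𝓕₁` consists of the forms `log + ∑ ψ_j ∧ b_j` with `b_j` in
`x_j⁻¹ Ω⟨log D⟩` (`NormChart.mem_filt_iff`). At a generic point of branch `i` all `b_j` with `j ≠ i`
are log forms, so `a - ψ_i ∧ b_i` is a log form there; this determines the class of `b_i` and is how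
the comparison is defined (`kappaRel`). The ambiguity of `b_i` is the condition that `ψ_i ∧ b_i` be
a log form, which by Koszul division by the nowhere vanishing `ψ_i` means that `b_i` is a log form
plus a multiple of `ψ_i` (`NormChart.On.mem_psiForms_iff`), that is, that `b_i` is zero in `𝓔₁`. Two
charts at a branch give fields `v_i` which differ by a log field vanishing on the branch, and this
zero cancels the simple pole, so the construction is intrinsic. Finally `d(ψ_i ∧ b) ≡ -ψ_i ∧ db`
modulo log forms, because closedness of `Φ` makes `dψ_i` divisible by `x_i`; this matches the sign
of the shift `[1]` in `𝓖₁`.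

The comparison of `𝓔₁` with the principal parts. Write `b = h / x_i` and restrict `h` to the branch.
The log tangent space of `X` along the branch is the log tangent space of `X₁` plus the line of
`v_i`, and it is identified with the dual of the principal parts by letting `dlog u` correspond to
`-dlog x_i`, where `u` is the class of `∂_i` in the normal bundle. The formula `d(h / x_i) = (dh -
dlog x_i ∧ h) / x_i` becomes the differential `d + dlog u ∧` (`nabla_polarRes`). If `x' = x r` is
the equation in another chart, then `∂_i = r ∂'` in the normal bundle and `dlog u` is sheared by
`dlog r`, which is exactly the transition rule of the principal parts
(`NormChart.On.polarExt_transition`).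

The contraction. The field `v_i` acts on `h / x_i` by `∂_i h - h / x_i`, that is, as `-1` modulo
forms without pole. So Cartan's formula makes minus the contraction with `v_i` a null-homotopy of
`𝓔₁`; it descends to the quotient because `ψ_i(v_i) = 0`. A contracted complex is exact, and the
homotopy is carried to `𝓖₁` by the direct image functor, so exactness of `f_*` is not needed.

The analytic basis is elementary: derivatives of holomorphic maps of several variables are
holomorphic (`Hol.hol_fderiv`), a holomorphic map vanishing on a coordinate hyperplane is divisible
by the coordinate (`Hol.exists_eq_smul`), and identities extend by continuity from the complement of
the hyperplanes. With them the change of log frames between adapted charts is seen to be holomorphic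
(`Adapted.exists_logTransition`), so that every local condition can be tested in one chart. -/

lemma IsClass.num {S : Subquot Y} {y : Y} {t : S.Stalk y} {a : S.Amb} (h : S.IsClass y t a) :
    a ∈ S.num y := h.1

lemma IsClass.add {S : Subquot Y} {y : Y} {t t' : S.Stalk y} {a a' : S.Amb}
    (h : S.IsClass y t a) (h' : S.IsClass y t' a') : S.IsClass y (t + t') (a + a') := by
  obtain ⟨h, rfl⟩ := h
  obtain ⟨h', rfl⟩ := h'
  exact ⟨(S.num y).add_mem h h', rfl⟩

lemma IsClass.smul {S : Subquot Y} {y : Y} {t : S.Stalk y} {a : S.Amb}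
    (h : S.IsClass y t a) (c : ℂ) : S.IsClass y (c • t) (c • a) := by
  obtain ⟨h, rfl⟩ := h
  exact ⟨(S.num y).smul_mem c h, rfl⟩

lemma isClass_mk {S : Subquot Y} {y : Y} {a : S.Amb} (h : a ∈ S.num y) :
    S.IsClass y (Submodule.Quotient.mk ⟨a, h⟩) a := ⟨h, rfl⟩

lemma exists_isClass {S : Subquot Y} {y : Y} (t : S.Stalk y) : ∃ a, S.IsClass y t a := by
  obtain ⟨⟨a, h⟩, rfl⟩ := Submodule.Quotient.mk_surjective _ t
  exact ⟨a, h, rfl⟩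

lemma IsClass.sub_mem {S : Subquot Y} {y : Y} {t : S.Stalk y} {a a' : S.Amb}
    (h : S.IsClass y t a) (h' : S.IsClass y t a') : a - a' ∈ S.den y := by
  obtain ⟨h, rfl⟩ := h
  obtain ⟨h', e⟩ := h'
  exact (Submodule.Quotient.eq ((S.den y).submoduleOf (S.num y))).1 e

lemma IsClass.eq_of_sub_mem {S : Subquot Y} {y : Y} {t t' : S.Stalk y} {a a' : S.Amb}
    (h : S.IsClass y t a) (h' : S.IsClass y t' a') (e : a - a' ∈ S.den y) : t = t' := by
  obtain ⟨h, rfl⟩ := h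
  obtain ⟨h', rfl⟩ := h'
  exact (Submodule.Quotient.eq _).2 e

lemma IsClass.congr {S : Subquot Y} {y : Y} {t : S.Stalk y} {a a' : S.Amb}
    (h : S.IsClass y t a) (h' : a' ∈ S.num y) (e : a - a' ∈ S.den y) : S.IsClass y t a' :=
  ⟨h', h.eq_of_sub_mem (isClass_mk h') e⟩

lemma sec_ext_of_rep {S : Subquot Y} {V : Opens Y} {s t : S.Sec V}
    (h : ∀ y, ∃ a, S.Rep s y a ∧ S.Rep t y a) : s = t := by
  refine Subtype.ext (funext fun y => ?_)
  obtain ⟨a, h1, h2⟩ := h y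
  exact h1.eq_of_sub_mem h2 (by simp)

lemma exists_rep {S : Subquot Y} {V : Opens Y} (s : S.Sec V) (y : V) : ∃ a, S.Rep s y a :=
  exists_isClass _

/-- A section is represented near each point by one element. -/
lemma exists_eventually_rep {S : Subquot Y} {V : Opens Y} (s : S.Sec V) (y : V) :
    ∃ a, ∀ᶠ z in 𝓝 y.1, ∀ hz : z ∈ V, S.Rep s ⟨z, hz⟩ a := by
  obtain ⟨W, hW, a, ha⟩ := s.2 y
  exact ⟨a, by filter_upwards [W.2.mem_nhds hW] with z hz hz' using ha ⟨z, hz'⟩ hz⟩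

lemma mem_sec_of_eventually {S : Subquot Y} {V : Opens Y} {s : ∀ y : V, S.Stalk y}
    (h : ∀ y : V, ∃ a, ∀ᶠ z in 𝓝 y.1, ∀ hz : z ∈ V, S.IsClass z (s ⟨z, hz⟩) a) : s ∈ S.Sec V := by
  intro y
  obtain ⟨a, ha⟩ := h y
  obtain ⟨W, hW, hWo, hy⟩ := eventually_nhds_iff.1 ha
  exact ⟨⟨W, hWo⟩, hy, a, fun z hz => hW z.1 hz z.2⟩

/-- A correspondence between the representatives of two subquotient sheaves, along a map `f`,
which induces linear maps on stalks and sections. -/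
structure Corr (S : Subquot Y) (S' : Subquot Y') (f : C(Y', Y)) where
  rel : Y' → Submodule ℂ (S.Amb × S'.Amb)
  num : ∀ {q a b}, (a, b) ∈ rel q → b ∈ S'.num q
  den : ∀ {q a b}, (a, b) ∈ rel q → a ∈ S.den (f q) → b ∈ S'.den q
  -- One `b` has to serve all nearby points: this is what makes the image of a locally represented
  -- family locally represented.
  exists_rel : ∀ q a, a ∈ S.num (f q) → ∃ b, ∀ᶠ q' in 𝓝 q, a ∈ S.num (f q') → (a, b) ∈ rel q'

namespace Corr

variable {S : Subquot Y} {S' : Subquot Y'} {f : C(Y', Y)} (R : Corr S S' f)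

lemma exists_stalk (q : Y') (t : S.Stalk (f q)) : ∃ t' : S'.Stalk q, ∃ a b,
    S.IsClass (f q) t a ∧ (a, b) ∈ R.rel q ∧ S'.IsClass q t' b := by
  obtain ⟨a, ha⟩ := exists_isClass t
  obtain ⟨b, hb⟩ := R.exists_rel q a ha.num
  exact ⟨_, a, b, ha, hb.self_of_nhds ha.num, isClass_mk (R.num (hb.self_of_nhds ha.num))⟩

/-- The induced map of stalks. -/
def stalkFun (q : Y') (t : S.Stalk (f q)) : S'.Stalk q := (R.exists_stalk q t).choose

/-- The difference of two related pairs is again a related pair, and its first entry lies in the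
denominator; by `den` the choices made in `stalkFun` therefore do not affect the class. -/
lemma isClass_stalkFun {q : Y'} {t : S.Stalk (f q)} {a : S.Amb} {b : S'.Amb}
    (ha : S.IsClass (f q) t a) (hab : (a, b) ∈ R.rel q) : S'.IsClass q (R.stalkFun q t) b := by
  obtain ⟨a', b', ha', hab', hb'⟩ := (R.exists_stalk q t).choose_spec
  refine IsClass.congr hb' (R.num hab) ?_
  exact R.den (a := a' - a) ((R.rel q).sub_mem hab' hab) (ha'.sub_mem ha)

/-- The induced map of sections. -/
def secMap (U : Opens Y) : S.Sec U →ₗ[ℂ] S'.Sec (U.comap f) where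
  toFun s := ⟨fun q => R.stalkFun q.1 (s.1 ⟨f q.1, q.2⟩), mem_sec_of_eventually fun q => by
    obtain ⟨a, ha⟩ := exists_eventually_rep s ⟨f q.1, q.2⟩
    obtain ⟨b, hb⟩ := R.exists_rel q.1 a (ha.self_of_nhds q.2).num
    refine ⟨b, ?_⟩
    filter_upwards [hb, (f.continuous.tendsto q.1).eventually ha] with z h1 h2 hz
    exact R.isClass_stalkFun (h2 hz) (h1 (h2 hz).num)⟩
  map_add' s t := by
    refine Subtype.ext (funext fun q => ?_)
    obtain ⟨a, ha⟩ := exists_isClass (s.1 ⟨f q.1, q.2⟩)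
    obtain ⟨b, hb⟩ := R.exists_rel q.1 a ha.num
    obtain ⟨a', ha'⟩ := exists_isClass (t.1 ⟨f q.1, q.2⟩)
    obtain ⟨b', hb'⟩ := R.exists_rel q.1 a' ha'.num
    have h := hb.self_of_nhds ha.num
    have h' := hb'.self_of_nhds ha'.num
    refine (R.isClass_stalkFun (ha.add ha') ((R.rel q.1).add_mem h h')).eq_of_sub_mem
      ((R.isClass_stalkFun ha h).add (R.isClass_stalkFun ha' h')) (by simp)
  map_smul' c s := by
    refine Subtype.ext (funext fun q => ?_)
    obtain ⟨a, ha⟩ := exists_isClass (s.1 ⟨f q.1, q.2⟩)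
    obtain ⟨b, hb⟩ := R.exists_rel q.1 a ha.num
    have h := hb.self_of_nhds ha.num
    refine (R.isClass_stalkFun (ha.smul c) ((R.rel q.1).smul_mem c h)).eq_of_sub_mem
      ((R.isClass_stalkFun ha h).smul c) (by simp)

lemma rep_secMap {U : Opens Y} {s : S.Sec U} {q : U.comap f} {a : S.Amb} {b : S'.Amb}
    (ha : S.Rep s ⟨f q.1, q.2⟩ a) (hab : (a, b) ∈ R.rel q.1) : S'.Rep (R.secMap U s) q b :=
  R.isClass_stalkFun ha hab

lemma exists_rep_secMap {U : Opens Y} (s : S.Sec U) (q : U.comap f) :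
    ∃ a b, S.Rep s ⟨f q.1, q.2⟩ a ∧ (a, b) ∈ R.rel q.1 ∧ S'.Rep (R.secMap U s) q b := by
  obtain ⟨a, ha⟩ := exists_rep s ⟨f q.1, q.2⟩
  obtain ⟨b, hb⟩ := R.exists_rel q.1 a ha.num
  exact ⟨a, b, ha, hb.self_of_nhds ha.num, R.rep_secMap ha (hb.self_of_nhds ha.num)⟩

/-- The hypothesis on `a` refers to all points of the fibre over `p` simultaneously, as the stalk of
a direct image along a finite map requires. -/
lemma injective_secMap (inj : ∀ p a, a ∈ S.num p →
      (∀ q, f q = p → ∃ b, (a, b) ∈ R.rel q ∧ b ∈ S'.den q) → a ∈ S.den p) (U : Opens Y) :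
    Function.Injective (R.secMap U) := by
  refine (injective_iff_map_eq_zero _).2 fun s hs => ?_
  refine Subtype.ext (funext fun p => ?_)
  obtain ⟨a, ha⟩ := exists_isClass (s.1 p)
  refine ha.eq_of_sub_mem (a' := 0) ⟨(S.num _).zero_mem, rfl⟩ ?_
  rw [sub_zero]
  refine inj p a ha.num fun q hq => ?_
  obtain ⟨p, hp⟩ := p
  dsimp at hq
  subst hq
  obtain ⟨b, hb⟩ := R.exists_rel q a ha.num
  refine ⟨b, hb.self_of_nhds ha.num, ?_⟩
  have h := R.rep_secMap (q := ⟨q, hp⟩) ha (hb.self_of_nhds ha.num)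
  rw [hs] at h
  simpa using h.sub_mem (a' := 0) ⟨(S'.num _).zero_mem, rfl⟩

/-- Local lifts of `t` need not agree as elements of the ambient space. By `inj` two lifts which are
both good at a point have the same class there, so the classes of the chosen lifts glue to a
section. -/
lemma surjective_secMap (U : Opens Y) (surj : ∀ (t : S'.Sec (U.comap f)), ∀ p ∈ U,
      ∃ a, ∀ᶠ p' in 𝓝 p, a ∈ S.num p' ∧ ∀ q (_ : f q = p') (hq' : f q ∈ U),
        ∃ b, S'.Rep t ⟨q, hq'⟩ b ∧ (a, b) ∈ R.rel q)
    (inj : ∀ p a, a ∈ S.num p →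
      (∀ q, f q = p → ∃ b, (a, b) ∈ R.rel q ∧ b ∈ S'.den q) → a ∈ S.den p) :
    Function.Surjective (R.secMap U) := by
  intro t
  choose A hA using fun p : U => surj t p.1 p.2
  have key : ∀ p p' : U, (A p ∈ S.num p'.1 ∧ ∀ q (_ : f q = p'.1) (hq' : f q ∈ U),
      ∃ b, S'.Rep t ⟨q, hq'⟩ b ∧ (A p, b) ∈ R.rel q) → ∀ h,
      S.IsClass p'.1 (Submodule.Quotient.mk ⟨A p', h⟩) (A p) := by
    intro p p' h h'
    refine (isClass_mk h').congr h.1 (inj _ _ ((S.num _).sub_mem h' h.1) fun q hq => ?_)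
    have hqU : f q ∈ U := hq ▸ p'.2
    obtain ⟨b, hb, hb'⟩ := h.2 q hq hqU
    obtain ⟨b₀, hb₀, hb₀'⟩ := (hA p').self_of_nhds.2 q hq hqU
    exact ⟨b₀ - b, (R.rel q).sub_mem hb₀' hb', hb₀.sub_mem hb⟩
  refine ⟨⟨fun p => Submodule.Quotient.mk ⟨A p, (hA p).self_of_nhds.1⟩,
    mem_sec_of_eventually fun p => ⟨A p, ?_⟩⟩, ?_⟩
  · filter_upwards [hA p] with p' hp' hU
    exact key p ⟨p', hU⟩ hp' _
  · refine sec_ext_of_rep fun q => ?_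
    obtain ⟨b, hb, hb'⟩ := (hA ⟨f q.1, q.2⟩).self_of_nhds.2 q.1 rfl q.2
    exact ⟨b, R.rep_secMap (isClass_mk _) hb', hb⟩

/-- The induced morphism to the direct image. -/
def homDirect : S.sheaf ⟶ (directImage f).obj S'.sheaf :=
  ⟨{ app := fun U => ModuleCat.ofHom (R.secMap U.unop)
     naturality := fun _ _ _ => rfl }⟩

/-- The induced morphism of sheaves on the same space. -/
def hom {S' : Subquot Y} (R : Corr S S' (ContinuousMap.id Y)) : S.sheaf ⟶ S'.sheaf :=
  ⟨{ app := fun U => ModuleCat.ofHom (R.secMap U.unop)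
     naturality := fun _ _ _ => rfl }⟩

lemma isIso_homDirect (h : ∀ U, Function.Bijective (R.secMap U)) : IsIso R.homDirect := by
  have : IsIso ((sheafToPresheaf _ _).map R.homDirect) := by
    change IsIso R.homDirect.hom
    rw [NatTrans.isIso_iff_isIso_app]
    intro U
    exact (ConcreteCategory.isIso_iff_bijective _).2 (h U.unop)
  exact (fullyFaithfulSheafToPresheaf _ _).isIso_of_isIso_map R.homDirect

lemma isIso_hom {S' : Subquot Y} (R : Corr S S' (ContinuousMap.id Y))
    (h : ∀ U, Function.Bijective (R.secMap U)) : IsIso R.hom := by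
  have : IsIso ((sheafToPresheaf _ _).map R.hom) := by
    change IsIso R.hom.hom
    rw [NatTrans.isIso_iff_isIso_app]
    intro U
    exact (ConcreteCategory.isIso_iff_bijective _).2 (h U.unop)
  exact (fullyFaithfulSheafToPresheaf _ _).isIso_of_isIso_map R.hom

lemma rep_onSec_hom {S' : Subquot Y} (R : Corr S S' (ContinuousMap.id Y)) {V : Opens Y}
    {s : S.Sec V} {y : V} {a : S.Amb} {b : S'.Amb} (ha : S.Rep s y a) (hab : (a, b) ∈ R.rel y) :
    S'.Rep (onSec R.hom V s) y b :=
  R.rep_secMap (q := y) ha hab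

lemma rep_onSecDirect {U : Opens Y} {s : S.Sec U} {q : U.comap f} {a : S.Amb} {b : S'.Amb}
    (ha : S.Rep s ⟨f q.1, q.2⟩ a) (hab : (a, b) ∈ R.rel q.1) :
    S'.Rep (onSecDirect R.homDirect U s) q b :=
  R.rep_secMap ha hab

end Corr

lemma hom_ext_of_rep {S S' : Subquot Y} {φ ψ : S.sheaf ⟶ S'.sheaf}
    (h : ∀ V s y, ∃ b, S'.Rep (onSec φ V s) y b ∧ S'.Rep (onSec ψ V s) y b) : φ = ψ := by
  apply CategoryTheory.Sheaf.hom_ext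
  ext V : 2
  exact ModuleCat.hom_ext (LinearMap.ext fun s => sec_ext_of_rep (h V.unop s))

lemma homDirect_ext_of_rep {S : Subquot Y} {S' : Subquot Y'} {f : C(Y', Y)}
    {φ ψ : S.sheaf ⟶ (directImage f).obj S'.sheaf}
    (h : ∀ U s q, ∃ b, S'.Rep (onSecDirect φ U s) q b ∧ S'.Rep (onSecDirect ψ U s) q b) :
    φ = ψ := by
  apply CategoryTheory.Sheaf.hom_ext
  ext V : 2
  exact ModuleCat.hom_ext (LinearMap.ext fun s => sec_ext_of_rep (h V.unop s))

end Subquot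

/-! ### Contracting homotopies -/

section Homotopy

open CategoryTheory.Limits

variable {𝒱 : Type*} [Category 𝒱] [Preadditive 𝒱] {F : ℕ → 𝒱} {d : ∀ n, F n ⟶ F (n + 1)}
  (hd : ∀ n, d n ≫ d (n + 1) = 0)

/-- A contracting homotopy of a cochain complex indexed by the natural numbers. -/
lemma nonempty_homotopy_of_contraction (h : ∀ n, F (n + 1) ⟶ F n) (h0 : d 0 ≫ h 0 = 𝟙 _)
    (hs : ∀ n, h n ≫ d n + d (n + 1) ≫ h (n + 1) = 𝟙 _) :
    Nonempty (Homotopy (𝟙 (CochainComplex.of F d hd)) 0) := by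
  -- A homotopy is indexed by all pairs with `i = j + 1`, so `h` is transported along that equality.
  let H : ∀ i j, (ComplexShape.up ℕ).Rel j i → (F i ⟶ F j) := fun i j hij =>
    eqToHom (congrArg F (show i = j + 1 from hij.symm)) ≫ h j
  have e : 𝟙 (CochainComplex.of F d hd) =
      Homotopy.nullHomotopicMap' (C := CochainComplex.of F d hd)
        (D := CochainComplex.of F d hd) H := by
    ext n
    cases n with
    | zero =>
      rw [Homotopy.nullHomotopicMap'_f_of_not_rel_right (k₁ := 0) (k₀ := 1) rfl (by simp)]
      change 𝟙 (F 0) = CochainComplex.of.d F d 0 (0 + 1) ≫ (eqToHom rfl ≫ h 0)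
      rw [CochainComplex.of_d, eqToHom_refl, Category.id_comp, h0]
    | succ n =>
      rw [Homotopy.nullHomotopicMap'_f (k₂ := n) (k₁ := n + 1) (k₀ := n + 1 + 1) rfl rfl]
      change 𝟙 (F (n + 1)) = CochainComplex.of.d F d (n + 1) (n + 1 + 1) ≫
        (eqToHom rfl ≫ h (n + 1)) + (eqToHom rfl ≫ h n) ≫ CochainComplex.of.d F d n (n + 1)
      rw [CochainComplex.of_d, CochainComplex.of_d, eqToHom_refl, Category.id_comp, eqToHom_refl,
        Category.id_comp]
      exact (hs n).symm.trans (add_comm _ _)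
  exact ⟨(Homotopy.ofEq e).trans (Homotopy.nullHomotopy' (C := CochainComplex.of F d hd)
    (D := CochainComplex.of F d hd) H)⟩

lemma acyclic_of_homotopy [CategoryWithHomology 𝒱]
    (h : Homotopy (𝟙 (CochainComplex.of F d hd)) 0) : (CochainComplex.of F d hd).Acyclic := by
  intro n
  rw [HomologicalComplex.exactAt_iff_isZero_homology, IsZero.iff_id_eq_zero]
  simpa using h.homologyMap_eq n

end Homotopy

/-! ### Algebra of alternating forms -/

open ContinuousAlternatingMap

section Alternating

variable {E E' : Type*} [NormedAddCommGroup E] [NormedSpace ℂ E]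
  [NormedAddCommGroup E'] [NormedSpace ℂ E'] {k : ℕ}

/-- Interior multiplication by a vector, as a linear map. -/
def contract (k : ℕ) (w : E) : (E [⋀^Fin (k + 1)]→L[ℂ] ℂ) →L[ℂ] E [⋀^Fin k]→L[ℂ] ℂ :=
  (ContinuousLinearMap.apply ℂ _ w).comp curryLeftLI.toContinuousLinearMap

@[simp]
lemma contract_apply (w : E) (a : E [⋀^Fin (k + 1)]→L[ℂ] ℂ) : contract k w a = a.curryLeft w := rfl

/-- A `1`-form as a linear form. -/
def oneForm : (E [⋀^Fin 1]→L[ℂ] ℂ) →L[ℂ] E →L[ℂ] ℂ :=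
  (ofSubsingletonLIE (𝕜 := ℂ) (E := E) (F := ℂ) (0 : Fin 1)).symm.toContinuousLinearEquiv.toContinuousLinearMap

lemma oneForm_apply (θ : E [⋀^Fin 1]→L[ℂ] ℂ) (v : E) : oneForm θ v = θ fun _ => v := rfl

/-- Allows identities of alternating forms to be proved by induction on the degree, contracting with
one vector at a time. -/
lemma curryLeft_eq_iff {a b : E [⋀^Fin (k + 1)]→L[ℂ] ℂ} :
    a = b ↔ ∀ w, a.curryLeft w = b.curryLeft w := by
  refine ⟨fun h w => h ▸ rfl, fun h => ?_⟩
  ext v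
  have := DFunLike.congr_fun (h (v 0)) (Fin.tail v)
  simpa [Matrix.vecCons] using this

lemma curryLeft_alternatize_zero (T : E →L[ℂ] E [⋀^Fin 0]→L[ℂ] ℂ) (w : E) :
    (alternatizeUncurryFin T).curryLeft w = T w := by
  ext v
  simp [alternatizeUncurryFin_apply, Subsingleton.elim _ v]

/-- In the alternating sum, the term that removes the first vector gives `T w`; in all other terms
`w` stays in the first slot and the sign is shifted by one. -/
lemma curryLeft_alternatize (T : E →L[ℂ] E [⋀^Fin (k + 1)]→L[ℂ] ℂ) (w : E) :
    (alternatizeUncurryFin T).curryLeft w =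
      T w - alternatizeUncurryFin ((contract k w).comp T) := by
  ext v
  have h (i : Fin (k + 1)) : Fin.removeNth i.succ (Matrix.vecCons w v) =
      Matrix.vecCons w (Fin.removeNth i v) := by
    ext j
    refine Fin.cases ?_ (fun j => ?_) j <;> simp [Fin.removeNth]
  simp [alternatizeUncurryFin_apply, Fin.sum_univ_succ, h, pow_succ, sub_eq_add_neg,
    Fin.removeNth_zero]

lemma alternatize_zero : alternatizeUncurryFin (0 : E →L[ℂ] E [⋀^Fin k]→L[ℂ] ℂ) = 0 :=
  (alternatizeUncurryFinCLM ℂ E ℂ).map_zero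

lemma alternatize_sub (T T' : E →L[ℂ] E [⋀^Fin k]→L[ℂ] ℂ) :
    alternatizeUncurryFin (T - T') = alternatizeUncurryFin T - alternatizeUncurryFin T' :=
  (alternatizeUncurryFinCLM ℂ E ℂ).map_sub T T'

lemma alternatize_comp (T : E →L[ℂ] E [⋀^Fin k]→L[ℂ] ℂ) (L : E' →L[ℂ] E) :
    (alternatizeUncurryFin T).compContinuousLinearMap L =
      alternatizeUncurryFin ((compContinuousLinearMapCLM L).comp (T.comp L)) := by
  ext v
  simp [alternatizeUncurryFin_apply, Fin.removeNth_apply, Function.comp_def]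
  rfl

/-- The wedge product as a continuous bilinear map. -/
def wedgeL (k : ℕ) : (E [⋀^Fin 1]→L[ℂ] ℂ) →L[ℂ] (E [⋀^Fin k]→L[ℂ] ℂ) →L[ℂ]
    E [⋀^Fin (k + 1)]→L[ℂ] ℂ :=
  ((ContinuousLinearMap.compL ℂ _ _ _ (alternatizeUncurryFinCLM ℂ E ℂ)).comp
    (ContinuousLinearMap.smulRightL ℂ E _)).comp oneForm

@[simp]
lemma wedgeL_apply (θ : E [⋀^Fin 1]→L[ℂ] ℂ) (a : E [⋀^Fin k]→L[ℂ] ℂ) :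
    wedgeL k θ a = wedge θ a := rfl

lemma wedge_eq (θ : E [⋀^Fin 1]→L[ℂ] ℂ) (a : E [⋀^Fin k]→L[ℂ] ℂ) :
    wedge θ a = alternatizeUncurryFin ((oneForm θ).smulRight a) := rfl

lemma wedge_add (θ : E [⋀^Fin 1]→L[ℂ] ℂ) (a b : E [⋀^Fin k]→L[ℂ] ℂ) :
    wedge θ (a + b) = wedge θ a + wedge θ b := (wedgeL k θ).map_add a b
lemma wedge_sub (θ : E [⋀^Fin 1]→L[ℂ] ℂ) (a b : E [⋀^Fin k]→L[ℂ] ℂ) :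
    wedge θ (a - b) = wedge θ a - wedge θ b := (wedgeL k θ).map_sub a b
lemma wedge_neg (θ : E [⋀^Fin 1]→L[ℂ] ℂ) (a : E [⋀^Fin k]→L[ℂ] ℂ) :
    wedge θ (-a) = -wedge θ a := (wedgeL k θ).map_neg a
lemma wedge_smul (θ : E [⋀^Fin 1]→L[ℂ] ℂ) (c : ℂ) (a : E [⋀^Fin k]→L[ℂ] ℂ) :
    wedge θ (c • a) = c • wedge θ a := (wedgeL k θ).map_smul c a
@[simp]
lemma wedge_zero (θ : E [⋀^Fin 1]→L[ℂ] ℂ) : wedge θ (0 : E [⋀^Fin k]→L[ℂ] ℂ) = 0 :=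
  (wedgeL k θ).map_zero
lemma add_wedge (θ η : E [⋀^Fin 1]→L[ℂ] ℂ) (a : E [⋀^Fin k]→L[ℂ] ℂ) :
    wedge (θ + η) a = wedge θ a + wedge η a := by simp [← wedgeL_apply]
lemma neg_wedge (θ : E [⋀^Fin 1]→L[ℂ] ℂ) (a : E [⋀^Fin k]→L[ℂ] ℂ) :
    wedge (-θ) a = -wedge θ a := by simp [← wedgeL_apply]
lemma smul_wedge (c : ℂ) (θ : E [⋀^Fin 1]→L[ℂ] ℂ) (a : E [⋀^Fin k]→L[ℂ] ℂ) :
    wedge (c • θ) a = c • wedge θ a := by simp [← wedgeL_apply]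
@[simp]
lemma zero_wedge (a : E [⋀^Fin k]→L[ℂ] ℂ) :
    wedge (0 : E [⋀^Fin 1]→L[ℂ] ℂ) a = 0 := by simp [← wedgeL_apply]

lemma wedge_comp (θ : E [⋀^Fin 1]→L[ℂ] ℂ) (a : E [⋀^Fin k]→L[ℂ] ℂ) (L : E' →L[ℂ] E) :
    (wedge θ a).compContinuousLinearMap L =
      wedge (θ.compContinuousLinearMap L) (a.compContinuousLinearMap L) := by
  rw [wedge_eq, wedge_eq, alternatize_comp]
  congr 1

lemma curryLeft_wedge_zero (θ : E [⋀^Fin 1]→L[ℂ] ℂ) (a : E [⋀^Fin 0]→L[ℂ] ℂ) (w : E) :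
    (wedge θ a).curryLeft w = oneForm θ w • a := by
  rw [wedge_eq, curryLeft_alternatize_zero, ContinuousLinearMap.smulRight_apply]

lemma curryLeft_wedge (θ : E [⋀^Fin 1]→L[ℂ] ℂ) (a : E [⋀^Fin (k + 1)]→L[ℂ] ℂ) (w : E) :
    (wedge θ a).curryLeft w = oneForm θ w • a - wedge θ (a.curryLeft w) := by
  rw [wedge_eq, curryLeft_alternatize, ContinuousLinearMap.smulRight_apply, wedge_eq]
  congr 2

lemma wedge_wedge_swap (θ η : E [⋀^Fin 1]→L[ℂ] ℂ) (a : E [⋀^Fin k]→L[ℂ] ℂ) :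
    wedge θ (wedge η a) = -wedge η (wedge θ a) := by
  induction k with
  | zero =>
    refine curryLeft_eq_iff.2 fun w => ?_
    rw [curryLeft_wedge, ← contract_apply w (-_), map_neg, contract_apply, curryLeft_wedge,
      curryLeft_wedge_zero, curryLeft_wedge_zero, wedge_smul, wedge_smul]
    abel
  | succ k ih =>
    refine curryLeft_eq_iff.2 fun w => ?_
    rw [curryLeft_wedge, ← contract_apply w (-_), map_neg, contract_apply, curryLeft_wedge,
      curryLeft_wedge, curryLeft_wedge, wedge_sub, wedge_sub, wedge_smul, wedge_smul, ih]
    abel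

lemma wedge_wedge_self (θ : E [⋀^Fin 1]→L[ℂ] ℂ) (a : E [⋀^Fin k]→L[ℂ] ℂ) :
    wedge θ (wedge θ a) = 0 := by
  have h := wedge_wedge_swap θ θ a
  rwa [eq_neg_iff_add_eq_zero, ← two_smul ℂ, smul_eq_zero_iff_right two_ne_zero] at h

/-- With `T` the derivative of a form, this is the sign in `d(θ ∧ a) = -θ ∧ da` for a `1`-form `θ`
with constant coefficients. -/
lemma alternatize_wedge (θ : E [⋀^Fin 1]→L[ℂ] ℂ) (T : E →L[ℂ] E [⋀^Fin k]→L[ℂ] ℂ) :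
    alternatizeUncurryFin ((wedgeL k θ).comp T) = -wedge θ (alternatizeUncurryFin T) := by
  induction k with
  | zero =>
    refine curryLeft_eq_iff.2 fun w => ?_
    have h : (contract 0 w).comp ((wedgeL 0 θ).comp T) = oneForm θ w • T := by
      ext v : 1
      simp [curryLeft_wedge_zero]
    rw [curryLeft_alternatize, h, ← contract_apply w (-_), map_neg, contract_apply,
      curryLeft_wedge, curryLeft_alternatize_zero, alternatizeUncurryFin_smul]
    simp
  | succ k ih =>
    refine curryLeft_eq_iff.2 fun w => ?_
    have h : (contract (k + 1) w).comp ((wedgeL (k + 1) θ).comp T) =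
        oneForm θ w • T - (wedgeL k θ).comp ((contract k w).comp T) := by
      ext v : 1
      simp [curryLeft_wedge]
    rw [curryLeft_alternatize, h, ← contract_apply w (-_), map_neg, contract_apply,
      curryLeft_wedge, curryLeft_alternatize, alternatize_sub, alternatizeUncurryFin_smul, ih]
    simp only [ContinuousLinearMap.comp_apply, wedgeL_apply, wedge_sub]
    abel

/-- If `T` is symmetric, then the alternatization of `v ↦ T v ∧ b` vanishes. -/
lemma alternatize_wedge_of_symmetric (T : E →L[ℂ] E [⋀^Fin 1]→L[ℂ] ℂ)
    (hT : ∀ v w, oneForm (T v) w = oneForm (T w) v) (b : E [⋀^Fin k]→L[ℂ] ℂ) :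
    alternatizeUncurryFin (((wedgeL k).flip b).comp T) = 0 := by
  induction k with
  | zero =>
    refine curryLeft_eq_iff.2 fun w => ?_
    have h : (contract 0 w).comp (((wedgeL 0).flip b).comp T) = (oneForm (T w)).smulRight b := by
      ext v : 1
      simp [curryLeft_wedge_zero, hT v w]
    rw [curryLeft_alternatize, h, ← wedge_eq]
    simp
  | succ k ih =>
    refine curryLeft_eq_iff.2 fun w => ?_
    have h : (contract (k + 1) w).comp (((wedgeL (k + 1)).flip b).comp T) =
        (oneForm (T w)).smulRight b - ((wedgeL k).flip (b.curryLeft w)).comp T := by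
      ext v : 1
      simp [curryLeft_wedge, hT v w]
    rw [curryLeft_alternatize, h, alternatize_sub, ← wedge_eq, ih]
    simp

end Alternating

/-! ### Holomorphic germs in several variables -/

section Holomorphic

open Filter Metric

variable {E F G : Type*} [NormedAddCommGroup E] [NormedSpace ℂ E]
  [NormedAddCommGroup F] [NormedSpace ℂ F] [NormedAddCommGroup G] [NormedSpace ℂ G]

/-- The map `h` is holomorphic near `z`. -/
def Hol (h : E → F) (z : E) : Prop := ∀ᶠ w in 𝓝 z, DifferentiableAt ℂ h w

namespace Hol

variable {h h' : E → F} {z : E}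

lemma eventually (H : Hol h z) : ∀ᶠ w in 𝓝 z, Hol h w := eventually_eventually_nhds.2 H
lemma differentiableAt (H : Hol h z) : DifferentiableAt ℂ h z := H.self_of_nhds
lemma continuousAt (H : Hol h z) : ContinuousAt h z := H.differentiableAt.continuousAt

lemma congr (H : Hol h z) (e : h' =ᶠ[𝓝 z] h) : Hol h' z := by
  filter_upwards [H, e.eventuallyEq_nhds] with w h1 h2 using h1.congr_of_eventuallyEq h2

lemma add (H : Hol h z) (H' : Hol h' z) : Hol (fun w => h w + h' w) z := by
  filter_upwards [H, H'] with w a b using a.add b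
lemma sub (H : Hol h z) (H' : Hol h' z) : Hol (fun w => h w - h' w) z := by
  filter_upwards [H, H'] with w a b using a.sub b
lemma smul {c : E → ℂ} (H : Hol c z) (H' : Hol h z) : Hol (fun w => c w • h w) z := by
  filter_upwards [H, H'] with w a b using a.smul b
lemma inv {c : E → ℂ} (H : Hol c z) (hc : c z ≠ 0) : Hol (fun w => (c w)⁻¹) z := by
  filter_upwards [H, H.continuousAt.eventually_ne hc] with w a b using a.inv b
lemma const (c : F) : Hol (fun _ : E => c) z :=
  Eventually.of_forall fun _ => differentiableAt_const c
lemma clm (L : E →L[ℂ] F) : Hol (fun w => L w) z := Eventually.of_forall fun _ => L.differentiableAt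
lemma sum {ι : Type*} {s : Finset ι} {a : ι → E → F} (H : ∀ i ∈ s, Hol (a i) z) :
    Hol (fun w => ∑ i ∈ s, a i w) z := by
  have : ∀ᶠ w in 𝓝 z, ∀ i ∈ s, DifferentiableAt ℂ (a i) w :=
    (Filter.eventually_all_finset s).2 H
  filter_upwards [this] with w a using DifferentiableAt.fun_sum a

lemma comp {g : F → G} {f : E → F} (H : Hol g (f z)) (H' : Hol f z) :
    Hol (fun w => g (f w)) z := by
  filter_upwards [H', H'.continuousAt.eventually H] with w a b
  exact DifferentiableAt.comp w b a

lemma clm_comp (L : F →L[ℂ] G) (H : Hol h z) : Hol (fun w => L (h w)) z := by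
  filter_upwards [H] with w a using L.differentiableAt.comp w a

lemma clm_apply {c : E → F →L[ℂ] G} (H : Hol c z) (H' : Hol h z) : Hol (fun w => c w (h w)) z := by
  filter_upwards [H, H'] with w a b using a.clm_apply b

lemma clm_comp₂ {c : E → F →L[ℂ] G} {c' : E → E →L[ℂ] F} (H : Hol c z) (H' : Hol c' z) :
    Hol (fun w => (c w).comp (c' w)) z := by
  filter_upwards [H, H'] with w a b using a.clm_comp b

end Hol

/-- The directional derivative is the limit of the holomorphic difference quotients `q n`. A second
order Schwarz estimate bounds the error by `K * t n` uniformly near `z₀`; Cauchy's estimate turns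
this into uniform convergence of the derivatives of `q n`, and a uniform limit of derivatives is the
derivative of the limit. -/
lemma differentiableAt_fderiv_apply [CompleteSpace F] {f : E → F} {z₀ : E} (H : Hol f z₀) (v : E) :
    DifferentiableAt ℂ (fun z => fderiv ℂ f z v) z₀ := by
  obtain ⟨C, hC⟩ : ∃ C, ∀ᶠ w in 𝓝 z₀, ‖f w‖ < C :=
    ⟨_, H.continuousAt.norm.eventually_lt continuousAt_const (lt_add_one _)⟩
  obtain ⟨R, hR, hball⟩ := Metric.eventually_nhds_iff_ball.1 (hC.and H)
  have hC0 : 0 < C := (norm_nonneg _).trans_lt (hball z₀ (mem_ball_self hR)).1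
  -- Three radii: the final statement lives on the ball of radius `r`, Cauchy's estimate there uses
  -- the ball of radius `2 * r`, and the Schwarz estimate there uses the ball of radius `3 * r`.
  obtain ⟨r, hr, rfl⟩ : ∃ r, 0 < r ∧ 3 * r = R := ⟨R / 3, by positivity, by ring⟩
  set K : ℝ := 4 * C * (‖v‖ / r) ^ 2 with hK
  -- Step lengths tending to zero, scaled so that `t n • v` always has norm less than `r`; the `1 +`
  -- takes care of `v = 0`.
  let t : ℕ → ℝ := fun n => r / (1 + ‖v‖) * (1 / ((n : ℝ) + 1))
  have hv0 : 0 < 1 + ‖v‖ := by positivity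
  have ht0 : ∀ n, 0 < t n := fun n => by positivity
  have htv : ∀ n, t n * ‖v‖ < r := fun n => by
    have h1 : 1 / ((n : ℝ) + 1) ≤ 1 := by rw [div_le_one (by positivity)]; simp
    calc t n * ‖v‖ ≤ (r / (1 + ‖v‖) * 1) * ‖v‖ := by simp only [t]; gcongr
      _ < r := by rw [mul_one, div_mul_eq_mul_div, div_lt_iff₀ hv0]; nlinarith
  have htlim : Tendsto t atTop (𝓝 0) := by
    rw [← mul_zero (r / (1 + ‖v‖))]
    exact (tendsto_one_div_add_atTop_nhds_zero_nat (𝕜 := ℝ)).const_mul (r / (1 + ‖v‖))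
  let q : ℕ → E → F := fun n z => (t n : ℂ)⁻¹ • (f (z + (t n : ℂ) • v) - f z)
  have hsub : ∀ z ∈ ball z₀ (2 * r), ball z r ⊆ ball z₀ (3 * r) := fun z hz =>
    ball_subset_ball' (by have := mem_ball.1 hz; linarith)
  have hmem : ∀ n, ∀ z ∈ ball z₀ (2 * r), z + (t n : ℂ) • v ∈ ball z r := fun n z hz => by
    rw [mem_ball_iff_norm, add_sub_cancel_left, norm_smul, Complex.norm_real,
      Real.norm_of_nonneg (ht0 n).le]
    exact htv n
  have hd : ∀ z ∈ ball z₀ (3 * r), DifferentiableAt ℂ f z := fun z hz => (hball z hz).2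
  -- second order estimate
  have hq : ∀ n, ∀ z ∈ ball z₀ (2 * r), ‖q n z - fderiv ℂ f z v‖ ≤ K * t n := by
    intro n z hz
    have hzz := hsub z hz
    have hz3 : z ∈ ball z₀ (3 * r) := hzz (mem_ball_self hr)
    have hd1 : DifferentiableOn ℂ f (ball z r) := fun w hw =>
      (hd w (hzz hw)).differentiableWithinAt
    have hm1 : Set.MapsTo f (ball z r) (closedBall (f z) (2 * C)) := fun w hw => by
      rw [mem_closedBall, dist_eq_norm]
      have := norm_sub_le (f w) (f z)
      have := (hball w (hzz hw)).1
      have := (hball z hz3).1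
      linarith
    have hD := Complex.norm_fderiv_le_div_of_mapsTo_ball hd1 hm1 hr
    -- After subtracting the linear part at `z`, the map `g - f z` vanishes to second order there,
    -- so the Schwarz estimate gains one power of the distance.
    let g : E → F := fun w => f w - fderiv ℂ f z (w - z)
    have hgz : g z = f z := by simp [g]
    have h := Complex.dist_le_mul_div_pow_of_mapsTo_ball_of_isLittleO (f := g) (n := 1)
      (R₂ := 4 * C) (z := z + (t n : ℂ) • v) (c := z) (R₁ := r)
      (by fun_prop) (fun w hw => by
        rw [hgz, mem_closedBall, dist_eq_norm]
        have h1 : ‖f w - f z‖ ≤ 2 * C := by simpa [dist_eq_norm] using hm1 hw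
        have h2 : ‖fderiv ℂ f z (w - z)‖ ≤ 2 * C / r * r :=
          (ContinuousLinearMap.le_of_opNorm_le _ hD _).trans
            (by gcongr; exact (mem_ball_iff_norm.1 hw).le)
        rw [div_mul_cancel₀ _ hr.ne'] at h2
        have : g w - f z = (f w - f z) - fderiv ℂ f z (w - z) := by simp only [g]; abel
        rw [this]
        exact (norm_sub_le _ _).trans (by linarith))
      (by
        have h1 := ((hd z hz3).hasFDerivAt.isLittleO).norm_right
        refine h1.congr' (.of_eq (funext fun w => ?_)) (.of_eq (funext fun w => by simp))
        rw [hgz]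
        simp only [g]
        abel) (hmem n z hz)
    have htn : (t n : ℂ) ≠ 0 := by exact_mod_cast (ht0 n).ne'
    have e : q n z - fderiv ℂ f z v = (t n : ℂ)⁻¹ • (g (z + (t n : ℂ) • v) - g z) := by
      rw [hgz]
      simp only [q, g, add_sub_cancel_left, map_smul, smul_sub, inv_smul_smul₀ htn]
      abel
    rw [e, norm_smul, norm_inv, Complex.norm_real, Real.norm_of_nonneg (ht0 n).le]
    rw [dist_eq_norm, dist_eq_norm, add_sub_cancel_left, norm_smul, Complex.norm_real,
      Real.norm_of_nonneg (ht0 n).le] at h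
    calc (t n)⁻¹ * ‖g (z + (t n : ℂ) • v) - g z‖
        ≤ (t n)⁻¹ * (4 * C * (t n * ‖v‖ / r) ^ (1 + 1)) := by
          have := ht0 n
          gcongr
      _ = K * t n := by
        have := (ht0 n).ne'
        rw [hK, one_add_one_eq_two, mul_div_assoc, mul_pow]
        field_simp
  have hqd : ∀ n, ∀ z ∈ ball z₀ (2 * r), DifferentiableAt ℂ (q n) z := fun n z hz => by
    have h1 := hd _ (hsub z hz (hmem n z hz))
    have h2 := hd z (hsub z hz (mem_ball_self hr))
    have h3 : DifferentiableAt ℂ (fun z => f (z + (t n : ℂ) • v)) z :=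
      DifferentiableAt.comp (f := fun z => z + (t n : ℂ) • v) z h1 (by fun_prop)
    exact (h3.sub h2).const_smul _
  have hK0 : 0 ≤ K := by positivity
  have hcau : ∀ n l, ∀ z ∈ ball z₀ r,
      ‖fderiv ℂ (q n) z - fderiv ℂ (q l) z‖ ≤ 2 * K / r * (t n + t l) := by
    intro n l z hz
    have hb : ball z r ⊆ ball z₀ (2 * r) :=
      ball_subset_ball' (by have := mem_ball.1 hz; linarith)
    have hz2 := hb (mem_ball_self hr)
    have hnl : ∀ w ∈ ball z₀ (2 * r), ‖q n w - q l w‖ ≤ K * (t n + t l) := fun w hw => by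
      have h1 := hq n w hw
      have h2 := hq l w hw
      have e : q n w - q l w = (q n w - fderiv ℂ f w v) - (q l w - fderiv ℂ f w v) := by abel
      rw [e]
      exact (norm_sub_le _ _).trans (by linarith)
    -- Cauchy's estimate for `q n - q l`; the factor `2` arises because the oscillation is measured
    -- from the value at the centre.
    have h := Complex.norm_fderiv_le_div_of_mapsTo_ball (f := q n - q l) (c := z) (R₁ := r)
      (R₂ := 2 * K * (t n + t l))
      (fun w hw => ((hqd n w (hb hw)).sub (hqd l w (hb hw))).differentiableWithinAt)
      (fun w hw => by
        rw [mem_closedBall, dist_eq_norm]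
        have h1 := hnl w (hb hw)
        have h2 := hnl z hz2
        refine (norm_sub_le _ _).trans ?_
        simp only [Pi.sub_apply]
        linarith) hr
    rw [fderiv_sub (hqd n z hz2) (hqd l z hz2)] at h
    refine h.trans (le_of_eq (by ring))
  have hlim : ∀ z ∈ ball z₀ r, ∃ L, Tendsto (fun n => fderiv ℂ (q n) z) atTop (𝓝 L) := by
    intro z hz
    refine cauchySeq_tendsto_of_complete (Metric.cauchySeq_iff'.2 fun ε hε => ?_)
    have : Tendsto (fun n => 2 * K / r * (t n + t n)) atTop (𝓝 0) := by
      simpa using (htlim.add htlim).const_mul (2 * K / r)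
    have hanti : Antitone t := fun n l h => by
      simp only [t]
      gcongr
    obtain ⟨N, hN⟩ := (this.eventually_lt_const hε).exists
    refine ⟨N, fun n hn => ?_⟩
    rw [dist_eq_norm]
    refine (hcau n N z hz).trans_lt (lt_of_le_of_lt ?_ hN)
    have := hanti hn
    gcongr
  choose! L hL using hlim
  have hunif : TendstoUniformlyOn (fun n => fderiv ℂ (q n)) L atTop (ball z₀ r) := by
    rw [Metric.tendstoUniformlyOn_iff]
    intro ε hε
    have h0 : Tendsto (fun n => 2 * K / r * t n) atTop (𝓝 0) := by
      simpa using htlim.const_mul (2 * K / r)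
    filter_upwards [h0.eventually_lt_const hε] with n hn z hz
    rw [dist_eq_norm]
    refine lt_of_le_of_lt (le_of_tendsto_of_tendsto ((hL z hz).sub_const _).norm
      (((htlim.add_const (t n)).const_mul (2 * K / r)))
      (Eventually.of_forall fun l => hcau l n z hz)) (by simpa using hn)
  have key : HasFDerivAt (fun z => fderiv ℂ f z v) (L z₀) z₀ := by
    refine hasFDerivAt_of_tendstoUniformlyOn (f := q) isOpen_ball hunif (fun n z hz => ?_)
      (fun z hz => ?_) (mem_ball_self hr)
    · exact (hqd n z (ball_subset_ball (by linarith) hz)).hasFDerivAt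
    · rw [tendsto_iff_norm_sub_tendsto_zero]
      refine squeeze_zero (fun _ => norm_nonneg _)
        (fun n => hq n z (ball_subset_ball (by linarith) hz)) ?_
      simpa using htlim.const_mul K
  exact key.differentiableAt

/-- The derivative of a holomorphic map of several variables is holomorphic. -/
lemma Hol.hol_fderiv [FiniteDimensional ℂ E] [CompleteSpace F] {f : E → F} {z : E} (H : Hol f z) :
    Hol (fderiv ℂ f) z := by
  filter_upwards [H.eventually] with w hw
  let b := Module.finBasis ℂ E
  have e : fderiv ℂ f = fun z => ∑ i, (LinearMap.toContinuousLinearMap (b.coord i)).smulRight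
      (fderiv ℂ f z (b i)) := by
    funext z
    ext v
    have h : fderiv ℂ f z v = fderiv ℂ f z (∑ i, b.repr v i • b i) := by rw [b.sum_repr]
    rw [h, _root_.map_sum]
    simp
  rw [e]
  refine DifferentiableAt.fun_sum fun i _ => ?_
  exact (ContinuousLinearMap.smulRightL ℂ E F
    (LinearMap.toContinuousLinearMap (b.coord i))).differentiableAt.comp w
    (differentiableAt_fderiv_apply hw (b i))

lemma Hol.fderiv_apply [FiniteDimensional ℂ E] [CompleteSpace F] {f : E → F} {z : E} {v : E → E}
    (H : Hol f z) (hv : Hol v z) : Hol (fun w => fderiv ℂ f w (v w)) z :=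
  H.hol_fderiv.clm_apply hv

/-- Used in order two: for `d ∘ d = 0`, for the naturality of `d` under pullback and for the
symmetry of second derivatives. -/
lemma Hol.contDiffAt_nat {E F : Type} [NormedAddCommGroup E] [NormedSpace ℂ E]
    [NormedAddCommGroup F] [NormedSpace ℂ F] [FiniteDimensional ℂ E] [CompleteSpace F] {f : E → F} {z : E} (n : ℕ)
    (H : Hol f z) : ContDiffAt ℂ n f z := by
  induction n generalizing F with
  | zero =>
    obtain ⟨u, hu, h⟩ := H.exists_mem
    exact contDiffAt_zero.2 ⟨u, hu, fun w hw => (h w hw).continuousAt.continuousWithinAt⟩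
  | succ n ih =>
    obtain ⟨u, hu, h⟩ := H.exists_mem
    exact contDiffAt_succ_iff_hasFDerivAt.2
      ⟨fderiv ℂ f, ⟨u, hu, fun w hw => (h w hw).hasFDerivAt⟩, ih H.hol_fderiv⟩

end Holomorphic

/-! ### Coordinate hyperplanes -/

section Coordinates

open Filter Metric

variable {n : ℕ} {F : Type*} [NormedAddCommGroup F] [NormedSpace ℂ F]

/-- The complement of the coordinate hyperplanes `z i = 0`, `i ∈ S`. -/
def Off (S : Finset (Fin n)) : Set (Cn n) := {z | ∀ i ∈ S, z i ≠ 0}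

lemma isOpen_Off (S : Finset (Fin n)) : IsOpen (Off S) := by
  have : Off S = ⋂ i ∈ S, {z : Cn n | z i ≠ 0} := by ext; simp [Off]
  rw [this]
  exact isOpen_biInter_finset fun i _ => isOpen_ne_fun (continuous_apply i) continuous_const

/-- Moving the coordinates in `S` by a small number leaves their hyperplanes. -/
def shift (S : Finset (Fin n)) (z : Cn n) (ε : ℂ) : Cn n := fun i => if i ∈ S then z i + ε else z i

lemma tendsto_shift (S : Finset (Fin n)) (z : Cn n) : Tendsto (shift S z) (𝓝[≠] 0) (𝓝 z) := by
  have h : ContinuousAt (shift S z) 0 := by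
    refine continuousAt_pi.2 fun i => ?_
    by_cases hi : i ∈ S <;> simp only [shift, hi, if_true, if_false] <;> fun_prop
  have h0 : shift S z 0 = z := by ext i; simp [shift]
  have := h.tendsto.mono_left (nhdsWithin_le_nhds (s := {0}ᶜ))
  rwa [h0] at this

lemma eventually_shift_mem (S : Finset (Fin n)) (z : Cn n) :
    ∀ᶠ ε in 𝓝[≠] (0 : ℂ), shift S z ε ∈ Off S := by
  have : ∀ᶠ ε in 𝓝[≠] (0 : ℂ), ∀ i ∈ S, ε ≠ -z i := by
    refine (Filter.eventually_all_finset S).2 fun i _ => ?_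
    by_cases h : z i = 0
    · filter_upwards [self_mem_nhdsWithin] with ε hε
      simpa [h] using hε
    · exact (eventually_ne_nhds (fun h' => h (by linear_combination h'))).filter_mono nhdsWithin_le_nhds
  filter_upwards [this] with ε hε i hi h
  simp only [shift, hi, if_true] at h
  exact hε i hi (by linear_combination h)

/-- The complement of the hyperplanes accumulates at every point, so values of continuous maps there
determine them everywhere. -/
instance neBot_nhdsWithin_Off (S : Finset (Fin n)) (z : Cn n) : (𝓝[Off S] z).NeBot :=
  (tendsto_nhdsWithin_iff.2 ⟨tendsto_shift S z, eventually_shift_mem S z⟩).neBot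

lemma eventually_nhdsWithin_Off {S : Finset (Fin n)} {z₀ : Cn n} {P : Cn n → Prop}
    (h : ∀ᶠ z in 𝓝[Off S] z₀, P z) : ∀ᶠ z in 𝓝 z₀, ∀ᶠ w in 𝓝[Off S] z, P w :=
  eventually_nhds_nhdsWithin.2 h

/-- Since `Off S` is open, an identity at generic points near `z₀` holds in a full neighbourhood of
each such point and may be differentiated there. -/
lemma eventually_of_Off {S : Finset (Fin n)} {z₀ : Cn n} {P : Cn n → Prop}
    (h : ∀ᶠ z in 𝓝[Off S] z₀, P z) : ∀ᶠ z in 𝓝[Off S] z₀, ∀ᶠ w in 𝓝 z, P w := by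
  have h1 := (eventually_nhdsWithin_Off h).filter_mono (nhdsWithin_le_nhds (s := Off S))
  filter_upwards [h1, self_mem_nhdsWithin] with z hz hS
  rwa [(isOpen_Off S).nhdsWithin_eq hS] at hz

/-- Continuity and density of the complement. This is the standard way in which identities between
log coefficients, computed off the divisor, are continued across it. -/
lemma Hol.eq_of_eq_Off {S : Finset (Fin n)} {z₀ : Cn n} {h h' : Cn n → F} (H : Hol h z₀)
    (H' : Hol h' z₀) (e : ∀ᶠ z in 𝓝[Off S] z₀, h z = h' z) : ∀ᶠ z in 𝓝 z₀, h z = h' z := by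
  filter_upwards [H, H', eventually_nhdsWithin_Off e] with z h1 h2 h3
  exact tendsto_nhds_unique_of_eventuallyEq (h1.continuousAt.tendsto.mono_left nhdsWithin_le_nhds)
    (h2.continuousAt.tendsto.mono_left nhdsWithin_le_nhds) h3

/-- An equation of holomorphic maps which holds on the regular part of a hyperplane holds on
the hyperplane. -/
lemma Hol.eq_of_eq_hyperplane {S : Finset (Fin n)} {z₀ : Cn n} {h h' : Cn n → F} (H : Hol h z₀)
    (H' : Hol h' z₀) {i : Fin n}
    (e : ∀ᶠ z in 𝓝 z₀, z i = 0 → z ∈ Off (S.erase i) → h z = h' z) :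
    ∀ᶠ z in 𝓝 z₀, z i = 0 → h z = h' z := by
  filter_upwards [H, H', eventually_eventually_nhds.2 e] with z h1 h2 h3 hz
  refine tendsto_nhds_unique_of_eventuallyEq
    (h1.continuousAt.tendsto.comp (tendsto_shift (S.erase i) z))
    (h2.continuousAt.tendsto.comp (tendsto_shift (S.erase i) z)) ?_
  filter_upwards [(tendsto_shift (S.erase i) z).eventually h3,
    eventually_shift_mem (S.erase i) z] with ε h4 h5
  exact h4 (by simp [shift, hz]) h5

lemma hol_proj (i : Fin n) (z : Cn n) : Hol (fun w : Cn n => w i) z :=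
  Hol.clm (ContinuousLinearMap.proj i : Cn n →L[ℂ] ℂ)

/-- A holomorphic map that vanishes on a coordinate hyperplane is divisible by the coordinate. -/
lemma Hol.exists_eq_smul [CompleteSpace F] {g : Cn n → F} {z₀ : Cn n} (H : Hol g z₀) {i : Fin n}
    (h0 : ∀ᶠ z in 𝓝 z₀, z i = 0 → g z = 0) :
    ∃ h, Hol h z₀ ∧ ∀ᶠ z in 𝓝 z₀, g z = z i • h z := by
  classical
  let e : Cn n := Pi.single i 1
  let D : Cn n → F := fun z => fderiv ℂ g z e
  have HD : Hol D z₀ := H.fderiv_apply (Hol.const e)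
  -- On the hyperplane the quotient receives its limit, the partial derivative of `g` in the `i`-th
  -- direction. Only differentiability at points of the hyperplane is then a problem.
  let h : Cn n → F := fun z => if z i = 0 then D z else (z i)⁻¹ • g z
  refine ⟨h, ?_, ?_⟩
  swap
  · filter_upwards [h0] with z hz
    by_cases hi : z i = 0
    · simp [hi, hz hi]
    · simp [h, hi, smul_inv_smul₀]
  filter_upwards [H.eventually, HD.eventually, eventually_eventually_nhds.2 h0] with a Ha HDa h0a
  by_cases hai : a i = 0
  swap
  · have : DifferentiableAt ℂ (fun z : Cn n => (z i)⁻¹ • g z) a :=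
      ((hol_proj i a).inv hai |>.smul Ha).differentiableAt
    refine this.congr_of_eventuallyEq ?_
    filter_upwards [(continuous_apply i).continuousAt.eventually_ne hai] with z hz
    simp [h, hz]
  let A := fderiv ℂ D a
  have hA : HasFDerivAt D A a := HDa.differentiableAt.hasFDerivAt
  -- At points off the hyperplane `h` is the mean of `D` over the segment that joins the point to
  -- the hyperplane in direction `e`. The linear part `A` of `D` has on this segment the mean `A (P
  -- w)`, where `P` halves the `i`-th coordinate; hence the candidate derivative `A ∘ P`.
  let P : Cn n →L[ℂ] Cn n := ContinuousLinearMap.id ℂ (Cn n) -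
    (1 / 2 : ℂ) • (ContinuousLinearMap.proj i : Cn n →L[ℂ] ℂ).smulRight e
  have key : HasFDerivAt h (A.comp P) a := by
    rw [hasFDerivAt_iff_isLittleO_nhds_zero]
    rw [Asymptotics.isLittleO_iff]
    intro ε hε
    have hA' := Asymptotics.isLittleO_iff.1 (hasFDerivAt_iff_isLittleO_nhds_zero.1 hA) hε
    have hall : ∀ᶠ z in 𝓝 a, DifferentiableAt ℂ g z ∧ (z i = 0 → g z = 0) := Ha.and h0a
    have hall0 : ∀ᶠ w in 𝓝 (0 : Cn n), DifferentiableAt ℂ g (a + w) ∧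
        ((a + w) i = 0 → g (a + w) = 0) := by
      have : Tendsto (fun w : Cn n => a + w) (𝓝 0) (𝓝 a) :=
        (continuous_const.add continuous_id).tendsto' _ _ (add_zero a)
      exact this.eventually hall
    obtain ⟨δ, hδ, hb⟩ := Metric.eventually_nhds_iff_ball.1 (hA'.and hall0)
    filter_upwards [ball_mem_nhds (0 : Cn n) hδ] with w hw
    have hha : h a = D a := by simp [h, hai]
    by_cases hwi : w i = 0
    · have h1 : h (a + w) = D (a + w) := by simp [h, hai, hwi]
      have h2 : P w = w := by simp [P, hwi]
      rw [ContinuousLinearMap.comp_apply, h1, h2, hha]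
      exact (hb w hw).1
    · let w' : Cn n := w - w i • e
      have hw'i : w' i = 0 := by simp [w', e]
      let u : ℂ → Cn n := fun s => w' + s • e
      -- For the sup norm, replacing the `i`-th coordinate by one of no larger modulus does not
      -- increase the norm.
      have hu : ∀ s ∈ closedBall (0 : ℂ) ‖w i‖, ‖u s‖ ≤ ‖w‖ := by
        intro s hs
        refine (pi_norm_le_iff_of_nonneg (norm_nonneg _)).2 fun j => ?_
        by_cases hj : j = i
        · subst hj
          have : u s j = s := by simp [u, hw'i, e]
          rw [this]
          exact (mem_closedBall_zero_iff.1 hs).trans (norm_le_pi_norm w j)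
        · have : u s j = w j := by simp [u, w', e, hj]
          rw [this]
          exact norm_le_pi_norm w j
      have hub : ∀ s ∈ closedBall (0 : ℂ) ‖w i‖, u s ∈ ball (0 : Cn n) δ := fun s hs =>
        mem_ball_zero_iff.2 ((hu s hs).trans_lt (mem_ball_zero_iff.1 hw))
      have hud : ∀ s, HasDerivAt (fun s => a + u s) e s := fun s => by
        simpa [u] using (((hasDerivAt_id s).smul_const e).const_add w').const_add a
      -- The primitive, along the segment, of the remainder `ψ'` of `D` at `a`. The mean value
      -- inequality bounds `ψ (w i)`, which is `w i` times the remainder of `h`.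
      let ψ : ℂ → F := fun s => g (a + u s) - s • D a - A (s • w' + (s ^ 2 / 2) • e)
      let ψ' : ℂ → F := fun s => D (a + u s) - D a - A (u s)
      have hψ : ∀ s ∈ closedBall (0 : ℂ) ‖w i‖, HasDerivAt ψ (ψ' s) s := by
        intro s hs
        have h1 : HasDerivAt (fun s => g (a + u s)) (D (a + u s)) s :=
          (hb _ (hub s hs)).2.1.hasFDerivAt.comp_hasDerivAt s (hud s)
        have h2 : HasDerivAt (fun s : ℂ => s • D a) (D a) s := by
          simpa using (hasDerivAt_id s).smul_const (D a)
        have h3 : HasDerivAt (fun s : ℂ => s • w' + (s ^ 2 / 2) • e) (u s) s := by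
          have h4 : HasDerivAt (fun s : ℂ => s ^ 2 / 2) s s := by
            simpa using (hasDerivAt_pow 2 s).div_const 2
          have h5 : HasDerivAt (fun s : ℂ => s • w') w' s := by
            simpa using (hasDerivAt_id s).smul_const w'
          exact h5.fun_add (h4.smul_const e)
        exact (h1.sub h2).sub (A.hasFDerivAt.comp_hasDerivAt s h3)
      have hbound : ∀ s ∈ closedBall (0 : ℂ) ‖w i‖, ‖ψ' s‖ ≤ ε * ‖w‖ := fun s hs =>
        (hb _ (hub s hs)).1.trans (by gcongr; exact hu s hs)
      have hfin := Convex.norm_image_sub_le_of_norm_hasDerivWithin_le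
        (fun s hs => (hψ s hs).hasDerivWithinAt) hbound (convex_closedBall 0 ‖w i‖)
        (x := 0) (y := w i) (by simp) (by simp)
      have hψ0 : ψ 0 = 0 := by
        have : g (a + w') = 0 :=
          (by simpa [u] using (hb _ (hub 0 (by simp))).2.2 : (a + w') i = 0 → g (a + w') = 0)
            (by simp [hai, hw'i])
        simp [ψ, u, this]
      have hψ1 : ψ (w i) = w i • (h (a + w) - h a - A (P w)) := by
        have h1 : u (w i) = w := by simp [u, w']
        have h2 : h (a + w) = (w i)⁻¹ • g (a + w) := by simp [h, hai, hwi]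
        have h3 : w i • w' + (w i ^ 2 / 2) • e = w i • P w := by
          simp only [P, w', _root_.sub_apply, ContinuousLinearMap.id_apply,
            _root_.smul_apply, ContinuousLinearMap.smulRight_apply,
            ContinuousLinearMap.proj_apply]
          module
        simp only [ψ]
        rw [h1, h3, hha, h2, map_smul, smul_sub, smul_sub, smul_inv_smul₀ hwi]
      rw [hψ0, sub_zero, sub_zero, hψ1, norm_smul, mul_comm] at hfin
      exact le_of_mul_le_mul_right hfin (norm_pos_iff.2 hwi)
  exact key.differentiableAt

/-! ### The log frame -/

/-- The inverse of the log frame outside of the hyperplanes. -/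
def logFrameInv (S : Finset (Fin n)) (z : Cn n) : Cn n →L[ℂ] Cn n :=
  ContinuousLinearMap.pi fun i =>
    (if i ∈ S then (z i)⁻¹ else 1) • (ContinuousLinearMap.proj i : Cn n →L[ℂ] ℂ)

lemma logFrame_apply (S : Finset (Fin n)) (z v : Cn n) (i : Fin n) :
    logFrame S z v i = (if i ∈ S then z i else 1) * v i := rfl

lemma logFrameInv_apply (S : Finset (Fin n)) (z v : Cn n) (i : Fin n) :
    logFrameInv S z v i = (if i ∈ S then (z i)⁻¹ else 1) * v i := rfl

lemma logFrame_logFrameInv {S : Finset (Fin n)} {z : Cn n} (hz : z ∈ Off S) (v : Cn n) :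
    logFrame S z (logFrameInv S z v) = v := by
  ext i
  rw [logFrame_apply, logFrameInv_apply]
  split_ifs with h
  · rw [mul_inv_cancel_left₀ (hz i h)]
  · simp

lemma logFrameInv_logFrame {S : Finset (Fin n)} {z : Cn n} (hz : z ∈ Off S) (v : Cn n) :
    logFrameInv S z (logFrame S z v) = v := by
  ext i
  rw [logFrameInv_apply, logFrame_apply]
  split_ifs with h
  · rw [inv_mul_cancel_left₀ (hz i h)]
  · simp

lemma hol_pi {ι : Type*} [Fintype ι] {E : Type*} [NormedAddCommGroup E] [NormedSpace ℂ E]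
    {h : E → ι → F} {z : E} (H : ∀ i, Hol (fun w => h w i) z) : Hol h z := by
  filter_upwards [Filter.eventually_all.2 H] with w hw using differentiableAt_pi.2 hw

/-- The log frame is an affine function of the point. -/
def logFrameLin (S : Finset (Fin n)) : Cn n →L[ℂ] Cn n →L[ℂ] Cn n :=
  ∑ i ∈ S, ((ContinuousLinearMap.smulRightL ℂ (Cn n) (Cn n)
    (ContinuousLinearMap.proj i)).comp
      ((ContinuousLinearMap.proj i : Cn n →L[ℂ] ℂ).smulRight (Pi.single i 1)))

lemma logFrameLin_apply (S : Finset (Fin n)) (z v : Cn n) (i : Fin n) :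
    logFrameLin S z v i = if i ∈ S then z i * v i else 0 := by
  simp [logFrameLin, Finset.sum_apply, Pi.single_apply]

lemma logFrame_eq (S : Finset (Fin n)) (z : Cn n) :
    logFrame S z = logFrame S 0 + logFrameLin S z := by
  ext v i
  rw [_root_.add_apply, Pi.add_apply, logFrameLin_apply, logFrame_apply, logFrame_apply]
  split_ifs <;> simp

lemma hasFDerivAt_logFrame (S : Finset (Fin n)) (z : Cn n) :
    HasFDerivAt (logFrame S) (logFrameLin S) z := by
  have : logFrame S = fun z => logFrame S 0 + logFrameLin S z := funext (logFrame_eq S)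
  rw [this]
  exact (logFrameLin S).hasFDerivAt.const_add _

lemma hol_logFrame (S : Finset (Fin n)) (z : Cn n) : Hol (logFrame S) z :=
  Eventually.of_forall fun w => (hasFDerivAt_logFrame S w).differentiableAt

/-- The fields of the log frame commute. This removes the bracket terms from the exterior derivative
computed in the log frame. -/
lemma logFrameLin_comm (S : Finset (Fin n)) (z v w : Cn n) :
    logFrameLin S (logFrame S z v) w = logFrameLin S (logFrame S z w) v := by
  ext i
  simp only [logFrameLin_apply, logFrame_apply]
  split_ifs <;> ring

end Coordinates

/-! ### The exterior derivative in a commuting frame -/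

section Frame

open ContinuousAlternatingMap

variable {E : Type*} [NormedAddCommGroup E] [NormedSpace ℂ E] {k : ℕ}

lemma fderiv_form_apply {E' : Type*} [NormedAddCommGroup E'] [NormedSpace ℂ E']
    {A : E → E' [⋀^Fin k]→L[ℂ] ℂ} {x : E} (hA : DifferentiableAt ℂ A x) (u : E)
    (v : Fin k → E') : fderiv ℂ A x u v = fderiv ℂ (fun y => A y v) x u := by
  have := ((ContinuousAlternatingMap.apply ℂ E' ℂ v).hasFDerivAt.comp x hA.hasFDerivAt).fderiv
  exact (DFunLike.congr_fun this u).symm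

/-- The invariant formula for `dα` on pairwise commuting fields has no bracket terms, so the
components of `dα` in a commuting frame are the alternating sums of the frame derivatives of the
components of `α`. -/
lemma extDeriv_comp_frame {α : E → E [⋀^Fin k]→L[ℂ] ℂ} {R : E → E →L[ℂ] E}
    {R' : E →L[ℂ] E →L[ℂ] E} {x : E} (hα : DifferentiableAt ℂ α x) (hR : HasFDerivAt R R' x)
    (hcomm : ∀ v w, R' (R x v) w = R' (R x w) v) :
    (extDeriv α x).compContinuousLinearMap (R x) = alternatizeUncurryFin
      ((fderiv ℂ (fun y => (α y).compContinuousLinearMap (R y)) x).comp (R x)) := by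
  ext v
  have hRv : ∀ w, HasFDerivAt (fun y => R y w) (R'.flip w) x := fun w =>
    (ContinuousLinearMap.apply ℂ E w).hasFDerivAt.comp x hR
  have hB : DifferentiableAt ℂ (fun y => (α y).compContinuousLinearMap (R y)) x :=
    hα.continuousAlternatingMapCompContinuousLinearMap hR.differentiableAt
  have h := extDeriv_apply_vectorField_of_pairwise_commute (V := fun i y => R y (v i)) hα
    (fun i => (hRv (v i)).differentiableAt) (fun i j _ => by
      beta_reduce
      rw [VectorField.lieBracket_eq]
      simp only [(hRv _).fderiv, ContinuousLinearMap.flip_apply]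
      rw [hcomm, sub_self])
  rw [compContinuousLinearMap_apply]
  refine Eq.trans ?_ (h.trans ?_)
  · rfl
  · rw [alternatizeUncurryFin_apply]
    refine Finset.sum_congr rfl fun i _ => ?_
    rw [ContinuousLinearMap.comp_apply, fderiv_form_apply hB]
    rfl

end Frame

/-! ### Charts -/

section Charts

open Filter ContinuousAlternatingMap

variable {m : ℕ} {Y : Type} [TopologicalSpace Y] [ChartedSpace (Cn m) Y]

/-- The differential of the change of charts is the composition of the differentials. -/
lemma hasFDerivAt_transition {e e' : OpenPartialHomeomorph Y (Cn m)}
    (he : e ∈ IsManifold.maximalAtlas 𝓘(ℂ, Cn m) ω Y)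
    (he' : e' ∈ IsManifold.maximalAtlas 𝓘(ℂ, Cn m) ω Y) {z : Cn m} (hz : z ∈ e.target)
    (hz' : e.symm z ∈ e'.source) :
    HasFDerivAt (fun w => e' (e.symm w))
      ((chartDeriv e' (e.symm z)).comp (chartInvDeriv e z)) z := by
  have h1 := (mdifferentiableAt_of_mem_maximalAtlas
    (IsManifold.maximalAtlas_subset_of_le (n := ω) le_top he') hz').hasMFDerivAt
  have h2 := (mdifferentiableAt_symm_of_mem_maximalAtlas
    (IsManifold.maximalAtlas_subset_of_le (n := ω) le_top he) hz).hasMFDerivAt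
  exact (h1.comp z h2).hasFDerivAt

lemma chartDeriv_chartInvDeriv {e : OpenPartialHomeomorph Y (Cn m)}
    (he : e ∈ IsManifold.maximalAtlas 𝓘(ℂ, Cn m) ω Y) {z : Cn m} (hz : z ∈ e.target) (v : Cn m) :
    chartDeriv e (e.symm z) (chartInvDeriv e z v) = v := by
  have h := hasFDerivAt_transition he he hz (e.map_target hz)
  have h' : HasFDerivAt (fun w => e (e.symm w)) (ContinuousLinearMap.id ℂ (Cn m)) z :=
    (hasFDerivAt_id z).congr_of_eventuallyEq
      (by filter_upwards [e.open_target.mem_nhds hz] with w hw using e.right_inv hw)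
  exact DFunLike.congr_fun (h.unique h') v

variable [IsManifold 𝓘(ℂ, Cn m) ω Y]

lemma mdifferentiable_of_mem {e : OpenPartialHomeomorph Y (Cn m)}
    (he : e ∈ IsManifold.maximalAtlas 𝓘(ℂ, Cn m) ω Y) :
    e.MDifferentiable 𝓘(ℂ, Cn m) 𝓘(ℂ, Cn m) :=
  ⟨fun _ hx => (mdifferentiableAt_of_mem_maximalAtlas
      (IsManifold.maximalAtlas_subset_of_le (n := ω) le_top he) hx).mdifferentiableWithinAt,
    fun _ hx => (mdifferentiableAt_symm_of_mem_maximalAtlas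
      (IsManifold.maximalAtlas_subset_of_le (n := ω) le_top he) hx).mdifferentiableWithinAt⟩

lemma chartInvDeriv_chartDeriv {e : OpenPartialHomeomorph Y (Cn m)}
    (he : e ∈ IsManifold.maximalAtlas 𝓘(ℂ, Cn m) ω Y) {y : Y} (hy : y ∈ e.source) (v : Cn m) :
    chartInvDeriv e (e y) (chartDeriv e y v) = v :=
  DFunLike.congr_fun ((mdifferentiable_of_mem he).symm_comp_deriv hy) v

lemma chartAt_mem (y : Y) : chartAt (Cn m) y ∈ IsManifold.maximalAtlas 𝓘(ℂ, Cn m) ω Y :=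
  IsManifold.chart_mem_maximalAtlas y

lemma eventually_transition {e e' : OpenPartialHomeomorph Y (Cn m)} {y : Y} (hy : y ∈ e.source)
    (hy' : y ∈ e'.source) : ∀ᶠ z in 𝓝 (e y), z ∈ e.target ∧ e.symm z ∈ e'.source := by
  have h : ContinuousAt e.symm (e y) := e.continuousAt_symm (e.map_source hy)
  filter_upwards [e.open_target.mem_nhds (e.map_source hy),
    h.preimage_mem_nhds (e'.open_source.mem_nhds (by rwa [e.left_inv hy]))] with z h1 h2
  exact ⟨h1, h2⟩

lemma hol_transition {e e' : OpenPartialHomeomorph Y (Cn m)}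
    (he : e ∈ IsManifold.maximalAtlas 𝓘(ℂ, Cn m) ω Y)
    (he' : e' ∈ IsManifold.maximalAtlas 𝓘(ℂ, Cn m) ω Y) {y : Y} (hy : y ∈ e.source)
    (hy' : y ∈ e'.source) : Hol (fun w => e' (e.symm w)) (e y) := by
  filter_upwards [eventually_transition hy hy'] with z hz
  exact (hasFDerivAt_transition he he' hz.1 hz.2).differentiableAt

lemma tendsto_transition {e e' : OpenPartialHomeomorph Y (Cn m)} {y : Y} (hy : y ∈ e.source)
    (hy' : y ∈ e'.source) : Tendsto (fun w => e' (e.symm w)) (𝓝 (e y)) (𝓝 (e' y)) := by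
  have h : ContinuousAt e.symm (e y) := e.continuousAt_symm (e.map_source hy)
  have h' : ContinuousAt e' (e.symm (e y)) := by
    rw [e.left_inv hy]
    exact e'.continuousAt hy'
  have := h'.tendsto.comp h.tendsto
  rwa [e.left_inv hy] at this

lemma inChart_transition {k : ℕ} {e e' : OpenPartialHomeomorph Y (Cn m)}
    (he' : e' ∈ IsManifold.maximalAtlas 𝓘(ℂ, Cn m) ω Y) (α : Form m k Y) {z : Cn m}
    (hz' : e.symm z ∈ e'.source) :
    inChart e α z = (inChart e' α (e' (e.symm z))).compContinuousLinearMap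
      ((chartDeriv e' (e.symm z)).comp (chartInvDeriv e z)) := by
  ext v
  simp only [inChart, compContinuousLinearMap_apply, e'.left_inv hz']
  congr 1
  funext i
  exact (chartInvDeriv_chartDeriv he' hz' _).symm

/-- The exterior derivative can be computed in every chart. -/
lemma inChart_dForm {k : ℕ} {e : OpenPartialHomeomorph Y (Cn m)}
    (he : e ∈ IsManifold.maximalAtlas 𝓘(ℂ, Cn m) ω Y) {α : Form m k Y} {z : Cn m}
    (hz : z ∈ e.target) (hα : DifferentiableAt ℂ (inChart e α) z) :
    inChart e (dForm α) z = extDeriv (inChart e α) z := by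
  obtain ⟨y, hy, rfl⟩ : ∃ y ∈ e.source, e y = z := ⟨e.symm z, e.map_target hz, e.right_inv hz⟩
  set c := chartAt (Cn m) y with hc
  have hcm : c ∈ IsManifold.maximalAtlas 𝓘(ℂ, Cn m) ω Y := chartAt_mem y
  have hyc : y ∈ c.source := mem_chart_source _ y
  set φ : Cn m → Cn m := fun w => e (c.symm w) with hφ
  have hφy : φ (c y) = e y := by simp [hφ, c.left_inv hyc]
  -- In the preferred chart `α` is the pullback, under the change of charts `φ`, of its expression
  -- in `e`; the claim is the naturality of the exterior derivative under `φ`.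
  have h1 : inChart c α =ᶠ[𝓝 (c y)]
      fun w => (inChart e α (φ w)).compContinuousLinearMap (fderiv ℂ φ w) := by
    filter_upwards [eventually_transition hyc hy] with w hw
    rw [inChart_transition he α hw.2, (hasFDerivAt_transition hcm he hw.1 hw.2).fderiv]
  have h2 : extDeriv (inChart c α) (c y) =
      (extDeriv (inChart e α) (e y)).compContinuousLinearMap (fderiv ℂ φ (c y)) := by
    have h := extDeriv_pullback (x := c y) (r := (2 : ℕ))
      (show DifferentiableAt ℂ (inChart e α) (φ (c y)) by rwa [hφy]) ((hol_transition hcm he hyc hy).contDiffAt_nat 2) (by simp)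
    rw [h1.extDeriv_eq, h, hφy]
  have h3 : dForm α y = (extDeriv (inChart e α) (e y)).compContinuousLinearMap
      (chartDeriv e y) := by
    rw [dForm, ← hc, h2]
    ext v
    simp only [compContinuousLinearMap_apply]
    congr 1
    funext i
    have := hasFDerivAt_transition hcm he (c.map_source hyc) (by rwa [c.left_inv hyc])
    rw [Function.comp_apply, hφ, this.fderiv, ContinuousLinearMap.comp_apply,
      c.left_inv hyc, Function.comp_apply, chartInvDeriv_chartDeriv hcm hyc]
    rfl
  rw [inChart, e.left_inv hy, h3]
  ext v
  simp only [compContinuousLinearMap_apply]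
  congr 1
  funext i
  have := chartDeriv_chartInvDeriv he hz (v i)
  rwa [e.left_inv hy] at this

/-- A vector field in the coordinates of a chart. -/
def vecInChart (e : OpenPartialHomeomorph Y (Cn m)) (ξ : Y → Cn m) (z : Cn m) : Cn m :=
  chartDeriv e (e.symm z) (ξ (e.symm z))

lemma mdifferentiableAt_iff_chart {F : Type*} [NormedAddCommGroup F] [NormedSpace ℂ F]
    {e : OpenPartialHomeomorph Y (Cn m)}
    (he : e ∈ IsManifold.maximalAtlas 𝓘(ℂ, Cn m) ω Y) {y : Y} (hy : y ∈ e.source) {g : Y → F} :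
    MDifferentiableAt 𝓘(ℂ, Cn m) 𝓘(ℂ, F) g y ↔
      DifferentiableAt ℂ (fun z => g (e.symm z)) (e y) := by
  have hm := mdifferentiable_of_mem he
  constructor
  · intro h
    rw [← mdifferentiableAt_iff_differentiableAt]
    refine MDifferentiableAt.comp (e y) (I' := 𝓘(ℂ, Cn m)) (g := g) ?_
      (hm.mdifferentiableAt_symm (e.map_source hy))
    rwa [e.left_inv hy]
  · intro h
    rw [← mdifferentiableAt_iff_differentiableAt] at h
    refine (h.comp y (hm.mdifferentiableAt hy)).congr_of_eventuallyEq ?_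
    filter_upwards [e.open_source.mem_nhds hy] with w hw
    simp [e.left_inv hw]

lemma holFun_iff {e : OpenPartialHomeomorph Y (Cn m)}
    (he : e ∈ IsManifold.maximalAtlas 𝓘(ℂ, Cn m) ω Y) {y : Y} (hy : y ∈ e.source) {g : Y → ℂ} :
    HolFun m g y ↔ Hol (fun z => g (e.symm z)) (e y) := by
  rw [HolFun, Hol, ← e.eventually_nhds' _ hy]
  refine eventually_congr ?_
  filter_upwards [e.open_target.mem_nhds (e.map_source hy)] with z hz
  rw [mdifferentiableAt_iff_chart he (e.map_target hz), e.right_inv hz]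

lemma dFun_eq {e : OpenPartialHomeomorph Y (Cn m)}
    (he : e ∈ IsManifold.maximalAtlas 𝓘(ℂ, Cn m) ω Y) {y : Y} (hy : y ∈ e.source) {g : Y → ℂ}
    (hg : DifferentiableAt ℂ (fun z => g (e.symm z)) (e y)) :
    dFun m g y = (fderiv ℂ (fun z => g (e.symm z)) (e y)).comp (chartDeriv e y) := by
  have hm := mdifferentiable_of_mem he
  have h1 : g =ᶠ[𝓝 y] (fun z => g (e.symm z)) ∘ e := by
    filter_upwards [e.open_source.mem_nhds hy] with w hw
    simp [e.left_inv hw]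
  have h2 := ((mdifferentiableAt_iff_differentiableAt.2 hg).hasMFDerivAt.comp y
    (hm.mdifferentiableAt hy).hasMFDerivAt).congr_of_eventuallyEq h1
  have h3 := h2.mfderiv
  rw [mfderiv_eq_fderiv] at h3
  exact h3

lemma vecInChart_transition {e c : OpenPartialHomeomorph Y (Cn m)}
    (he : e ∈ IsManifold.maximalAtlas 𝓘(ℂ, Cn m) ω Y)
    (hc : c ∈ IsManifold.maximalAtlas 𝓘(ℂ, Cn m) ω Y) (ξ : Y → Cn m) {z : Cn m}
    (hz : z ∈ e.target) (hz' : e.symm z ∈ c.source) :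
    vecInChart e ξ z = fderiv ℂ (fun w => e (c.symm w)) (c (e.symm z))
      (vecInChart c ξ (c (e.symm z))) := by
  have h := hasFDerivAt_transition hc he (z := c (e.symm z)) (c.map_source hz')
    (by rw [c.left_inv hz']; exact e.map_target hz)
  rw [h.fderiv, vecInChart, vecInChart, ContinuousLinearMap.comp_apply, c.left_inv hz',
    chartInvDeriv_chartDeriv hc hz']

lemma differentiableAt_vecInChart {e c : OpenPartialHomeomorph Y (Cn m)}
    (he : e ∈ IsManifold.maximalAtlas 𝓘(ℂ, Cn m) ω Y)
    (hc : c ∈ IsManifold.maximalAtlas 𝓘(ℂ, Cn m) ω Y) {ξ : Y → Cn m} {y : Y}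
    (hy : y ∈ e.source) (hy' : y ∈ c.source) (h : DifferentiableAt ℂ (vecInChart c ξ) (c y)) :
    DifferentiableAt ℂ (vecInChart e ξ) (e y) := by
  have h1 : vecInChart e ξ =ᶠ[𝓝 (e y)] fun z => fderiv ℂ (fun w => e (c.symm w))
      (c (e.symm z)) (vecInChart c ξ (c (e.symm z))) := by
    filter_upwards [eventually_transition hy hy'] with z hz
    exact vecInChart_transition he hc ξ hz.1 hz.2
  have h2 := (hol_transition he hc hy hy').differentiableAt
  have hey : c (e.symm (e y)) = c y := by rw [e.left_inv hy]
  have h3 : DifferentiableAt ℂ (fun z => fderiv ℂ (fun w => e (c.symm w)) (c (e.symm z))) (e y) :=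
    DifferentiableAt.comp (f := fun z => c (e.symm z)) (e y)
      (by rw [hey]; exact (hol_transition hc he hy' hy).hol_fderiv.differentiableAt) h2
  have h4 : DifferentiableAt ℂ (fun z => vecInChart c ξ (c (e.symm z))) (e y) :=
    DifferentiableAt.comp (g := vecInChart c ξ) (f := fun z => c (e.symm z)) (e y)
      (by rwa [hey]) h2
  exact (h3.clm_apply h4).congr_of_eventuallyEq h1

/-- In the trivialization of the tangent bundle at `y`, the fibre coordinate of a vector is its
image under the differential of the preferred chart; a change of charts then leads to `e`. -/
lemma mdifferentiableAt_field_iff {e : OpenPartialHomeomorph Y (Cn m)}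
    (he : e ∈ IsManifold.maximalAtlas 𝓘(ℂ, Cn m) ω Y) {y : Y} (hy : y ∈ e.source) {ξ : Y → Cn m} :
    haveI : IsManifold 𝓘(ℂ, Cn m) 1 Y := IsManifold.of_le (n := ω) le_top
    MDifferentiableAt 𝓘(ℂ, Cn m) 𝓘(ℂ, Cn m).tangent
      (fun x => (⟨x, ξ x⟩ : TangentBundle 𝓘(ℂ, Cn m) Y)) y ↔
      DifferentiableAt ℂ (vecInChart e ξ) (e y) := by
  have : IsManifold 𝓘(ℂ, Cn m) 1 Y := IsManifold.of_le (n := ω) le_top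
  have h1 := mdifferentiableAt_section (IB := 𝓘(ℂ, Cn m)) (F := Cn m)
    (E := (TangentSpace 𝓘(ℂ, Cn m) : Y → Type)) ξ (b₀ := y)
  refine h1.trans ?_
  set c := chartAt (Cn m) y with hc
  have hcm : c ∈ IsManifold.maximalAtlas 𝓘(ℂ, Cn m) ω Y := chartAt_mem y
  have hyc : y ∈ c.source := mem_chart_source _ y
  have h2 : (fun b => (trivializationAt (Cn m) (TangentSpace 𝓘(ℂ, Cn m) : Y → Type) y
      (⟨b, ξ b⟩ : TangentBundle 𝓘(ℂ, Cn m) Y)).2) =ᶠ[𝓝 y]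
      fun b => chartDeriv c b (ξ b) := by
    filter_upwards [c.open_source.mem_nhds hyc] with b hb
    have h3 := DFunLike.congr_fun (TangentBundle.continuousLinearMapAt_trivializationAt
      (I := 𝓘(ℂ, Cn m)) (𝕜 := ℂ) (x₀ := y) (x := b) hb) (ξ b)
    exact (congrFun (Bundle.Trivialization.coe_linearMapAt_of_mem (R := ℂ)
      (trivializationAt (Cn m) (TangentSpace 𝓘(ℂ, Cn m) : Y → Type) y) (by simpa using hb))
      (ξ b)).symm.trans h3
  rw [h2.mdifferentiableAt_iff, mdifferentiableAt_iff_chart hcm hyc]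
  exact ⟨differentiableAt_vecInChart he hcm hy hyc, differentiableAt_vecInChart hcm he hyc hy⟩

lemma holField_iff {e : OpenPartialHomeomorph Y (Cn m)}
    (he : e ∈ IsManifold.maximalAtlas 𝓘(ℂ, Cn m) ω Y) {y : Y} (hy : y ∈ e.source)
    {ξ : Y → Cn m} : HolField ξ y ↔ Hol (vecInChart e ξ) (e y) := by
  rw [HolField, Hol, ← e.eventually_nhds' _ hy]
  refine eventually_congr ?_
  filter_upwards [e.open_target.mem_nhds (e.map_source hy)] with z hz
  rw [mdifferentiableAt_field_iff he (e.map_target hz), e.right_inv hz]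

end Charts

/-! ### Forms in logarithmic coordinates -/

section LogCoordinates

open Filter ContinuousAlternatingMap

/-- The map `A`, defined outside of the hyperplanes, extends holomorphically near `z₀`. -/
def LogHol {n : ℕ} {F : Type*} [NormedAddCommGroup F] [NormedSpace ℂ F] (S : Finset (Fin n))
    (A : Cn n → F) (z₀ : Cn n) : Prop :=
  ∃ h, Hol h z₀ ∧ ∀ᶠ z in 𝓝[Off S] z₀, A z = h z

section LogHol

variable {n : ℕ} {F G : Type*} [NormedAddCommGroup F] [NormedSpace ℂ F]
  [NormedAddCommGroup G] [NormedSpace ℂ G] {S : Finset (Fin n)} {A B : Cn n → F} {z₀ : Cn n}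

lemma Hol.logHol (H : Hol A z₀) : LogHol S A z₀ := ⟨A, H, Eventually.of_forall fun _ => rfl⟩

lemma LogHol.congr (H : LogHol S A z₀) (e : ∀ᶠ z in 𝓝[Off S] z₀, B z = A z) : LogHol S B z₀ := by
  obtain ⟨h, h1, h2⟩ := H
  exact ⟨h, h1, by filter_upwards [h2, e] with z a b using b.trans a⟩

lemma LogHol.add (H : LogHol S A z₀) (H' : LogHol S B z₀) : LogHol S (fun z => A z + B z) z₀ := by
  obtain ⟨h, h1, h2⟩ := H
  obtain ⟨h', h1', h2'⟩ := H'
  exact ⟨_, h1.add h1', by filter_upwards [h2, h2'] with z a b using by rw [a, b]⟩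

lemma LogHol.sub (H : LogHol S A z₀) (H' : LogHol S B z₀) : LogHol S (fun z => A z - B z) z₀ := by
  obtain ⟨h, h1, h2⟩ := H
  obtain ⟨h', h1', h2'⟩ := H'
  exact ⟨_, h1.sub h1', by filter_upwards [h2, h2'] with z a b using by rw [a, b]⟩

lemma LogHol.smul {c : Cn n → ℂ} (H : LogHol S c z₀) (H' : LogHol S A z₀) :
    LogHol S (fun z => c z • A z) z₀ := by
  obtain ⟨h, h1, h2⟩ := H
  obtain ⟨h', h1', h2'⟩ := H'
  exact ⟨_, h1.smul h1', by filter_upwards [h2, h2'] with z a b using by rw [a, b]⟩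

lemma LogHol.clm_apply {c : Cn n → F →L[ℂ] G} (H : LogHol S c z₀) (H' : LogHol S A z₀) :
    LogHol S (fun z => c z (A z)) z₀ := by
  obtain ⟨h, h1, h2⟩ := H
  obtain ⟨h', h1', h2'⟩ := H'
  exact ⟨_, h1.clm_apply h1', by filter_upwards [h2, h2'] with z a b using by rw [a, b]⟩

lemma LogHol.clm_comp (L : F →L[ℂ] G) (H : LogHol S A z₀) : LogHol S (fun z => L (A z)) z₀ :=
  (Hol.const L).logHol.clm_apply H

lemma LogHol.eventually (H : LogHol S A z₀) : ∀ᶠ z in 𝓝 z₀, LogHol S A z := by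
  obtain ⟨h, h1, h2⟩ := H
  filter_upwards [h1.eventually, eventually_nhdsWithin_Off h2] with z a b using ⟨h, a, b⟩

/-- Outside of the hyperplanes the map is holomorphic. -/
lemma LogHol.eventually_hol (H : LogHol S A z₀) : ∀ᶠ z in 𝓝[Off S] z₀, Hol A z := by
  obtain ⟨h, h1, h2⟩ := H
  filter_upwards [h1.eventually.filter_mono nhdsWithin_le_nhds, eventually_of_Off h2] with z a b
  exact a.congr b

end LogHol

/-! ### Germs of forms and the derivative in the log frame -/

section FormGerms

variable {n : ℕ} {E E' : Type*} [NormedAddCommGroup E] [NormedSpace ℂ E]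
  [NormedAddCommGroup E'] [NormedSpace ℂ E'] {k : ℕ} {S : Finset (Fin n)}

lemma Hol.compForm {X : Type*} [NormedAddCommGroup X] [NormedSpace ℂ X]
    {A : X → E [⋀^Fin k]→L[ℂ] ℂ} {L : X → E' →L[ℂ] E} {x : X}
    (hA : Hol A x) (hL : Hol L x) : Hol (fun z => (A z).compContinuousLinearMap (L z)) x := by
  filter_upwards [hA, hL] with z a b using a.continuousAlternatingMapCompContinuousLinearMap b

lemma Hol.wedge {X : Type*} [NormedAddCommGroup X] [NormedSpace ℂ X]
    {θ : X → E [⋀^Fin 1]→L[ℂ] ℂ} {a : X → E [⋀^Fin k]→L[ℂ] ℂ} {x : X}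
    (hθ : Hol θ x) (ha : Hol a x) : Hol (fun z => wedge (θ z) (a z)) x :=
  (hθ.clm_comp (wedgeL k)).clm_apply ha

lemma LogHol.wedge {θ : Cn n → E [⋀^Fin 1]→L[ℂ] ℂ} {a : Cn n → E [⋀^Fin k]→L[ℂ] ℂ} {x : Cn n}
    (hθ : LogHol S θ x) (ha : LogHol S a x) : LogHol S (fun z => wedge (θ z) (a z)) x :=
  (hθ.clm_comp (wedgeL k)).clm_apply ha

/-- Interior multiplication, as a continuous linear map. -/
def curryL (k : ℕ) (E : Type*) [NormedAddCommGroup E] [NormedSpace ℂ E] :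
    (E [⋀^Fin (k + 1)]→L[ℂ] ℂ) →L[ℂ] (E →L[ℂ] (E [⋀^Fin k]→L[ℂ] ℂ)) :=
  (curryLeftLI (𝕜 := ℂ) (E := E) (F := ℂ) (n := k)).toContinuousLinearMap

@[simp] lemma curryL_apply (A : E [⋀^Fin (k + 1)]→L[ℂ] ℂ) (v : E) :
    curryL k E A v = A.curryLeft v := rfl

lemma LogHol.curryLeft {A : Cn n → E [⋀^Fin (k + 1)]→L[ℂ] ℂ} {v : Cn n → E} {x : Cn n}
    (hA : LogHol S A x) (hv : LogHol S v x) : LogHol S (fun z => (A z).curryLeft (v z)) x :=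
  (hA.clm_comp (curryL k E)).clm_apply hv

lemma Hol.curryLeft {X : Type*} [NormedAddCommGroup X] [NormedSpace ℂ X]
    {A : X → E [⋀^Fin (k + 1)]→L[ℂ] ℂ} {v : X → E} {x : X}
    (hA : Hol A x) (hv : Hol v x) : Hol (fun z => (A z).curryLeft (v z)) x :=
  (Hol.clm_comp (G := E →L[ℂ] E [⋀^Fin k]→L[ℂ] ℂ) (curryL k E) hA).clm_apply hv

/-- The exterior derivative in the log frame. -/
def logD (S : Finset (Fin n)) (A : Cn n → (Cn n) [⋀^Fin k]→L[ℂ] ℂ) (z : Cn n) :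
    (Cn n) [⋀^Fin (k + 1)]→L[ℂ] ℂ :=
  alternatizeUncurryFin ((fderiv ℂ A z).comp (logFrame S z))

/-- The exterior derivative of extended forms in the log frame. -/
def extLogD (S : Finset (Fin n)) (A : Cn n → (Cn n × ℂ) [⋀^Fin k]→L[ℂ] ℂ) (z : Cn n) :
    (Cn n × ℂ) [⋀^Fin (k + 1)]→L[ℂ] ℂ :=
  alternatizeUncurryFin ((fderiv ℂ A z).comp
    ((logFrame S z).comp (ContinuousLinearMap.fst ℂ (Cn n) ℂ)))

lemma Hol.logD {A : Cn n → (Cn n) [⋀^Fin k]→L[ℂ] ℂ} {z : Cn n} (H : Hol A z) :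
    Hol (logD S A) z :=
  (H.hol_fderiv.clm_comp₂ (hol_logFrame S z)).clm_comp (alternatizeUncurryFinCLM ℂ (Cn n) ℂ)

lemma Hol.extLogD {A : Cn n → (Cn n × ℂ) [⋀^Fin k]→L[ℂ] ℂ} {z : Cn n} (H : Hol A z) :
    Hol (extLogD S A) z := by
  have h1 : Hol (fun w => (logFrame S w).comp (ContinuousLinearMap.fst ℂ (Cn n) ℂ)) z := by
    filter_upwards [hol_logFrame S z] with w hw using hw.clm_comp (differentiableAt_const _)
  filter_upwards [H.hol_fderiv, h1] with w hw hw'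
  exact (alternatizeUncurryFinCLM ℂ (Cn n × ℂ) ℂ).differentiableAt.comp w (hw.clm_comp hw')

lemma logD_congr {A B : Cn n → (Cn n) [⋀^Fin k]→L[ℂ] ℂ} {z : Cn n} (h : A =ᶠ[𝓝 z] B) :
    logD S A z = logD S B z := by
  rw [logD, logD, h.fderiv_eq]

lemma extLogD_congr {A B : Cn n → (Cn n × ℂ) [⋀^Fin k]→L[ℂ] ℂ} {z : Cn n} (h : A =ᶠ[𝓝 z] B) :
    extLogD S A z = extLogD S B z := by
  rw [extLogD, extLogD, h.fderiv_eq]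

lemma hol_logFrameInv {z : Cn n} (hz : z ∈ Off S) : Hol (logFrameInv S) z := by
  have e : logFrameInv S = fun w => ∑ i, ((if i ∈ S then (w i)⁻¹ else 1) : ℂ) •
      (ContinuousLinearMap.proj i : Cn n →L[ℂ] ℂ).smulRight (Pi.single i (1 : ℂ)) := by
    funext w
    ext v j
    rw [logFrameInv_apply, _root_.sum_apply, Finset.sum_apply, Finset.sum_eq_single j]
    · rw [_root_.smul_apply]
      simp
    · intro i _ hi
      rw [_root_.smul_apply]
      simp [hi.symm]
    · simp
  rw [e]
  refine Hol.sum fun i _ => Hol.smul ?_ (Hol.const _)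
  by_cases hi : i ∈ S
  · simpa [hi] using (hol_proj i z).inv (hz i hi)
  · simpa [hi] using Hol.const (1 : ℂ)

end FormGerms

variable {m : ℕ} {Y : Type} [TopologicalSpace Y] [ChartedSpace (Cn m) Y]
  [IsManifold 𝓘(ℂ, Cn m) ω Y] {D : Set Y} {e e' : OpenPartialHomeomorph Y (Cn m)}
  {S S' : Finset (Fin m)} {y : Y} {k : ℕ}

/-- A form in the log coframe of a chart. -/
def logCoord (e : OpenPartialHomeomorph Y (Cn m)) (S : Finset (Fin m)) (α : Form m k Y)
    (z : Cn m) : (Cn m) [⋀^Fin k]→L[ℂ] ℂ :=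
  (inChart e α z).compContinuousLinearMap (logFrame S z)

/-- An extended form in the log coframe of a chart. -/
def extCoord (e : OpenPartialHomeomorph Y (Cn m)) (S : Finset (Fin m)) (c : ExtForm m k Y)
    (z : Cn m) : (Cn m × ℂ) [⋀^Fin k]→L[ℂ] ℂ :=
  (extInChart e c z).compContinuousLinearMap
    ((logFrame S z).prodMap (ContinuousLinearMap.id ℂ ℂ))

/-- The form with given log coordinates. -/
def formOf (e : OpenPartialHomeomorph Y (Cn m)) (S : Finset (Fin m))
    (A : Cn m → (Cn m) [⋀^Fin k]→L[ℂ] ℂ) : Form m k Y := fun y =>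
  (A (e y)).compContinuousLinearMap ((logFrameInv S (e y)).comp (chartDeriv e y))

/-- The extended form with given log coordinates. -/
def extFormOf (e : OpenPartialHomeomorph Y (Cn m)) (S : Finset (Fin m))
    (A : Cn m → (Cn m × ℂ) [⋀^Fin k]→L[ℂ] ℂ) : ExtForm m k Y := fun y =>
  (A (e y)).compContinuousLinearMap
    (((logFrameInv S (e y)).comp (chartDeriv e y)).prodMap (ContinuousLinearMap.id ℂ ℂ))

/-- The vector field with given log coordinates. -/
def fieldOf (e : OpenPartialHomeomorph Y (Cn m)) (S : Finset (Fin m)) (w : Cn m → Cn m) :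
    Y → Cn m := fun y => chartInvDeriv e (e y) (logFrame S (e y) (w (e y)))

lemma Adapted.nhds (h : Adapted D e S y) : ∀ᶠ z in 𝓝 (e y), z ∈ e.target ∧
    (e.symm z ∉ D ↔ z ∈ Off S) := by
  filter_upwards [e.open_target.mem_nhds (e.map_source h.2.1)] with z hz
  refine ⟨hz, ?_⟩
  rw [h.2.2 _ (e.map_target hz), e.right_inv hz]
  simp [Off]

lemma Adapted.of_mem (h : Adapted D e S y) {y' : Y} (hy' : y' ∈ e.source) : Adapted D e S y' :=
  ⟨h.1, hy', h.2.2⟩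

/-- Properties of points outside of `D` in terms of an adapted chart. -/
lemma Adapted.eventually_iff (h : Adapted D e S y) {P : Y → Prop} :
    (∀ᶠ x in 𝓝[Dᶜ] y, P x) ↔ ∀ᶠ z in 𝓝[Off S] (e y), P (e.symm z) := by
  rw [eventually_nhdsWithin_iff, eventually_nhdsWithin_iff, ← e.eventually_nhds' _ h.2.1]
  refine eventually_congr ?_
  filter_upwards [h.nhds] with z hz
  rw [Set.mem_compl_iff, hz.2]

lemma logCoord_formOf (he : e ∈ IsManifold.maximalAtlas 𝓘(ℂ, Cn m) ω Y)
    (A : Cn m → (Cn m) [⋀^Fin k]→L[ℂ] ℂ) {z : Cn m} (hz : z ∈ e.target) (hS : z ∈ Off S) :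
    logCoord e S (formOf e S A) z = A z := by
  ext v
  simp only [logCoord, inChart, formOf, compContinuousLinearMap_apply, e.right_inv hz,
    Function.comp_def, ContinuousLinearMap.comp_apply, chartDeriv_chartInvDeriv he hz,
    logFrameInv_logFrame hS]

lemma extCoord_extFormOf (he : e ∈ IsManifold.maximalAtlas 𝓘(ℂ, Cn m) ω Y)
    (A : Cn m → (Cn m × ℂ) [⋀^Fin k]→L[ℂ] ℂ) {z : Cn m} (hz : z ∈ e.target) (hS : z ∈ Off S) :
    extCoord e S (extFormOf e S A) z = A z := by
  ext v
  simp only [extCoord, extInChart, extFormOf, compContinuousLinearMap_apply, e.right_inv hz,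
    Function.comp_def, ContinuousLinearMap.coe_prodMap', Prod.map,
    ContinuousLinearMap.comp_apply, chartDeriv_chartInvDeriv he hz, logFrameInv_logFrame hS,
    ContinuousLinearMap.id_apply]

lemma vecInChart_fieldOf (he : e ∈ IsManifold.maximalAtlas 𝓘(ℂ, Cn m) ω Y) (w : Cn m → Cn m)
    {z : Cn m} (hz : z ∈ e.target) : vecInChart e (fieldOf e S w) z = logFrame S z (w z) := by
  rw [vecInChart, fieldOf, e.right_inv hz, chartDeriv_chartInvDeriv he hz]

/-- A vector field in log coordinates. -/
def logVec (e : OpenPartialHomeomorph Y (Cn m)) (S : Finset (Fin m)) (ξ : Y → Cn m) (z : Cn m) :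
    Cn m := logFrameInv S z (vecInChart e ξ z)

lemma logVec_fieldOf (he : e ∈ IsManifold.maximalAtlas 𝓘(ℂ, Cn m) ω Y) (w : Cn m → Cn m)
    {z : Cn m} (hz : z ∈ e.target) (hS : z ∈ Off S) : logVec e S (fieldOf e S w) z = w z := by
  rw [logVec, vecInChart_fieldOf he w hz, logFrameInv_logFrame hS]

lemma logCoord_add (α β : Form m k Y) (z : Cn m) :
    logCoord e S (α + β) z = logCoord e S α z + logCoord e S β z := rfl
lemma logCoord_sub (α β : Form m k Y) (z : Cn m) :
    logCoord e S (α - β) z = logCoord e S α z - logCoord e S β z := rfl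
lemma logCoord_smul (c : ℂ) (α : Form m k Y) (z : Cn m) :
    logCoord e S (c • α) z = c • logCoord e S α z := rfl
lemma logCoord_fun_smul (g : Y → ℂ) (α : Form m k Y) (z : Cn m) :
    logCoord e S (fun x => g x • α x) z = g (e.symm z) • logCoord e S α z := rfl
lemma extCoord_add (α β : ExtForm m k Y) (z : Cn m) :
    extCoord e S (α + β) z = extCoord e S α z + extCoord e S β z := rfl
lemma extCoord_sub (α β : ExtForm m k Y) (z : Cn m) :
    extCoord e S (α - β) z = extCoord e S α z - extCoord e S β z := rfl
lemma extCoord_smul (c : ℂ) (α : ExtForm m k Y) (z : Cn m) :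
    extCoord e S (c • α) z = c • extCoord e S α z := rfl
lemma extCoord_fun_smul (g : Y → ℂ) (α : ExtForm m k Y) (z : Cn m) :
    extCoord e S (fun x => g x • α x) z = g (e.symm z) • extCoord e S α z := rfl

lemma logCoord_wedge (θ : Form m 1 Y) (α : Form m k Y) (z : Cn m) :
    logCoord e S (fun x => wedge (θ x) (α x)) z = wedge (logCoord e S θ z) (logCoord e S α z) := by
  simp only [logCoord, inChart, wedge_comp]

lemma extCoord_wedge (θ : ExtForm m 1 Y) (α : ExtForm m k Y) (z : Cn m) :
    extCoord e S (fun x => wedge (θ x) (α x)) z = wedge (extCoord e S θ z) (extCoord e S α z) := by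
  simp only [extCoord, extInChart, wedge_comp]

lemma extCoord_toExt (α : Form m k Y) (z : Cn m) :
    extCoord e S (toExt α) z =
      (logCoord e S α z).compContinuousLinearMap (ContinuousLinearMap.fst ℂ (Cn m) ℂ) := rfl

lemma logCoord_contract (he : e ∈ IsManifold.maximalAtlas 𝓘(ℂ, Cn m) ω Y)
    (α : Form m (k + 1) Y) (ξ : Y → Cn m) {z : Cn m} (hz : z ∈ e.target) (hS : z ∈ Off S) :
    logCoord e S (fun x => (α x).curryLeft (ξ x)) z =
      (logCoord e S α z).curryLeft (logVec e S ξ z) := by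
  have h : chartInvDeriv e z (vecInChart e ξ z) = ξ (e.symm z) := by
    have := chartInvDeriv_chartDeriv he (e.map_target hz) (ξ (e.symm z))
    rwa [e.right_inv hz] at this
  simp only [logCoord, inChart]
  rw [curryLeft_compContinuousLinearMap, curryLeft_compContinuousLinearMap, logVec,
    logFrame_logFrameInv hS, h]

lemma logCoord_interior (he : e ∈ IsManifold.maximalAtlas 𝓘(ℂ, Cn m) ω Y)
    (Φ : Form m 2 Y) (ξ : Y → Cn m) {z : Cn m} (hz : z ∈ e.target) (hS : z ∈ Off S) :
    logCoord e S (interior Φ ξ) z = (logCoord e S Φ z).curryLeft (logVec e S ξ z) :=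
  logCoord_contract he Φ ξ hz hS

/-- The exterior derivative in log coordinates. -/
lemma logCoord_dForm (he : e ∈ IsManifold.maximalAtlas 𝓘(ℂ, Cn m) ω Y) {α : Form m k Y}
    {z : Cn m} (hz : z ∈ e.target) (hS : z ∈ Off S)
    (h : DifferentiableAt ℂ (logCoord e S α) z) :
    DifferentiableAt ℂ (inChart e α) z ∧ logCoord e S (dForm α) z = logD S (logCoord e S α) z := by
  -- Off the hyperplanes the log frame is invertible, with holomorphic inverse, so differentiability
  -- passes from the log coefficients to the ordinary ones.
  have h1 : inChart e α =ᶠ[𝓝 z]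
      fun w => (logCoord e S α w).compContinuousLinearMap (logFrameInv S w) := by
    filter_upwards [(isOpen_Off S).mem_nhds hS] with w hw
    ext v
    simp [logCoord, Function.comp_def, logFrame_logFrameInv hw]
  have h2 : DifferentiableAt ℂ (inChart e α) z :=
    (h.continuousAlternatingMapCompContinuousLinearMap
      (hol_logFrameInv hS).differentiableAt).congr_of_eventuallyEq h1
  refine ⟨h2, ?_⟩
  rw [logCoord, inChart_dForm he hz h2,
    extDeriv_comp_frame h2 (hasFDerivAt_logFrame S z) (logFrameLin_comm S z)]
  rfl

lemma inChart_dForm_dForm (he : e ∈ IsManifold.maximalAtlas 𝓘(ℂ, Cn m) ω Y) {α : Form m k Y}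
    {z : Cn m} (hz : z ∈ e.target) (h : Hol (inChart e α) z) :
    inChart e (dForm (dForm α)) z = 0 := by
  have h1 : inChart e (dForm α) =ᶠ[𝓝 z] extDeriv (inChart e α) := by
    filter_upwards [e.open_target.mem_nhds hz, h] with w hw hw'
    exact inChart_dForm he hw hw'
  have h2 : Hol (extDeriv (inChart e α)) z := h.hol_fderiv.clm_comp
    (alternatizeUncurryFinCLM ℂ (Cn m) ℂ)
  rw [inChart_dForm he hz (h2.congr h1).differentiableAt, h1.extDeriv_eq]
  exact extDeriv_extDeriv_apply (r := (2 : ℕ)) (h.contDiffAt_nat 2) (by simp)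

end LogCoordinates

/-! ### Change of adapted charts -/

section Transition

open Filter ContinuousAlternatingMap

variable {m : ℕ} {Y : Type} [TopologicalSpace Y] [ChartedSpace (Cn m) Y]
  [IsManifold 𝓘(ℂ, Cn m) ω Y] {D : Set Y} {e e' : OpenPartialHomeomorph Y (Cn m)}
  {S S' : Finset (Fin m)} {y : Y} {k : ℕ}

/-- The change of coordinates. -/
def transition (e e' : OpenPartialHomeomorph Y (Cn m)) (z : Cn m) : Cn m := e' (e.symm z)

lemma Adapted.hol_transition (h : Adapted D e S y) (h' : Adapted D e' S' y) :
    Hol (transition e e') (e y) :=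
  LogSymp.hol_transition h.1 h'.1 h.2.1 h'.2.1

lemma Adapted.transition_self (h : Adapted D e S y) : transition e e' (e y) = e' y := by
  rw [transition, e.left_inv h.2.1]

lemma Adapted.tendsto_transition (h : Adapted D e S y) (h' : Adapted D e' S' y) :
    Tendsto (transition e e') (𝓝 (e y)) (𝓝 (e' y)) :=
  LogSymp.tendsto_transition h.2.1 h'.2.1

lemma Adapted.eventually_transition (h : Adapted D e S y) (h' : Adapted D e' S' y) :
    ∀ᶠ z in 𝓝 (e y), z ∈ e.target ∧ e.symm z ∈ e'.source ∧ transition e e' z ∈ e'.target ∧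
      transition e' e (transition e e' z) = z ∧ (z ∈ Off S ↔ transition e e' z ∈ Off S') ∧
      e'.symm (transition e e' z) = e.symm z := by
  filter_upwards [LogSymp.eventually_transition h.2.1 h'.2.1, h.nhds,
    (h.tendsto_transition h').eventually h'.nhds] with z h1 h2 h3
  have h4 : e'.symm (transition e e' z) = e.symm z := e'.left_inv h1.2
  refine ⟨h1.1, h1.2, h3.1, ?_, ?_, h4⟩
  · rw [transition, h4, e.right_inv h1.1]
  · rw [← h2.2, ← h3.2, h4]

lemma Adapted.tendsto_transition_Off (h : Adapted D e S y) (h' : Adapted D e' S' y) :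
    Tendsto (transition e e') (𝓝[Off S] (e y)) (𝓝[Off S'] (e' y)) := by
  refine tendsto_nhdsWithin_iff.2
    ⟨(h.tendsto_transition h').mono_left nhdsWithin_le_nhds, ?_⟩
  filter_upwards [(h.eventually_transition h').filter_mono nhdsWithin_le_nhds,
    self_mem_nhdsWithin] with z h1 h2
  exact h1.2.2.2.2.1.1 h2

lemma LogHol.comp_transition {F : Type*} [NormedAddCommGroup F] [NormedSpace ℂ F]
    {A : Cn m → F} (h : Adapted D e S y) (h' : Adapted D e' S' y) (H : LogHol S' A (e' y)) :
    LogHol S (fun z => A (transition e e' z)) (e y) := by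
  obtain ⟨B, h1, h2⟩ := H
  refine ⟨fun z => B (transition e e' z), Hol.comp ?_ (h.hol_transition h'),
    (h.tendsto_transition_Off h').eventually h2⟩
  rwa [h.transition_self]

/-- The components of the change of log frames. -/
lemma Adapted.exists_transition_row (h : Adapted D e S y) (h' : Adapted D e' S' y) (j : Fin m) :
    ∃ M : Cn m → Cn m →L[ℂ] ℂ, Hol M (e y) ∧ ∀ᶠ z in 𝓝 (e y),
      (if j ∈ S' then transition e e' z j else 1) • M z =
        (ContinuousLinearMap.proj j : Cn m →L[ℂ] ℂ).comp
          ((fderiv ℂ (transition e e') z).comp (logFrame S z)) := by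
  set φ := transition e e' with hφ
  set G : Cn m → Cn m →L[ℂ] ℂ := fun z => (ContinuousLinearMap.proj j : Cn m →L[ℂ] ℂ).comp
    ((fderiv ℂ φ z).comp (logFrame S z)) with hG
  have G_hol : Hol G (e y) := by
    have h1 : Hol (fun z => (fderiv ℂ φ z).comp (logFrame S z)) (e y) :=
      (h.hol_transition h').hol_fderiv.clm_comp₂ (hol_logFrame S _)
    filter_upwards [h1] with z hz using (differentiableAt_const _).clm_comp hz
  by_cases hj : j ∈ S'
  swap
  · exact ⟨G, G_hol, Eventually.of_forall fun z => by rw [if_neg hj, one_smul]⟩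
  simp only [if_pos hj]
  set ψ := transition e' e with hψ
  -- Read in the target chart, where the coordinate to divide by is a coordinate function. Division
  -- requires `K` to vanish on `w j = 0`, and this is checked only where no other coordinate of `S'`
  -- vanishes.
  have K_hol : Hol (fun w => G (ψ w)) (e' y) :=
    Hol.comp (by rwa [hψ, h'.transition_self]) (h'.hol_transition h)
  obtain ⟨M, M_hol, hM⟩ := K_hol.exists_eq_smul (i := j) (by
    refine K_hol.eq_of_eq_hyperplane (S := S') (Hol.const _) ?_
    filter_upwards [h'.eventually_transition h, (h'.tendsto_transition h).eventually
      ((h.eventually_transition h').and (h.hol_transition h'))] with w hw hz hwj hwS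
    set z := ψ w
    have hzw : φ z = w := hw.2.2.2.1
    have hwS' : w ∉ Off S' := fun hh => hh j hj hwj
    have : z ∉ Off S := fun hh => hwS' (hw.2.2.2.2.1.2 hh)
    simp only [Off, Set.mem_ofPred_eq, not_forall, not_not] at this
    obtain ⟨i, hi, hzi⟩ := this
    ext v
    -- A log vector at a point of `z i = 0` is tangent to that hyperplane. The line in its direction
    -- stays in `D`, so its image stays in `D`; near `w` the only hyperplane of `S'` it can lie in
    -- is the `j`-th, so the `j`-th coordinate vanishes along the line and so does its derivative.
    have hline : HasDerivAt (fun t : ℂ => z + t • logFrame S z v) (logFrame S z v) 0 := by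
      simpa using ((hasDerivAt_id (0 : ℂ)).smul_const (logFrame S z v)).const_add z
    have hc : Tendsto (fun t : ℂ => z + t • logFrame S z v) (𝓝 0) (𝓝 z) := by
      simpa using hline.continuousAt.tendsto
    have hφz : HasFDerivAt φ (fderiv ℂ φ z) (z + (0 : ℂ) • logFrame S z v) := by
      simpa using hz.2.hasFDerivAt
    have hd : HasDerivAt (fun t : ℂ => φ (z + t • logFrame S z v) j)
        (fderiv ℂ φ z (logFrame S z v) j) 0 :=
      (hasDerivAt_pi.1 (hφz.comp_hasDerivAt (0 : ℂ) hline)) j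
    have hz0 : (fun t : ℂ => φ (z + t • logFrame S z v) j) =ᶠ[𝓝 0] fun _ => 0 := by
      have hcφ : Tendsto (fun t : ℂ => φ (z + t • logFrame S z v)) (𝓝 0) (𝓝 w) := by
        have : ContinuousAt φ z := hz.2.continuousAt
        have := this.tendsto.comp hc
        rwa [hzw] at this
      have hev : ∀ᶠ x in 𝓝 z, x ∈ e.target ∧ e.symm x ∈ e'.source := by
        have hc' := e.continuousAt_symm hz.1.1
        filter_upwards [e.open_target.mem_nhds hz.1.1,
          hc'.preimage_mem_nhds (e'.open_source.mem_nhds hz.1.2.1)] with x h1 h2 using ⟨h1, h2⟩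
      filter_upwards [hc.eventually hev, hcφ.eventually
        ((isOpen_Off (S'.erase j)).mem_nhds hwS)] with t ht ht'
      have h1 : e.symm (z + t • logFrame S z v) ∈ D := by
        rw [h.2.2 _ (e.map_target ht.1), e.right_inv ht.1]
        exact ⟨i, hi, by simp [logFrame_apply, hi, hzi]⟩
      rw [h'.2.2 _ ht.2] at h1
      obtain ⟨j', hj', h2⟩ := h1
      by_cases hjj : j' = j
      · rwa [hjj] at h2
      · exact absurd h2 (ht' j' (Finset.mem_erase.2 ⟨hjj, hj'⟩))
    have := (hd.congr_of_eventuallyEq hz0.symm).unique (hasDerivAt_const (0 : ℂ) (0 : ℂ))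
    simpa [hG] using this)
  refine ⟨fun z => M (φ z), Hol.comp (by rwa [hφ, h.transition_self]) (h.hol_transition h'), ?_⟩
  filter_upwards [h.eventually_transition h', (h.tendsto_transition h').eventually hM] with z h1 h2
  rw [← h2, hψ, hφ, h1.2.2.2.1]

/-- The change of log frames is holomorphic. -/
theorem Adapted.exists_logTransition (h : Adapted D e S y) (h' : Adapted D e' S' y) :
    ∃ M : Cn m → Cn m →L[ℂ] Cn m, Hol M (e y) ∧ ∀ᶠ z in 𝓝 (e y), ∀ v,
      logFrame S' (transition e e' z) (M z v) =
        fderiv ℂ (transition e e') z (logFrame S z v) := by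
  choose M hM hM' using fun j => h.exists_transition_row h' j
  refine ⟨fun z => ∑ j, (ContinuousLinearMap.smulRightL ℂ (Cn m) (Cn m)).flip (Pi.single j 1)
    (M j z), Hol.sum fun j _ => (hM j).clm_comp _, ?_⟩
  filter_upwards [eventually_all.2 hM'] with z hz v
  ext j
  have := congrArg (fun L : Cn m →L[ℂ] ℂ => L v) (hz j)
  simp only [_root_.smul_apply, smul_eq_mul, ContinuousLinearMap.comp_apply,
    ContinuousLinearMap.proj_apply] at this
  rw [logFrame_apply, ← this]
  congr 1
  simp [_root_.sum_apply, Pi.single_apply]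

end Transition

/-! ### Transformation of forms under change of adapted charts -/

section TransitionForms

open Filter ContinuousAlternatingMap

variable {m : ℕ} {Y : Type} [TopologicalSpace Y] [ChartedSpace (Cn m) Y]
  [IsManifold 𝓘(ℂ, Cn m) ω Y] {D : Set Y} {e e' : OpenPartialHomeomorph Y (Cn m)}
  {S S' : Finset (Fin m)} {y : Y} {k : ℕ}

/-- `M` is the change of log frames between two adapted charts, near `z`. -/
def IsLogTransition (e : OpenPartialHomeomorph Y (Cn m)) (S : Finset (Fin m))
    (e' : OpenPartialHomeomorph Y (Cn m)) (S' : Finset (Fin m)) (M : Cn m → Cn m →L[ℂ] Cn m)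
    (z₀ : Cn m) : Prop :=
  Hol M z₀ ∧ ∀ᶠ z in 𝓝 z₀, ∀ v, logFrame S' (transition e e' z) (M z v) =
    fderiv ℂ (transition e e') z (logFrame S z v)

lemma Adapted.fderiv_transition (h : Adapted D e S y) (h' : Adapted D e' S' y) :
    ∀ᶠ z in 𝓝 (e y), fderiv ℂ (transition e e') z =
      (chartDeriv e' (e.symm z)).comp (chartInvDeriv e z) := by
  filter_upwards [h.eventually_transition h'] with z hz
  exact (hasFDerivAt_transition h.1 h'.1 hz.1 hz.2.1).fderiv

lemma Adapted.logCoord_transition (h : Adapted D e S y) (h' : Adapted D e' S' y)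
    {M : Cn m → Cn m →L[ℂ] Cn m} (hM : IsLogTransition e S e' S' M (e y)) :
    ∀ᶠ z in 𝓝 (e y), ∀ (k : ℕ) (α : Form m k Y), logCoord e S α z =
      (logCoord e' S' α (transition e e' z)).compContinuousLinearMap (M z) := by
  filter_upwards [h.eventually_transition h', h.fderiv_transition h', hM.2] with z h1 h2 h3 k α
  rw [logCoord, inChart_transition h'.1 α h1.2.1, ← h2]
  ext v
  simp only [logCoord, compContinuousLinearMap_apply]
  exact congrArg _ (funext fun i => (h3 (v i)).symm)

lemma Adapted.extCoord_transition (h : Adapted D e S y) (h' : Adapted D e' S' y)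
    {M : Cn m → Cn m →L[ℂ] Cn m} (hM : IsLogTransition e S e' S' M (e y)) :
    ∀ᶠ z in 𝓝 (e y), ∀ (k : ℕ) (c : ExtForm m k Y), extCoord e S c z =
      (extCoord e' S' c (transition e e' z)).compContinuousLinearMap
        ((M z).prodMap (ContinuousLinearMap.id ℂ ℂ)) := by
  filter_upwards [h.eventually_transition h', h.fderiv_transition h', hM.2] with z h1 h2 h3 k c
  ext v
  simp only [extCoord, extInChart, compContinuousLinearMap_apply, h1.2.2.2.2.2]
  refine congrArg _ (funext fun i => Prod.ext ?_ rfl)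
  change chartInvDeriv e z (logFrame S z (v i).1) =
    chartInvDeriv e' (transition e e' z) (logFrame S' (transition e e' z) (M z (v i).1))
  rw [h3, h2, ContinuousLinearMap.comp_apply]
  have := chartInvDeriv_chartDeriv h'.1 h1.2.1 (chartInvDeriv e z (logFrame S z (v i).1))
  exact this.symm

lemma Adapted.logVec_transition (h : Adapted D e S y) (h' : Adapted D e' S' y)
    {M : Cn m → Cn m →L[ℂ] Cn m} (hM : IsLogTransition e S e' S' M (e y)) :
    ∀ᶠ z in 𝓝[Off S] (e y), ∀ ξ : Y → Cn m,
      M z (logVec e S ξ z) = logVec e' S' ξ (transition e e' z) := by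
  filter_upwards [(h.eventually_transition h').filter_mono nhdsWithin_le_nhds,
    (h.fderiv_transition h').filter_mono nhdsWithin_le_nhds, hM.2.filter_mono nhdsWithin_le_nhds,
    self_mem_nhdsWithin] with z h1 h2 h3 hz ξ
  have hz' := h1.2.2.2.2.1.1 hz
  rw [← logFrameInv_logFrame hz' (M z _), h3, logVec, logFrame_logFrameInv hz, h2, logVec,
    vecInChart, vecInChart, h1.2.2.2.2.2, ContinuousLinearMap.comp_apply]
  have := chartInvDeriv_chartDeriv h.1 (e.map_target h1.1) (ξ (e.symm z))
  rw [e.right_inv h1.1] at this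
  rw [this]

lemma logCoeff_iff (h : Adapted D e S y) {α : Form m k Y}
    {A : Cn m → (Cn m) [⋀^Fin k]→L[ℂ] ℂ} : LogCoeff D e S α y A ↔
      Hol A (e y) ∧ ∀ᶠ z in 𝓝[Off S] (e y), logCoord e S α z = A z := by
  refine and_congr Iff.rfl ?_
  rw [eventually_nhdsWithin_iff]
  refine eventually_congr ?_
  filter_upwards [h.nhds] with z hz
  rw [hz.2]
  rfl

lemma LogHol.compForm {E E' : Type*} [NormedAddCommGroup E] [NormedSpace ℂ E]
    [NormedAddCommGroup E'] [NormedSpace ℂ E'] {A : Cn m → E [⋀^Fin k]→L[ℂ] ℂ}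
    {L : Cn m → E' →L[ℂ] E} {x : Cn m} (hA : LogHol S A x) (hL : LogHol S L x) :
    LogHol S (fun z => (A z).compContinuousLinearMap (L z)) x := by
  obtain ⟨a, h1, h2⟩ := hA
  obtain ⟨b, h3, h4⟩ := hL
  exact ⟨_, h1.compForm h3, by filter_upwards [h2, h4] with z e1 e2 using by rw [e1, e2]⟩

/-- Log forms are recognized in one adapted chart. -/
theorem mem_logForms_iff (h : Adapted D e S y) {α : Form m k Y} :
    α ∈ logForms D k y ↔ LogHol S (logCoord e S α) (e y) := by
  constructor
  · intro hα
    obtain ⟨A, hA⟩ := hα e S h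
    exact ⟨A, (logCoeff_iff h).1 hA⟩
  · intro H e' S' h'
    obtain ⟨M, hM⟩ := h'.exists_logTransition h
    obtain ⟨A, hA⟩ : LogHol S' (logCoord e' S' α) (e' y) :=
      ((H.comp_transition h' h).compForm hM.1.logHol).congr (by
        filter_upwards [(h'.logCoord_transition h hM).filter_mono nhdsWithin_le_nhds] with z hz
        exact hz k α)
    exact ⟨A, (logCoeff_iff h').2 hA⟩

/-- Extended log forms are recognized in one adapted chart. -/
theorem mem_extLogForms_iff (h : Adapted D e S y) {c : ExtForm m k Y} :
    c ∈ extLogForms D k y ↔ LogHol S (extCoord e S c) (e y) := by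
  have key : ∀ {e' S'}, Adapted D e' S' y → ∀ A : Cn m → (Cn m × ℂ) [⋀^Fin k]→L[ℂ] ℂ,
      (∀ᶠ z in 𝓝 (e' y), e'.symm z ∉ D → (extInChart e' c z).compContinuousLinearMap
        ((logFrame S' z).prodMap (ContinuousLinearMap.id ℂ ℂ)) = A z) ↔
      ∀ᶠ z in 𝓝[Off S'] (e' y), extCoord e' S' c z = A z := by
    intro e' S' h' A
    rw [eventually_nhdsWithin_iff]
    refine eventually_congr ?_
    filter_upwards [h'.nhds] with z hz
    rw [hz.2]
    rfl
  constructor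
  · intro hc
    obtain ⟨A, h1, h2⟩ := hc e S h
    exact ⟨A, h1, (key h A).1 h2⟩
  · intro H e' S' h'
    obtain ⟨M, hM⟩ := h'.exists_logTransition h
    have hM' : Hol (fun z => (M z).prodMap (ContinuousLinearMap.id ℂ ℂ)) (e' y) := by
      have h1 : Hol (fun z => (M z, ContinuousLinearMap.id ℂ ℂ)) (e' y) := by
        filter_upwards [hM.1] with z hz using hz.prodMk (differentiableAt_const _)
      exact h1.clm_comp (ContinuousLinearMap.prodMapL ℂ (Cn m) (Cn m) ℂ ℂ)
    obtain ⟨A, h1, h2⟩ : LogHol S' (extCoord e' S' c) (e' y) :=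
      ((H.comp_transition h' h).compForm hM'.logHol).congr (by
        filter_upwards [(h'.extCoord_transition h hM).filter_mono nhdsWithin_le_nhds] with z hz
        exact hz k c)
    exact ⟨A, h1, (key h' A).2 h2⟩

/-- Being a log form at a point is an open condition on the point. -/
lemma eventually_mem_logForms (h : Adapted D e S y) {α : Form m k Y} (hα : α ∈ logForms D k y) :
    ∀ᶠ x in 𝓝 y, α ∈ logForms D k x := by
  rw [mem_logForms_iff h] at hα
  filter_upwards [(e.continuousAt h.2.1).eventually hα.eventually, e.open_source.mem_nhds h.2.1]
    with x h1 h2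
  exact (mem_logForms_iff (h.of_mem h2)).2 h1

/-- The exterior derivative in log coordinates, generically. -/
lemma Adapted.logCoord_dForm (h : Adapted D e S y) {α : Form m k Y}
    (hα : ∀ᶠ z in 𝓝[Off S] (e y), Hol (logCoord e S α) z) :
    ∀ᶠ z in 𝓝[Off S] (e y), logCoord e S (dForm α) z = logD S (logCoord e S α) z := by
  filter_upwards [hα, h.nhds.filter_mono nhdsWithin_le_nhds, self_mem_nhdsWithin] with z h1 h2 h3
  exact (LogSymp.logCoord_dForm h.1 h2.1 h3 h1.differentiableAt).2

lemma LogHol.logD {A : Cn m → (Cn m) [⋀^Fin k]→L[ℂ] ℂ} {z₀ : Cn m} (H : LogHol S A z₀) :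
    LogHol S (logD S A) z₀ := by
  obtain ⟨B, h1, h2⟩ := H
  exact ⟨_, h1.logD, by filter_upwards [eventually_of_Off h2] with z hz using logD_congr hz⟩

end TransitionForms

/-! ### The exterior derivative of extended forms -/

section ExtendedDerivative

open Filter ContinuousAlternatingMap

variable {m : ℕ} {Y : Type} [TopologicalSpace Y] [ChartedSpace (Cn m) Y]
  [IsManifold 𝓘(ℂ, Cn m) ω Y] {D : Set Y} {e e' : OpenPartialHomeomorph Y (Cn m)}
  {S S' : Finset (Fin m)} {y : Y} {k : ℕ}

lemma extInChart_transition (he' : e' ∈ IsManifold.maximalAtlas 𝓘(ℂ, Cn m) ω Y)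
    (c : ExtForm m k Y) {z : Cn m} (hz' : e.symm z ∈ e'.source) :
    extInChart e c z = (extInChart e' c (e' (e.symm z))).compContinuousLinearMap
      (((chartDeriv e' (e.symm z)).comp (chartInvDeriv e z)).prodMap
        (ContinuousLinearMap.id ℂ ℂ)) := by
  ext v
  simp only [extInChart, compContinuousLinearMap_apply, e'.left_inv hz']
  refine congrArg _ (funext fun i => Prod.ext ?_ rfl)
  exact (chartInvDeriv_chartDeriv he' hz' _).symm

/-- The exterior derivative of extended forms can be computed in every chart. -/
lemma extInChart_dExt (he : e ∈ IsManifold.maximalAtlas 𝓘(ℂ, Cn m) ω Y) {c : ExtForm m k Y}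
    {z : Cn m} (hz : z ∈ e.target) (hc : DifferentiableAt ℂ (extInChart e c) z) (s : ℂ) :
    extInChart e (dExt c) z = extDeriv (fun p : Cn m × ℂ => extInChart e c p.1) (z, s) := by
  obtain ⟨y, hy, rfl⟩ : ∃ y ∈ e.source, e y = z := ⟨e.symm z, e.map_target hz, e.right_inv hz⟩
  set b := chartAt (Cn m) y with hb
  have hbm : b ∈ IsManifold.maximalAtlas 𝓘(ℂ, Cn m) ω Y := chartAt_mem y
  have hyb : y ∈ b.source := mem_chart_source _ y
  set φ : Cn m → Cn m := fun w => e (b.symm w) with hφ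
  have hφy : φ (b y) = e y := by simp [hφ, b.left_inv hyb]
  -- The derivative of an extended form is taken at second coordinate `0`, whereas `s` is arbitrary.
  -- The translation by `s` is harmless because the coefficients do not depend on the second
  -- variable.
  set Ψ : Cn m × ℂ → Cn m × ℂ := fun p => (φ p.1, p.2 + s) with hΨ
  have hΨd : ∀ w, b.symm w ∈ e.source → w ∈ b.target → ∀ t : ℂ, HasFDerivAt Ψ
      (((chartDeriv e (b.symm w)).comp (chartInvDeriv b w)).prodMap
        (ContinuousLinearMap.id ℂ ℂ)) (w, t) := by
    intro w h1 h2 t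
    have h3 := hasFDerivAt_transition hbm he h2 h1
    have h4 : HasFDerivAt (fun p : Cn m × ℂ => φ p.1) _ (w, t) :=
      HasFDerivAt.comp (w, t) (g := φ) (f := Prod.fst) h3 hasFDerivAt_fst
    exact h4.prodMk ((hasFDerivAt_snd (p := (w, t))).add_const s)
  have hev : ∀ᶠ p : Cn m × ℂ in 𝓝 (b y, 0), p.1 ∈ b.target ∧ b.symm p.1 ∈ e.source :=
    (continuous_fst.tendsto ((b y, 0) : Cn m × ℂ)).eventually (eventually_transition hyb hy)
  have hΨhol : Hol Ψ (b y, 0) := by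
    filter_upwards [hev] with p hp
    exact (hΨd p.1 hp.2 hp.1 p.2).differentiableAt
  have h1 : (fun p : Cn m × ℂ => extInChart b c p.1) =ᶠ[𝓝 (b y, 0)]
      fun p => (extInChart e c (Ψ p).1).compContinuousLinearMap (fderiv ℂ Ψ p) := by
    filter_upwards [hev] with p hp
    rw [extInChart_transition he c hp.2, (hΨd p.1 hp.2 hp.1 p.2).fderiv]
  have hc' : DifferentiableAt ℂ (fun p : Cn m × ℂ => extInChart e c p.1) (e y, s) :=
    DifferentiableAt.comp (e y, s) (f := Prod.fst) hc differentiableAt_fst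
  have hΨy : Ψ (b y, 0) = (e y, s) := by simp [hΨ, hφy]
  have h2 : extDeriv (fun p : Cn m × ℂ => extInChart b c p.1) (b y, 0) =
      (extDeriv (fun p : Cn m × ℂ => extInChart e c p.1) (e y, s)).compContinuousLinearMap
        (fderiv ℂ Ψ (b y, 0)) := by
    have h := extDeriv_pullback (x := (b y, (0 : ℂ))) (r := (2 : ℕ)) (f := Ψ)
      (show DifferentiableAt ℂ (fun p : Cn m × ℂ => extInChart e c p.1) (Ψ (b y, 0)) by
        rwa [hΨy]) (hΨhol.contDiffAt_nat 2) (by simp)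
    rw [h1.extDeriv_eq, h, hΨy]
  have hby : b.symm (b y) ∈ e.source := by rwa [b.left_inv hyb]
  have h3 : dExt c y = (extDeriv (fun p : Cn m × ℂ => extInChart e c p.1)
      (e y, s)).compContinuousLinearMap
        ((chartDeriv e y).prodMap (ContinuousLinearMap.id ℂ ℂ)) := by
    rw [dExt, ← hb, h2]
    ext v
    simp only [compContinuousLinearMap_apply]
    congr 1
    funext i
    rw [Function.comp_apply, (hΨd (b y) hby (b.map_source hyb) 0).fderiv, Function.comp_apply,
      Function.comp_apply]
    refine Prod.ext ?_ rfl
    change chartDeriv e (b.symm (b y)) (chartInvDeriv b (b y) (chartDeriv b y (v i).1)) =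
      chartDeriv e y (v i).1
    rw [b.left_inv hyb, chartInvDeriv_chartDeriv hbm hyb]
  rw [extInChart, e.left_inv hy, h3]
  ext v
  simp only [compContinuousLinearMap_apply]
  congr 1
  funext i
  have := chartDeriv_chartInvDeriv he hz (v i).1
  rw [e.left_inv hy] at this
  exact Prod.ext this rfl

/-- The exterior derivative of extended forms in log coordinates. -/
lemma extCoord_dExt (he : e ∈ IsManifold.maximalAtlas 𝓘(ℂ, Cn m) ω Y) {c : ExtForm m k Y}
    {z : Cn m} (hz : z ∈ e.target) (hS : z ∈ Off S)
    (h : DifferentiableAt ℂ (extCoord e S c) z) :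
    extCoord e S (dExt c) z = extLogD S (extCoord e S c) z := by
  have h1 : extInChart e c =ᶠ[𝓝 z] fun w => (extCoord e S c w).compContinuousLinearMap
      ((logFrameInv S w).prodMap (ContinuousLinearMap.id ℂ ℂ)) := by
    filter_upwards [(isOpen_Off S).mem_nhds hS] with w hw
    ext v
    simp only [extCoord, compContinuousLinearMap_apply]
    refine congrArg _ (funext fun i => Prod.ext ?_ rfl)
    exact (logFrame_logFrameInv hw _).symm
  -- The log frame on `ℂᵐ × ℂ`, completed by the constant field in the last direction, is again a
  -- commuting frame.
  have hR : HasFDerivAt (fun p : Cn m × ℂ => (logFrame S p.1).prodMap (ContinuousLinearMap.id ℂ ℂ))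
      ((ContinuousLinearMap.prodMapL ℂ (Cn m) (Cn m) ℂ ℂ).comp
        (((logFrameLin S).comp (ContinuousLinearMap.fst ℂ (Cn m) ℂ)).prod 0)) (z, 0) := by
    have h3 : HasFDerivAt (fun p : Cn m × ℂ => logFrame S p.1)
        ((logFrameLin S).comp (ContinuousLinearMap.fst ℂ (Cn m) ℂ)) (z, 0) :=
      HasFDerivAt.comp ((z, 0) : Cn m × ℂ) (g := logFrame S) (f := Prod.fst)
        (hasFDerivAt_logFrame S z) hasFDerivAt_fst
    exact (ContinuousLinearMap.prodMapL ℂ (Cn m) (Cn m) ℂ ℂ).hasFDerivAt.comp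
      ((z, 0) : Cn m × ℂ) (h3.prodMk
        (hasFDerivAt_const (ContinuousLinearMap.id ℂ ℂ) ((z, 0) : Cn m × ℂ)))
  have hInv : DifferentiableAt ℂ (fun w => (logFrameInv S w).prodMap
      (ContinuousLinearMap.id ℂ ℂ)) z :=
    DifferentiableAt.comp z (ContinuousLinearMap.prodMapL ℂ (Cn m) (Cn m) ℂ ℂ).differentiableAt
      ((hol_logFrameInv hS).differentiableAt.prodMk (differentiableAt_const _))
  have h2 : DifferentiableAt ℂ (extInChart e c) z :=
    (h.continuousAlternatingMapCompContinuousLinearMap hInv).congr_of_eventuallyEq h1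
  have h2' : DifferentiableAt ℂ (fun p : Cn m × ℂ => extInChart e c p.1) (z, 0) :=
    DifferentiableAt.comp ((z, 0) : Cn m × ℂ) (f := Prod.fst) h2 differentiableAt_fst
  rw [extCoord, extInChart_dExt he hz h2 0]
  refine (extDeriv_comp_frame h2' hR ?_).trans ?_
  · rintro ⟨v, s⟩ ⟨w, t⟩
    exact Prod.ext (logFrameLin_comm S z v w) rfl
  · rw [extLogD]
    congr 1
    have h3 : fderiv ℂ (fun p : Cn m × ℂ => extCoord e S c p.1) (z, 0) =
        (fderiv ℂ (extCoord e S c) z).comp (ContinuousLinearMap.fst ℂ (Cn m) ℂ) :=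
      (HasFDerivAt.comp ((z, 0) : Cn m × ℂ) (f := Prod.fst) h.hasFDerivAt hasFDerivAt_fst).fderiv
    change (fderiv ℂ (fun p : Cn m × ℂ => extCoord e S c p.1) (z, 0)).comp _ = _
    rw [h3]
    rfl

lemma Adapted.extCoord_dExt (h : Adapted D e S y) {c : ExtForm m k Y}
    (hc : ∀ᶠ z in 𝓝[Off S] (e y), Hol (extCoord e S c) z) :
    ∀ᶠ z in 𝓝[Off S] (e y), extCoord e S (dExt c) z = extLogD S (extCoord e S c) z := by
  filter_upwards [hc, h.nhds.filter_mono nhdsWithin_le_nhds, self_mem_nhdsWithin] with z h1 h2 h3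
  exact LogSymp.extCoord_dExt h.1 h2.1 h3 h1.differentiableAt

end ExtendedDerivative

/-! ### Charts of the normalization -/

section Insertion

open Filter ContinuousAlternatingMap

variable {m : ℕ}

/-- The inclusion of the hyperplane `z i = 0`. -/
def insL (i : Fin (m + 1)) : Cn m →L[ℂ] Cn (m + 1) :=
  ContinuousLinearMap.pi (i.insertNth (α := fun _ => Cn m →L[ℂ] ℂ) 0
    fun k => ContinuousLinearMap.proj k)

/-- The projection that forgets the coordinate `z i`. -/
def remL (i : Fin (m + 1)) : Cn (m + 1) →L[ℂ] Cn m :=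
  ContinuousLinearMap.pi fun k => ContinuousLinearMap.proj (i.succAbove k)

@[simp] lemma insL_self (i : Fin (m + 1)) (y : Cn m) : insL i y i = 0 := by simp [insL]

@[simp] lemma insL_succAbove (i : Fin (m + 1)) (y : Cn m) (k : Fin m) :
    insL i y (i.succAbove k) = y k := by simp [insL]

@[simp] lemma remL_apply (i : Fin (m + 1)) (z : Cn (m + 1)) (k : Fin m) :
    remL i z k = z (i.succAbove k) := rfl

@[simp] lemma remL_insL (i : Fin (m + 1)) (y : Cn m) : remL i (insL i y) = y := by ext; simp

lemma ext_succAbove (i : Fin (m + 1)) {z w : Cn (m + 1)} (h : z i = w i)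
    (h' : remL i z = remL i w) : z = w := by
  funext j
  exact (Fin.forall_iff_succAbove (P := fun j => z j = w j) i).2 ⟨h, fun k => congrFun h' k⟩ j

lemma insL_remL {i : Fin (m + 1)} {z : Cn (m + 1)} (h : z i = 0) : insL i (remL i z) = z :=
  ext_succAbove i (by simp [h]) (by simp)

@[simp] lemma remL_single (i : Fin (m + 1)) : remL i (Pi.single i (1 : ℂ)) = 0 := by
  ext k
  simp

lemma eq_insL_add (i : Fin (m + 1)) (z : Cn (m + 1)) :
    z = insL i (remL i z) + z i • Pi.single i (1 : ℂ) :=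
  ext_succAbove i (by simp) (by simp)

/-- The indices of the other hyperplanes. -/
def rest (S : Finset (Fin (m + 1))) (i : Fin (m + 1)) : Finset (Fin m) :=
  Finset.univ.filter fun k => i.succAbove k ∈ S

@[simp] lemma mem_rest {S : Finset (Fin (m + 1))} {i : Fin (m + 1)} {k : Fin m} :
    k ∈ rest S i ↔ i.succAbove k ∈ S := by simp [rest]

lemma insL_mem_Off {S : Finset (Fin (m + 1))} {i : Fin (m + 1)} {y : Cn m} :
    insL i y ∈ Off (S.erase i) ↔ y ∈ Off (rest S i) := by
  constructor
  · intro h k hk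
    simpa using h (i.succAbove k) (Finset.mem_erase.2 ⟨Fin.succAbove_ne i k, mem_rest.1 hk⟩)
  · intro h j hj
    obtain ⟨hji, hj⟩ := Finset.mem_erase.1 hj
    obtain ⟨k, rfl⟩ := Fin.exists_succAbove_eq hji
    simpa using h k (mem_rest.2 hj)

lemma logFrame_insL {S : Finset (Fin (m + 1))} {i : Fin (m + 1)} (hi : i ∈ S) (y : Cn m)
    (v : Cn (m + 1)) :
    logFrame S (insL i y) v = insL i (logFrame (rest S i) y (remL i v)) :=
  ext_succAbove i (by simp [logFrame_apply, hi]) (by ext k; simp [logFrame_apply])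

/-- The points of the hyperplane near a given one. -/
lemma eventually_insL_iff {i : Fin (m + 1)} {y₀ : Cn m} {P : Cn (m + 1) → Prop} :
    (∀ᶠ y in 𝓝 y₀, P (insL i y)) ↔ ∀ᶠ z in 𝓝 (insL i y₀), z i = 0 → P z := by
  constructor
  · intro h
    have : Tendsto (remL i) (𝓝 (insL i y₀)) (𝓝 y₀) :=
      ((remL i).continuous.tendsto' _ _ (remL_insL i y₀))
    filter_upwards [this.eventually h] with z hz hi
    rwa [insL_remL hi] at hz
  · intro h
    filter_upwards [((insL i).continuous.tendsto y₀).eventually h] with y hy using hy (by simp)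

lemma tendsto_insL (i : Fin (m + 1)) (y₀ : Cn m) : Tendsto (insL i) (𝓝 y₀) (𝓝 (insL i y₀)) :=
  (insL i).continuous.tendsto y₀

end Insertion

/-! ### Adapted charts of the divisor with the charts of its normalization -/

section NormalizationCharts

open Filter ContinuousAlternatingMap

variable {m : ℕ} {X X₁ : Type} [TopologicalSpace X] [ChartedSpace (Cn (m + 1)) X]
  [IsManifold 𝓘(ℂ, Cn (m + 1)) ω X] [TopologicalSpace X₁] [ChartedSpace (Cn m) X₁]
  [IsManifold 𝓘(ℂ, Cn m) ω X₁] {D : Set X} {f : X₁ → X}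

/-- An adapted chart of `D` together with the charts that it induces on the normalization. -/
structure NormChart (D : Set X) (f : X₁ → X) where
  e : OpenPartialHomeomorph X (Cn (m + 1))
  S : Finset (Fin (m + 1))
  c : Fin (m + 1) → OpenPartialHomeomorph X₁ (Cn m)
  e_mem : e ∈ IsManifold.maximalAtlas 𝓘(ℂ, Cn (m + 1)) ω X
  div : ∀ z ∈ e.source, z ∈ D ↔ ∃ i ∈ S, e z i = 0
  c_mem : ∀ i ∈ S, c i ∈ IsManifold.maximalAtlas 𝓘(ℂ, Cn m) ω X₁
  disj : ∀ i ∈ S, ∀ j ∈ S, i ≠ j → Disjoint (c i).source (c j).source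
  preimage : f ⁻¹' e.source = ⋃ i ∈ S, (c i).source
  coord : ∀ i ∈ S, ∀ q ∈ (c i).source, e (f q) i = 0 ∧ c i q = i.removeNth (e (f q))
  surj : ∀ i ∈ S, ∀ z ∈ e.source, e z i = 0 → ∃ q ∈ (c i).source, f q = z

lemma IsNormalization.exists_normChart (hf : IsNormalization (m := m) D f) (p : X) :
    ∃ N : NormChart (m := m) D f, p ∈ N.e.source := by
  obtain ⟨e, S, c, h1, h2, h3, h4, h5, h6⟩ := hf p
  exact ⟨⟨e, S, c, h1.1, h1.2.2, h2, h3, h4, h5, h6⟩, h1.2.1⟩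

namespace NormChart

variable (N : NormChart (m := m) D f)

/-- The point `q` lies on the `i`-th branch in the chart. -/
def On (i : Fin (m + 1)) (q : X₁) : Prop := i ∈ N.S ∧ q ∈ (N.c i).source

lemma adapted {p : X} (hp : p ∈ N.e.source) : Adapted D N.e N.S p := ⟨N.e_mem, hp, N.div⟩

lemma exists_on {q : X₁} (hq : f q ∈ N.e.source) : ∃ i, N.On i q := by
  have : q ∈ f ⁻¹' N.e.source := hq
  rw [N.preimage] at this
  simpa [On] using this

variable {N} {i : Fin (m + 1)} {q : X₁}

lemma On.maps (h : N.On i q) : f q ∈ N.e.source := by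
  change q ∈ f ⁻¹' N.e.source
  rw [N.preimage]
  exact Set.mem_biUnion h.1 h.2

lemma On.adapted (h : N.On i q) : Adapted D N.e N.S (f q) := N.adapted h.maps

lemma On.e_apply (h : N.On i q) : N.e (f q) = insL i (N.c i q) := by
  obtain ⟨h1, h2⟩ := N.coord i h.1 q h.2
  rw [h2]
  exact (insL_remL h1).symm

lemma On.coord_eq_zero (h : N.On i q) : N.e (f q) i = 0 := (N.coord i h.1 q h.2).1

lemma On.nhds (h : N.On i q) : ∀ᶠ q' in 𝓝 q, N.On i q' := by
  filter_upwards [(N.c i).open_source.mem_nhds h.2] with q' hq' using ⟨h.1, hq'⟩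

lemma On.of_mem (h : N.On i q) {q' : X₁} (hq' : q' ∈ (N.c i).source) : N.On i q' := ⟨h.1, hq'⟩

/-- On each piece `f` is injective, because the remaining coordinates are coordinates on the piece;
a second preimage of `f q` therefore lies on another piece. Conversely a second hyperplane through
`f q` carries a preimage, which differs from `q` because the pieces are disjoint. -/
lemma On.mem_inducedDivisor (h : N.On i q) :
    q ∈ inducedDivisor f ↔ ∃ k ∈ rest N.S i, N.c i q k = 0 := by
  constructor
  · rintro ⟨q', hne, he⟩
    obtain ⟨j, hj⟩ := N.exists_on (q := q') (he ▸ h.maps)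
    by_cases hji : j = i
    · subst hji
      refine absurd ((N.c j).injOn hj.2 h.2 ?_) hne
      rw [(N.coord j hj.1 q' hj.2).2, (N.coord j h.1 q h.2).2, he]
    · obtain ⟨k, rfl⟩ := Fin.exists_succAbove_eq hji
      refine ⟨k, mem_rest.2 hj.1, ?_⟩
      have := hj.coord_eq_zero
      rwa [he, h.e_apply, insL_succAbove] at this
  · rintro ⟨k, hk, h0⟩
    have h1 : N.e (f q) (i.succAbove k) = 0 := by rw [h.e_apply, insL_succAbove, h0]
    obtain ⟨q', hq', he⟩ := N.surj _ (mem_rest.1 hk) (f q) h.maps h1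
    refine ⟨q', fun hqq => ?_, he⟩
    subst hqq
    exact Set.disjoint_left.1 (N.disj _ (mem_rest.1 hk) i h.1 (Fin.succAbove_ne i k)) hq' h.2

lemma On.adapted₁ (h : N.On i q) : Adapted (inducedDivisor f) (N.c i) (rest N.S i) q :=
  ⟨N.c_mem i h.1, h.2, fun _ hq' => (h.of_mem hq').mem_inducedDivisor⟩

lemma On.f_symm (h : N.On i q) {y : Cn m} (hy : y ∈ (N.c i).target) :
    f ((N.c i).symm y) = N.e.symm (insL i y) := by
  have h1 := h.of_mem ((N.c i).map_target hy)
  rw [← (N.c i).right_inv hy, ← h1.e_apply, N.e.left_inv h1.maps, (N.c i).right_inv hy]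

/-- Points of `X₁` near `q`, in terms of the coordinates. -/
lemma On.eventually_iff (h : N.On i q) {P : Cn (m + 1) → Prop} :
    (∀ᶠ q' in 𝓝 q, P (N.e (f q'))) ↔ ∀ᶠ z in 𝓝 (N.e (f q)), z i = 0 → P z := by
  rw [h.e_apply, ← eventually_insL_iff, ← (N.c i).eventually_nhds' _ h.2]
  refine eventually_congr ?_
  filter_upwards [(N.c i).open_target.mem_nhds ((N.c i).map_source h.2)] with y hy
  rw [(h.of_mem ((N.c i).map_target hy)).e_apply, (N.c i).right_inv hy]

/-- Generic points of `X₁` near `q`, in terms of the coordinates. -/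
lemma On.eventually_generic_iff (h : N.On i q) {P : Cn (m + 1) → Prop} :
    (∀ᶠ q' in 𝓝[(inducedDivisor f)ᶜ] q, P (N.e (f q'))) ↔
      ∀ᶠ z in 𝓝 (N.e (f q)), z i = 0 → z ∈ Off (N.S.erase i) → P z := by
  rw [eventually_nhdsWithin_iff,
    ← h.eventually_iff (P := fun z => z ∈ Off (N.S.erase i) → P z)]
  refine eventually_congr ?_
  filter_upwards [h.nhds] with q' hq'
  rw [hq'.e_apply, insL_mem_Off, Set.mem_compl_iff, hq'.mem_inducedDivisor]
  simp [Off]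

lemma On.continuousAt (h : N.On i q) : ContinuousAt f q := by
  have h1 : f =ᶠ[𝓝 q] fun q' => N.e.symm (insL i (N.c i q')) := by
    filter_upwards [h.nhds] with q' hq'
    rw [← hq'.e_apply, N.e.left_inv hq'.maps]
  refine ContinuousAt.congr ?_ h1.symm
  refine ContinuousAt.comp (g := N.e.symm) ?_ ?_
  · rw [← h.e_apply]
    exact N.e.continuousAt_symm (N.e.map_source h.maps)
  · exact ((insL i).continuous.continuousAt).comp ((N.c i).continuousAt h.2)

/-- The differential of the normalization in the charts. -/
lemma On.dMap_apply (h : N.On i q) (v : Cn m) :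
    dMap (m := m) f q v =
      chartInvDeriv N.e (N.e (f q)) (insL i (chartDeriv (N.c i) q v)) := by
  have h1 : f =ᶠ[𝓝 q] N.e.symm ∘ insL i ∘ N.c i := by
    filter_upwards [h.nhds] with q' hq'
    change f q' = N.e.symm (insL i (N.c i q'))
    rw [← hq'.e_apply, N.e.left_inv hq'.maps]
  have h2 := ((mdifferentiable_of_mem (N.c_mem i h.1)).mdifferentiableAt h.2).hasMFDerivAt
  have h3 : HasMFDerivAt 𝓘(ℂ, Cn m) 𝓘(ℂ, Cn (m + 1)) (insL i) (N.c i q) (insL i) :=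
    (insL i).hasFDerivAt.hasMFDerivAt
  have h4 : HasMFDerivAt 𝓘(ℂ, Cn (m + 1)) 𝓘(ℂ, Cn (m + 1)) N.e.symm (insL i (N.c i q))
      (chartInvDeriv N.e (insL i (N.c i q))) :=
    ((mdifferentiable_of_mem N.e_mem).mdifferentiableAt_symm (by
      rw [← h.e_apply]; exact N.e.map_source h.maps)).hasMFDerivAt
  have h5 := ((h4.comp q (h3.comp q h2)).congr_of_eventuallyEq h1).mfderiv
  rw [dMap, h5, h.e_apply]
  rfl

/-- In the charts the differential of `f` is the inclusion `insL i` of the tangent hyperplane. -/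
lemma On.mem_range_dMap (h : N.On i q) {w : Cn (m + 1)} :
    w ∈ LinearMap.range (dMap (m := m) f q).toLinearMap ↔
      chartDeriv N.e (f q) w i = 0 := by
  constructor
  · rintro ⟨v, rfl⟩
    change chartDeriv N.e (f q) (dMap (m := m) f q v) i = 0
    have := chartDeriv_chartInvDeriv N.e_mem (N.e.map_source h.maps)
      (insL i (chartDeriv (N.c i) q v))
    rw [N.e.left_inv h.maps] at this
    rw [h.dMap_apply, this, insL_self]
  · intro hw
    refine ⟨chartInvDeriv (N.c i) (N.c i q) (remL i (chartDeriv N.e (f q) w)), ?_⟩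
    change dMap (m := m) f q _ = w
    have := chartDeriv_chartInvDeriv (N.c_mem i h.1) ((N.c i).map_source h.2)
      (remL i (chartDeriv N.e (f q) w))
    rw [(N.c i).left_inv h.2] at this
    rw [h.dMap_apply, this, insL_remL hw, chartInvDeriv_chartDeriv N.e_mem h.maps]

end NormChart

end NormalizationCharts

/-! ### Forms with a simple pole along a hyperplane -/

section Polar

open Filter ContinuousAlternatingMap

variable {n k : ℕ} {E F G : Type*} [NormedAddCommGroup E] [NormedSpace ℂ E]
  [NormedAddCommGroup F] [NormedSpace ℂ F] [NormedAddCommGroup G] [NormedSpace ℂ G]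
  {S : Finset (Fin n)} {i : Fin n} {z₀ : Cn n}

/-- The map `A` has at most a simple pole along `z i = 0`. -/
def Polar (S : Finset (Fin n)) (i : Fin n) (A : Cn n → F) (z₀ : Cn n) : Prop :=
  LogHol S (fun z => z i • A z) z₀

lemma LogHol.const (c : F) : LogHol S (fun _ => c) z₀ := (Hol.const c).logHol

lemma LogHol.zero_of_eventually {A : Cn n → F} (h : ∀ᶠ z in 𝓝[Off S] z₀, A z = 0) :
    LogHol S A z₀ := (LogHol.const (0 : F)).congr h

lemma LogHol.neg {A : Cn n → F} (H : LogHol S A z₀) : LogHol S (fun z => -A z) z₀ := by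
  simpa using (LogHol.const (0 : F)).sub H

lemma LogHol.polar {A : Cn n → F} (H : LogHol S A z₀) : Polar S i A z₀ :=
  (hol_proj i z₀).logHol.smul H

lemma Polar.congr {A B : Cn n → F} (H : Polar S i A z₀) (e : ∀ᶠ z in 𝓝[Off S] z₀, B z = A z) :
    Polar S i B z₀ := LogHol.congr H (by filter_upwards [e] with z hz using by rw [hz])

lemma Polar.add {A B : Cn n → F} (H : Polar S i A z₀) (H' : Polar S i B z₀) :
    Polar S i (fun z => A z + B z) z₀ :=
  (LogHol.add H H').congr (Eventually.of_forall fun _ => smul_add _ _ _)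

lemma Polar.smul {c : Cn n → ℂ} {A : Cn n → F} (hc : LogHol S c z₀) (H : Polar S i A z₀) :
    Polar S i (fun z => c z • A z) z₀ :=
  (LogHol.smul hc H).congr (Eventually.of_forall fun _ => smul_comm _ _ _)

lemma Polar.wedge {θ : Cn n → E [⋀^Fin 1]→L[ℂ] ℂ} {A : Cn n → E [⋀^Fin k]→L[ℂ] ℂ}
    (hθ : LogHol S θ z₀) (H : Polar S i A z₀) :
    Polar S i (fun z => LogSymp.wedge (θ z) (A z)) z₀ := by
  obtain ⟨h, h1, h2⟩ := H
  obtain ⟨η, h3, h4⟩ := hθ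
  refine ⟨fun z => LogSymp.wedge (η z) (h z), h3.wedge h1, ?_⟩
  filter_upwards [h2, h4] with z h5 h6
  rw [← h5, ← h6, wedge_smul]

lemma Polar.curryLeft {A : Cn n → E [⋀^Fin (k + 1)]→L[ℂ] ℂ} {v : Cn n → E}
    (H : Polar S i A z₀) (hv : LogHol S v z₀) :
    Polar S i (fun z => (A z).curryLeft (v z)) z₀ := by
  obtain ⟨h, h1, h2⟩ := H
  obtain ⟨w, h3, h4⟩ := hv
  refine ⟨fun z => (h z).curryLeft (w z), h1.curryLeft h3, ?_⟩
  filter_upwards [h2, h4] with z h5 h6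
  rw [← h5, ← h6]
  rfl

lemma Polar.eventually {A : Cn n → F} (H : Polar S i A z₀) : ∀ᶠ z in 𝓝 z₀, Polar S i A z :=
  LogHol.eventually H

lemma Polar.eventually_hol (hi : i ∈ S) {A : Cn n → F} (H : Polar S i A z₀) :
    ∀ᶠ z in 𝓝[Off S] z₀, Hol A z := by
  filter_upwards [LogHol.eventually_hol H, self_mem_nhdsWithin] with z hz hS
  refine (((hol_proj i z).inv (hS i hi)).smul hz).congr ?_
  filter_upwards [(isOpen_Off S).mem_nhds hS] with w hw
  rw [inv_smul_smul₀ (hw i hi)]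

/-- A simple pole is absent exactly if its numerator is divisible by the coordinate, that is,
vanishes on the hyperplane. -/
lemma logHol_iff_vanish [CompleteSpace F] (hi : i ∈ S) {A h : Cn n → F} (hh : Hol h z₀)
    (e : ∀ᶠ z in 𝓝[Off S] z₀, z i • A z = h z) :
    LogHol S A z₀ ↔ ∀ᶠ z in 𝓝 z₀, z i = 0 → h z = 0 := by
  constructor
  · rintro ⟨a, ha, ha'⟩
    have := Hol.eq_of_eq_Off hh ((hol_proj i z₀).smul ha) (S := S) (by
      filter_upwards [e, ha'] with z h1 h2
      rw [← h1, h2])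
    filter_upwards [this] with z hz hi0
    rw [hz, hi0, zero_smul]
  · intro h0
    obtain ⟨b, hb, hb'⟩ := hh.exists_eq_smul h0
    refine ⟨b, hb, ?_⟩
    filter_upwards [e, hb'.filter_mono nhdsWithin_le_nhds, self_mem_nhdsWithin] with z h1 h2 h3
    rw [h2] at h1
    exact smul_right_injective F (h3 i hi) h1

/-- A simple pole along a hyperplane which is absent at the generic points of the hyperplane is
absent. -/
lemma Polar.logHol_of_generic [CompleteSpace F] (hi : i ∈ S) {A : Cn n → F} (H : Polar S i A z₀)
    (e : ∀ᶠ z in 𝓝 z₀, z i = 0 → z ∈ Off (S.erase i) → LogHol S A z) : LogHol S A z₀ := by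
  obtain ⟨h, h1, h2⟩ := H
  rw [logHol_iff_vanish hi h1 h2]
  refine h1.eq_of_eq_hyperplane (S := S) (Hol.const _) ?_
  filter_upwards [e, h1.eventually, eventually_nhdsWithin_Off h2] with z h3 h4 h5 h6 h7
  exact ((logHol_iff_vanish hi h4 h5).1 (h3 h6 h7)).self_of_nhds h6

/-- The linear form `v ↦ v i`. -/
def coordForm (i : Fin n) : (Cn n) [⋀^Fin 1]→L[ℂ] ℂ :=
  ofSubsingleton ℂ (Cn n) ℂ (0 : Fin 1) (ContinuousLinearMap.proj i)

lemma oneForm_coordForm (i : Fin n) : oneForm (coordForm i) = ContinuousLinearMap.proj i := by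
  ext v
  simp [oneForm_apply, coordForm]

lemma hasFDerivAt_inv_smul {h : Cn n → F} {z : Cn n} (hh : DifferentiableAt ℂ h z)
    (hz : z i ≠ 0) :
    HasFDerivAt (fun w : Cn n => (w i)⁻¹ • h w) ((z i)⁻¹ • fderiv ℂ h z +
      ((-(z i ^ 2)⁻¹) • (ContinuousLinearMap.proj i : Cn n →L[ℂ] ℂ)).smulRight (h z)) z := by
  have h1 : HasFDerivAt (fun w : Cn n => w i) (ContinuousLinearMap.proj i : Cn n →L[ℂ] ℂ) z :=
    (ContinuousLinearMap.proj i : Cn n →L[ℂ] ℂ).hasFDerivAt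
  exact ((hasDerivAt_inv hz).comp_hasFDerivAt z h1).smul hh.hasFDerivAt

/-- The derivative of a form with a simple pole. -/
lemma logD_polar (hi : i ∈ S) {A h : Cn n → (Cn n) [⋀^Fin k]→L[ℂ] ℂ} (hh : Hol h z₀)
    (e : ∀ᶠ z in 𝓝[Off S] z₀, z i • A z = h z) :
    ∀ᶠ z in 𝓝[Off S] z₀, z i • logD S A z = logD S h z - wedge (coordForm i) (h z) := by
  filter_upwards [eventually_of_Off e, hh.filter_mono nhdsWithin_le_nhds, self_mem_nhdsWithin]
    with z h1 h2 h3
  have h4 : A =ᶠ[𝓝 z] fun w => (w i)⁻¹ • h w := by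
    filter_upwards [h1, (isOpen_Off S).mem_nhds h3] with w h5 h6
    rw [← h5, inv_smul_smul₀ (h6 i hi)]
  rw [logD, h4.fderiv_eq, (hasFDerivAt_inv_smul h2 (h3 i hi)).fderiv, wedge_eq,
    oneForm_coordForm, logD, ← alternatize_sub]
  change z i • alternatizeUncurryFinCLM ℂ (Cn n) ℂ _ = alternatizeUncurryFinCLM ℂ (Cn n) ℂ _
  rw [← map_smul]
  congr 1
  ext v : 1
  have hz : z i ≠ 0 := h3 i hi
  simp only [_root_.smul_apply, ContinuousLinearMap.comp_apply, _root_.add_apply, _root_.sub_apply,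
    ContinuousLinearMap.smulRight_apply, ContinuousLinearMap.proj_apply, smul_add, smul_smul,
    logFrame_apply, if_pos hi, mul_inv_cancel₀ hz, one_smul, smul_eq_mul, sub_eq_add_neg, ← neg_smul]
  congr 2
  field_simp

lemma Polar.logD (hi : i ∈ S) {A : Cn n → (Cn n) [⋀^Fin k]→L[ℂ] ℂ} (H : Polar S i A z₀) :
    Polar S i (logD S A) z₀ := by
  obtain ⟨h, h1, h2⟩ := H
  exact ((h1.logD.sub ((Hol.const (coordForm i)).wedge h1)).logHol).congr (logD_polar hi h1 h2)

/-- For `A = h / z i` one has `z i ∂_i A = ∂_i h - h / z i`, so adding `A` cancels the pole: the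
field `x_i ∂_i` acts as `-1` on polar parts. This is the source of the contracting homotopy. -/
lemma fderiv_frame_polar [CompleteSpace F] (hi : i ∈ S) {A : Cn n → F} (H : Polar S i A z₀) :
    LogHol S (fun z => fderiv ℂ A z (logFrame S z (Pi.single i 1)) + A z) z₀ := by
  obtain ⟨h, h1, h2⟩ := H
  refine ⟨_, h1.fderiv_apply (Hol.const (Pi.single i 1)), ?_⟩
  filter_upwards [eventually_of_Off h2, h1.filter_mono nhdsWithin_le_nhds, self_mem_nhdsWithin]
    with z h3 h4 h5
  have hz : z i ≠ 0 := h5 i hi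
  have h6 : A =ᶠ[𝓝 z] fun w => (w i)⁻¹ • h w := by
    filter_upwards [h3, (isOpen_Off S).mem_nhds h5] with w h7 h8
    rw [← h7, inv_smul_smul₀ (h8 i hi)]
  have h7 : logFrame S z (Pi.single i 1) = z i • Pi.single i 1 := by
    ext j
    by_cases hj : j = i
    · subst hj; simp [logFrame_apply, hi]
    · simp [logFrame_apply, hj]
  rw [h6.fderiv_eq, (hasFDerivAt_inv_smul h4 hz).fderiv, h6.self_of_nhds, h7, map_smul]
  simp only [_root_.smul_apply, _root_.add_apply,
    ContinuousLinearMap.smulRight_apply, ContinuousLinearMap.proj_apply, Pi.single_eq_same,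
    smul_add, smul_smul, mul_inv_cancel₀ hz, one_smul, add_assoc, ← add_smul, smul_eq_mul]
  rw [show z i * (-(z i ^ 2)⁻¹ * 1) + (z i)⁻¹ = 0 by field_simp; ring, zero_smul, add_zero]

lemma contract_logD_zero {A : Cn n → (Cn n) [⋀^Fin 0]→L[ℂ] ℂ} {z : Cn n} (w : Cn n) :
    (LogSymp.logD S A z).curryLeft w = fderiv ℂ A z (logFrame S z w) :=
  curryLeft_alternatize_zero _ w

/-- Cartan's formula for a constant field in log coordinates. -/
lemma contract_logD {A : Cn n → (Cn n) [⋀^Fin (k + 1)]→L[ℂ] ℂ} {z : Cn n}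
    (hA : DifferentiableAt ℂ A z) (w : Cn n) :
    LogSymp.logD S (fun x => (A x).curryLeft w) z + (LogSymp.logD S A z).curryLeft w =
      fderiv ℂ A z (logFrame S z w) := by
  have h : fderiv ℂ (fun x => (A x).curryLeft w) z = (contract k w).comp (fderiv ℂ A z) :=
    ((contract k w).hasFDerivAt.comp z hA.hasFDerivAt).fderiv
  rw [LogSymp.logD, LogSymp.logD, h, curryLeft_alternatize]
  exact add_sub_cancel _ _

/-- The derivative of the product with a `1`-form in a frame. -/
lemma alternatize_fderiv_wedge {θ : F → E [⋀^Fin 1]→L[ℂ] ℂ} {A : F → E [⋀^Fin k]→L[ℂ] ℂ} {x : F}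
    (hθ : DifferentiableAt ℂ θ x) (hA : DifferentiableAt ℂ A x) (R : E →L[ℂ] F) :
    alternatizeUncurryFin ((fderiv ℂ (fun y => LogSymp.wedge (θ y) (A y)) x).comp R) =
      alternatizeUncurryFin (((wedgeL k).flip (A x)).comp ((fderiv ℂ θ x).comp R)) -
        LogSymp.wedge (θ x) (alternatizeUncurryFin ((fderiv ℂ A x).comp R)) := by
  have h : HasFDerivAt (fun y => LogSymp.wedge (θ y) (A y))
      (((wedgeL k) (θ x)).comp (fderiv ℂ A x) + ((wedgeL k).flip (A x)).comp (fderiv ℂ θ x)) x :=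
    (wedgeL k).hasFDerivAt_of_bilinear hθ.hasFDerivAt hA.hasFDerivAt
  rw [h.fderiv, sub_eq_add_neg, ← alternatize_wedge, ContinuousLinearMap.add_comp]
  refine ((alternatizeUncurryFinCLM ℂ E ℂ).map_add _ _).trans ?_
  exact add_comm _ _

/-- The derivative of the contraction of a closed `2`-form is symmetric up to a derivative. -/
lemma fderiv_contract_symm {h : Cn n → (Cn n) [⋀^Fin 2]→L[ℂ] ℂ} {z : Cn n}
    (hc : LogSymp.logD S h z = 0) (e v w : Cn n) :
    oneForm ((fderiv ℂ h z (logFrame S z v)).curryLeft e) w -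
      oneForm ((fderiv ℂ h z (logFrame S z w)).curryLeft e) v =
      oneForm ((fderiv ℂ h z (logFrame S z e)).curryLeft v) w := by
  -- Closedness evaluated on `e`, `v`, `w`: the frame is commuting, so only the three derivatives of
  -- the coefficients occur.
  have h1 : ((LogSymp.logD S h z).curryLeft e).curryLeft v = 0 := by rw [hc]; rfl
  rw [LogSymp.logD, curryLeft_alternatize, ← contract_apply, map_sub, contract_apply,
    contract_apply, curryLeft_alternatize] at h1
  have h2 := congrArg (fun a => oneForm a w) h1
  simp only [_root_.map_sub, _root_.map_zero, _root_.sub_apply, _root_.zero_apply] at h2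
  have h3 : oneForm (alternatizeUncurryFin ((contract 0 v).comp ((contract 1 e).comp
      ((fderiv ℂ h z).comp (logFrame S z))))) w =
      oneForm ((fderiv ℂ h z (logFrame S z w)).curryLeft e) v := by
    have := congrArg (fun a => a (Fin.elim0 : Fin 0 → Cn n)) (curryLeft_alternatize_zero
      ((contract 0 v).comp ((contract 1 e).comp ((fderiv ℂ h z).comp (logFrame S z)))) w)
    rw [oneForm_apply, oneForm_apply]
    refine Eq.trans ?_ (this.trans ?_)
    · rw [curryLeft_apply_apply]
      congr 1
      funext j
      fin_cases j
      rfl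
    · simp only [ContinuousLinearMap.comp_apply, contract_apply]
      rw [curryLeft_apply_apply]
      congr 1
      funext j
      fin_cases j
      rfl
  rw [h3] at h2
  simp only [contract_apply, ContinuousLinearMap.comp_apply] at h2
  linear_combination -h2

end Polar

/-! ### Products with the contraction of a closed form -/

section ClosedContraction

open Filter ContinuousAlternatingMap

variable {n k : ℕ} {E F : Type*} [NormedAddCommGroup E] [NormedSpace ℂ E]
  [NormedAddCommGroup F] [NormedSpace ℂ F] {S : Finset (Fin n)} {i : Fin n} {z₀ : Cn n}

lemma alternatize_fderiv_wedge_of_symmetric {θ : F → E [⋀^Fin 1]→L[ℂ] ℂ}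
    {A : F → E [⋀^Fin k]→L[ℂ] ℂ} {x : F} (hθ : DifferentiableAt ℂ θ x)
    (hA : DifferentiableAt ℂ A x) (R : E →L[ℂ] F)
    (hs : ∀ v w, oneForm (fderiv ℂ θ x (R v)) w = oneForm (fderiv ℂ θ x (R w)) v) :
    alternatizeUncurryFin ((fderiv ℂ (fun y => wedge (θ y) (A y)) x).comp R) =
      -wedge (θ x) (alternatizeUncurryFin ((fderiv ℂ A x).comp R)) := by
  rw [alternatize_fderiv_wedge hθ hA R, alternatize_wedge_of_symmetric _ hs, zero_sub]

lemma logFrame_single (hi : i ∈ S) (z : Cn n) :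
    logFrame S z (Pi.single i 1) = z i • Pi.single i 1 := by
  ext j
  by_cases hj : j = i
  · subst hj; simp [logFrame_apply, hi]
  · simp [logFrame_apply, hj]

lemma oneForm_curryLeft (a : E [⋀^Fin 2]→L[ℂ] ℂ) (v w : E) :
    oneForm (a.curryLeft v) w = a ![v, w] := by
  rw [oneForm_apply, curryLeft_apply_apply]
  congr 1
  funext j
  fin_cases j <;> rfl

lemma oneForm_curryLeft_swap (a : E [⋀^Fin 2]→L[ℂ] ℂ) (v w : E) :
    oneForm (a.curryLeft v) w = -oneForm (a.curryLeft w) v := by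
  rw [oneForm_curryLeft, oneForm_curryLeft]
  have : a (![w, v] ∘ Equiv.swap 0 1) = -a ![w, v] :=
    a.toAlternatingMap.map_swap ![w, v] (i := 0) (j := 1) (by decide)
  rw [← this]
  congr 1
  funext j
  fin_cases j <;> rfl

lemma fderiv_contract {h : F → E [⋀^Fin 2]→L[ℂ] ℂ} {z : F} (hh : DifferentiableAt ℂ h z) (e : E)
    (v : F) : fderiv ℂ (fun x => (h x).curryLeft e) z v = (fderiv ℂ h z v).curryLeft e := by
  have : fderiv ℂ (fun x => (h x).curryLeft e) z = (contract 1 e).comp (fderiv ℂ h z) :=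
    ((contract 1 e).hasFDerivAt.comp z hh.hasFDerivAt).fderiv
  rw [this]
  rfl

/-- Let `θ` be the contraction of `h` by the `i`-th frame vector. By closedness the bilinear form
given by the frame derivative of `θ` has antisymmetric part `z i / 2` times `∂_i h`; subtracting
this part leaves a symmetric form, whose product with `A` alternates to zero. The factor `z i` is
then moved to `A`, where it cancels a simple pole. -/
lemma logD_wedge_contract (hi : i ∈ S) {h : Cn n → (Cn n) [⋀^Fin 2]→L[ℂ] ℂ} {z : Cn n}
    (hh : DifferentiableAt ℂ h z) (hc : logD S h z = 0)
    {A : Cn n → (Cn n) [⋀^Fin k]→L[ℂ] ℂ} (hA : DifferentiableAt ℂ A z) :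
    logD S (fun x => wedge ((h x).curryLeft (Pi.single i 1)) (A x)) z =
      alternatizeUncurryFin (((wedgeL k).flip (z i • A z)).comp
        ((1 / 2 : ℂ) • curryL 1 (Cn n) (fderiv ℂ h z (Pi.single i 1)))) -
      wedge ((h z).curryLeft (Pi.single i 1)) (logD S A z) := by
  set θ : Cn n → (Cn n) [⋀^Fin 1]→L[ℂ] ℂ := fun x => (h x).curryLeft (Pi.single i 1)
  have hθ : DifferentiableAt ℂ θ z :=
    ((contract 1 (Pi.single i (1 : ℂ) : Cn n)).hasFDerivAt.comp z hh.hasFDerivAt).differentiableAt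
  rw [logD, alternatize_fderiv_wedge hθ hA (logFrame S z), logD]
  congr 1
  set a := fderiv ℂ h z (Pi.single i 1) with ha
  set B : Cn n →L[ℂ] (Cn n) [⋀^Fin 1]→L[ℂ] ℂ := (1 / 2 : ℂ) • curryL 1 (Cn n) a with hB
  have hBv : ∀ v w, oneForm (B v) w = 1 / 2 * oneForm (a.curryLeft v) w := fun v w => rfl
  have hT : ∀ v w, oneForm (((fderiv ℂ θ z).comp (logFrame S z) - z i • B) v) w =
      oneForm (((fderiv ℂ θ z).comp (logFrame S z) - z i • B) w) v := by
    intro v w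
    have h1 := fderiv_contract_symm hc (Pi.single i 1) v w
    rw [logFrame_single hi, map_smul, ← ha] at h1
    have h2 : oneForm ((z i • a).curryLeft v) w = z i * oneForm (a.curryLeft v) w := rfl
    rw [h2] at h1
    have h3 := oneForm_curryLeft_swap a v w
    simp only [_root_.sub_apply, _root_.smul_apply, _root_.map_sub, map_smul, hBv, smul_eq_mul,
      ContinuousLinearMap.comp_apply, θ, fderiv_contract hh]
    linear_combination h1 + z i / 2 * h3
  have h4 := alternatize_wedge_of_symmetric _ hT (A z)
  rw [ContinuousLinearMap.comp_sub, alternatize_sub, sub_eq_zero] at h4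
  rw [h4]
  congr 1
  ext v : 1
  simp only [ContinuousLinearMap.comp_apply, ContinuousLinearMap.flip_apply, _root_.smul_apply,
    map_smul]

section

attribute [local irreducible] curryL

lemma Hol.curryL {a : Cn n → E [⋀^Fin (k + 1)]→L[ℂ] ℂ} (ha : Hol a z₀) :
    Hol (fun z => curryL k E (a z)) z₀ :=
  Hol.clm_comp (G := E →L[ℂ] E [⋀^Fin k]→L[ℂ] ℂ) (LogSymp.curryL k E) ha

end

lemma hol_half_curry {h : Cn n → (Cn n) [⋀^Fin 2]→L[ℂ] ℂ} (hh : Hol h z₀) (i : Fin n) :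
    Hol (fun z => (1 / 2 : ℂ) • curryL 1 (Cn n) (fderiv ℂ h z (Pi.single i (1 : ℂ)))) z₀ := by
  have h1 : Hol (fun z => fderiv ℂ h z (Pi.single i (1 : ℂ))) z₀ :=
    hh.fderiv_apply (Hol.const _)
  exact (Hol.const (1 / 2 : ℂ)).smul h1.curryL

lemma hol_flip_wedge {a : Cn n → E [⋀^Fin k]→L[ℂ] ℂ} (ha : Hol a z₀) :
    Hol (fun z => (wedgeL k).flip (a z)) z₀ := by
  have := Hol.clm_comp (G := (E [⋀^Fin 1]→L[ℂ] ℂ) →L[ℂ] E [⋀^Fin (k + 1)]→L[ℂ] ℂ)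
    (wedgeL (E := E) k).flip ha
  exact this

/-- The derivative of a product with the contraction of a closed form. -/
lemma Polar.logD_wedge_contract (hi : i ∈ S) {h : Cn n → (Cn n) [⋀^Fin 2]→L[ℂ] ℂ}
    (hh : Hol h z₀) (hc : ∀ᶠ z in 𝓝 z₀, LogSymp.logD S h z = 0)
    {A : Cn n → (Cn n) [⋀^Fin k]→L[ℂ] ℂ} (hA : Polar S i A z₀) :
    LogHol S (fun z =>
      LogSymp.logD S (fun x => LogSymp.wedge ((h x).curryLeft (Pi.single i 1)) (A x)) z +
      LogSymp.wedge ((h z).curryLeft (Pi.single i 1)) (LogSymp.logD S A z)) z₀ := by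
  have hA' := hA
  obtain ⟨a, ha, ha'⟩ := hA
  have h2 := hol_half_curry hh i
  have h4 := hol_flip_wedge ha
  have h5 : Hol (fun z => ((wedgeL k).flip (a z)).comp
      ((1 / 2 : ℂ) • curryL 1 (Cn n) (fderiv ℂ h z (Pi.single i 1)))) z₀ := h4.clm_comp₂ h2
  have h6 : Hol (fun z => alternatizeUncurryFin (((wedgeL k).flip (a z)).comp
      ((1 / 2 : ℂ) • curryL 1 (Cn n) (fderiv ℂ h z (Pi.single i 1))))) z₀ :=
    h5.clm_comp (alternatizeUncurryFinCLM ℂ (Cn n) ℂ)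
  refine h6.logHol.congr ?_
  filter_upwards [ha', hh.filter_mono nhdsWithin_le_nhds, hc.filter_mono nhdsWithin_le_nhds,
    hA'.eventually_hol hi] with z e1 e2 e3 e4
  rw [LogSymp.logD_wedge_contract hi e2 e3 e4.differentiableAt, sub_add_cancel, e1]

/-! ### Division by a nonvanishing `1`-form -/

lemma eq_of_wedge_zero {θ : E [⋀^Fin 1]→L[ℂ] ℂ} {u : E} (hu : oneForm θ u ≠ 0)
    (A : E [⋀^Fin 0]→L[ℂ] ℂ) : A = (oneForm θ u)⁻¹ • (wedge θ A).curryLeft u := by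
  rw [curryLeft_wedge_zero, inv_smul_smul₀ hu]

/-- The Koszul homotopy: contraction by a vector `u` with `θ(u) ≠ 0` inverts the product with `θ` up
to a multiple of `θ`. It yields the divisions by `θ` below, with quotient `θ(u)⁻¹` times the
contraction of `A`. -/
lemma eq_of_wedge_succ {θ : E [⋀^Fin 1]→L[ℂ] ℂ} {u : E} (hu : oneForm θ u ≠ 0)
    (A : E [⋀^Fin (k + 1)]→L[ℂ] ℂ) : A = (oneForm θ u)⁻¹ • (wedge θ A).curryLeft u +
      wedge θ ((oneForm θ u)⁻¹ • A.curryLeft u) := by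
  rw [curryLeft_wedge, smul_sub, inv_smul_smul₀ hu, wedge_smul, sub_add_cancel]

/-- Evaluation of `1`-forms. -/
def evalOne (u : E) : (E [⋀^Fin 1]→L[ℂ] ℂ) →L[ℂ] ℂ := (ContinuousLinearMap.apply ℂ ℂ u).comp oneForm

lemma evalOne_apply (u : E) (θ : E [⋀^Fin 1]→L[ℂ] ℂ) : evalOne u θ = oneForm θ u := rfl

lemma Hol.oneForm {θ : Cn n → E [⋀^Fin 1]→L[ℂ] ℂ} (hθ : Hol θ z₀) (u : E) :
    Hol (fun z => oneForm (θ z) u) z₀ := by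
  simp only [← evalOne_apply]
  exact hθ.clm_comp (evalOne u)

lemma Hol.oneForm_inv {θ : Cn n → E [⋀^Fin 1]→L[ℂ] ℂ} (hθ : Hol θ z₀) {u : E}
    (hu : LogSymp.oneForm (θ z₀) u ≠ 0) : Hol (fun z => (LogSymp.oneForm (θ z) u)⁻¹) z₀ :=
  (hθ.oneForm u).inv hu

lemma Hol.eventually_oneForm_ne {θ : Cn n → E [⋀^Fin 1]→L[ℂ] ℂ} (hθ : Hol θ z₀) {u : E}
    (hu : LogSymp.oneForm (θ z₀) u ≠ 0) : ∀ᶠ z in 𝓝 z₀, LogSymp.oneForm (θ z) u ≠ 0 :=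
  (hθ.oneForm u).continuousAt.eventually_ne hu

lemma Polar.logHol_of_wedge_zero {θ : Cn n → E [⋀^Fin 1]→L[ℂ] ℂ} (hθ : Hol θ z₀) {u : E}
    (hu : oneForm (θ z₀) u ≠ 0) {A : Cn n → E [⋀^Fin 0]→L[ℂ] ℂ}
    (h : LogHol S (fun z => LogSymp.wedge (θ z) (A z)) z₀) : LogHol S A z₀ := by
  refine ((hθ.oneForm_inv hu).logHol.smul (h.curryLeft (LogHol.const u))).congr ?_
  filter_upwards [(hθ.eventually_oneForm_ne hu).filter_mono nhdsWithin_le_nhds] with z hz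
    using eq_of_wedge_zero hz _

lemma Polar.exists_sub_wedge {θ : Cn n → E [⋀^Fin 1]→L[ℂ] ℂ} (hθ : Hol θ z₀) {u : E}
    (hu : oneForm (θ z₀) u ≠ 0) {A : Cn n → E [⋀^Fin (k + 1)]→L[ℂ] ℂ} (hA : Polar S i A z₀)
    (h : LogHol S (fun z => LogSymp.wedge (θ z) (A z)) z₀) :
    ∃ B : Cn n → E [⋀^Fin k]→L[ℂ] ℂ, Polar S i B z₀ ∧
      LogHol S (fun z => A z - LogSymp.wedge (θ z) (B z)) z₀ := by
  refine ⟨fun z => (oneForm (θ z) u)⁻¹ • (A z).curryLeft u,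
    Polar.smul (hθ.oneForm_inv hu).logHol (hA.curryLeft (LogHol.const u)),
    ((hθ.oneForm_inv hu).logHol.smul (h.curryLeft (LogHol.const u))).congr ?_⟩
  filter_upwards [(hθ.eventually_oneForm_ne hu).filter_mono nhdsWithin_le_nhds] with z hz
  rw [sub_eq_iff_eq_add]
  exact eq_of_wedge_succ hz _

lemma LogHol.exists_eq_wedge {θ : Cn n → E [⋀^Fin 1]→L[ℂ] ℂ} (hθ : Hol θ z₀) {u : E}
    (hu : oneForm (θ z₀) u ≠ 0) {A : Cn n → E [⋀^Fin (k + 1)]→L[ℂ] ℂ} (hA : LogHol S A z₀)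
    (h : ∀ᶠ z in 𝓝[Off S] z₀, LogSymp.wedge (θ z) (A z) = 0) :
    ∃ B : Cn n → E [⋀^Fin k]→L[ℂ] ℂ, Hol B z₀ ∧
      ∀ᶠ z in 𝓝[Off S] z₀, A z = LogSymp.wedge (θ z) (B z) := by
  obtain ⟨a, ha, ha'⟩ := hA
  refine ⟨fun z => (oneForm (θ z) u)⁻¹ • (a z).curryLeft u,
    (hθ.oneForm_inv hu).smul (ha.curryLeft (Hol.const u)), ?_⟩
  filter_upwards [(hθ.eventually_oneForm_ne hu).filter_mono nhdsWithin_le_nhds, h, ha']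
    with z h1 h2 h3
  rw [← h3]
  have h4 := eq_of_wedge_succ h1 (A z)
  rw [h2, ← contract_apply, _root_.map_zero, smul_zero, zero_add] at h4
  exact h4

end ClosedContraction

/-! ### The log-symplectic form in an adapted chart -/

section SymplecticCoordinates

open Filter ContinuousAlternatingMap

variable {m : ℕ} {Y : Type} [TopologicalSpace Y] [ChartedSpace (Cn m) Y]
  [IsManifold 𝓘(ℂ, Cn m) ω Y] {D : Set Y} {e : OpenPartialHomeomorph Y (Cn m)}
  {S : Finset (Fin m)} {y : Y} {Φ : Form m 2 Y}

/-- The map `h` gives the coefficients of a log-symplectic form in an adapted chart. -/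
structure SympCoord (Φ : Form m 2 Y) (e : OpenPartialHomeomorph Y (Cn m)) (S : Finset (Fin m))
    (y : Y) (h : Cn m → (Cn m) [⋀^Fin 2]→L[ℂ] ℂ) : Prop where
  hol : Hol h (e y)
  eq : ∀ᶠ z in 𝓝[Off S] (e y), logCoord e S Φ z = h z
  closed : ∀ᶠ z in 𝓝 (e y), logD S h z = 0
  nondegenerate : ∀ i : Fin m, ∃ u, oneForm ((h (e y)).curryLeft (Pi.single i 1)) u ≠ 0

/-- Closedness is given only off `D`; since the coefficients are holomorphic, their frame derivative
vanishes along `D` too. Nondegeneracy is used only for the frame vectors: it says that each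
contraction by one of them is nonzero at the point. -/
lemma IsLogSymplectic.exists_sympCoord (hΦ : IsLogSymplectic D Φ) (h : Adapted D e S y) :
    ∃ a, SympCoord Φ e S y a := by
  obtain ⟨a, ha⟩ := hΦ.log y e S h
  have ha' := (logCoeff_iff h).1 ha
  refine ⟨a, ha'.1, ha'.2, ?_, fun i => ?_⟩
  · refine Hol.eq_of_eq_Off ha'.1.logD (Hol.const _) (S := S) ?_
    have h1 : LogHol S (logCoord e S Φ) (e y) := ⟨a, ha'⟩
    filter_upwards [h.logCoord_dForm h1.eventually_hol, eventually_of_Off ha'.2,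
      h.nhds.filter_mono nhdsWithin_le_nhds, self_mem_nhdsWithin] with z h2 h3 h4 h5
    rw [← logD_congr h3, ← h2, logCoord, inChart, hΦ.closed _ (h4.2.2 h5)]
    rfl
  · obtain ⟨w, hw⟩ := hΦ.nondegenerate y e S a h ha (Pi.single i 1) (by
      intro h0
      simpa using congrFun h0 i)
    exact ⟨w, by rwa [oneForm_curryLeft]⟩

end SymplecticCoordinates

/-! ### Residue fields and polar forms in coordinates -/

section PolarVanish

open Filter ContinuousAlternatingMap

variable {n k : ℕ} {E F : Type*} [NormedAddCommGroup E] [NormedSpace ℂ E]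
  [NormedAddCommGroup F] [NormedSpace ℂ F] {S : Finset (Fin n)} {i : Fin n} {z₀ : Cn n}

lemma Polar.curryLeft_vanish [CompleteSpace E] {A : Cn n → E [⋀^Fin (k + 1)]→L[ℂ] ℂ} {c : Cn n → E}
    (H : Polar S i A z₀) (hc : Hol c z₀) (h0 : ∀ᶠ z in 𝓝 z₀, z i = 0 → c z = 0) :
    LogHol S (fun z => (A z).curryLeft (c z)) z₀ := by
  obtain ⟨b, hb, hb'⟩ := hc.exists_eq_smul h0
  refine (LogHol.curryLeft (A := fun z => z i • A z) H hb.logHol).congr ?_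
  filter_upwards [hb'.filter_mono nhdsWithin_le_nhds] with z hz
  rw [hz, map_smul]
  rfl

/-- The zero of `c` along the hyperplane cancels the simple pole of `A`. Together with the analogue
for contractions, this is why changes of chart do not matter modulo log forms. -/
lemma Polar.wedge_vanish {A : Cn n → E [⋀^Fin k]→L[ℂ] ℂ} {c : Cn n → E [⋀^Fin 1]→L[ℂ] ℂ}
    (H : Polar S i A z₀) (hc : Hol c z₀) (h0 : ∀ᶠ z in 𝓝 z₀, z i = 0 → c z = 0) :
    LogHol S (fun z => LogSymp.wedge (c z) (A z)) z₀ := by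
  obtain ⟨b, hb, hb'⟩ := hc.exists_eq_smul h0
  refine (LogHol.wedge (a := fun z => z i • A z) hb.logHol H).congr ?_
  filter_upwards [hb'.filter_mono nhdsWithin_le_nhds] with z hz
  rw [hz, smul_wedge, wedge_smul]

end PolarVanish

section Residue

open Filter ContinuousAlternatingMap

variable {m : ℕ} {X X₁ : Type} [TopologicalSpace X] [ChartedSpace (Cn (m + 1)) X]
  [IsManifold 𝓘(ℂ, Cn (m + 1)) ω X] [TopologicalSpace X₁] [ChartedSpace (Cn m) X₁]
  [IsManifold 𝓘(ℂ, Cn m) ω X₁] {D : Set X} {f : X₁ → X} {N N' : NormChart (m := m) D f}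
  {i i' : Fin (m + 1)} {q : X₁} {k : ℕ} {Φ : Form (m + 1) 2 X}

namespace NormChart

/-- The residue field `x_i ∂_i`. -/
def res (N : NormChart (m := m) D f) (i : Fin (m + 1)) : X → Cn (m + 1) :=
  fieldOf N.e N.S fun _ => Pi.single i 1

/-- The form `⟨Φ, x_i ∂_i⟩`. -/
def psi (N : NormChart (m := m) D f) (Φ : Form (m + 1) 2 X) (i : Fin (m + 1)) :
    Form (m + 1) 1 X := interior Φ (N.res i)

lemma logVec_res {z : Cn (m + 1)} (hz : z ∈ N.e.target) (hS : z ∈ Off N.S) :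
    logVec N.e N.S (N.res i) z = Pi.single i 1 := logVec_fieldOf N.e_mem _ hz hS

lemma logCoord_psi {z : Cn (m + 1)} (hz : z ∈ N.e.target) (hS : z ∈ Off N.S) :
    logCoord N.e N.S (N.psi Φ i) z = (logCoord N.e N.S Φ z).curryLeft (Pi.single i 1) := by
  rw [psi, logCoord_interior N.e_mem Φ _ hz hS, logVec_res hz hS]

lemma eventually_logCoord_psi {p : X} (hp : p ∈ N.e.source)
    {a : Cn (m + 1) → (Cn (m + 1)) [⋀^Fin 2]→L[ℂ] ℂ} (ha : SympCoord Φ N.e N.S p a)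
    (i : Fin (m + 1)) : ∀ᶠ z in 𝓝[Off N.S] (N.e p),
      logCoord N.e N.S (N.psi Φ i) z = (a z).curryLeft (Pi.single i 1) := by
  filter_upwards [ha.eq, (N.adapted hp).nhds.filter_mono nhdsWithin_le_nhds,
    self_mem_nhdsWithin] with z h1 h2 h3
  rw [logCoord_psi h2.1 h3, h1]

lemma psi_mem_logForms (hΦ : IsLogSymplectic D Φ) {p : X} (hp : p ∈ N.e.source)
    (i : Fin (m + 1)) : N.psi Φ i ∈ logForms D 1 p := by
  obtain ⟨a, ha⟩ := hΦ.exists_sympCoord (N.adapted hp)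
  rw [mem_logForms_iff (N.adapted hp)]
  exact ⟨_, ha.hol.curryLeft (Hol.const _), eventually_logCoord_psi hp ha i⟩

/-- The coordinate `x_i` is an equation of the `i`-th branch. -/
lemma On.branchEq (h : N.On i q) : BranchEq (m := m) f q fun x => N.e x i := by
  have h1 : (fun z => N.e (N.e.symm z) i) =ᶠ[𝓝 (N.e (f q))]
      (ContinuousLinearMap.proj i : Cn (m + 1) →L[ℂ] ℂ) := by
    filter_upwards [N.e.open_target.mem_nhds (N.e.map_source h.maps)] with z hz
    rw [N.e.right_inv hz]
    rfl
  have h2 : Hol (fun z => N.e (N.e.symm z) i) (N.e (f q)) := (hol_proj i _).congr h1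
  refine ⟨(holFun_iff N.e_mem h.maps).2 h2, ?_, fun h0 => ?_⟩
  · filter_upwards [h.nhds] with q' hq' using hq'.coord_eq_zero
  · rw [dFun_eq N.e_mem h.maps h2.differentiableAt, h1.fderiv_eq,
      ContinuousLinearMap.fderiv] at h0
    have h3 := DFunLike.congr_fun h0 (chartInvDeriv N.e (N.e (f q)) (Pi.single i 1))
    have h4 := chartDeriv_chartInvDeriv N.e_mem (N.e.map_source h.maps) (Pi.single i 1)
    rw [N.e.left_inv h.maps] at h4
    rw [ContinuousLinearMap.comp_apply, h4] at h3
    simp at h3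

/-- Enough to compare pole conditions for different equations: the coordinate `x_i` is itself a
branch equation, and every other one is a holomorphic multiple of it. -/
lemma On.exists_branchEq (h : N.On i q) {x : X → ℂ} (hx : BranchEq (m := m) f q x) :
    ∃ b, Hol b (N.e (f q)) ∧ ∀ᶠ z in 𝓝 (N.e (f q)), x (N.e.symm z) = z i • b z := by
  refine ((holFun_iff N.e_mem h.maps).1 hx.1).exists_eq_smul ?_
  rw [← h.eventually_iff (P := fun z => x (N.e.symm z) = 0)]
  filter_upwards [hx.2.1, h.nhds] with q' h1 h2
  rwa [N.e.left_inv h2.maps]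

/-- Polar forms in coordinates. -/
lemma On.mem_polarForms_iff (h : N.On i q) {α : Form (m + 1) k X} :
    α ∈ polarForms (m := m) D f k q ↔ Polar N.S i (logCoord N.e N.S α) (N.e (f q)) := by
  constructor
  · intro hα
    have h1 := (mem_logForms_iff h.adapted).1 (hα _ h.branchEq)
    refine LogHol.congr h1 ?_
    filter_upwards [h.adapted.nhds.filter_mono nhdsWithin_le_nhds] with z hz
    rw [logCoord_fun_smul (fun x => N.e x i), N.e.right_inv hz.1]
  · intro H x hx
    obtain ⟨b, h1, h2⟩ := h.exists_branchEq hx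
    refine (mem_logForms_iff h.adapted).2 ((LogHol.smul h1.logHol H).congr ?_)
    filter_upwards [h2.filter_mono nhdsWithin_le_nhds] with z hz
    rw [logCoord_fun_smul, hz, smul_smul, smul_eq_mul, mul_comm]

lemma On.logForms_le_polarForms (h : N.On i q) :
    logForms D k (f q) ≤ polarForms (m := m) D f k q := fun _ hα =>
  h.mem_polarForms_iff.2 ((mem_logForms_iff h.adapted).1 hα).polar

lemma On.eventually_mem_polarForms (h : N.On i q) {α : Form (m + 1) k X}
    (hα : α ∈ polarForms (m := m) D f k q) :
    ∀ᶠ q' in 𝓝 q, α ∈ polarForms (m := m) D f k q' := by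
  have h1 := (h.mem_polarForms_iff.1 hα).eventually
  have h2 : ContinuousAt (fun q' => N.e (f q')) q :=
    ContinuousAt.comp (g := N.e) (N.e.continuousAt h.maps) h.continuousAt
  filter_upwards [h2.eventually h1, h.nhds] with q' h3 h4
  exact h4.mem_polarForms_iff.2 h3

/-- A polar form which is a log form generically along the branch is a log form. -/
lemma On.mem_logForms_of_generic (h : N.On i q) {α : Form (m + 1) k X}
    (hα : α ∈ polarForms (m := m) D f k q)
    (hg : ∀ᶠ q' in 𝓝[(inducedDivisor f)ᶜ] q, α ∈ logForms D k (f q')) :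
    α ∈ logForms D k (f q) := by
  rw [mem_logForms_iff h.adapted]
  refine (h.mem_polarForms_iff.1 hα).logHol_of_generic h.1
    (h.eventually_generic_iff.1 ?_)
  filter_upwards [hg, h.nhds.filter_mono nhdsWithin_le_nhds] with q' h1 h2
  exact (mem_logForms_iff h2.adapted).1 h1

/-- The residue field is a co-residue field. -/
lemma On.res_mem (h : N.On i q) : N.res i ∈ coresidueFields (m := m) f q := by
  have key : ∀ {x}, x ∈ N.e.source →
      chartDeriv N.e x (N.res i x) = logFrame N.S (N.e x) (Pi.single i 1) := by
    intro x hx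
    have := vecInChart_fieldOf (S := N.S) N.e_mem (fun _ => Pi.single i (1 : ℂ))
      (N.e.map_source hx)
    rwa [vecInChart, N.e.left_inv hx] at this
  refine ⟨(holField_iff N.e_mem h.maps).2 ?_, ?_, ?_⟩
  · refine ((hol_logFrame N.S _).clm_apply (Hol.const (Pi.single i (1 : ℂ)))).congr ?_
    filter_upwards [N.e.open_target.mem_nhds (N.e.map_source h.maps)] with z hz
    exact vecInChart_fieldOf N.e_mem _ hz
  · rw [eventually_comap]
    filter_upwards [N.e.open_source.mem_nhds h.maps] with x hx q' hq'
    subst hq'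
    obtain ⟨j, hj⟩ := N.exists_on hx
    rw [hj.mem_range_dMap, key hx, logFrame_single h.1]
    by_cases hji : j = i
    · subst hji
      simp [hj.coord_eq_zero]
    · simp [hji]
  · filter_upwards [h.nhds] with q' hq'
    rw [res, fieldOf, logFrame_single h.1, hq'.coord_eq_zero, zero_smul, _root_.map_zero]

/-- Co-residue fields in coordinates. -/
lemma On.coresidue_coord (h : N.On i q) {v : X → Cn (m + 1)}
    (hv : v ∈ coresidueFields (m := m) f q) :
    ∃ w, Hol w (N.e (f q)) ∧
      (∀ᶠ z in 𝓝 (N.e (f q)), vecInChart N.e v z = logFrame N.S z (w z)) ∧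
      ∀ᶠ z in 𝓝 (N.e (f q)), z i = 0 → w z = w z i • Pi.single i 1 := by
  obtain ⟨h1, h2, h3⟩ := hv
  set V := vecInChart N.e v with hV
  have V_hol : Hol V (N.e (f q)) := (holField_iff N.e_mem h.maps).1 h1
  have hVj : ∀ j, Hol (fun z => V z j) (N.e (f q)) := fun j =>
    V_hol.clm_comp (ContinuousLinearMap.proj j : Cn (m + 1) →L[ℂ] ℂ)
  have V_zero : ∀ᶠ z in 𝓝 (N.e (f q)), z i = 0 → V z = 0 := by
    rw [← h.eventually_iff (P := fun z => V z = 0)]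
    filter_upwards [h3, h.nhds] with q' h4 h5
    rw [hV, vecInChart, N.e.left_inv h5.maps, h4, _root_.map_zero]
  -- Every point of the `j`-th hyperplane in the chart is the image of a point of the `j`-th piece
  -- of `X₁`, and there tangency to the image of `f` means that the `j`-th component vanishes.
  have V_tang : ∀ᶠ z in 𝓝 (N.e (f q)), ∀ j ∈ N.S, z j = 0 → V z j = 0 := by
    rw [eventually_comap, ← N.e.eventually_nhds' _ h.maps] at h2
    filter_upwards [h2, N.e.open_target.mem_nhds (N.e.map_source h.maps)] with z h4 h5 j hj hz
    obtain ⟨q', hq', he⟩ := N.surj j hj _ (N.e.map_target h5) (by rwa [N.e.right_inv h5])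
    have h6 := (NormChart.On.mem_range_dMap (N := N) ⟨hj, hq'⟩).1 (h4 q' he)
    rwa [he] at h6
  have comp : ∀ j, ∃ w : Cn (m + 1) → ℂ, Hol w (N.e (f q)) ∧
      (∀ᶠ z in 𝓝 (N.e (f q)), V z j = (if j ∈ N.S then z j else 1) * w z) ∧
      (j ≠ i → ∀ᶠ z in 𝓝 (N.e (f q)), z i = 0 → w z = 0) := by
    intro j
    by_cases hj : j ∈ N.S
    · obtain ⟨w, hw, hw'⟩ := (hVj j).exists_eq_smul (i := j) (by
        filter_upwards [V_tang] with z hz using hz j hj)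
      refine ⟨w, hw, by simpa [hj] using hw', fun hji => ?_⟩
      -- On `z i = 0` the product `z j * w z` vanishes, hence so does `w` where `z j ≠ 0`; the
      -- remaining points follow by continuity.
      refine hw.eq_of_eq_hyperplane (S := N.S) (Hol.const _) ?_
      filter_upwards [hw', V_zero] with z h4 h5 h6 h7
      rw [h5 h6] at h4
      have := h4.symm
      rw [Pi.zero_apply, smul_eq_mul] at this
      exact (mul_eq_zero.1 this).resolve_left (h7 j (Finset.mem_erase.2 ⟨hji, hj⟩))
    · refine ⟨fun z => V z j, hVj j, Eventually.of_forall fun z => by simp [hj], fun _ => ?_⟩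
      filter_upwards [V_zero] with z hz hz'
      rw [hz hz', Pi.zero_apply]
  choose w hw1 hw2 hw3 using comp
  refine ⟨fun z j => w j z, hol_pi hw1, ?_, ?_⟩
  · filter_upwards [eventually_all.2 hw2] with z hz
    ext j
    rw [logFrame_apply]
    exact hz j
  · have : ∀ᶠ z in 𝓝 (N.e (f q)), ∀ j, j ≠ i → z i = 0 → w j z = 0 :=
      eventually_all.2 fun j => by
        by_cases hj : j = i
        · exact Eventually.of_forall fun _ h => absurd hj h
        · filter_upwards [hw3 j hj] with z hz _ using hz
    filter_upwards [this] with z hz hzi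
    ext j
    by_cases hj : j = i
    · subst hj; simp
    · simp [hj, hz j hj hzi]

/-- Splits a co-residue field into a function times `v_i` and a log field `c` vanishing on the
branch; in products with polar forms the latter contributes only log forms. -/
lemma On.logVec_coresidue (h : N.On i q) {v : X → Cn (m + 1)}
    (hv : v ∈ coresidueFields (m := m) f q) :
    ∃ (g : Cn (m + 1) → ℂ) (c : Cn (m + 1) → Cn (m + 1)), Hol g (N.e (f q)) ∧
      Hol c (N.e (f q)) ∧ (∀ᶠ z in 𝓝 (N.e (f q)), z i = 0 → c z = 0) ∧
      ∀ᶠ z in 𝓝[Off N.S] (N.e (f q)), logVec N.e N.S v z = g z • Pi.single i 1 + c z := by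
  obtain ⟨w, h1, h2, h3⟩ := h.coresidue_coord hv
  have hg : Hol (fun z => w z i) (N.e (f q)) :=
    h1.clm_comp (ContinuousLinearMap.proj i : Cn (m + 1) →L[ℂ] ℂ)
  refine ⟨fun z => w z i, fun z => w z - w z i • Pi.single i 1, hg,
    h1.sub (hg.smul (Hol.const _)), ?_, ?_⟩
  · filter_upwards [h3] with z hz hzi
    exact sub_eq_zero.2 (hz hzi)
  · filter_upwards [h2.filter_mono nhdsWithin_le_nhds, self_mem_nhdsWithin] with z h4 h5
    rw [logVec, h4, logFrameInv_logFrame h5, add_sub_cancel]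

end NormChart

end Residue

/-! ### Multiplication and contraction as linear maps -/

section FormOperators

open Filter ContinuousAlternatingMap

variable {m k : ℕ} {Y : Type}

/-- Multiplication by a `1`-form. -/
def wedgeForm (θ : Form m 1 Y) : Form m k Y →ₗ[ℂ] Form m (k + 1) Y where
  toFun α := fun x => wedge (θ x) (α x)
  map_add' _ _ := funext fun _ => wedge_add _ _ _
  map_smul' _ _ := funext fun _ => wedge_smul _ _ _

/-- Interior multiplication by a vector field. -/
def contractForm (ξ : Y → Cn m) : Form m (k + 1) Y →ₗ[ℂ] Form m k Y where
  toFun α := fun x => (α x).curryLeft (ξ x)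
  map_add' _ _ := rfl
  map_smul' _ _ := rfl

/-- Multiplication by a function. -/
def mulForm (g : Y → ℂ) : Form m k Y →ₗ[ℂ] Form m k Y where
  toFun α := fun x => g x • α x
  map_add' _ _ := funext fun _ => smul_add _ _ _
  map_smul' c α := funext fun x => smul_comm (g x) c (α x)

variable [TopologicalSpace Y] [ChartedSpace (Cn m) Y] [IsManifold 𝓘(ℂ, Cn m) ω Y]
  {e : OpenPartialHomeomorph Y (Cn m)}
  {S : Finset (Fin m)}

lemma logCoord_wedgeForm (θ : Form m 1 Y) (α : Form m k Y) (z : Cn m) :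
    logCoord e S (wedgeForm θ α) z = wedge (logCoord e S θ z) (logCoord e S α z) :=
  logCoord_wedge θ α z

end FormOperators

/-! ### The denominators of the branch complex -/

section PsiForms

open Filter ContinuousAlternatingMap

variable {m : ℕ} {X X₁ : Type} [TopologicalSpace X] [ChartedSpace (Cn (m + 1)) X]
  [IsManifold 𝓘(ℂ, Cn (m + 1)) ω X] [TopologicalSpace X₁] [ChartedSpace (Cn m) X₁]
  [IsManifold 𝓘(ℂ, Cn m) ω X₁] {D : Set X} {f : X₁ → X} {N N' : NormChart (m := m) D f}
  {i i' : Fin (m + 1)} {q : X₁} {k : ℕ} {Φ : Form (m + 1) 2 X}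

namespace NormChart

/-- The contraction of `Φ` by a co-residue field is a multiple of the canonical one. -/
lemma On.interior_coresidue (hΦ : IsLogSymplectic D Φ) (h : N.On i q) {v : X → Cn (m + 1)}
    (hv : v ∈ coresidueFields (m := m) f q) :
    ∃ g : Cn (m + 1) → ℂ, Hol g (N.e (f q)) ∧ ∀ (k : ℕ), ∀ α ∈ polarForms (m := m) D f k q,
      LogHol N.S (fun z => logCoord N.e N.S (wedgeForm (interior Φ v) α) z -
        g z • logCoord N.e N.S (wedgeForm (N.psi Φ i) α) z) (N.e (f q)) := by
  obtain ⟨a, ha⟩ := hΦ.exists_sympCoord h.adapted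
  obtain ⟨g, c, hg, hc, hc0, hgc⟩ := h.logVec_coresidue hv
  refine ⟨g, hg, fun k α hα => ?_⟩
  refine (Polar.wedge_vanish (h.mem_polarForms_iff.1 hα) (ha.hol.curryLeft hc) (by
    filter_upwards [hc0] with z hz hzi
    rw [hz hzi, _root_.map_zero])).congr ?_
  filter_upwards [hgc, ha.eq, eventually_logCoord_psi h.maps ha i,
    h.adapted.nhds.filter_mono nhdsWithin_le_nhds, self_mem_nhdsWithin] with z h1 h2 h3 h4 h5
  rw [logCoord_wedgeForm, logCoord_wedgeForm, h3, logCoord_interior N.e_mem Φ v h4.1 h5, h1, h2,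
    _root_.map_add, map_smul, add_wedge, smul_wedge, add_sub_cancel_left]

lemma polar_wedge_psi (hΦ : IsLogSymplectic D Φ) {p : X} (hp : p ∈ N.e.source)
    (j : Fin (m + 1)) {α : Form (m + 1) k X} (hα : Polar N.S i (logCoord N.e N.S α) (N.e p)) :
    Polar N.S i (logCoord N.e N.S (wedgeForm (N.psi Φ j) α)) (N.e p) := by
  have h1 := (mem_logForms_iff (N.adapted hp)).1 (psi_mem_logForms hΦ hp j)
  refine (Polar.wedge h1 hα).congr (Eventually.of_forall fun z => ?_)
  rw [logCoord_wedgeForm]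

lemma On.wedge_psi_mem_polarForms (hΦ : IsLogSymplectic D Φ) (h : N.On i q) (j : Fin (m + 1))
    {α : Form (m + 1) k X} (hα : α ∈ polarForms (m := m) D f k q) :
    wedgeForm (N.psi Φ j) α ∈ polarForms (m := m) D f (k + 1) q := by
  rw [h.mem_polarForms_iff] at hα ⊢
  exact polar_wedge_psi hΦ h.maps j hα

lemma wedge_psi_mem_logForms (hΦ : IsLogSymplectic D Φ) {p : X} (hp : p ∈ N.e.source)
    (j : Fin (m + 1)) {α : Form (m + 1) k X} (hα : α ∈ logForms D k p) :
    wedgeForm (N.psi Φ j) α ∈ logForms D (k + 1) p := by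
  rw [mem_logForms_iff (N.adapted hp)] at hα ⊢
  have h1 := (mem_logForms_iff (N.adapted hp)).1 (psi_mem_logForms hΦ hp j)
  refine (LogHol.wedge h1 hα).congr (Eventually.of_forall fun z => ?_)
  rw [logCoord_wedgeForm]

/-- The form with given polar log coordinates. -/
lemma On.formOf_mem_polarForms (h : N.On i q) {A : Cn (m + 1) → (Cn (m + 1)) [⋀^Fin k]→L[ℂ] ℂ}
    (hA : Polar N.S i A (N.e (f q))) :
    formOf N.e N.S A ∈ polarForms (m := m) D f k q := by
  rw [h.mem_polarForms_iff]
  refine hA.congr ?_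
  filter_upwards [h.adapted.nhds.filter_mono nhdsWithin_le_nhds, self_mem_nhdsWithin]
    with z h1 h2 using logCoord_formOf N.e_mem A h1.1 h2

/-- The forms that vanish in `N_f ⊗ Λ^k (f^* Ω^1⟨log D⟩ / 𝓞 ψ)`. -/
theorem On.mem_psiForms_iff (hΦ : IsLogSymplectic D Φ) (h : N.On i q) {γ : Form (m + 1) k X} :
    γ ∈ psiForms (m := m) D Φ f k q ↔ γ ∈ polarForms (m := m) D f k q ∧
      wedgeForm (N.psi Φ i) γ ∈ logForms D (k + 1) (f q) := by
  obtain ⟨a, ha⟩ := hΦ.exists_sympCoord h.adapted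
  obtain ⟨u, hu⟩ := ha.nondegenerate i
  have hθ : Hol (fun z => (a z).curryLeft (Pi.single i 1)) (N.e (f q)) :=
    ha.hol.curryLeft (Hol.const _)
  have hψ := eventually_logCoord_psi h.maps ha i
  constructor
  · intro hγ
    have log_case : ∀ {l : ℕ} {β : Form (m + 1) l X}, β ∈ logForms D l (f q) →
        β ∈ polarForms (m := m) D f l q ∧
          wedgeForm (N.psi Φ i) β ∈ logForms D (l + 1) (f q) := fun hβ =>
      ⟨h.logForms_le_polarForms hβ, wedge_psi_mem_logForms hΦ h.maps i hβ⟩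
    cases k with
    | zero => exact log_case hγ
    | succ k =>
      let Q := polarForms (m := m) D f (k + 1) q ⊓
        (logForms D (k + 2) (f q)).comap (wedgeForm (N.psi Φ i))
      have hle : psiForms (m := m) D Φ f (k + 1) q ≤ Q := by
        refine sup_le (fun β hβ => log_case hβ) (Submodule.span_le.2 ?_)
        rintro _ ⟨v, hv, α, hα, rfl⟩
        obtain ⟨g, hg, hgα⟩ := h.interior_coresidue hΦ hv
        have hB := hgα k α hα
        have hα' := h.wedge_psi_mem_polarForms hΦ i hα
        constructor
        · refine h.mem_polarForms_iff.2 (((Polar.smul hg.logHol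
            (h.mem_polarForms_iff.1 hα')).add hB.polar).congr (Eventually.of_forall fun z => ?_))
          exact (add_sub_cancel _ _).symm
        · refine (mem_logForms_iff h.adapted).2 ((LogHol.wedge hθ.logHol hB).congr ?_)
          filter_upwards [hψ] with z hz
          -- The multiple of `ψ` that may have a pole is killed by `ψ ∧ ψ = 0`.
          have e1 : wedge ((a z).curryLeft (Pi.single i 1))
              (logCoord N.e N.S (wedgeForm (N.psi Φ i) α) z) = 0 := by
            rw [logCoord_wedgeForm, hz, wedge_wedge_self]
          rw [logCoord_wedgeForm, hz, wedge_sub, wedge_smul, e1]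
          exact (sub_eq_self.2 (smul_zero _)).symm
      exact hle hγ
  · rintro ⟨h1, h2⟩
    have h1' := h.mem_polarForms_iff.1 h1
    have h2' : LogHol N.S (fun z => wedge ((a z).curryLeft (Pi.single i 1))
        (logCoord N.e N.S γ z)) (N.e (f q)) := by
      refine ((mem_logForms_iff h.adapted).1 h2).congr ?_
      filter_upwards [hψ] with z hz
      rw [logCoord_wedgeForm, hz]
    cases k with
    | zero => exact (mem_logForms_iff h.adapted).2 (Polar.logHol_of_wedge_zero hθ hu h2')
    | succ k =>
      -- As `ψ ∧ γ` has no pole and `ψ` does not vanish, Koszul division writes `γ` as a log form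
      -- plus `ψ ∧ B` with `B` polar.
      obtain ⟨B, hB, hB'⟩ := Polar.exists_sub_wedge hθ hu h1' h2'
      have h3 : γ - wedgeForm (N.psi Φ i) (formOf N.e N.S B) ∈ logForms D (k + 1) (f q) := by
        refine (mem_logForms_iff h.adapted).2 (hB'.congr ?_)
        filter_upwards [hψ, h.adapted.nhds.filter_mono nhdsWithin_le_nhds, self_mem_nhdsWithin]
          with z h4 h5 h6
        rw [logCoord_sub, logCoord_wedgeForm, h4, logCoord_formOf N.e_mem B h5.1 h6]
      rw [← sub_add_cancel γ (wedgeForm (N.psi Φ i) (formOf N.e N.S B))]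
      exact Submodule.add_mem_sup h3 (Submodule.subset_span
        ⟨N.res i, h.res_mem, _, h.formOf_mem_polarForms hB, rfl⟩)

/-! ### Two charts at the same branch -/

lemma On.transition_generic (h : N.On i q) (h' : N'.On i' q) :
    ∀ᶠ z in 𝓝 (N.e (f q)), z i = 0 → z ∈ Off (N.S.erase i) →
      transition N.e N'.e z ∈ Off (N'.S.erase i') := by
  refine h.eventually_generic_iff.1 ?_
  filter_upwards [h.nhds.filter_mono nhdsWithin_le_nhds, h'.nhds.filter_mono nhdsWithin_le_nhds,
    self_mem_nhdsWithin] with q' h1 h2 h3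
  rw [Set.mem_compl_iff, h2.mem_inducedDivisor] at h3
  rw [h1.adapted.transition_self, h2.e_apply, insL_mem_Off]
  simpa [Off] using h3

/-- The normal component of the change of coordinates. -/
lemma On.transition_normal (h : N.On i q) (h' : N'.On i' q)
    {M : Cn (m + 1) → Cn (m + 1) →L[ℂ] Cn (m + 1)}
    (hM : IsLogTransition N.e N.S N'.e N'.S M (N.e (f q))) :
    ∃ r : Cn (m + 1) → ℂ, Hol r (N.e (f q)) ∧ r (N.e (f q)) ≠ 0 ∧
      (∀ᶠ z in 𝓝 (N.e (f q)), transition N.e N'.e z i' = z i * r z) ∧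
      ∀ᶠ z in 𝓝 (N.e (f q)), ∀ v,
        r z * M z v i' = fderiv ℂ r z (logFrame N.S z v) + v i * r z := by
  set φ := transition N.e N'.e with hφ
  have φ_hol : Hol φ (N.e (f q)) := h.adapted.hol_transition h'.adapted
  have φi_hol : Hol (fun z => φ z i') (N.e (f q)) :=
    φ_hol.clm_comp (ContinuousLinearMap.proj i' : Cn (m + 1) →L[ℂ] ℂ)
  -- Both charts describe the same branch through `q`, so the new equation vanishes on the old
  -- hyperplane and is `z i * r`.
  obtain ⟨r, hr, hr'⟩ := φi_hol.exists_eq_smul (i := i) (by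
    rw [← h.eventually_iff (P := fun z => φ z i' = 0)]
    filter_upwards [h.nhds, h'.nhds] with q' h1 h2
    rw [hφ, h1.adapted.transition_self, h2.coord_eq_zero])
  have hder : ∀ᶠ z in 𝓝 (N.e (f q)), ∀ u,
      fderiv ℂ φ z u i' = u i * r z + z i * fderiv ℂ r z u := by
    filter_upwards [eventually_eventually_nhds.2 hr', φ_hol, hr] with z h1 h2 h3 u
    have e1 : HasFDerivAt (fun w => φ w i') ((ContinuousLinearMap.proj i' :
        Cn (m + 1) →L[ℂ] ℂ).comp (fderiv ℂ φ z)) z :=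
      (ContinuousLinearMap.proj i' : Cn (m + 1) →L[ℂ] ℂ).hasFDerivAt.comp z h2.hasFDerivAt
    have e2 : HasFDerivAt (fun w : Cn (m + 1) => w i)
        (ContinuousLinearMap.proj i : Cn (m + 1) →L[ℂ] ℂ) z :=
      (ContinuousLinearMap.proj i : Cn (m + 1) →L[ℂ] ℂ).hasFDerivAt
    have e3 := (e1.congr_of_eventuallyEq (show (fun w : Cn (m + 1) => w i • r w) =ᶠ[𝓝 z] _ by
      filter_upwards [h1] with w hw using hw.symm)).unique (e2.smul h3.hasFDerivAt)
    have e4 := DFunLike.congr_fun e3 u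
    simp only [ContinuousLinearMap.comp_apply, ContinuousLinearMap.proj_apply,
      _root_.add_apply, _root_.smul_apply, ContinuousLinearMap.smulRight_apply, smul_eq_mul] at e4
    rw [e4]
    ring
  -- Along the branch the normal component of the differential of the change of charts is
  -- multiplication by `r`; it takes the value `1` on the preimage of the `i'`-th coordinate vector,
  -- so `r` cannot be zero.
  refine ⟨r, hr, fun h0 => ?_, hr', ?_⟩
  · have h1 := (h.adapted.fderiv_transition h'.adapted).self_of_nhds
    have h2 := hder.self_of_nhds (chartDeriv N.e (f q) (chartInvDeriv N'.e (N'.e (f q))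
      (Pi.single i' 1)))
    have h3 := chartDeriv_chartInvDeriv N'.e_mem (N'.e.map_source h'.maps) (Pi.single i' 1)
    rw [N'.e.left_inv h'.maps] at h3
    rw [h1, ContinuousLinearMap.comp_apply, N.e.left_inv h.maps,
      chartInvDeriv_chartDeriv N.e_mem h.maps, h3, h0, h.coord_eq_zero] at h2
    simp at h2
  · have hL : Hol (fun z => r z • (ContinuousLinearMap.proj i' : Cn (m + 1) →L[ℂ] ℂ).comp (M z))
        (N.e (f q)) := by
      filter_upwards [hr, hM.1] with z h1 h2
      exact h1.smul ((differentiableAt_const _).clm_comp h2)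
    have hR : Hol (fun z => (fderiv ℂ r z).comp (logFrame N.S z) +
        r z • (ContinuousLinearMap.proj i : Cn (m + 1) →L[ℂ] ℂ)) (N.e (f q)) :=
      (hr.hol_fderiv.clm_comp₂ (hol_logFrame N.S _)).add (hr.smul (Hol.const _))
    -- Off the hyperplanes the relation follows from the derivative of `z i * r` after division by
    -- `z i`; both sides are holomorphic, so it persists along the branch.
    have key := hL.eq_of_eq_Off hR (S := N.S) (by
      filter_upwards [hder.filter_mono nhdsWithin_le_nhds, hM.2.filter_mono nhdsWithin_le_nhds,
        hr'.filter_mono nhdsWithin_le_nhds, self_mem_nhdsWithin] with z h1 h2 h3 h4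
      have hzi : z i ≠ 0 := h4 i h.1
      ext v
      have e1 := congrFun (h2 v) i'
      rw [h1, logFrame_apply, logFrame_apply, if_pos h'.1, if_pos h.1] at e1
      change φ z i' * M z v i' = _ at e1
      rw [h3, smul_eq_mul] at e1
      simp only [_root_.add_apply, _root_.smul_apply, ContinuousLinearMap.comp_apply,
        ContinuousLinearMap.proj_apply, smul_eq_mul]
      refine mul_left_cancel₀ hzi ?_
      linear_combination e1)
    filter_upwards [key] with z hz v
    have := DFunLike.congr_fun hz v
    simp only [_root_.add_apply, _root_.smul_apply, ContinuousLinearMap.comp_apply,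
      ContinuousLinearMap.proj_apply, smul_eq_mul] at this
    rw [this]
    ring

/-- Along the branch, the residue fields of two charts agree. -/
lemma On.transition_single (h : N.On i q) (h' : N'.On i' q)
    {M : Cn (m + 1) → Cn (m + 1) →L[ℂ] Cn (m + 1)}
    (hM : IsLogTransition N.e N.S N'.e N'.S M (N.e (f q))) :
    ∀ᶠ z in 𝓝 (N.e (f q)), z i = 0 → M z (Pi.single i 1) = Pi.single i' 1 := by
  obtain ⟨r, hr, hr0, -, hrM⟩ := h.transition_normal h' hM
  refine Hol.eq_of_eq_hyperplane (S := N.S) (hM.1.clm_apply (Hol.const _)) (Hol.const _) ?_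
  filter_upwards [hr.continuousAt.eventually_ne hr0, hrM, hM.2, h.transition_generic h']
    with z h1 h2 h3 h4 h5 h6
  ext j
  -- The vector `x_i ∂_i` is zero on the branch, so the ordinary differential of the change of
  -- charts gives `0`. Where the other coordinates do not vanish this kills the components `j ≠ i'`;
  -- the `i'`-th one is read off from the normal relation.
  have e1 : logFrame N.S z (Pi.single i 1) = 0 := by rw [logFrame_single h.1, h5, zero_smul]
  by_cases hj : j = i'
  · subst hj
    have := h2 (Pi.single i 1)
    rw [e1, _root_.map_zero, Pi.single_eq_same, zero_add, one_mul] at this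
    rw [Pi.single_eq_same]
    exact mul_left_cancel₀ h1 (by rw [this, mul_one])
  · have := congrFun (h3 (Pi.single i 1)) j
    rw [e1, _root_.map_zero, logFrame_apply, Pi.zero_apply] at this
    rw [Pi.single_eq_of_ne hj]
    refine (mul_eq_zero.1 this).resolve_left ?_
    split_ifs with hjS
    · exact h4 h5 h6 j (Finset.mem_erase.2 ⟨hj, hjS⟩)
    · exact one_ne_zero

/-- The residue field of a chart in the coordinates of another chart. -/
lemma On.logVec_res (h : N.On i q) (h' : N'.On i' q) :
    ∃ c : Cn (m + 1) → Cn (m + 1), Hol c (N.e (f q)) ∧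
      (∀ᶠ z in 𝓝 (N.e (f q)), z i = 0 → c z = 0) ∧
      ∀ᶠ z in 𝓝[Off N.S] (N.e (f q)), logVec N.e N.S (N'.res i') z = Pi.single i 1 + c z := by
  obtain ⟨M, hM⟩ := h.adapted.exists_logTransition h'.adapted
  obtain ⟨w, h1, h2, h3⟩ := h.coresidue_coord h'.res_mem
  have h4 : ∀ᶠ z in 𝓝[Off N.S] (N.e (f q)), logVec N.e N.S (N'.res i') z = w z := by
    filter_upwards [h2.filter_mono nhdsWithin_le_nhds, self_mem_nhdsWithin] with z h4 h5
    rw [logVec, h4, logFrameInv_logFrame h5]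
  -- Off `D` both `w` and the `i'`-th vector represent the same field in the two log frames; the
  -- identity extends to the branch, where `w` is a multiple of the `i`-th vector and the preceding
  -- result forces the factor `1`.
  have h5 : ∀ᶠ z in 𝓝 (N.e (f q)), M z (w z) = Pi.single i' 1 := by
    refine (hM.1.clm_apply h1).eq_of_eq_Off (Hol.const _) (S := N.S) ?_
    filter_upwards [h.adapted.logVec_transition h'.adapted hM, h4,
      (h.adapted.eventually_transition h'.adapted).filter_mono nhdsWithin_le_nhds,
      self_mem_nhdsWithin] with z e1 e2 e3 e4
    rw [← e2, e1]
    exact NormChart.logVec_res e3.2.2.1 (e3.2.2.2.2.1.1 e4)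
  refine ⟨fun z => w z - Pi.single i 1, h1.sub (Hol.const _), ?_, ?_⟩
  · filter_upwards [h3, h5, h.transition_single h' hM] with z e1 e2 e3 e4
    have e5 := e2
    rw [e1 e4, map_smul, e3 e4] at e5
    have e6 := congrFun e5 i'
    simp only [Pi.smul_apply, Pi.single_eq_same, smul_eq_mul, mul_one] at e6
    rw [e1 e4, e6, one_smul, sub_self]
  · filter_upwards [h4] with z hz
    rw [hz, add_sub_cancel]

/-- The residue fields of the two charts differ by a log field vanishing on the branch, and its zero
cancels the pole of `α`. So `ψ ∧ α` is intrinsic modulo log forms. -/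
lemma On.psi_sub_wedge_mem (hΦ : IsLogSymplectic D Φ) (h : N.On i q) (h' : N'.On i' q)
    {α : Form (m + 1) k X} (hα : α ∈ polarForms (m := m) D f k q) :
    wedgeForm (N'.psi Φ i') α - wedgeForm (N.psi Φ i) α ∈ logForms D (k + 1) (f q) := by
  obtain ⟨a, ha⟩ := hΦ.exists_sympCoord h.adapted
  obtain ⟨c, hc, hc0, hc'⟩ := h.logVec_res h'
  refine (mem_logForms_iff h.adapted).2 ((Polar.wedge_vanish (h.mem_polarForms_iff.1 hα)
    (ha.hol.curryLeft hc) (by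
      filter_upwards [hc0] with z hz hzi
      rw [hz hzi, _root_.map_zero])).congr ?_)
  filter_upwards [hc', ha.eq, eventually_logCoord_psi h.maps ha i,
    h.adapted.nhds.filter_mono nhdsWithin_le_nhds, self_mem_nhdsWithin] with z h1 h2 h3 h4 h5
  rw [logCoord_sub, logCoord_wedgeForm, logCoord_wedgeForm, h3, psi,
    logCoord_interior N.e_mem Φ _ h4.1 h5, h1, h2, _root_.map_add, add_wedge, add_sub_cancel_left]

/-- Same cancellation as for `ψ ∧ α`; it makes the contraction by the residue field intrinsic modulo
log forms. -/
lemma On.contract_res_sub_mem (h : N.On i q) (h' : N'.On i' q)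
    {α : Form (m + 1) (k + 1) X} (hα : α ∈ polarForms (m := m) D f (k + 1) q) :
    contractForm (N'.res i') α - contractForm (N.res i) α ∈ logForms D k (f q) := by
  obtain ⟨c, hc, hc0, hc'⟩ := h.logVec_res h'
  refine (mem_logForms_iff h.adapted).2 ((Polar.curryLeft_vanish (h.mem_polarForms_iff.1 hα)
    hc hc0).congr ?_)
  filter_upwards [hc', h.adapted.nhds.filter_mono nhdsWithin_le_nhds, self_mem_nhdsWithin]
    with z h1 h4 h5
  have e1 : ∀ v, logCoord N.e N.S (contractForm v α) z =
      (logCoord N.e N.S α z).curryLeft (logVec N.e N.S v z) := fun v =>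
    logCoord_contract N.e_mem α v h4.1 h5
  rw [logCoord_sub, e1, e1, h1, NormChart.logVec_res h4.1 h5, _root_.map_add, add_sub_cancel_left]

end NormChart

end PsiForms

/-! ### Morphisms induced by maps of representatives -/

namespace Subquot

open Filter

variable {Y : Type} [TopologicalSpace Y] {S S' S'' : Subquot Y}

/-- The correspondence given by a locally coherent family of maps of representatives which are
linear modulo the denominators. -/
def Corr.ofFamily (δ : Y → S.Amb → S'.Amb)
    (den : ∀ y, ∀ a ∈ S.num y, a ∈ S.den y → δ y a ∈ S'.den y)
    (add : ∀ y, ∀ a ∈ S.num y, ∀ a' ∈ S.num y, δ y (a + a') - δ y a - δ y a' ∈ S'.den y)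
    (smul : ∀ y (c : ℂ), ∀ a ∈ S.num y, δ y (c • a) - c • δ y a ∈ S'.den y)
    -- The map of representatives may depend on the point, in practice through a chosen chart;
    -- coherence modulo denominators is what keeps the result a section.
    (coh : ∀ y, ∀ a ∈ S.num y, ∀ᶠ y' in 𝓝 y, a ∈ S.num y' →
      δ y a ∈ S'.num y' ∧ δ y a - δ y' a ∈ S'.den y') : Corr S S' (ContinuousMap.id Y) where
  rel y :=
    { carrier := {p | p.1 ∈ S.num y ∧ p.2 ∈ S'.num y ∧ p.2 - δ y p.1 ∈ S'.den y}
      zero_mem' := by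
        refine ⟨(S.num y).zero_mem, (S'.num y).zero_mem, ?_⟩
        have := smul y 0 0 (S.num y).zero_mem
        rw [zero_smul, zero_smul, sub_zero] at this
        exact (S'.den y).sub_mem (S'.den y).zero_mem this
      add_mem' := by
        rintro ⟨a, b⟩ ⟨a', b'⟩ ⟨h1, h2, h3⟩ ⟨h1', h2', h3'⟩
        refine ⟨(S.num y).add_mem h1 h1', (S'.num y).add_mem h2 h2', ?_⟩
        have := (S'.den y).sub_mem ((S'.den y).add_mem h3 h3') (add y a h1 a' h1')
        convert! this using 1
        change b + b' - δ y (a + a') = b - δ y a + (b' - δ y a') - _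
        abel
      smul_mem' := by
        rintro c ⟨a, b⟩ ⟨h1, h2, h3⟩
        refine ⟨(S.num y).smul_mem c h1, (S'.num y).smul_mem c h2, ?_⟩
        have := (S'.den y).sub_mem ((S'.den y).smul_mem c h3) (smul y c a h1)
        convert! this using 1
        change c • b - δ y (c • a) = c • (b - δ y a) - _
        rw [smul_sub]
        abel }
  num h := h.2.1
  den := by
    intro y a b h ha
    have := (S'.den y).add_mem h.2.2 (den y a h.1 ha)
    rwa [sub_add_cancel] at this
  exists_rel y a ha := by
    refine ⟨δ y a, ?_⟩
    filter_upwards [coh y a ha] with y' h h' using ⟨h', h h'⟩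

lemma Induced.rep {φ : S.sheaf ⟶ S'.sheaf} {δ : S.Amb → S'.Amb} (h : Induced φ δ)
    {V : Opens Y} {s : S.Sec V} {y : V} {a : S.Amb} (ha : S.Rep s y a) :
    S'.Rep (onSec φ V s) y (δ a) := h V s y a ha

lemma Rep.congr {V : Opens Y} {s : S.Sec V} {y : V} {a a' : S.Amb} (h : S.Rep s y a)
    (h' : a' ∈ S.num y) (e : a - a' ∈ S.den y) : S.Rep s y a' := IsClass.congr h h' e

lemma Rep.num {V : Opens Y} {s : S.Sec V} {y : V} {a : S.Amb} (h : S.Rep s y a) :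
    a ∈ S.num y := IsClass.num h

/-- The morphism of sheaves given by a map of representatives. -/
lemma exists_induced (δ : S.Amb → S'.Amb)
    (num : ∀ y, ∀ a ∈ S.num y, δ a ∈ S'.num y)
    (den : ∀ y, ∀ a ∈ S.num y, a ∈ S.den y → δ a ∈ S'.den y)
    (add : ∀ y, ∀ a ∈ S.num y, ∀ a' ∈ S.num y, δ (a + a') - δ a - δ a' ∈ S'.den y)
    (smul : ∀ y (c : ℂ), ∀ a ∈ S.num y, δ (c • a) - c • δ a ∈ S'.den y) :
    ∃ φ : S.sheaf ⟶ S'.sheaf, Induced φ δ := by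
  refine ⟨(Corr.ofFamily (fun _ => δ) den add smul fun y a _ => Eventually.of_forall
    fun y' ha => ⟨num y' a ha, by simp⟩).hom, fun V s y a ha => ?_⟩
  exact Corr.rep_onSec_hom _ ha ⟨ha.num, num _ a ha.num, by simp⟩

lemma Induced.comp_eq_zero {φ : S.sheaf ⟶ S'.sheaf} {ψ : S'.sheaf ⟶ S''.sheaf}
    {δ : S.Amb → S'.Amb} {δ' : S'.Amb → S''.Amb} (hφ : Induced φ δ) (hψ : Induced ψ δ')
    (h : ∀ y, ∀ a ∈ S.num y, δ' (δ a) ∈ S''.den y) : φ ≫ ψ = 0 := by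
  refine hom_ext_of_rep fun V s y => ?_
  obtain ⟨a, ha⟩ := exists_rep s y
  refine ⟨δ' (δ a), hψ.rep (hφ.rep ha), ?_⟩
  have h0 : S''.Rep (0 : S''.Sec V) y 0 := ⟨(S''.num y).zero_mem, rfl⟩
  refine h0.congr (hψ.rep (hφ.rep ha)).num ?_
  rw [zero_sub]
  exact (S''.den y).neg_mem (h y a ha.num)

end Subquot

/-! ### The exterior derivative modulo log forms -/

section Derivatives

open Filter ContinuousAlternatingMap

variable {m k : ℕ} {Y : Type} [TopologicalSpace Y] [ChartedSpace (Cn m) Y]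
  [IsManifold 𝓘(ℂ, Cn m) ω Y] {D : Set Y} {e : OpenPartialHomeomorph Y (Cn m)}
  {S : Finset (Fin m)} {y : Y} {i : Fin m}

/-- The form is holomorphic outside of the divisor. -/
def GenHol (e : OpenPartialHomeomorph Y (Cn m)) (S : Finset (Fin m)) (α : Form m k Y) (y : Y) :
    Prop := ∀ᶠ z in 𝓝[Off S] (e y), Hol (logCoord e S α) z

lemma Polar.genHol (hi : i ∈ S) {α : Form m k Y} (h : Polar S i (logCoord e S α) (e y)) :
    GenHol e S α y := h.eventually_hol hi

lemma LogHol.genHol {α : Form m k Y} (h : LogHol S (logCoord e S α) (e y)) :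
    GenHol e S α y := h.eventually_hol

lemma GenHol.add {α β : Form m k Y} (hα : GenHol e S α y) (hβ : GenHol e S β y) :
    GenHol e S (α + β) y := by
  filter_upwards [hα, hβ] with z h1 h2 using h1.add h2

lemma GenHol.smul {α : Form m k Y} (hα : GenHol e S α y) (c : ℂ) : GenHol e S (c • α) y := by
  filter_upwards [hα] with z h1 using (Hol.const c).smul h1

lemma GenHol.sub {α β : Form m k Y} (hα : GenHol e S α y) (hβ : GenHol e S β y) :
    GenHol e S (α - β) y := by
  filter_upwards [hα, hβ] with z h1 h2 using h1.sub h2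

lemma GenHol.sum {ι : Type*} {s : Finset ι} {α : ι → Form m k Y}
    (h : ∀ j ∈ s, GenHol e S (α j) y) : GenHol e S (∑ j ∈ s, α j) y := by
  classical
  induction s using Finset.induction_on with
  | empty => exact Eventually.of_forall fun z => Hol.const 0
  | insert j s hj ih =>
    rw [Finset.sum_insert hj]
    exact (h j (Finset.mem_insert_self j s)).add
      (ih fun l hl => h l (Finset.mem_insert_of_mem hl))

lemma logD_add {A B : Cn m → (Cn m) [⋀^Fin k]→L[ℂ] ℂ} {z : Cn m} (hA : DifferentiableAt ℂ A z)
    (hB : DifferentiableAt ℂ B z) : logD S (fun w => A w + B w) z = logD S A z + logD S B z := by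
  have : fderiv ℂ (fun w => A w + B w) z = fderiv ℂ A z + fderiv ℂ B z := fderiv_add hA hB
  rw [logD, logD, logD, this, ContinuousLinearMap.add_comp]
  exact (alternatizeUncurryFinCLM ℂ (Cn m) ℂ).map_add _ _

lemma logD_smul {A : Cn m → (Cn m) [⋀^Fin k]→L[ℂ] ℂ} {z : Cn m} (hA : DifferentiableAt ℂ A z)
    (c : ℂ) : logD S (fun w => c • A w) z = c • logD S A z := by
  have : fderiv ℂ (fun w => c • A w) z = c • fderiv ℂ A z := fderiv_const_smul hA c
  rw [logD, logD, this, ContinuousLinearMap.smul_comp]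
  exact (alternatizeUncurryFinCLM ℂ (Cn m) ℂ).map_smul _ _

lemma Adapted.mem_logForms_of_eventually_zero (h : Adapted D e S y) {α : Form m k Y}
    (hα : ∀ᶠ z in 𝓝[Off S] (e y), logCoord e S α z = 0) : α ∈ logForms D k y :=
  (mem_logForms_iff h).2 (LogHol.zero_of_eventually hα)

/-- `dForm` is additive only where its arguments are differentiable. The defect vanishes at generic
points, and any form vanishing there is a log form, because log forms are only tested off `D`. -/
lemma Adapted.dForm_add_mem (h : Adapted D e S y) {α β : Form m k Y} (hα : GenHol e S α y)
    (hβ : GenHol e S β y) : dForm (α + β) - dForm α - dForm β ∈ logForms D (k + 1) y := by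
  refine h.mem_logForms_of_eventually_zero ?_
  filter_upwards [h.logCoord_dForm hα, h.logCoord_dForm hβ, h.logCoord_dForm (hα.add hβ), hα, hβ]
    with z h1 h2 h3 h4 h5
  rw [logCoord_sub, logCoord_sub, h1, h2, h3]
  have := logD_add (S := S) h4.differentiableAt h5.differentiableAt
  change logD S (fun w => logCoord e S α w + logCoord e S β w) z - _ - _ = 0
  rw [this, add_sub_cancel_left, sub_self]

lemma Adapted.dForm_smul_mem (h : Adapted D e S y) {α : Form m k Y} (hα : GenHol e S α y)
    (c : ℂ) : dForm (c • α) - c • dForm α ∈ logForms D (k + 1) y := by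
  refine h.mem_logForms_of_eventually_zero ?_
  filter_upwards [h.logCoord_dForm hα, h.logCoord_dForm (hα.smul c), hα] with z h1 h2 h3
  have := logD_smul (S := S) h3.differentiableAt c
  rw [logCoord_sub, logCoord_smul, h1, h2]
  change logD S (fun w => c • logCoord e S α w) z - _ = 0
  rw [this, sub_self]

lemma Adapted.dForm_sub_mem (h : Adapted D e S y) {α β : Form m k Y} (hα : GenHol e S α y)
    (hβ : GenHol e S β y) : dForm (α - β) - (dForm α - dForm β) ∈ logForms D (k + 1) y := by
  have h1 := h.dForm_add_mem (hα.sub hβ) hβ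
  rw [sub_add_cancel] at h1
  convert! (logForms D (k + 1) y).neg_mem h1 using 1
  abel

lemma Adapted.dForm_sum_mem (h : Adapted D e S y) {ι : Type*} {s : Finset ι}
    {α : ι → Form m k Y} (hα : ∀ j ∈ s, GenHol e S (α j) y) :
    dForm (∑ j ∈ s, α j) - ∑ j ∈ s, dForm (α j) ∈ logForms D (k + 1) y := by
  classical
  induction s using Finset.induction_on with
  | empty =>
    have := h.dForm_smul_mem (α := (0 : Form m k Y)) (Eventually.of_forall fun z => Hol.const 0) 0
    have e1 : (0 : ℂ) • (0 : Form m k Y) = 0 := by ext; simp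
    have e2 : (0 : ℂ) • dForm (0 : Form m k Y) = 0 := by ext; simp
    rw [e1, e2, sub_zero] at this
    rwa [Finset.sum_empty, Finset.sum_empty, sub_zero]
  | insert j s hj ih =>
    rw [Finset.sum_insert hj, Finset.sum_insert hj]
    have h1 := h.dForm_add_mem (hα j (Finset.mem_insert_self j s))
      (GenHol.sum fun l hl => hα l (Finset.mem_insert_of_mem hl))
    have h2 := (logForms D (k + 1) y).add_mem h1
      (ih fun l hl => hα l (Finset.mem_insert_of_mem hl))
    convert! h2 using 1
    abel

lemma Adapted.dForm_dForm_mem (h : Adapted D e S y) {α : Form m k Y} (hα : GenHol e S α y) :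
    dForm (dForm α) ∈ logForms D (k + 2) y := by
  refine h.mem_logForms_of_eventually_zero ?_
  filter_upwards [hα, h.nhds.filter_mono nhdsWithin_le_nhds, self_mem_nhdsWithin] with z h1 h2 h3
  rw [logCoord, inChart_dForm_dForm h.1 h2.1]
  · rfl
  · filter_upwards [h1, e.open_target.mem_nhds h2.1, (isOpen_Off S).mem_nhds h3] with w h4 h5 h6
    exact (LogSymp.logCoord_dForm h.1 h5 h6 h4).1

lemma Adapted.dForm_mem_logForms (h : Adapted D e S y) {α : Form m k Y}
    (hα : α ∈ logForms D k y) : dForm α ∈ logForms D (k + 1) y := by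
  rw [mem_logForms_iff h] at hα ⊢
  exact hα.logD.congr (h.logCoord_dForm hα.genHol)

lemma Adapted.polar_dForm (h : Adapted D e S y) (hi : i ∈ S) {α : Form m k Y}
    (hα : Polar S i (logCoord e S α) (e y)) : Polar S i (logCoord e S (dForm α)) (e y) :=
  (hα.logD hi).congr (h.logCoord_dForm (hα.genHol hi))

end Derivatives

/-! ### The complex `𝓔₁` -/

lemma zero_smul_form {E : Type*} [NormedAddCommGroup E] [NormedSpace ℂ E] {k : ℕ}
    (a : E [⋀^Fin k]→L[ℂ] ℂ) : (0 : ℂ) • a = 0 := by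
  ext
  simp

section ComplexE

open Filter ContinuousAlternatingMap

variable {m : ℕ} {X X₁ : Type} [TopologicalSpace X] [ChartedSpace (Cn (m + 1)) X]
  [IsManifold 𝓘(ℂ, Cn (m + 1)) ω X] [TopologicalSpace X₁] [ChartedSpace (Cn m) X₁]
  [IsManifold 𝓘(ℂ, Cn m) ω X₁] {D : Set X} {f : X₁ → X} {N N' : NormChart (m := m) D f}
  {i i' : Fin (m + 1)} {q : X₁} {k : ℕ} {Φ : Form (m + 1) 2 X}

lemma IsNormalization.exists_on (hf : IsNormalization (m := m) D f) (q : X₁) :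
    ∃ (N : NormChart (m := m) D f) (i : Fin (m + 1)), N.On i q := by
  obtain ⟨N, hN⟩ := hf.exists_normChart (f q)
  exact ⟨N, N.exists_on hN⟩

namespace NormChart

lemma On.genHol (h : N.On i q) {α : Form (m + 1) k X}
    (hα : α ∈ polarForms (m := m) D f k q) : GenHol N.e N.S α (f q) :=
  (h.mem_polarForms_iff.1 hα).genHol h.1

lemma On.dForm_mem_polarForms (h : N.On i q) {α : Form (m + 1) k X}
    (hα : α ∈ polarForms (m := m) D f k q) :
    dForm α ∈ polarForms (m := m) D f (k + 1) q := by
  rw [h.mem_polarForms_iff] at hα ⊢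
  exact h.adapted.polar_dForm h.1 hα

lemma On.logForms_le_psiForms (hΦ : IsLogSymplectic D Φ) (h : N.On i q) :
    logForms D k (f q) ≤ psiForms (m := m) D Φ f k q := fun _ hα =>
  (h.mem_psiForms_iff hΦ).2 ⟨h.logForms_le_polarForms hα, wedge_psi_mem_logForms hΦ h.maps i hα⟩

/-- The derivative of a product with `ψ`. -/
lemma dForm_wedge_psi_mem (hΦ : IsLogSymplectic D Φ) {p : X} (hp : p ∈ N.e.source) (hi : i ∈ N.S)
    {α : Form (m + 1) k X} (hα : Polar N.S i (logCoord N.e N.S α) (N.e p)) :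
    dForm (wedgeForm (N.psi Φ i) α) + wedgeForm (N.psi Φ i) (dForm α) ∈ logForms D (k + 2) p := by
  have h := N.adapted hp
  obtain ⟨a, ha⟩ := hΦ.exists_sympCoord h
  refine (mem_logForms_iff h).2 ((hα.logD_wedge_contract hi ha.hol ha.closed).congr ?_)
  have hψ := eventually_logCoord_psi hp ha i
  filter_upwards [h.logCoord_dForm (hα.genHol hi), hψ, eventually_of_Off hψ,
    h.logCoord_dForm ((polar_wedge_psi hΦ hp i hα).genHol hi)] with z h2 h3 h4 h5
  rw [logCoord_add, h5, logCoord_wedgeForm, h2, h3]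
  congr 1
  refine logD_congr ?_
  filter_upwards [h4] with w hw
  rw [logCoord_wedgeForm, hw]

lemma On.dForm_wedge_psi_mem (hΦ : IsLogSymplectic D Φ) (h : N.On i q) {α : Form (m + 1) k X}
    (hα : α ∈ polarForms (m := m) D f k q) :
    dForm (wedgeForm (N.psi Φ i) α) + wedgeForm (N.psi Φ i) (dForm α) ∈
      logForms D (k + 2) (f q) :=
  NormChart.dForm_wedge_psi_mem hΦ h.maps h.1 (h.mem_polarForms_iff.1 hα)

/-- By the criterion `mem_psiForms_iff` it suffices that `ψ ∧ dα` be a log form, and modulo log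
forms it equals `-d(ψ ∧ α)`. -/
lemma On.dForm_mem_psiForms (hΦ : IsLogSymplectic D Φ) (h : N.On i q) {α : Form (m + 1) k X}
    (hα : α ∈ psiForms (m := m) D Φ f k q) : dForm α ∈ psiForms (m := m) D Φ f (k + 1) q := by
  rw [h.mem_psiForms_iff hΦ] at hα ⊢
  refine ⟨h.dForm_mem_polarForms hα.1, ?_⟩
  have := (logForms D (k + 2) (f q)).sub_mem (h.dForm_wedge_psi_mem hΦ hα.1)
    (h.adapted.dForm_mem_logForms hα.2)
  rwa [add_sub_cancel_left] at this

lemma On.logCoord_contract_res (h : N.On i q) (α : Form (m + 1) (k + 1) X) :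
    ∀ᶠ z in 𝓝[Off N.S] (N.e (f q)), logCoord N.e N.S (contractForm (N.res i) α) z =
      (logCoord N.e N.S α z).curryLeft (Pi.single i 1) := by
  filter_upwards [h.adapted.nhds.filter_mono nhdsWithin_le_nhds, self_mem_nhdsWithin] with z h1 h2
  have := logCoord_contract N.e_mem α (N.res i) h1.1 h2
  rw [NormChart.logVec_res h1.1 h2] at this
  exact this

lemma On.contract_res_mem_polarForms (h : N.On i q) {α : Form (m + 1) (k + 1) X}
    (hα : α ∈ polarForms (m := m) D f (k + 1) q) :
    contractForm (N.res i) α ∈ polarForms (m := m) D f k q := by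
  rw [h.mem_polarForms_iff] at hα ⊢
  exact (hα.curryLeft (LogHol.const (Pi.single i 1))).congr (h.logCoord_contract_res α)

/-- Since `ψ(v) = Φ(v, v) = 0`, contraction by the residue field anticommutes with the product by
`ψ` and so preserves the criterion for being zero in the quotient. -/
lemma On.contract_res_mem_psiForms (hΦ : IsLogSymplectic D Φ) (h : N.On i q)
    {α : Form (m + 1) (k + 1) X} (hα : α ∈ psiForms (m := m) D Φ f (k + 1) q) :
    contractForm (N.res i) α ∈ psiForms (m := m) D Φ f k q := by
  rw [h.mem_psiForms_iff hΦ] at hα ⊢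
  refine ⟨h.contract_res_mem_polarForms hα.1, ?_⟩
  obtain ⟨a, ha⟩ := hΦ.exists_sympCoord h.adapted
  have h1 := (mem_logForms_iff h.adapted).1 hα.2
  refine (mem_logForms_iff h.adapted).2
    ((h1.curryLeft (LogHol.const (Pi.single i (1 : ℂ)))).neg.congr ?_)
  filter_upwards [h.logCoord_contract_res α, eventually_logCoord_psi h.maps ha i] with z h2 h3
  have h4 : oneForm ((a z).curryLeft (Pi.single i 1)) (Pi.single i 1) = 0 := by
    have := oneForm_curryLeft_swap (a z) (Pi.single i (1 : ℂ)) (Pi.single i 1)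
    exact self_eq_neg.1 this
  rw [logCoord_wedgeForm, logCoord_wedgeForm, h2, h3, curryLeft_wedge, h4, zero_smul_form, zero_sub,
    neg_neg]

/-- Cartan's formula for the residue field. -/
lemma On.cartan_mem (h : N.On i q) {α : Form (m + 1) (k + 1) X}
    (hα : α ∈ polarForms (m := m) D f (k + 1) q) :
    dForm (contractForm (N.res i) α) + contractForm (N.res i) (dForm α) + α ∈
      logForms D (k + 1) (f q) := by
  have h1 := h.mem_polarForms_iff.1 hα
  refine (mem_logForms_iff h.adapted).2 ((fderiv_frame_polar h.1 h1).congr ?_)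
  filter_upwards [h.adapted.logCoord_dForm (h.genHol hα), h.logCoord_contract_res (dForm α),
    eventually_of_Off (h.logCoord_contract_res α), h.genHol hα,
    h.adapted.logCoord_dForm (h.genHol (h.contract_res_mem_polarForms hα))] with z h2 h3 h4 h5 h6
  rw [logCoord_add, logCoord_add, h6, h3, h2, logD_congr h4,
    contract_logD h5.differentiableAt]

lemma On.cartan_mem_zero (h : N.On i q) {α : Form (m + 1) 0 X}
    (hα : α ∈ polarForms (m := m) D f 0 q) :
    contractForm (N.res i) (dForm α) + α ∈ logForms D 0 (f q) := by
  have h1 := h.mem_polarForms_iff.1 hα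
  refine (mem_logForms_iff h.adapted).2 ((fderiv_frame_polar h.1 h1).congr ?_)
  filter_upwards [h.adapted.logCoord_dForm (h.genHol hα), h.logCoord_contract_res (dForm α)]
    with z h2 h3
  rw [logCoord_add, h3, h2, contract_logD_zero]

end NormChart

open Subquot

lemma exists_dE (hΦ : IsLogSymplectic D Φ) (hf : IsNormalization (m := m) D f) (k : ℕ) :
    ∃ d : (calE (m := m) D Φ f k).sheaf ⟶ (calE (m := m) D Φ f (k + 1)).sheaf,
      Induced d (fun a => dForm a) := by
  refine exists_induced _ (fun q a ha => ?_) (fun q a _ ha => ?_) (fun q a ha a' ha' => ?_)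
    (fun q c a ha => ?_) <;> obtain ⟨N, i, h⟩ := hf.exists_on q
  · exact h.dForm_mem_polarForms ha
  · exact h.dForm_mem_psiForms hΦ ha
  · exact h.logForms_le_psiForms hΦ (h.adapted.dForm_add_mem (h.genHol ha) (h.genHol ha'))
  · exact h.logForms_le_psiForms hΦ (h.adapted.dForm_smul_mem (h.genHol ha) c)

/-- The residue field is chosen chart by chart, but its contraction is intrinsic modulo log forms,
so the formula holds with every chart. The sign compensates the `-1` by which the Lie derivative
acts on polar parts. -/
lemma exists_contraction (hΦ : IsLogSymplectic D Φ) (hf : IsNormalization (m := m) D f) (k : ℕ) :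
    ∃ σ : (calE (m := m) D Φ f (k + 1)).sheaf ⟶ (calE (m := m) D Φ f k).sheaf,
      ∀ (V : Opens X₁) s (q : V) a, (calE (m := m) D Φ f (k + 1)).Rep (V := V) s q a →
        ∀ (N : NormChart (m := m) D f) i, N.On i q →
          (calE (m := m) D Φ f k).Rep (onSec σ V s) q (-contractForm (N.res i) a) := by
  choose N i hN using hf.exists_on
  have coh : ∀ q (N' : NormChart (m := m) D f) i', N'.On i' q →
      ∀ a ∈ polarForms (m := m) D f (k + 1) q,
      -contractForm (N'.res i') a - -contractForm ((N q).res (i q)) a ∈ psiForms D Φ f k q := by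
    intro q N' i' h' a ha
    have := (hN q).logForms_le_psiForms hΦ (h'.contract_res_sub_mem (hN q) ha)
    convert! this using 1
    abel
  have hadd : ∀ q (a a' : Form (m + 1) (k + 1) X), -contractForm ((N q).res (i q)) (a + a') -
      -contractForm ((N q).res (i q)) a - -contractForm ((N q).res (i q)) a' ∈
        psiForms D Φ f k q := by
    intro q a a'
    rw [_root_.map_add]
    convert! (psiForms D Φ f k q).zero_mem using 1
    abel
  have hsmul : ∀ q (c : ℂ) (a : Form (m + 1) (k + 1) X),
      -contractForm ((N q).res (i q)) (c • a) - c • -contractForm ((N q).res (i q)) a ∈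
        psiForms D Φ f k q := by
    intro q c a
    rw [map_smul, smul_neg, sub_self]
    exact (psiForms D Φ f k q).zero_mem
  let R : Corr (calE (m := m) D Φ f (k + 1)) (calE (m := m) D Φ f k) (ContinuousMap.id X₁) :=
    Corr.ofFamily (fun q a => -contractForm ((N q).res (i q)) a)
      (fun q a _ ha => (psiForms D Φ f k q).neg_mem ((hN q).contract_res_mem_psiForms hΦ ha))
      (fun q a _ a' _ => hadd q a a') (fun q c a _ => hsmul q c a)
      (fun q a _ => by
        filter_upwards [(hN q).nhds] with q' h ha
        exact ⟨(polarForms D f k q').neg_mem (h.contract_res_mem_polarForms ha),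
          coh q' _ _ h a ha⟩)
  refine ⟨R.hom, fun V s q a ha N' i' h' => ?_⟩
  exact Corr.rep_onSec_hom R ha ⟨ha.num, (polarForms D f k q.1).neg_mem
    (h'.contract_res_mem_polarForms ha.num), coh q.1 N' i' h' a ha.num⟩

/-- Cartan's formula for the residue field; in degree zero one of its two terms is absent. -/
lemma exists_homotopyE (hΦ : IsLogSymplectic D Φ) (hf : IsNormalization (m := m) D f)
    {d : ∀ k, (calE (m := m) D Φ f k).sheaf ⟶ (calE (m := m) D Φ f (k + 1)).sheaf}
    (hd : ∀ k, Induced (d k) (fun a => dForm a)) :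
    ∃ σ : ∀ k, (calE (m := m) D Φ f (k + 1)).sheaf ⟶ (calE (m := m) D Φ f k).sheaf,
      d 0 ≫ σ 0 = 𝟙 _ ∧ ∀ k, σ k ≫ d k + d (k + 1) ≫ σ (k + 1) = 𝟙 _ := by
  choose σ hσ using exists_contraction hΦ hf
  refine ⟨σ, hom_ext_of_rep fun V s q => ?_, fun k => hom_ext_of_rep fun V s q => ?_⟩ <;>
    obtain ⟨N, i, h⟩ := hf.exists_on q.1 <;> obtain ⟨a, ha⟩ := exists_rep s q
  · refine ⟨a, ?_, ha⟩
    refine (hσ 0 V _ q _ ((hd 0).rep ha) N i h).congr ha.num ?_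
    have := h.logForms_le_psiForms hΦ (h.cartan_mem_zero ha.num)
    have e : ∀ x y : Form (m + 1) 0 X, -x - y = -(x + y) := fun x y => by abel
    exact (e _ _).symm ▸ (psiForms D Φ f 0 q.1).neg_mem this
  · refine ⟨a, ?_, ha⟩
    have h1 := (hd k).rep (hσ k V _ q _ ha N i h)
    have h2 := hσ (k + 1) V _ q _ ((hd (k + 1)).rep ha) N i h
    refine Rep.congr (IsClass.add h1 h2) ha.num ?_
    have h3 := h.logForms_le_psiForms hΦ (h.cartan_mem ha.num)
    -- The homotopy carries a minus sign inside the derivative; it may be taken out modulo log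
    -- forms.
    have h4 := h.logForms_le_psiForms hΦ (h.adapted.dForm_smul_mem
      (h.genHol (h.contract_res_mem_polarForms ha.num)) (-1))
    convert! (psiForms D Φ f (k + 1) q.1).sub_mem h4 h3 using 1
    have e : ∀ {l : ℕ} (x : Form (m + 1) l X), (-1 : ℂ) • x = -x := fun x => by ext; simp
    rw [e, e]
    abel

end ComplexE

/-! ### The first step of the filtration -/

section Filtration

open Filter ContinuousAlternatingMap

variable {m : ℕ} {X X₁ : Type} [TopologicalSpace X] [ChartedSpace (Cn (m + 1)) X]
  [IsManifold 𝓘(ℂ, Cn (m + 1)) ω X] [TopologicalSpace X₁] [ChartedSpace (Cn m) X₁]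
  [IsManifold 𝓘(ℂ, Cn m) ω X₁] {D : Set X} {f : X₁ → X} {N N' : NormChart (m := m) D f}
  {i i' : Fin (m + 1)} {p : X} {q : X₁} {k : ℕ} {Φ : Form (m + 1) 2 X}

lemma Polar.logHol_of_ne {n : ℕ} {F : Type*} [NormedAddCommGroup F] [NormedSpace ℂ F]
    {S : Finset (Fin n)} {i : Fin n} {z₀ : Cn n} {A : Cn n → F} (H : Polar S i A z₀)
    (h0 : z₀ i ≠ 0) : LogHol S A z₀ := by
  refine (LogHol.smul ((hol_proj i z₀).inv h0).logHol H).congr ?_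
  filter_upwards [((hol_proj i z₀).continuousAt.eventually_ne h0).filter_mono nhdsWithin_le_nhds]
    with z hz
  rw [inv_smul_smul₀ hz]

namespace NormChart

/-- The form `a` is the sum of a log form and of the products `ψ_j ∧ b_j`, where `b_j` has a simple
pole along the `j`-th branch. -/
structure Decomp (N : NormChart (m := m) D f) (Φ : Form (m + 1) 2 X) (a : Form (m + 1) (k + 1) X)
    (b : Fin (m + 1) → Form (m + 1) k X) (p : X) : Prop where
  polar : ∀ j ∈ N.S, Polar N.S j (logCoord N.e N.S (b j)) (N.e p)
  mem : a - ∑ j ∈ N.S, wedgeForm (N.psi Φ j) (b j) ∈ logForms D (k + 1) p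

lemma Decomp.eventually (hp : p ∈ N.e.source) {a : Form (m + 1) (k + 1) X}
    {b : Fin (m + 1) → Form (m + 1) k X} (h : N.Decomp Φ a b p) :
    ∀ᶠ p' in 𝓝 p, N.Decomp Φ a b p' := by
  have h1 : ∀ᶠ p' in 𝓝 p, ∀ j ∈ N.S, Polar N.S j (logCoord N.e N.S (b j)) (N.e p') :=
    (eventually_all_finset _).2 fun j hj =>
      (N.e.continuousAt hp).eventually (h.polar j hj).eventually
  filter_upwards [h1, eventually_mem_logForms (N.adapted hp) h.mem] with p' h2 h3 using ⟨h2, h3⟩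

/-- Since `v_i = x_i ∂_i`, one has `ψ_i ∧ b = ⟨Φ, ∂_i⟩ ∧ x_i b`, a log-plus form times a log form.
-/
lemma sum_wedge_psi_mem_filt (hΦ : IsLogSymplectic D Φ) (hp : p ∈ N.e.source) (hi : i ∈ N.S)
    {b : Form (m + 1) k X} (hb : Polar N.S i (logCoord N.e N.S b) (N.e p)) :
    wedgeForm (N.psi Φ i) b ∈ filt D Φ 1 (k + 1) p := by
  have H := N.adapted hp
  obtain ⟨a, ha⟩ := hΦ.exists_sympCoord H
  obtain ⟨h, h1, h2⟩ := hb
  set ξ := fieldOf N.e ∅ fun _ => (Pi.single i (1 : ℂ) : Cn (m + 1))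
  have hξ : ∀ z ∈ N.e.target, vecInChart N.e ξ z = Pi.single i 1 := by
    intro z hz
    rw [vecInChart_fieldOf N.e_mem _ hz]
    ext j
    simp [logFrame_apply]
  have h3 : wedgeForm (interior Φ ξ) (formOf N.e N.S h) ∈ filt D Φ 1 (k + 1) p := by
    refine Submodule.mem_sup_right (Submodule.subset_span
      ⟨interior Φ ξ, ⟨ξ, ?_, Eventually.of_forall fun _ => rfl⟩, formOf N.e N.S h, ?_, rfl⟩)
    · refine (holField_iff N.e_mem hp).2 ((Hol.const (Pi.single i (1 : ℂ) : Cn (m + 1))).congr ?_)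
      filter_upwards [N.e.open_target.mem_nhds (N.e.map_source hp)] with z hz using hξ z hz
    · refine (mem_logForms_iff H).2 (h1.logHol.congr ?_)
      filter_upwards [H.nhds.filter_mono nhdsWithin_le_nhds, self_mem_nhdsWithin] with z h4 h5
        using logCoord_formOf N.e_mem h h4.1 h5
  have h4 : wedgeForm (N.psi Φ i) b - wedgeForm (interior Φ ξ) (formOf N.e N.S h) ∈
      logForms D (k + 1) p := by
    refine H.mem_logForms_of_eventually_zero ?_
    filter_upwards [H.nhds.filter_mono nhdsWithin_le_nhds, self_mem_nhdsWithin, h2, ha.eq,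
      eventually_logCoord_psi hp ha i] with z h5 h6 h7 h8 h9
    have h10 : logVec N.e N.S ξ z = (z i)⁻¹ • Pi.single i 1 := by
      rw [logVec, hξ z h5.1]
      ext j
      by_cases hj : j = i
      · subst hj; simp [logFrameInv_apply, hi]
      · simp [logFrameInv_apply, hj]
    rw [logCoord_sub, logCoord_wedgeForm, logCoord_wedgeForm, h9,
      logCoord_interior N.e_mem Φ ξ h5.1 h6, h10, h8, map_smul, logCoord_formOf N.e_mem h h5.1 h6,
      ← h7, wedge_smul, smul_wedge, smul_inv_smul₀ (h6 i hi), sub_self]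
  have h5 : wedgeForm (N.psi Φ i) b - wedgeForm (interior Φ ξ) (formOf N.e N.S h) ∈
      filt D Φ 1 (k + 1) p := Submodule.mem_sup_left h4
  have := Submodule.add_mem _ h5 h3
  rwa [sub_add_cancel] at this

lemma Decomp.mem_filt (hΦ : IsLogSymplectic D Φ) (hp : p ∈ N.e.source)
    {a : Form (m + 1) (k + 1) X} {b : Fin (m + 1) → Form (m + 1) k X} (h : N.Decomp Φ a b p) :
    a ∈ filt D Φ 1 (k + 1) p := by
  have h1 : a - ∑ j ∈ N.S, wedgeForm (N.psi Φ j) (b j) ∈ filt D Φ 1 (k + 1) p :=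
    Submodule.mem_sup_left h.mem
  have h2 := Submodule.add_mem _ h1 (Submodule.sum_mem _ fun j hj =>
    sum_wedge_psi_mem_filt hΦ hp hj (h.polar j hj))
  rwa [sub_add_cancel] at h2

/-- Expand the field as `ξ = ∑ V_j ∂_j`. For `j ∉ S` the contraction of `Φ` by `∂_j` is a log form;
for `j ∈ S` it is `x_j⁻¹ ψ_j`, which yields `b_j = x_j⁻¹ V_j α`. -/
lemma exists_decomp_wedge (hΦ : IsLogSymplectic D Φ) (hp : p ∈ N.e.source)
    {θ : Form (m + 1) 1 X} (hθ : θ ∈ logPlusOne D Φ p) {α : Form (m + 1) k X}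
    (hα : α ∈ logForms D k p) : ∃ b, N.Decomp Φ (wedgeForm θ α) b p := by
  have H := N.adapted hp
  obtain ⟨a, ha⟩ := hΦ.exists_sympCoord H
  obtain ⟨ξ, hξ, hθξ⟩ := hθ
  set V := vecInChart N.e ξ with hV
  have V_hol : Hol V (N.e p) := (holField_iff N.e_mem hp).1 hξ
  have hVj : ∀ j, Hol (fun z => V z j) (N.e p) := fun j =>
    V_hol.clm_comp (ContinuousLinearMap.proj j : Cn (m + 1) →L[ℂ] ℂ)
  have hα' := (mem_logForms_iff H).1 hα
  have hb : ∀ j, ∀ᶠ z in 𝓝[Off N.S] (N.e p),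
      logCoord N.e N.S (formOf N.e N.S fun z => ((z j)⁻¹ * V z j) • logCoord N.e N.S α z) z =
        ((z j)⁻¹ * V z j) • logCoord N.e N.S α z := by
    intro j
    filter_upwards [H.nhds.filter_mono nhdsWithin_le_nhds, self_mem_nhdsWithin] with z h1 h2
      using logCoord_formOf N.e_mem _ h1.1 h2
  refine ⟨fun j => formOf N.e N.S fun z => ((z j)⁻¹ * V z j) • logCoord N.e N.S α z,
    fun j hj => ?_, ?_⟩
  · refine ((hVj j).logHol.smul hα').congr ?_
    filter_upwards [hb j, self_mem_nhdsWithin] with z h1 h2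
    rw [h1, smul_smul, mul_inv_cancel_left₀ (h2 j hj)]
  · have hw : Hol (fun z => ∑ j ∈ Finset.univ.filter (· ∉ N.S),
        V z j • (Pi.single j 1 : Cn (m + 1))) (N.e p) :=
      Hol.sum fun j _ => (hVj j).smul (Hol.const _)
    refine (mem_logForms_iff H).2 ((LogHol.wedge (ha.hol.curryLeft hw).logHol hα').congr ?_)
    have hθ' := H.eventually_iff.1 hθξ
    filter_upwards [eventually_all.2 hb, eventually_all.2 fun j => eventually_logCoord_psi hp ha j,
      ha.eq, H.nhds.filter_mono nhdsWithin_le_nhds, self_mem_nhdsWithin, hθ']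
      with z h1 h2 h3 h4 h5 h6
    have h7 : logCoord N.e N.S θ z = (a z).curryLeft (logVec N.e N.S ξ z) := by
      rw [← h3, ← logCoord_interior N.e_mem Φ ξ h4.1 h5]
      simp only [logCoord, inChart, h6]
    have h8 : logVec N.e N.S ξ z = ∑ j ∈ Finset.univ.filter (· ∉ N.S),
        V z j • (Pi.single j 1 : Cn (m + 1)) +
          ∑ j ∈ N.S, ((z j)⁻¹ * V z j) • (Pi.single j 1 : Cn (m + 1)) := by
      have e1 : logVec N.e N.S ξ z = ∑ j, (if j ∈ N.S then (z j)⁻¹ * V z j else V z j) •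
          (Pi.single j 1 : Cn (m + 1)) := by
        ext l
        rw [Finset.sum_apply, logVec, logFrameInv_apply, ← hV]
        simp [Pi.single_apply]
      rw [e1, ← Finset.sum_filter_not_add_sum_filter Finset.univ (· ∈ N.S)]
      congr 1
      · refine Finset.sum_congr rfl fun j hj => ?_
        rw [if_neg (Finset.mem_filter.1 hj).2]
      · rw [Finset.filter_mem_eq_inter, Finset.univ_inter]
        refine Finset.sum_congr rfl fun j hj => ?_
        rw [if_pos hj]
    have h9 : logCoord N.e N.S (∑ j ∈ N.S, wedgeForm (N.psi Φ j)
        (formOf N.e N.S fun z => ((z j)⁻¹ * V z j) • logCoord N.e N.S α z)) z =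
        wedge ((a z).curryLeft (∑ j ∈ N.S, ((z j)⁻¹ * V z j) • (Pi.single j 1 : Cn (m + 1))))
          (logCoord N.e N.S α z) := by
      have e1 : ∀ s : Finset (Fin (m + 1)), logCoord N.e N.S (∑ j ∈ s, wedgeForm (N.psi Φ j)
        (formOf N.e N.S fun z => ((z j)⁻¹ * V z j) • logCoord N.e N.S α z)) z =
        wedge ((a z).curryLeft (∑ j ∈ s, ((z j)⁻¹ * V z j) • (Pi.single j 1 : Cn (m + 1))))
          (logCoord N.e N.S α z) := by
        intro s
        induction s using Finset.induction_on with
        | empty =>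
          rw [Finset.sum_empty, Finset.sum_empty, _root_.map_zero, zero_wedge]
          rfl
        | insert j s hj ih =>
          rw [Finset.sum_insert hj, Finset.sum_insert hj, logCoord_add, ih, _root_.map_add,
            add_wedge, logCoord_wedgeForm, h1, h2, map_smul, smul_wedge, wedge_smul]
      exact e1 _
    rw [logCoord_sub, h9, logCoord_wedgeForm, h7, h8, _root_.map_add, add_wedge,
      add_sub_cancel_right]

lemma Decomp.of_logForms {a : Form (m + 1) (k + 1) X} (ha : a ∈ logForms D (k + 1) p) :
    N.Decomp Φ a 0 p := by
  refine ⟨fun j _ => LogHol.polar (LogHol.const 0), ?_⟩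
  have : ∑ j ∈ N.S, wedgeForm (N.psi Φ j) ((0 : Fin (m + 1) → Form (m + 1) k X) j) = 0 :=
    Finset.sum_eq_zero fun j _ => (wedgeForm (N.psi Φ j)).map_zero
  rwa [this, sub_zero]

lemma Decomp.add {a a' : Form (m + 1) (k + 1) X} {b b' : Fin (m + 1) → Form (m + 1) k X}
    (h : N.Decomp Φ a b p) (h' : N.Decomp Φ a' b' p) :
    N.Decomp Φ (a + a') (fun j => b j + b' j) p := by
  refine ⟨fun j hj => (h.polar j hj).add (h'.polar j hj), ?_⟩
  have e : ∑ j ∈ N.S, wedgeForm (N.psi Φ j) (b j + b' j) =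
      ∑ j ∈ N.S, wedgeForm (N.psi Φ j) (b j) + ∑ j ∈ N.S, wedgeForm (N.psi Φ j) (b' j) := by
    rw [← Finset.sum_add_distrib]
    exact Finset.sum_congr rfl fun j _ => (wedgeForm (N.psi Φ j)).map_add _ _
  rw [e, add_sub_add_comm]
  exact (logForms D (k + 1) p).add_mem h.mem h'.mem

lemma Decomp.smul {a : Form (m + 1) (k + 1) X} {b : Fin (m + 1) → Form (m + 1) k X}
    (h : N.Decomp Φ a b p) (c : ℂ) : N.Decomp Φ (c • a) (fun j => c • b j) p := by
  refine ⟨fun j hj => (Polar.smul (c := fun _ => c) (LogHol.const c) (h.polar j hj)).congr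
    (Eventually.of_forall fun z => logCoord_smul c (b j) z), ?_⟩
  have e : ∑ j ∈ N.S, wedgeForm (N.psi Φ j) (c • b j) =
      c • ∑ j ∈ N.S, wedgeForm (N.psi Φ j) (b j) := by
    rw [Finset.smul_sum]
    exact Finset.sum_congr rfl fun j _ => (wedgeForm (N.psi Φ j)).map_smul _ _
  rw [e]
  have := (logForms D (k + 1) p).smul_mem c h.mem
  convert! this using 1
  exact funext fun x => (smul_sub c (a x) _).symm

/-- The first step of the filtration in coordinates. -/
theorem mem_filt_iff (hΦ : IsLogSymplectic D Φ) (hp : p ∈ N.e.source)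
    {a : Form (m + 1) (k + 1) X} :
    a ∈ filt D Φ 1 (k + 1) p ↔ ∃ b, N.Decomp Φ a b p := by
  refine ⟨fun ha => ?_, fun ⟨b, hb⟩ => hb.mem_filt hΦ hp⟩
  let Q : Submodule ℂ (Form (m + 1) (k + 1) X) :=
    { carrier := {a | ∃ b, N.Decomp Φ a b p}
      zero_mem' := ⟨0, Decomp.of_logForms (logForms D (k + 1) p).zero_mem⟩
      add_mem' := fun ⟨_, h⟩ ⟨_, h'⟩ => ⟨_, h.add h'⟩
      smul_mem' := fun c _ ⟨_, h⟩ => ⟨_, h.smul c⟩ }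
  have hle : filt D Φ 1 (k + 1) p ≤ Q := by
    refine sup_le (fun a ha => ⟨0, Decomp.of_logForms ha⟩) (Submodule.span_le.2 ?_)
    rintro _ ⟨θ, hθ, α, hα, rfl⟩
    exact exists_decomp_wedge hΦ hp hθ hα
  exact hle ha

lemma Decomp.genHol (hΦ : IsLogSymplectic D Φ) (hp : p ∈ N.e.source)
    {a : Form (m + 1) (k + 1) X} {b : Fin (m + 1) → Form (m + 1) k X} (h : N.Decomp Φ a b p) :
    GenHol N.e N.S a p := by
  have h1 : GenHol N.e N.S (a - ∑ j ∈ N.S, wedgeForm (N.psi Φ j) (b j)) p :=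
    LogHol.genHol ((mem_logForms_iff (N.adapted hp)).1 h.mem)
  have h2 : GenHol N.e N.S (∑ j ∈ N.S, wedgeForm (N.psi Φ j) (b j)) p :=
    GenHol.sum fun j hj => Polar.genHol hj (polar_wedge_psi hΦ hp j (h.polar j hj))
  have := h1.add h2
  rwa [sub_add_cancel] at this

/-- As `d(ψ_j ∧ b_j) ≡ -ψ_j ∧ db_j` modulo log forms, the form with components `db_j` is `-da`. This
is why the differential of the shifted complex carries a sign. -/
lemma Decomp.dForm (hΦ : IsLogSymplectic D Φ) (hp : p ∈ N.e.source)
    {a : Form (m + 1) (k + 1) X} {b : Fin (m + 1) → Form (m + 1) k X} (h : N.Decomp Φ a b p) :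
    N.Decomp Φ (-dForm a) (fun j => LogSymp.dForm (b j)) p := by
  have H := N.adapted hp
  refine ⟨fun j hj => H.polar_dForm hj (h.polar j hj), ?_⟩
  have hg : ∀ j ∈ N.S, GenHol N.e N.S (wedgeForm (N.psi Φ j) (b j)) p := fun j hj =>
    Polar.genHol hj (polar_wedge_psi hΦ hp j (h.polar j hj))
  have h1 := H.dForm_sub_mem (h.genHol hΦ hp) (GenHol.sum hg)
  have h2 := H.dForm_mem_logForms h.mem
  have h3 := H.dForm_sum_mem hg
  have h4 := Submodule.sum_mem _ fun j hj => dForm_wedge_psi_mem hΦ hp hj (h.polar j hj)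
  rw [Finset.sum_add_distrib] at h4
  have := (logForms D (k + 2) p).sub_mem ((logForms D (k + 2) p).sub_mem h1 h2)
    ((logForms D (k + 2) p).add_mem h3 h4)
  convert! this using 1
  abel

end NormChart

end Filtration

/-! ### The comparison of `𝓖₁` with the direct image of `𝓔₁` -/

section Comparison

open Filter ContinuousAlternatingMap Subquot

variable {m : ℕ} {X X₁ : Type} [TopologicalSpace X] [ChartedSpace (Cn (m + 1)) X]
  [IsManifold 𝓘(ℂ, Cn (m + 1)) ω X] [TopologicalSpace X₁] [ChartedSpace (Cn m) X₁]
  [IsManifold 𝓘(ℂ, Cn m) ω X₁] {D : Set X} {f : C(X₁, X)} {N N' : NormChart (m := m) D f}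
  {i i' : Fin (m + 1)} {p : X} {q : X₁} {k : ℕ} {Φ : Form (m + 1) 2 X}

lemma mulForm_mem_logForms {e : OpenPartialHomeomorph X (Cn (m + 1))} {S : Finset (Fin (m + 1))}
    (h : Adapted D e S p) {g : X → ℂ} (hg : HolFun (m + 1) g p) {α : Form (m + 1) k X}
    (hα : α ∈ logForms D k p) : mulForm g α ∈ logForms D k p := by
  rw [mem_logForms_iff h] at hα ⊢
  exact (LogHol.smul ((holFun_iff h.1 h.2.1).1 hg).logHol hα).congr
    (Eventually.of_forall fun z => logCoord_fun_smul g α z)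

lemma NormChart.On.mulForm_mem_polarForms (h : N.On i q) {g : X → ℂ}
    (hg : HolFun (m + 1) g (f q)) {α : Form (m + 1) k X}
    (hα : α ∈ polarForms (m := m) D f k q) : mulForm g α ∈ polarForms (m := m) D f k q := by
  rw [h.mem_polarForms_iff] at hα ⊢
  exact (Polar.smul ((holFun_iff N.e_mem h.maps).1 hg).logHol hα).congr
    (Eventually.of_forall fun z => logCoord_fun_smul g α z)

lemma wedgeForm_mulForm (θ : Form (m + 1) 1 X) (g : X → ℂ) (α : Form (m + 1) k X) :
    wedgeForm θ (mulForm g α) = mulForm g (wedgeForm θ α) :=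
  funext fun _ => wedge_smul _ _ _

lemma exists_dG (hΦ : IsLogSymplectic D Φ) (hf : IsNormalization (m := m) D f) (k : ℕ) :
    ∃ d : (grOne D Φ k).sheaf ⟶ (grOne D Φ (k + 1)).sheaf, Induced d (fun a => -dForm a) := by
  refine exists_induced _ (fun p a ha => ?_) (fun p a _ ha => ?_) (fun p a ha a' ha' => ?_)
    (fun p c a ha => ?_) <;> obtain ⟨N, hp⟩ := hf.exists_normChart p
  · obtain ⟨b, hb⟩ := (N.mem_filt_iff hΦ hp).1 ha
    exact (hb.dForm hΦ hp).mem_filt hΦ hp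
  · exact (logForms D (k + 2) p).neg_mem ((N.adapted hp).dForm_mem_logForms ha)
  · obtain ⟨b, hb⟩ := (N.mem_filt_iff hΦ hp).1 ha
    obtain ⟨b', hb'⟩ := (N.mem_filt_iff hΦ hp).1 ha'
    have h1 := (N.adapted hp).dForm_add_mem (hb.genHol hΦ hp) (hb'.genHol hΦ hp)
    have e : ∀ x y z : Form (m + 1) (k + 2) X, -x - -y - -z = -(x - y - z) := fun x y z => by abel
    exact (e _ _ _).symm ▸ (logForms D (k + 2) p).neg_mem h1
  · obtain ⟨b, hb⟩ := (N.mem_filt_iff hΦ hp).1 ha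
    have h1 := (N.adapted hp).dForm_smul_mem (hb.genHol hΦ hp) c
    have e : ∀ x y : Form (m + 1) (k + 2) X, -x - c • -y = -(x - c • y) := fun x y => by
      ext; simp; ring
    exact (e _ _).symm ▸ (logForms D (k + 2) p).neg_mem h1

/-- The relation between representatives of sections of `𝓖₁` and of `𝓔₁`. -/
def kappaRel (D : Set X) (Φ : Form (m + 1) 2 X) (f : C(X₁, X)) (k : ℕ) (q : X₁) :
    Submodule ℂ (Form (m + 1) (k + 1) X × Form (m + 1) k X) where
  carrier := {x | x.1 ∈ filt D Φ 1 (k + 1) (f q) ∧ x.2 ∈ polarForms (m := m) D f k q ∧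
    ∀ (N : NormChart (m := m) D f) i, N.On i q → ∀ᶠ q' in 𝓝[(inducedDivisor f)ᶜ] q,
      x.1 - wedgeForm (N.psi Φ i) x.2 ∈ logForms D (k + 1) (f q')}
  zero_mem' := ⟨Submodule.zero_mem _, Submodule.zero_mem _, fun N i _ =>
    Eventually.of_forall fun q' => by
      have : (0 : Form (m + 1) (k + 1) X) - wedgeForm (N.psi Φ i) (0 : Form (m + 1) k X) = 0 := by
        rw [_root_.map_zero, sub_zero]
      exact this.symm ▸ Submodule.zero_mem _⟩
  add_mem' := by
    rintro ⟨a, b⟩ ⟨a', b'⟩ ⟨h1, h2, h3⟩ ⟨h1', h2', h3'⟩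
    refine ⟨Submodule.add_mem _ h1 h1', Submodule.add_mem _ h2 h2', fun N i h => ?_⟩
    filter_upwards [h3 N i h, h3' N i h] with q' h4 h5
    have : a + a' - wedgeForm (N.psi Φ i) (b + b') =
        a - wedgeForm (N.psi Φ i) b + (a' - wedgeForm (N.psi Φ i) b') := by
      rw [_root_.map_add, add_sub_add_comm]
    exact this.symm ▸ Submodule.add_mem _ h4 h5
  smul_mem' := by
    rintro c ⟨a, b⟩ ⟨h1, h2, h3⟩
    refine ⟨Submodule.smul_mem _ c h1, Submodule.smul_mem _ c h2, fun N i h => ?_⟩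
    filter_upwards [h3 N i h] with q' h4
    have : c • a - wedgeForm (N.psi Φ i) (c • b) = c • (a - wedgeForm (N.psi Φ i) b) := by
      rw [map_smul]
      exact funext fun x => (smul_sub c (a x) _).symm
    exact this.symm ▸ Submodule.smul_mem _ c h4

namespace NormChart

/-- At generic points of branch `j` the coefficients of the other branches have no pole, so only
`ψ_j ∧ b_j` survives modulo log forms; replacing the chart changes this product by a log form. -/
lemma Decomp.mem_kappaRel (hΦ : IsLogSymplectic D Φ) (hp : p ∈ N.e.source)
    {a : Form (m + 1) (k + 1) X} {b : Fin (m + 1) → Form (m + 1) k X} (h : N.Decomp Φ a b p) :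
    ∀ᶠ p' in 𝓝 p, ∀ j q, f q = p' → N.On j q → (a, b j) ∈ kappaRel D Φ f k q := by
  filter_upwards [eventually_eventually_nhds.2 (h.eventually hp), N.e.open_source.mem_nhds hp]
    with p' h1 hp' j q hq hj
  subst hq
  have hd := h1.self_of_nhds
  have hb := hj.mem_polarForms_iff.2 (hd.polar j hj.1)
  refine ⟨hd.mem_filt hΦ hp', hb, fun N' i' h' => ?_⟩
  have h2 : ∀ᶠ q' in 𝓝 q, wedgeForm (N'.psi Φ i') (b j) - wedgeForm (N.psi Φ j) (b j) ∈
      logForms D (k + 1) (f q') :=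
    hj.continuousAt.eventually (eventually_mem_logForms hj.adapted
      (hj.psi_sub_wedge_mem hΦ h' hb))
  filter_upwards [h2.filter_mono nhdsWithin_le_nhds,
    (hj.continuousAt.eventually h1).filter_mono nhdsWithin_le_nhds,
    hj.nhds.filter_mono nhdsWithin_le_nhds, self_mem_nhdsWithin] with q' h3 h4 h5 h6
  have h7 : ∑ l ∈ N.S.erase j, wedgeForm (N.psi Φ l) (b l) ∈ logForms D (k + 1) (f q') := by
    refine Submodule.sum_mem _ fun l hl => ?_
    obtain ⟨hlj, hl⟩ := Finset.mem_erase.1 hl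
    refine wedge_psi_mem_logForms hΦ h5.maps l ((mem_logForms_iff h5.adapted).2
      ((h4.polar l hl).logHol_of_ne fun h0 => h6 ?_))
    obtain ⟨r, rfl⟩ := Fin.exists_succAbove_eq hlj
    refine h5.mem_inducedDivisor.2 ⟨r, mem_rest.2 hl, ?_⟩
    rwa [h5.e_apply, insL_succAbove] at h0
  have h8 := h4.mem
  rw [← Finset.add_sum_erase _ _ hj.1] at h8
  have := (logForms D (k + 1) (f q')).sub_mem
    ((logForms D (k + 1) (f q')).add_mem h8 h7) h3
  convert! this using 1
  abel

end NormChart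

/-- The relation makes `ψ ∧ b` a log form at generic points of the branch. Its pole along the branch
is simple, and a simple pole that is generically absent is absent. -/
lemma kappaRel_den (hΦ : IsLogSymplectic D Φ) (hf : IsNormalization (m := m) D f)
    {a : Form (m + 1) (k + 1) X} {b : Form (m + 1) k X} (h : (a, b) ∈ kappaRel D Φ f k q)
    (ha : a ∈ logForms D (k + 1) (f q)) : b ∈ psiForms (m := m) D Φ f k q := by
  obtain ⟨N, i, hi⟩ := hf.exists_on q
  refine (hi.mem_psiForms_iff hΦ).2 ⟨h.2.1, hi.mem_logForms_of_generic
    (hi.wedge_psi_mem_polarForms hΦ i h.2.1) ?_⟩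
  filter_upwards [h.2.2 N i hi, (hi.continuousAt.eventually
    (eventually_mem_logForms hi.adapted ha)).filter_mono nhdsWithin_le_nhds] with q' h1 h2
  have := (logForms D (k + 1) (f q')).sub_mem h2 h1
  rwa [sub_sub_cancel] at this

/-- The comparison of representatives. -/
def kappaCorr (hΦ : IsLogSymplectic D Φ) (hf : IsNormalization (m := m) D f) (k : ℕ) :
    Corr (grOne D Φ k) (calE (m := m) D Φ f k) f where
  rel := kappaRel D Φ f k
  num h := h.2.1
  den h ha := kappaRel_den hΦ hf h ha
  exists_rel q a ha := by
    obtain ⟨N, i, hi⟩ := hf.exists_on q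
    obtain ⟨b, hb⟩ := (N.mem_filt_iff hΦ hi.maps).1 ha
    refine ⟨b i, ?_⟩
    filter_upwards [hi.continuousAt.eventually (hb.mem_kappaRel hΦ hi.maps), hi.nhds]
      with q' h1 h2 _ using h1 i q' rfl h2

/-- The summand `b_j` of a decomposition and the given `b'` are both related to `a`, so they agree
modulo denominators. Hence `ψ_j ∧ b_j` is a log form for every branch through `p`; the other
branches contribute no pole at `p`. -/
lemma kappa_inj (hΦ : IsLogSymplectic D Φ) (hf : IsNormalization (m := m) D f)
    {a : Form (m + 1) (k + 1) X} (ha : a ∈ filt D Φ 1 (k + 1) p)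
    (h : ∀ q, f q = p → ∃ b, (a, b) ∈ kappaRel D Φ f k q ∧ b ∈ psiForms (m := m) D Φ f k q) :
    a ∈ logForms D (k + 1) p := by
  obtain ⟨N, hp⟩ := hf.exists_normChart p
  obtain ⟨b, hb⟩ := (N.mem_filt_iff hΦ hp).1 ha
  have h1 : ∑ j ∈ N.S, wedgeForm (N.psi Φ j) (b j) ∈ logForms D (k + 1) p := by
    refine Submodule.sum_mem _ fun j hj => ?_
    by_cases h0 : N.e p j = 0
    · obtain ⟨q, hq, rfl⟩ := N.surj j hj p hp h0
      have hi : N.On j q := ⟨hj, hq⟩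
      have h2 := (hb.mem_kappaRel hΦ hp).self_of_nhds j q rfl hi
      obtain ⟨b', h3, h4⟩ := h q rfl
      have h5 := (kappaRel D Φ f k q).sub_mem h2 h3
      -- The first entry of the difference is `a - a = 0`, so its second entry is a denominator.
      have h6 := kappaRel_den hΦ hf (a := a - a) h5 (by
        rw [sub_self]
        exact Submodule.zero_mem _)
      have h7 := (psiForms (m := m) D Φ f k q).add_mem h6 h4
      rw [sub_add_cancel] at h7
      exact ((hi.mem_psiForms_iff hΦ).1 h7).2
    · exact NormChart.wedge_psi_mem_logForms hΦ hp j ((mem_logForms_iff (N.adapted hp)).2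
        ((hb.polar j hj).logHol_of_ne h0))
  have := (logForms D (k + 1) p).add_mem hb.mem h1
  rwa [sub_add_cancel] at this

/-- Take `a = ∑ ψ_j ∧ b_j`, where `b_j` represents `t` at the point of branch `j` over `p`, and `b_j
= 0` if branch `j` does not pass through `p`. -/
lemma kappa_surj (hΦ : IsLogSymplectic D Φ) (hf : IsNormalization (m := m) D f) (U : Opens X)
    (t : (calE (m := m) D Φ f k).Sec (U.comap f)) (hpU : p ∈ U) :
    ∃ a, ∀ᶠ p' in 𝓝 p, a ∈ filt D Φ 1 (k + 1) p' ∧ ∀ q (_ : f q = p') (hq : f q ∈ U),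
      ∃ b, (calE (m := m) D Φ f k).Rep t ⟨q, hq⟩ b ∧ (a, b) ∈ kappaRel D Φ f k q := by
  obtain ⟨N, hp⟩ := hf.exists_normChart p
  have hb : ∀ j : Fin (m + 1), ∃ b : Form (m + 1) k X, j ∈ N.S →
      Polar N.S j (logCoord N.e N.S b) (N.e p) ∧
      ∀ᶠ p' in 𝓝 p, ∀ q, N.On j q → f q = p' → ∀ hq : f q ∈ U,
        (calE (m := m) D Φ f k).Rep t ⟨q, hq⟩ b := by
    intro j
    by_cases hj : j ∈ N.S
    swap
    · exact ⟨0, fun h => absurd h hj⟩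
    by_cases h0 : N.e p j = 0
    · obtain ⟨q, hq, rfl⟩ := N.surj j hj p hp h0
      have hi : N.On j q := ⟨hj, hq⟩
      obtain ⟨b, h1⟩ := exists_eventually_rep t ⟨q, hpU⟩
      refine ⟨b, fun _ => ⟨hi.mem_polarForms_iff.1 (h1.self_of_nhds hpU).num, ?_⟩⟩
      -- Projecting to the `j`-th hyperplane gives a continuous map from a neighbourhood of `f q` to
      -- `X₁` that inverts `f` on the branch. It converts the validity of `b` near `q` into validity
      -- on all points of the branch over a neighbourhood of `f q`.
      have h2 : Tendsto (fun p' => (N.c j).symm (remL j (N.e p'))) (𝓝 (f q)) (𝓝 q) := by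
        have e1 : Tendsto (fun p' => remL j (N.e p')) (𝓝 (f q)) (𝓝 (N.c j q)) := by
          have := ((remL j).continuous.tendsto (N.e (f q))).comp (N.e.continuousAt hp)
          rwa [show remL j (N.e (f q)) = N.c j q by rw [hi.e_apply, remL_insL]] at this
        have e2 := (N.c j).continuousAt_symm ((N.c j).map_source hq)
        have e3 := e2.tendsto.comp e1
        rwa [(N.c j).left_inv hq] at e3
      filter_upwards [h2.eventually h1] with p' h3 q' hq' hfq' hU
      subst hfq'
      rw [hq'.e_apply, remL_insL, (N.c j).left_inv hq'.2] at h3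
      exact h3 hU
    · refine ⟨0, fun _ => ⟨LogHol.polar (LogHol.const 0), ?_⟩⟩
      have h2 : ContinuousAt (fun p' => N.e p' j) p :=
        (continuous_apply j).continuousAt.comp (N.e.continuousAt hp)
      filter_upwards [h2.eventually_ne h0] with p' h3 q' hq' hfq'
      subst hfq'
      exact absurd hq'.coord_eq_zero h3
  choose b hb using hb
  have hd : N.Decomp Φ (∑ j ∈ N.S, wedgeForm (N.psi Φ j) (b j)) b p :=
    ⟨fun j hj => (hb j hj).1, by rw [sub_self]; exact Submodule.zero_mem _⟩
  refine ⟨∑ j ∈ N.S, wedgeForm (N.psi Φ j) (b j), ?_⟩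
  have h1 : ∀ᶠ p' in 𝓝 p, ∀ j ∈ N.S, ∀ q, N.On j q → f q = p' → ∀ hq : f q ∈ U,
      (calE (m := m) D Φ f k).Rep t ⟨q, hq⟩ (b j) :=
    (eventually_all_finset _).2 fun j hj => (hb j hj).2
  filter_upwards [h1, hd.eventually hp, hd.mem_kappaRel hΦ hp, N.e.open_source.mem_nhds hp]
    with p' h2 h3 h4 h5
  refine ⟨h3.mem_filt hΦ h5, fun q hq hU => ?_⟩
  obtain ⟨j, hj⟩ := N.exists_on (q := q) (hq ▸ h5)
  exact ⟨b j, h2 j hj.1 q hj hq hU, h4 j q hq hj⟩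

/-- Apply `d` to `a - ψ ∧ b` at generic points and use `d(ψ ∧ b) ≡ -ψ ∧ db`. -/
lemma kappaRel_dForm (hΦ : IsLogSymplectic D Φ) (hf : IsNormalization (m := m) D f)
    {a : Form (m + 1) (k + 1) X} {b : Form (m + 1) k X} (h : (a, b) ∈ kappaRel D Φ f k q) :
    (-dForm a, dForm b) ∈ kappaRel D Φ f (k + 1) q := by
  obtain ⟨N, i, hi⟩ := hf.exists_on q
  obtain ⟨B, hB⟩ := (N.mem_filt_iff hΦ hi.maps).1 h.1
  refine ⟨(hB.dForm hΦ hi.maps).mem_filt hΦ hi.maps, hi.dForm_mem_polarForms h.2.1,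
    fun N' i' h' => ?_⟩
  filter_upwards [h.2.2 N' i' h', (hi.continuousAt.eventually
    (hB.eventually hi.maps)).filter_mono nhdsWithin_le_nhds,
    (h'.eventually_mem_polarForms h.2.1).filter_mono nhdsWithin_le_nhds,
    hi.nhds.filter_mono nhdsWithin_le_nhds, h'.nhds.filter_mono nhdsWithin_le_nhds]
    with q' h1 h2 h3 h4 h5
  -- The generic condition refers to the chart `N'`, so holomorphy of `a` off `D` is also needed
  -- there.
  obtain ⟨B', hB'⟩ := (N'.mem_filt_iff hΦ h5.maps).1 (h2.mem_filt hΦ h4.maps)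
  have e1 := h5.adapted.dForm_mem_logForms h1
  have e2 := h5.adapted.dForm_sub_mem (hB'.genHol hΦ h5.maps)
    (h5.genHol (h5.wedge_psi_mem_polarForms hΦ i' h3))
  have e3 := h5.dForm_wedge_psi_mem hΦ h3
  have := (logForms D (k + 2) (f q')).sub_mem
    ((logForms D (k + 2) (f q')).sub_mem e2 e1) e3
  convert! this using 1
  abel

lemma kappaRel_mul {g : X → ℂ} (hg : HolFun (m + 1) g (f q)) {a : Form (m + 1) (k + 1) X}
    (hf : IsNormalization (m := m) D f)
    {b : Form (m + 1) k X} (h : (a, b) ∈ kappaRel D Φ f k q)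
    (ha : mulForm g a ∈ filt D Φ 1 (k + 1) (f q)) :
    (mulForm g a, mulForm g b) ∈ kappaRel D Φ f k q := by
  obtain ⟨N, i, hi⟩ := hf.exists_on q
  refine ⟨ha, hi.mulForm_mem_polarForms hg h.2.1, fun N' i' h' => ?_⟩
  filter_upwards [h.2.2 N' i' h', h'.nhds.filter_mono nhdsWithin_le_nhds,
    (hi.continuousAt.eventually (eventually_eventually_nhds.2 hg)).filter_mono
      nhdsWithin_le_nhds] with q' h1 h2 h3
  change mulForm g a - wedgeForm (N'.psi Φ i') (mulForm g b) ∈ _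
  rw [wedgeForm_mulForm, ← map_sub]
  exact mulForm_mem_logForms h2.adapted h3 h1

/-- The complex `𝓖₁` is the direct image of the complex `𝓔₁`. -/
theorem exists_kappa (hΦ : IsLogSymplectic D Φ) (hf : IsNormalization (m := m) D f)
    {dG : ∀ k, (grOne D Φ k).sheaf ⟶ (grOne D Φ (k + 1)).sheaf}
    {dE : ∀ k, (calE (m := m) D Φ f k).sheaf ⟶ (calE (m := m) D Φ f (k + 1)).sheaf}
    (hG : ∀ k, Induced (dG k) (fun a => -dForm a)) (hE : ∀ k, Induced (dE k) (fun a => dForm a)) :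
    ∃ κ : ∀ k, (grOne D Φ k).sheaf ≅ (directImage f).obj (calE (m := m) D Φ f k).sheaf,
      (∀ k, dG k ≫ (κ (k + 1)).hom = (κ k).hom ≫ (directImage f).map (dE k)) ∧
      ∀ k U (g : X → ℂ) s t, (∀ p ∈ U, HolFun (m + 1) g p) → IsMulG g s t →
        IsMulE (g ∘ f) (onSecDirect (κ k).hom U s) (onSecDirect (κ k).hom U t) := by
  let R := kappaCorr (m := m) hΦ hf
  have hbij : ∀ k U, Function.Bijective ((R k).secMap U) := fun k U =>
    have inj : ∀ p a, a ∈ (grOne D Φ k).num p →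
        (∀ q, f q = p → ∃ b, (a, b) ∈ (R k).rel q ∧ b ∈ (calE (m := m) D Φ f k).den q) →
          a ∈ (grOne D Φ k).den p := fun p a ha h => kappa_inj hΦ hf ha h
    ⟨(R k).injective_secMap inj U,
      (R k).surjective_secMap U (fun t p hp => kappa_surj hΦ hf U t hp) inj⟩
  have := fun k => (R k).isIso_homDirect (hbij k)
  refine ⟨fun k => asIso (R k).homDirect, fun k => ?_, fun k U g s t hg hst q => ?_⟩
  · refine homDirect_ext_of_rep fun U s q => ?_
    obtain ⟨a, b, ha, hab, hb⟩ := (R k).exists_rep_secMap s q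
    exact ⟨dForm b, (R (k + 1)).rep_onSecDirect ((hG k).rep ha) (kappaRel_dForm hΦ hf hab),
      (hE k).rep hb⟩
  · obtain ⟨a, h1, h2⟩ := hst ⟨f q.1, q.2⟩
    obtain ⟨b, hb⟩ := (R k).exists_rel q.1 a h1.num
    have hab := hb.self_of_nhds h1.num
    exact ⟨g, hg _ q.2, Eventually.of_forall fun _ => rfl, b, (R k).rep_onSecDirect h1 hab,
      (R k).rep_onSecDirect h2 (kappaRel_mul (hg _ q.2) hf hab h2.num)⟩

end Comparison

/-! ### The foliation on the normalization -/

section Foliation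

open Filter ContinuousAlternatingMap

variable {m : ℕ} {X X₁ : Type} [TopologicalSpace X] [ChartedSpace (Cn (m + 1)) X]
  [IsManifold 𝓘(ℂ, Cn (m + 1)) ω X] [TopologicalSpace X₁] [ChartedSpace (Cn m) X₁]
  [IsManifold 𝓘(ℂ, Cn m) ω X₁] {D : Set X} {f : X₁ → X} {N N' : NormChart (m := m) D f}
  {i i' : Fin (m + 1)} {p : X} {q : X₁} {k : ℕ} {Φ : Form (m + 1) 2 X}
  {a : Cn (m + 1) → (Cn (m + 1)) [⋀^Fin 2]→L[ℂ] ℂ}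

/-- The restriction to the hyperplane `z i = 0` of the contraction of `a` by the `i`-th vector. -/
def psiRes (a : Cn (m + 1) → (Cn (m + 1)) [⋀^Fin 2]→L[ℂ] ℂ) (i : Fin (m + 1)) (y : Cn m) :
    (Cn m) [⋀^Fin 1]→L[ℂ] ℂ :=
  ((a (insL i y)).curryLeft (Pi.single i 1)).compContinuousLinearMap (insL i)

/-- The same, as an extended form. -/
def psiExt (a : Cn (m + 1) → (Cn (m + 1)) [⋀^Fin 2]→L[ℂ] ℂ) (i : Fin (m + 1)) (y : Cn m) :
    (Cn m × ℂ) [⋀^Fin 1]→L[ℂ] ℂ :=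
  (psiRes a i y).compContinuousLinearMap (ContinuousLinearMap.fst ℂ (Cn m) ℂ)

lemma smul_zero_form {E : Type*} [NormedAddCommGroup E] [NormedSpace ℂ E] (c : ℂ) :
    c • (0 : E [⋀^Fin k]→L[ℂ] ℂ) = 0 := by
  ext
  simp

lemma logFrame_empty {n : ℕ} (z v : Cn n) : logFrame ∅ z v = v := by
  ext j
  simp [logFrame_apply]

lemma Hol.insL {F : Type*} [NormedAddCommGroup F] [NormedSpace ℂ F] {g : Cn (m + 1) → F}
    {y : Cn m} (H : Hol g (LogSymp.insL i y)) : Hol (fun y => g (LogSymp.insL i y)) y :=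
  Hol.comp (f := LogSymp.insL i) H (Hol.clm _)

lemma hol_psiRes {y : Cn m} (ha : Hol a (insL i y)) : Hol (psiRes a i) y :=
  Hol.compForm (A := fun y => (a (insL i y)).curryLeft (Pi.single i 1)) (L := fun _ => insL i)
    (Hol.curryLeft (v := fun _ => Pi.single i 1) ha.insL (Hol.const _)) (Hol.const _)

lemma hol_psiExt {y : Cn m} (ha : Hol a (insL i y)) : Hol (psiExt a i) y :=
  (hol_psiRes ha).compForm (Hol.const (ContinuousLinearMap.fst ℂ (Cn m) ℂ))

lemma oneForm_comp {E E' : Type*} [NormedAddCommGroup E] [NormedSpace ℂ E]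
    [NormedAddCommGroup E'] [NormedSpace ℂ E'] (θ : E [⋀^Fin 1]→L[ℂ] ℂ) (L : E' →L[ℂ] E)
    (v : E') : oneForm (θ.compContinuousLinearMap L) v = oneForm θ (L v) := rfl

lemma oneForm_ext {E : Type*} [NormedAddCommGroup E] [NormedSpace ℂ E]
    {θ η : E [⋀^Fin 1]→L[ℂ] ℂ} (h : ∀ v, oneForm θ v = oneForm η v) : θ = η := by
  ext v
  have := h (v 0)
  rw [oneForm_apply, oneForm_apply] at this
  rwa [show (fun _ => v 0) = v from funext fun j => by rw [Fin.fin_one_eq_zero j]] at this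

lemma oneForm_curryLeft_self {E : Type*} [NormedAddCommGroup E] [NormedSpace ℂ E]
    (b : E [⋀^Fin 2]→L[ℂ] ℂ) (v : E) : oneForm (b.curryLeft v) v = 0 :=
  self_eq_neg.1 (oneForm_curryLeft_swap b v v)

/-- As `ψ_i(v_i) = 0`, the value of `ψ_i` does not see the `i`-th component. Its restriction to the
branch thus loses nothing, and in particular does not vanish. -/
lemma oneForm_psiRes_remL (y : Cn m) (u : Cn (m + 1)) :
    oneForm (psiRes a i y) (remL i u) =
      oneForm ((a (insL i y)).curryLeft (Pi.single i 1)) u := by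
  conv_rhs => rw [eq_insL_add i u, _root_.map_add, map_smul, oneForm_curryLeft_self, smul_zero,
    add_zero]
  rfl

lemma SympCoord.exists_psiExt_ne {y : Cn m} (h : insL i y = N.e p)
    (ha : SympCoord Φ N.e N.S p a) : ∃ u, oneForm (psiExt a i y) u ≠ 0 := by
  obtain ⟨u, hu⟩ := ha.nondegenerate i
  refine ⟨(remL i u, 0), ?_⟩
  rw [← h, ← oneForm_psiRes_remL] at hu
  exact hu

lemma form_eq_of_inChart_eq {n : ℕ} {Y : Type} [TopologicalSpace Y] [ChartedSpace (Cn n) Y]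
    [IsManifold 𝓘(ℂ, Cn n) ω Y] {e : OpenPartialHomeomorph Y (Cn n)}
    (he : e ∈ IsManifold.maximalAtlas 𝓘(ℂ, Cn n) ω Y) {α β : Form n k Y} {y : Y}
    (hy : y ∈ e.source) (h : inChart e α (e y) = inChart e β (e y)) : α y = β y := by
  ext v
  have := DFunLike.congr_fun h fun j => chartDeriv e y (v j)
  simpa only [inChart, compContinuousLinearMap_apply, e.left_inv hy, Function.comp_def,
    chartInvDeriv_chartDeriv he hy] using this

lemma ext_eq_zero_of_extCoord {n : ℕ} {Y : Type} [TopologicalSpace Y] [ChartedSpace (Cn n) Y]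
    [IsManifold 𝓘(ℂ, Cn n) ω Y] {e : OpenPartialHomeomorph Y (Cn n)} {S : Finset (Fin n)}
    (he : e ∈ IsManifold.maximalAtlas 𝓘(ℂ, Cn n) ω Y) {C : ExtForm n k Y} {z : Cn n}
    (hz : z ∈ e.target) (hS : z ∈ Off S) (h : extCoord e S C z = 0) : C (e.symm z) = 0 := by
  ext v
  have := DFunLike.congr_fun h fun j =>
    ((logFrameInv S z (chartDeriv e (e.symm z) (v j).1), (v j).2) : Cn n × ℂ)
  have h1 : ∀ w, chartInvDeriv e z (chartDeriv e (e.symm z) w) = w := fun w => by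
    have := chartInvDeriv_chartDeriv he (e.map_target hz) w
    rwa [e.right_inv hz] at this
  simp only [extCoord, extInChart, compContinuousLinearMap_apply, Function.comp_def,
    ContinuousLinearMap.coe_prodMap', Prod.map, ContinuousLinearMap.id_apply,
    logFrame_logFrameInv hS, h1] at this
  exact this

lemma Adapted.mem_zeroGerms_iff {n : ℕ} {Y : Type} [TopologicalSpace Y] [ChartedSpace (Cn n) Y]
    [IsManifold 𝓘(ℂ, Cn n) ω Y] {e : OpenPartialHomeomorph Y (Cn n)} {S : Finset (Fin n)}
    {D : Set Y} {y : Y} (h : Adapted D e S y) {C : ExtForm n k Y} :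
    C ∈ zeroGerms D k y ↔ ∀ᶠ z in 𝓝[Off S] (e y), extCoord e S C z = 0 := by
  change (∀ᶠ x in 𝓝[Dᶜ] y, C x = 0) ↔ _
  rw [h.eventually_iff]
  refine eventually_congr ?_
  filter_upwards [h.nhds.filter_mono nhdsWithin_le_nhds, self_mem_nhdsWithin] with z h1 h2
  refine ⟨fun h3 => ?_, ext_eq_zero_of_extCoord h.1 h1.1 h2⟩
  rw [extCoord, extInChart, h3]
  rfl

lemma logFrameInv_erase_insL {S : Finset (Fin (m + 1))} (y u : Cn m) :
    logFrameInv (S.erase i) (insL i y) (insL i u) = insL i (logFrameInv (rest S i) y u) :=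
  ext_succAbove i (by simp [logFrameInv_apply]) (by
    ext k
    simp [logFrameInv_apply, Fin.succAbove_ne])

/-- The form kills the `i`-th frame vector, so the factor `(z i)⁻¹` of the inverse frame may be
dropped. The resulting expression is holomorphic across `z i = 0`, which shows that `ψ_i` has no
pole along its own branch. -/
lemma inChart_eq_of_logCoord {e : OpenPartialHomeomorph X (Cn (m + 1))} {S : Finset (Fin (m + 1))}
    {z : Cn (m + 1)} (hz : z ∈ Off S) {b : (Cn (m + 1)) [⋀^Fin 2]→L[ℂ] ℂ} {α : Form (m + 1) 1 X}
    (h : logCoord e S α z = b.curryLeft (Pi.single i 1)) :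
    inChart e α z = (b.curryLeft (Pi.single i 1)).compContinuousLinearMap
      (logFrameInv (S.erase i) z) := by
  refine oneForm_ext fun u => ?_
  have h1 : oneForm (logCoord e S α z) (logFrameInv S z u) = oneForm (inChart e α z) u := by
    rw [logCoord, oneForm_comp, logFrame_logFrameInv hz]
  have h2 : logFrameInv S z u = logFrameInv (S.erase i) z u +
      (logFrameInv S z u i - u i) • (Pi.single i 1 : Cn (m + 1)) := by
    ext j
    by_cases hj : j = i
    · subst hj; simp [logFrameInv_apply]
    · simp [logFrameInv_apply, hj]
  rw [← h1, h, h2, _root_.map_add, map_smul, oneForm_curryLeft_self, smul_zero, add_zero,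
    oneForm_comp]

namespace NormChart

/-- The elements of the foliation are multiples of `psiRes`. -/
lemma On.psiFoliation_coord (h : N.On i q) (ha : SympCoord Φ N.e N.S (f q) a) {β : Form m 1 X₁}
    (hβ : β ∈ psiFoliation (m := m) D Φ f q) :
    ∃ w : Cn m → ℂ, Hol w (N.c i q) ∧ ∀ᶠ y in 𝓝[Off (rest N.S i)] (N.c i q),
      logCoord (N.c i) (rest N.S i) β y = w y • psiRes a i y := by
  obtain ⟨v, hv, hβ⟩ := hβ
  obtain ⟨w, hw, hvw, hwi⟩ := h.coresidue_coord hv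
  rw [h.e_apply] at hw
  refine ⟨fun y => w (insL i y) i,
    (hw.insL.clm_comp (ContinuousLinearMap.proj i : Cn (m + 1) →L[ℂ] ℂ)), ?_⟩
  have e1 : ∀ᶠ y in 𝓝 (N.c i q), w (insL i y) = w (insL i y) i • Pi.single i 1 := by
    rw [h.e_apply, ← eventually_insL_iff] at hwi
    exact hwi
  have e2 : ∀ᶠ z in 𝓝[Off N.S] (N.e (f q)), logCoord N.e N.S (interior Φ v) z =
      (a z).curryLeft (w z) := by
    filter_upwards [ha.eq, h.adapted.nhds.filter_mono nhdsWithin_le_nhds,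
      hvw.filter_mono nhdsWithin_le_nhds, self_mem_nhdsWithin] with z h1 h2 h3 h4
    rw [logCoord_interior N.e_mem Φ v h2.1 h4, h1, logVec, h3, logFrameInv_logFrame h4]
  have e3 := eventually_nhdsWithin_Off e2
  have e4 := ha.hol.eventually
  rw [h.e_apply] at e3 e4
  filter_upwards [h.adapted₁.eventually_iff.1 hβ, e1.filter_mono nhdsWithin_le_nhds,
    ((tendsto_insL i _).eventually e3).filter_mono nhdsWithin_le_nhds,
    ((tendsto_insL i _).eventually e4).filter_mono nhdsWithin_le_nhds,
    ((tendsto_insL i _).eventually hw.eventually).filter_mono nhdsWithin_le_nhds,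
    h.adapted₁.nhds.filter_mono nhdsWithin_le_nhds] with y h1 h2 h3 h4 h5 h6
  obtain ⟨α, hα, hαv, hβα⟩ := h1
  have hq' := h.of_mem ((N.c i).map_target h6.1)
  set q' := (N.c i).symm y with hq'def
  have hy : N.e (f q') = insL i y := by rw [hq'.e_apply, (N.c i).right_inv h6.1]
  have hA : Adapted ∅ N.e ∅ (f q') := ⟨N.e_mem, hq'.maps, by simp⟩
  obtain ⟨g, hg, hαg⟩ := (mem_logForms_iff hA).1 hα
  have hOff : Off (∅ : Finset (Fin (m + 1))) = Set.univ := by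
    ext
    simp [Off]
  rw [hOff, nhdsWithin_univ, hy] at hαg
  rw [hy] at hg
  -- The holomorphic extension `α` and `⟨Φ, v⟩` agree off `D`. Both sides here are holomorphic near
  -- the generic point of the branch, so the equality can be evaluated on the branch itself.
  have e5 : ∀ᶠ z in 𝓝 (insL i y), (g z).compContinuousLinearMap (logFrame N.S z) =
      (a z).curryLeft (w z) := by
    refine Hol.eq_of_eq_Off (S := N.S) (hg.compForm (hol_logFrame N.S _)) (h4.curryLeft h5) ?_
    have h7 := hq'.adapted.eventually_iff.1 hαv
    rw [hy] at h7
    filter_upwards [h3, h7, hαg.filter_mono nhdsWithin_le_nhds] with z h8 h9 h10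
    rw [← h8, ← h10]
    ext u
    simp only [logCoord, inChart, compContinuousLinearMap_apply, h9]
    simp only [Function.comp_def, logFrame_empty]
  refine oneForm_ext fun u => ?_
  have e6 := congrArg (fun θ => oneForm θ (insL i u)) e5.self_of_nhds
  simp only [oneForm_comp] at e6
  rw [h2, map_smul, map_smul] at e6
  have e7 : oneForm (g (insL i y)) = oneForm (logCoord N.e ∅ α (insL i y)) := by
    rw [hαg.self_of_nhds]
  rw [e7, logFrame_insL h.1, remL_insL] at e6
  change _ = w (insL i y) i * _ at e6
  change oneForm (β q') (chartInvDeriv (N.c i) y (logFrame (rest N.S i) y u)) =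
    w (insL i y) i * _
  refine Eq.trans ?_ e6
  rw [hβα, oneForm_comp, hq'.dMap_apply, hy]
  have e8 := chartDeriv_chartInvDeriv (N.c_mem i h.1) h6.1 (logFrame (rest N.S i) y u)
  rw [e8]
  change _ = oneForm (α (N.e.symm (insL i y))) _
  rw [← hy, N.e.left_inv hq'.maps, hy]
  exact congrArg (fun t => oneForm (α (f q')) (chartInvDeriv N.e (insL i y) t))
    (logFrame_empty (insL i y) _).symm

/-- The form `psiRes` belongs to the foliation. -/
lemma On.formOf_psiRes_mem (h : N.On i q) (ha : SympCoord Φ N.e N.S (f q) a) :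
    formOf (N.c i) (rest N.S i) (psiRes a i) ∈ psiFoliation (m := m) D Φ f q := by
  refine ⟨N.res i, h.res_mem, ?_⟩
  have e2 := eventually_nhdsWithin_Off (eventually_logCoord_psi h.maps ha i)
  rw [h.adapted₁.eventually_iff]
  have e4 := ha.hol.eventually
  rw [h.e_apply] at e2 e4
  filter_upwards [((tendsto_insL i _).eventually e2).filter_mono nhdsWithin_le_nhds,
    ((tendsto_insL i _).eventually e4).filter_mono nhdsWithin_le_nhds,
    h.adapted₁.nhds.filter_mono nhdsWithin_le_nhds, self_mem_nhdsWithin] with y h1 h2 h3 h4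
  have hq' := h.of_mem ((N.c i).map_target h3.1)
  set q' := (N.c i).symm y with hq'def
  have hy : N.e (f q') = insL i y := by rw [hq'.e_apply, (N.c i).right_inv h3.1]
  set A : Cn (m + 1) → (Cn (m + 1)) [⋀^Fin 1]→L[ℂ] ℂ := fun z =>
    (a z).curryLeft (Pi.single i 1) with hA
  have hin : ∀ z ∈ N.e.target, inChart N.e (formOf N.e (N.S.erase i) A) z =
      (A z).compContinuousLinearMap (logFrameInv (N.S.erase i) z) := by
    intro z hz
    ext u
    simp only [inChart, formOf, compContinuousLinearMap_apply, N.e.right_inv hz,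
      Function.comp_def, ContinuousLinearMap.comp_apply, chartDeriv_chartInvDeriv N.e_mem hz]
  -- The extension across the branch is written in the frame that is logarithmic only along the
  -- other branches, where it has holomorphic coefficients.
  refine ⟨formOf N.e (N.S.erase i) A, ?_, ?_, ?_⟩
  · have hA' : Adapted ∅ N.e ∅ (f q') := ⟨N.e_mem, hq'.maps, by simp⟩
    rw [mem_logForms_iff hA', hy]
    have h5 : Hol A (insL i y) :=
      Hol.curryLeft (v := fun _ => Pi.single i 1) h2 (Hol.const _)
    refine (h5.compForm (hol_logFrameInv (insL_mem_Off.2 h4))).logHol.congr ?_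
    have h6 : N.e.target ∈ 𝓝 (insL i y) := by
      rw [← hy]
      exact N.e.open_target.mem_nhds (N.e.map_source hq'.maps)
    filter_upwards [mem_nhdsWithin_of_mem_nhds h6] with z hz
    rw [logCoord, hin z hz]
    ext u
    simp only [compContinuousLinearMap_apply, Function.comp_def, logFrame_empty]
  · rw [hq'.adapted.eventually_iff, hy]
    have h6 := hq'.adapted.nhds
    rw [hy] at h6
    filter_upwards [h1, h6.filter_mono nhdsWithin_le_nhds, self_mem_nhdsWithin] with z h7 h8 h9
    have hz := N.e.map_target h8.1
    refine form_eq_of_inChart_eq N.e_mem hz ?_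
    rw [N.e.right_inv h8.1, hin z h8.1]
    exact (inChart_eq_of_logCoord h9 h7).symm
  · refine oneForm_ext fun u => ?_
    rw [oneForm_comp, hq'.dMap_apply, hy]
    change oneForm (psiRes a i (N.c i q')) (logFrameInv (rest N.S i) (N.c i q')
      (chartDeriv (N.c i) q' u)) = oneForm (A (N.e (f q'))) (logFrameInv (N.S.erase i) (N.e (f q'))
        (chartDeriv N.e (f q') (chartInvDeriv N.e (insL i y)
          (insL i (chartDeriv (N.c i) q' u)))))
    have h5 := chartDeriv_chartInvDeriv N.e_mem (N.e.map_source hq'.maps)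
      (insL i (chartDeriv (N.c i) q' u))
    rw [N.e.left_inv hq'.maps, hy] at h5
    rw [hy, h5, logFrameInv_erase_insL, hq'def, (N.c i).right_inv h3.1]
    rfl

/-- The ideal of the foliation. -/
theorem On.mem_extIdeal_iff (h : N.On i q) (ha : SympCoord Φ N.e N.S (f q) a)
    {C : ExtForm m k X₁} :
    C ∈ extIdeal (inducedDivisor f) (psiFoliation (m := m) D Φ f) k q ↔
      LogHol (rest N.S i) (extCoord (N.c i) (rest N.S i) C) (N.c i q) ∧
      ∀ᶠ y in 𝓝[Off (rest N.S i)] (N.c i q),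
        wedge (psiExt a i y) (extCoord (N.c i) (rest N.S i) C y) = 0 := by
  have hψ : Hol (psiExt a i) (N.c i q) := hol_psiExt (by rw [← h.e_apply]; exact ha.hol)
  obtain ⟨u, hu⟩ := ha.exists_psiExt_ne h.e_apply.symm
  have zero_case : ∀ {l : ℕ} {C : ExtForm m l X₁}, C ∈ zeroGerms (inducedDivisor f) l q →
      LogHol (rest N.S i) (extCoord (N.c i) (rest N.S i) C) (N.c i q) ∧
      ∀ᶠ y in 𝓝[Off (rest N.S i)] (N.c i q),
        wedge (psiExt a i y) (extCoord (N.c i) (rest N.S i) C y) = 0 := by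
    intro l C hC
    have h1 := h.adapted₁.mem_zeroGerms_iff.1 hC
    refine ⟨LogHol.zero_of_eventually h1, ?_⟩
    filter_upwards [h1] with y hy
    rw [hy, wedge_zero]
  cases k with
  | zero =>
    refine ⟨zero_case, fun ⟨_, h2⟩ => h.adapted₁.mem_zeroGerms_iff.2 ?_⟩
    filter_upwards [h2, (hψ.eventually_oneForm_ne hu).filter_mono nhdsWithin_le_nhds]
      with y h3 h4
    rw [eq_of_wedge_zero h4 (extCoord _ _ C y), h3, ← contract_apply, _root_.map_zero]
    exact smul_zero_form _
  | succ k =>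
    constructor
    · intro hC
      let Q : Submodule ℂ (ExtForm m (k + 1) X₁) :=
        { carrier := {C | LogHol (rest N.S i) (extCoord (N.c i) (rest N.S i) C) (N.c i q) ∧
            ∀ᶠ y in 𝓝[Off (rest N.S i)] (N.c i q),
              wedge (psiExt a i y) (extCoord (N.c i) (rest N.S i) C y) = 0}
          zero_mem' := zero_case (Submodule.zero_mem _)
          add_mem' := by
            rintro C C' ⟨h1, h2⟩ ⟨h1', h2'⟩
            refine ⟨h1.add h1', ?_⟩
            filter_upwards [h2, h2'] with y h3 h4
            rw [extCoord_add, wedge_add, h3, h4, add_zero]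
          smul_mem' := by
            rintro c C ⟨h1, h2⟩
            refine ⟨((LogHol.const c).smul h1).congr
              (Eventually.of_forall fun y => extCoord_smul c C y), ?_⟩
            filter_upwards [h2] with y h3
            rw [extCoord_smul, wedge_smul, h3]
            exact smul_zero_form _ }
      have hle : extIdeal (inducedDivisor f) (psiFoliation (m := m) D Φ f) (k + 1) q ≤ Q := by
        refine sup_le (fun C hC => zero_case hC) (Submodule.span_le.2 ?_)
        rintro _ ⟨θ, hθ, B, hB, rfl⟩
        obtain ⟨w, hw, hw'⟩ := h.psiFoliation_coord ha hθ
        have hB' := (mem_extLogForms_iff h.adapted₁).1 hB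
        have e1 : ∀ᶠ y in 𝓝[Off (rest N.S i)] (N.c i q), extCoord (N.c i) (rest N.S i)
            (fun z => wedge (toExt θ z) (B z)) y = wedge (w y • psiExt a i y)
              (extCoord (N.c i) (rest N.S i) B y) := by
          filter_upwards [hw'] with y hy
          rw [extCoord_wedge, extCoord_toExt, hy]
          rfl
        constructor
        · exact (LogHol.wedge (hw.smul hψ).logHol hB').congr e1
        · filter_upwards [e1] with y hy
          rw [hy, smul_wedge, wedge_smul, wedge_wedge_self]
          exact smul_zero_form _
      exact hle hC
    · rintro ⟨h1, h2⟩
      -- Koszul division by the nonvanishing `psiExt`: a form annihilated by it is a multiple of it.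
      obtain ⟨B, hB, hB'⟩ := LogHol.exists_eq_wedge hψ hu h1 h2
      set C' : ExtForm m (k + 1) X₁ := fun z =>
        wedge (toExt (formOf (N.c i) (rest N.S i) (psiRes a i)) z)
          (extFormOf (N.c i) (rest N.S i) B z) with hC'
      have e1 : C' ∈ extIdeal (inducedDivisor f) (psiFoliation (m := m) D Φ f) (k + 1) q := by
        refine Submodule.mem_sup_right (Submodule.subset_span
          ⟨_, h.formOf_psiRes_mem ha, _, (mem_extLogForms_iff h.adapted₁).2
            (hB.logHol.congr ?_), rfl⟩)
        filter_upwards [h.adapted₁.nhds.filter_mono nhdsWithin_le_nhds, self_mem_nhdsWithin]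
          with y h3 h4 using extCoord_extFormOf (N.c_mem i h.1) B h3.1 h4
      have e2 : C - C' ∈ extIdeal (inducedDivisor f) (psiFoliation (m := m) D Φ f) (k + 1) q := by
        refine Submodule.mem_sup_left (h.adapted₁.mem_zeroGerms_iff.2 ?_)
        filter_upwards [hB', h.adapted₁.nhds.filter_mono nhdsWithin_le_nhds, self_mem_nhdsWithin]
          with y h3 h4 h5
        rw [extCoord_sub, hC', extCoord_wedge, extCoord_toExt,
          extCoord_extFormOf (N.c_mem i h.1) B h4.1 h5,
          logCoord_formOf (N.c_mem i h.1) (psiRes a i) h4.1 h5, h3]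
        exact sub_self _
      have := Submodule.add_mem _ e2 e1
      rwa [sub_add_cancel] at this

end NormChart

end Foliation

/-! ### Shears and the connection on extended forms -/

section Shear

open ContinuousAlternatingMap Filter

variable {E : Type*} [NormedAddCommGroup E] [NormedSpace ℂ E] {k : ℕ}

/-- A linear form as a `1`-form. -/
def toOne (l : E →L[ℂ] ℂ) : E [⋀^Fin 1]→L[ℂ] ℂ :=
  ContinuousAlternatingMap.ofSubsingleton ℂ E ℂ (0 : Fin 1) l

@[simp] lemma oneForm_toOne (l : E →L[ℂ] ℂ) (v : E) : oneForm (toOne l) v = l v := rfl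

/-- The shear `v ↦ v + θ(v) e`. -/
def shear (θ : E [⋀^Fin 1]→L[ℂ] ℂ) (e : E) : E →L[ℂ] E :=
  ContinuousLinearMap.id ℂ E + (oneForm θ).smulRight e

lemma shear_apply (θ : E [⋀^Fin 1]→L[ℂ] ℂ) (e v : E) : shear θ e v = v + oneForm θ v • e := rfl

/-- In the multilinear expansion a term with `e` in two slots vanishes, so only the part linear in
`θ` remains. -/
lemma comp_shear (θ : E [⋀^Fin 1]→L[ℂ] ℂ) (e : E) (a : E [⋀^Fin (k + 1)]→L[ℂ] ℂ) :
    a.compContinuousLinearMap (shear θ e) = a + wedge θ (a.curryLeft e) := by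
  have key : ∀ {n : ℕ} (b : E [⋀^Fin (n + 1)]→L[ℂ] ℂ) (v : E),
      (b.compContinuousLinearMap (shear θ e)).curryLeft v =
        ((b.curryLeft v).compContinuousLinearMap (shear θ e)) +
          oneForm θ v • (b.curryLeft e).compContinuousLinearMap (shear θ e) := by
    intro n b v
    have h1 : (b.compContinuousLinearMap (shear θ e)).curryLeft v =
        (b.curryLeft (shear θ e v)).compContinuousLinearMap (shear θ e) := by
      ext u
      simp only [curryLeft_apply_apply, compContinuousLinearMap_apply]
      congr 1
      ext j : 1
      refine Fin.cases ?_ (fun j => ?_) j <;> rfl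
    rw [h1, shear_apply, ← curryL_apply, _root_.map_add, map_smul]
    rfl
  induction k with
  | zero =>
    refine curryLeft_eq_iff.2 fun v => ?_
    rw [key, ← curryL_apply, ← curryL_apply, ← curryL_apply, _root_.map_add, _root_.add_apply,
      curryL_apply _ v, curryL_apply _ v, curryLeft_wedge_zero]
    congr 1
    · ext u
      exact congrArg (a.curryLeft v) (Subsingleton.elim _ _)
    · congr 1
      ext u
      exact congrArg (a.curryLeft e) (Subsingleton.elim _ _)
  | succ k ih =>
    refine curryLeft_eq_iff.2 fun v => ?_
    have h0 : ∀ x : E, (a.curryLeft x).curryLeft x = 0 := by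
      intro x
      ext u
      exact a.map_eq_zero_of_eq (Matrix.vecCons x (Matrix.vecCons x u))
        (i := (0 : Fin (k + 2))) (j := 1) rfl Fin.zero_ne_one
    have h2 := h0 e
    have h3 : (a.curryLeft v).curryLeft e = -(a.curryLeft e).curryLeft v := by
      have h4 := h0 (v + e)
      rw [← curryL_apply, ← curryL_apply, _root_.map_add, _root_.map_add, _root_.map_add,
        _root_.add_apply, _root_.add_apply] at h4
      simp only [curryL_apply, h0] at h4
      rw [zero_add, add_zero, add_comm] at h4
      exact eq_neg_of_add_eq_zero_left h4
    rw [key, ih, ih, h2, wedge_zero, add_zero, h3, wedge_neg, ← curryL_apply (a + _), _root_.map_add,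
      _root_.add_apply, curryL_apply, curryL_apply, curryLeft_wedge]
    abel

lemma wedge_comp_shear (θ η : E [⋀^Fin 1]→L[ℂ] ℂ) (e : E) (a : E [⋀^Fin k]→L[ℂ] ℂ) :
    (wedge η a).compContinuousLinearMap (shear θ e) =
      wedge (η + oneForm η e • θ) (a.compContinuousLinearMap (shear θ e)) := by
  rw [wedge_comp]
  congr 1
  refine oneForm_ext fun v => ?_
  rw [oneForm_comp, shear_apply, _root_.map_add, _root_.map_add, map_smul, map_smul,
    _root_.add_apply, _root_.smul_apply, smul_eq_mul, smul_eq_mul, mul_comm]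

end Shear

/-! ### The connection on extended forms in log coordinates -/

section Nabla

open ContinuousAlternatingMap Filter

variable {n k : ℕ} {S : Finset (Fin n)} {G : Cn n → ℂ} {z : Cn n}

/-- The logarithmic derivative of `G` in the log frame, as an extended form. -/
def dlogForm (S : Finset (Fin n)) (G : Cn n → ℂ) (z : Cn n) : (Cn n × ℂ) [⋀^Fin 1]→L[ℂ] ℂ :=
  (G z)⁻¹ • toOne ((fderiv ℂ G z).comp ((logFrame S z).comp (ContinuousLinearMap.fst ℂ (Cn n) ℂ)))

lemma oneForm_dlogForm (w : Cn n × ℂ) :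
    oneForm (dlogForm S G z) w = (G z)⁻¹ * fderiv ℂ G z (logFrame S z w.1) := rfl

lemma dlogForm_congr {G' : Cn n → ℂ} (h : G =ᶠ[𝓝 z] G') : dlogForm S G z = dlogForm S G' z := by
  rw [dlogForm, dlogForm, h.fderiv_eq, h.self_of_nhds]

lemma Hol.dlogForm (H : Hol G z) (h0 : G z ≠ 0) : Hol (dlogForm S G) z := by
  refine (H.inv h0).smul ?_
  have h1 : Hol (fun w => (logFrame S w).comp (ContinuousLinearMap.fst ℂ (Cn n) ℂ)) z := by
    filter_upwards [hol_logFrame S z] with w hw using hw.clm_comp (differentiableAt_const _)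
  have h2 : Hol (fun w => (fderiv ℂ G w).comp
      ((logFrame S w).comp (ContinuousLinearMap.fst ℂ (Cn n) ℂ))) z := by
    filter_upwards [H.hol_fderiv, h1] with w hw hw' using hw.clm_comp hw'
  exact Hol.clm_comp (G := (Cn n × ℂ) [⋀^Fin 1]→L[ℂ] ℂ)
    (ofSubsingletonLIE (𝕜 := ℂ) (E := Cn n × ℂ) (F := ℂ)
      (0 : Fin 1)).toContinuousLinearEquiv.toContinuousLinearMap h2

/-- Expresses that `dlog G` is closed: the second derivative of `G` is symmetric, the frame fields
commute, and the term from differentiating `1 / G` is symmetric. -/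
lemma fderiv_dlogForm_symm (H : Hol G z) (h0 : G z ≠ 0) (v w : Cn n × ℂ) :
    oneForm (fderiv ℂ (dlogForm S G) z (logFrame S z v.1)) w =
      oneForm (fderiv ℂ (dlogForm S G) z (logFrame S z w.1)) v := by
  have h1 : ∀ u w, oneForm (fderiv ℂ (dlogForm S G) z u) w =
      fderiv ℂ (fun y => (G y)⁻¹ * fderiv ℂ G y (logFrame S y w.1)) z u := fun u w =>
    fderiv_form_apply (H.dlogForm h0).differentiableAt u _
  have h2 : ∀ u w : Cn n, fderiv ℂ (fun y => (G y)⁻¹ * fderiv ℂ G y (logFrame S y w)) z u =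
      -((G z ^ 2)⁻¹ * fderiv ℂ G z u) * fderiv ℂ G z (logFrame S z w) +
        (G z)⁻¹ * (fderiv ℂ (fderiv ℂ G) z u (logFrame S z w) +
          fderiv ℂ G z (logFrameLin S u w)) := by
    intro u w
    have h3 := H.differentiableAt.hasFDerivAt
    have h4 := (hasDerivAt_inv h0).comp_hasFDerivAt z h3
    have h5 := H.hol_fderiv.differentiableAt.hasFDerivAt.clm_apply
      ((hasFDerivAt_logFrame S z).clm_apply (hasFDerivAt_const w z))
    refine (DFunLike.congr_fun (h4.mul h5).fderiv u).trans ?_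
    simp
    ring
  have h3 : IsSymmSndFDerivAt ℂ G z := (H.contDiffAt_nat 2).isSymmSndFDerivAt (by simp)
  rw [h1, h1, h2, h2, h3.eq (logFrame S z v.1), logFrameLin_comm]
  ring

/-- The differential of extended forms twisted by the frame of the line bundle. -/
def nabla (S : Finset (Fin n)) (A : Cn n → (Cn n × ℂ) [⋀^Fin k]→L[ℂ] ℂ) (z : Cn n) :
    (Cn n × ℂ) [⋀^Fin (k + 1)]→L[ℂ] ℂ :=
  extLogD S A z + wedge (dlogFrame n) (A z)

variable {A B : Cn n → (Cn n × ℂ) [⋀^Fin k]→L[ℂ] ℂ}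

lemma nabla_congr (h : A =ᶠ[𝓝 z] B) : nabla S A z = nabla S B z := by
  rw [nabla, nabla, extLogD_congr h, h.self_of_nhds]

lemma Hol.nabla (H : Hol A z) : Hol (nabla S A) z :=
  H.extLogD.add (Hol.wedge (Hol.const (dlogFrame n)) H)

lemma LogHol.nabla (H : LogHol S A z) : LogHol S (nabla S A) z := by
  obtain ⟨B, h1, h2⟩ := H
  exact ⟨_, h1.nabla, by filter_upwards [eventually_of_Off h2] with z hz using nabla_congr hz⟩

lemma extLogD_add (hA : DifferentiableAt ℂ A z) (hB : DifferentiableAt ℂ B z) :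
    extLogD S (fun w => A w + B w) z = extLogD S A z + extLogD S B z := by
  rw [extLogD, fderiv_fun_add hA hB, ContinuousLinearMap.add_comp]
  exact (alternatizeUncurryFinCLM ℂ (Cn n × ℂ) ℂ).map_add _ _

lemma extLogD_smul (hG : DifferentiableAt ℂ G z) (hA : DifferentiableAt ℂ A z) :
    extLogD S (fun w => G w • A w) z = G z • extLogD S A z +
      wedge (toOne ((fderiv ℂ G z).comp
        ((logFrame S z).comp (ContinuousLinearMap.fst ℂ (Cn n) ℂ)))) (A z) := by
  rw [extLogD, fderiv_fun_smul hG hA, ContinuousLinearMap.add_comp, wedge_eq]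
  refine ((alternatizeUncurryFinCLM ℂ (Cn n × ℂ) ℂ).map_add _ _).trans ?_
  congr 1
  exact (alternatizeUncurryFinCLM ℂ (Cn n × ℂ) ℂ).map_smul (G z)
    ((fderiv ℂ A z).comp ((logFrame S z).comp (ContinuousLinearMap.fst ℂ (Cn n) ℂ)))

lemma nabla_add (hA : DifferentiableAt ℂ A z) (hB : DifferentiableAt ℂ B z) :
    nabla S (fun w => A w + B w) z = nabla S A z + nabla S B z := by
  rw [nabla, extLogD_add hA hB, wedge_add, nabla, nabla]
  abel

lemma nabla_const_smul (c : ℂ) (hA : DifferentiableAt ℂ A z) :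
    nabla S (fun w => c • A w) z = c • nabla S A z := by
  rw [nabla, nabla, wedge_smul, smul_add, extLogD, fderiv_fun_const_smul hA]
  congr 1
  exact (alternatizeUncurryFinCLM ℂ (Cn n × ℂ) ℂ).map_smul c
    ((fderiv ℂ A z).comp ((logFrame S z).comp (ContinuousLinearMap.fst ℂ (Cn n) ℂ)))

lemma nabla_sub (hA : DifferentiableAt ℂ A z) (hB : DifferentiableAt ℂ B z) :
    nabla S (fun w => A w - B w) z = nabla S A z - nabla S B z := by
  have h : (fun w => A w - B w) = fun w => A w + (-1 : ℂ) • B w := by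
    funext w
    ext u
    simp [sub_eq_add_neg]
  rw [h]
  refine (nabla_add (B := fun w => (-1 : ℂ) • B w) hA (hB.const_smul (-1 : ℂ))).trans ?_
  rw [nabla_const_smul _ hB]
  ext u
  simp [sub_eq_add_neg]

/-- The coefficients do not depend on the second variable, so in the contraction formula the
derivative in direction `(0, 1)` disappears. -/
lemma curryLeft_extLogD {A : Cn n → (Cn n × ℂ) [⋀^Fin (k + 1)]→L[ℂ] ℂ}
    (hA : DifferentiableAt ℂ A z) : (extLogD S A z).curryLeft (0, 1) =
      -extLogD S (fun w => (A w).curryLeft (0, 1)) z := by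
  have h : fderiv ℂ (fun w => (A w).curryLeft ((0, 1) : Cn n × ℂ)) z =
      (contract k (0, 1)).comp (fderiv ℂ A z) :=
    ((contract k ((0, 1) : Cn n × ℂ)).hasFDerivAt.comp z hA.hasFDerivAt).fderiv
  rw [extLogD, curryLeft_alternatize, extLogD, h]
  simp only [ContinuousLinearMap.comp_apply, ContinuousLinearMap.coe_fst', _root_.map_zero, zero_sub]
  rfl

lemma extLogD_wedge_of_symmetric {θ : Cn n → (Cn n × ℂ) [⋀^Fin 1]→L[ℂ] ℂ}
    (hθ : DifferentiableAt ℂ θ z) (hA : DifferentiableAt ℂ A z)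
    (hs : ∀ v w : Cn n × ℂ, oneForm (fderiv ℂ θ z (logFrame S z v.1)) w =
      oneForm (fderiv ℂ θ z (logFrame S z w.1)) v) :
    extLogD S (fun w => wedge (θ w) (A w)) z = -wedge (θ z) (extLogD S A z) :=
  alternatize_fderiv_wedge_of_symmetric hθ hA _ hs

lemma nabla_wedge_of_symmetric {θ : Cn n → (Cn n × ℂ) [⋀^Fin 1]→L[ℂ] ℂ}
    (hθ : DifferentiableAt ℂ θ z) (hA : DifferentiableAt ℂ A z)
    (hs : ∀ v w : Cn n × ℂ, oneForm (fderiv ℂ θ z (logFrame S z v.1)) w =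
      oneForm (fderiv ℂ θ z (logFrame S z w.1)) v) :
    nabla S (fun w => wedge (θ w) (A w)) z = -wedge (θ z) (nabla S A z) := by
  rw [nabla, extLogD_wedge_of_symmetric hθ hA hs, wedge_wedge_swap, nabla, wedge_add]
  abel

lemma wedge_dlogForm (h0 : G z ≠ 0) (a : (Cn n × ℂ) [⋀^Fin k]→L[ℂ] ℂ) :
    wedge (toOne ((fderiv ℂ G z).comp
      ((logFrame S z).comp (ContinuousLinearMap.fst ℂ (Cn n) ℂ)))) a =
      G z • wedge (dlogForm S G z) a := by
  rw [dlogForm, smul_wedge, smul_inv_smul₀ h0]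

/-- The connection is compatible with a change of the frame of the line bundle. -/
lemma nabla_shear (hG : Hol G z) (h0 : G z ≠ 0) (hA : Hol A z) :
    nabla S (fun w => G w • (A w).compContinuousLinearMap (shear (dlogForm S G w) (0, 1))) z =
      G z • (nabla S A z).compContinuousLinearMap (shear (dlogForm S G z) (0, 1)) := by
  set θ := dlogForm S G with hθ
  have hθd : DifferentiableAt ℂ θ z := (hG.dlogForm h0).differentiableAt
  -- The exterior derivative commutes with the shear: the correction term is the product of the
  -- closed form `dlog G` with a contraction by `(0, 1)`, and the two signs cancel.
  have h1 : extLogD S (fun w => (A w).compContinuousLinearMap (shear (θ w) (0, 1))) z =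
      (extLogD S A z).compContinuousLinearMap (shear (θ z) (0, 1)) ∧
      DifferentiableAt ℂ (fun w => (A w).compContinuousLinearMap (shear (θ w) (0, 1))) z := by
    cases k with
    | zero =>
      have e : (fun w => (A w).compContinuousLinearMap (shear (θ w) (0, 1))) = A := by
        funext w
        ext u
        exact congrArg (A w) (Subsingleton.elim _ _)
      rw [e, comp_shear]
      refine ⟨?_, hA.differentiableAt⟩
      have e2 : (extLogD S A z).curryLeft (0, 1) = 0 := by
        rw [extLogD, curryLeft_alternatize_zero]
        simp
      rw [e2, wedge_zero, add_zero]
    | succ k =>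
      have e : (fun w => (A w).compContinuousLinearMap (shear (θ w) (0, 1))) =
          fun w => A w + wedge (θ w) ((A w).curryLeft (0, 1)) := funext fun w => comp_shear _ _ _
      have hA' : Hol (fun w => (A w).curryLeft ((0, 1) : Cn n × ℂ)) z :=
        Hol.curryLeft (v := fun _ => (0, 1)) hA (Hol.const _)
      have hw := ((hG.dlogForm (S := S) h0).wedge hA').differentiableAt
      rw [e, extLogD_add hA.differentiableAt hw,
        extLogD_wedge_of_symmetric hθd hA'.differentiableAt (fderiv_dlogForm_symm hG h0),
        comp_shear, curryLeft_extLogD hA.differentiableAt, wedge_neg]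
      exact ⟨rfl, hA.differentiableAt.add hw⟩
  have h2 : oneForm (dlogFrame n) (0, 1) = 1 := rfl
  have sa : ∀ x y : (Cn n × ℂ) [⋀^Fin (k + 1)]→L[ℂ] ℂ, G z • x + G z • y = G z • (x + y) :=
    fun x y => by
      ext u
      simp
  rw [nabla, extLogD_smul hG.differentiableAt h1.2, h1.1, wedge_dlogForm h0, ← hθ, wedge_smul,
    sa, sa, nabla]
  congr 1
  have h3 : ∀ a b : (Cn n × ℂ) [⋀^Fin (k + 1)]→L[ℂ] ℂ, (a + b).compContinuousLinearMap
      (shear (θ z) (0, 1)) = a.compContinuousLinearMap (shear (θ z) (0, 1)) +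
        b.compContinuousLinearMap (shear (θ z) (0, 1)) := fun _ _ => rfl
  -- Under the shear `dlog u` becomes `dlog u + dlog G`; this accounts for the term produced by
  -- differentiating the factor `G`.
  rw [h3, wedge_comp_shear, h2, one_smul, add_wedge]
  abel

/-- The form `dlog u` has constant coefficients, so the mixed terms cancel, and its square is zero.
-/
lemma nabla_nabla (hA : DifferentiableAt ℂ A z) (hA' : DifferentiableAt ℂ (extLogD S A) z)
    (h : extLogD S (extLogD S A) z = 0) : nabla S (nabla S A) z = 0 := by
  have h1 : extLogD S (fun w => wedge (dlogFrame n) (A w)) z =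
      -wedge (dlogFrame n) (extLogD S A z) :=
    extLogD_wedge_of_symmetric (θ := fun _ => dlogFrame n) (differentiableAt_const _) hA (by simp)
  have h2 : DifferentiableAt ℂ (fun w => wedge (dlogFrame n) (A w)) z :=
    (wedgeL k (dlogFrame n)).differentiableAt.comp z hA
  change extLogD S (fun w => extLogD S A w + wedge (dlogFrame n) (A w)) z +
    wedge _ (extLogD S A z + wedge (dlogFrame n) (A z)) = 0
  rw [extLogD_add hA' h2, h, h1, wedge_add, wedge_wedge_self]
  abel

end Nabla

/-! ### The differential of the principal parts complex -/

section Twist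

open ContinuousAlternatingMap Filter

variable {n k : ℕ} {Y : Type} [TopologicalSpace Y] [ChartedSpace (Cn n) Y]
  [IsManifold 𝓘(ℂ, Cn n) ω Y] {e : OpenPartialHomeomorph Y (Cn n)} {S : Finset (Fin n)}
  {D : Set Y} {y : Y} {z : Cn n} {L : Y → Type}

lemma extCoord_twist (he : e ∈ IsManifold.maximalAtlas 𝓘(ℂ, Cn n) ω Y) (hz : z ∈ e.target)
    {g : Y → ℂ} (hg : DifferentiableAt ℂ (fun w => g (e.symm w)) z) (c : ExtForm n k Y) :
    extCoord e S (twist g c) z = (extCoord e S c z).compContinuousLinearMap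
      (shear (dlogForm S (fun w => g (e.symm w)) z) (0, 1)) := by
  have h : dFun n g (e.symm z) = (fderiv ℂ (fun w => g (e.symm w)) z).comp
      (chartDeriv e (e.symm z)) := by
    have := dFun_eq he (e.map_target hz) (g := g) (by rwa [e.right_inv hz])
    rwa [e.right_inv hz] at this
  ext v
  simp only [extCoord, extInChart, twist, compContinuousLinearMap_apply, h]
  refine congrArg _ (funext fun j => ?_)
  simp only [Function.comp_apply, shear_apply, oneForm_dlogForm]
  refine Prod.ext ?_ ?_
  · simp
  · simp [chartDeriv_chartInvDeriv he hz]

lemma Adapted.extCoord_dPrincipalParts (h : Adapted D e S y) {C : (∀ y, L y) → ExtForm n k Y}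
    {u : ∀ y, L y} (hC : LogHol S (extCoord e S (C u)) (e y)) :
    ∀ᶠ z in 𝓝[Off S] (e y),
      extCoord e S (dPrincipalParts 1 C u) z = nabla S (extCoord e S (C u)) z := by
  filter_upwards [h.extCoord_dExt hC.eventually_hol] with z hz
  have h1 : dPrincipalParts 1 C u = dExt (C u) + fun y => wedge (dlogFrame n) (C u y) := by
    funext y
    simp only [dPrincipalParts, Nat.cast_one, Pi.add_apply]
    congr 1
    ext v
    simp
  rw [h1, extCoord_add, hz, extCoord_wedge (fun _ => dlogFrame n)]
  rfl

/-- At generic points the frame derivative computes the exterior derivative of an honest form on `ℂⁿ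
× ℂ`, for which `d ∘ d = 0`. -/
lemma Adapted.extLogD_extLogD (h : Adapted D e S y) {c : ExtForm n k Y}
    (hc : LogHol S (extCoord e S c) (e y)) :
    ∀ᶠ z in 𝓝[Off S] (e y), extLogD S (extLogD S (extCoord e S c)) z = 0 := by
  have h1 := h.extCoord_dExt hc.eventually_hol
  have h2 : ∀ᶠ z in 𝓝[Off S] (e y), Hol (extCoord e S (dExt c)) z := by
    filter_upwards [eventually_of_Off h1, hc.eventually_hol] with z h3 h4
    exact h4.extLogD.congr h3
  filter_upwards [h.extCoord_dExt h2, eventually_of_Off h1, hc.eventually_hol, self_mem_nhdsWithin,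
    h.nhds.filter_mono nhdsWithin_le_nhds] with z h3 h4 h5 h6 h7
  rw [← extLogD_congr h4, ← h3]
  have h8 : Hol (extInChart e c) z := by
    have h9 : extInChart e c =ᶠ[𝓝 z] fun w => (extCoord e S c w).compContinuousLinearMap
        ((logFrameInv S w).prodMap (ContinuousLinearMap.id ℂ ℂ)) := by
      filter_upwards [(isOpen_Off S).mem_nhds h6] with w hw
      ext v
      simp only [extCoord, compContinuousLinearMap_apply]
      refine congrArg _ (funext fun j => Prod.ext ?_ rfl)
      exact (logFrame_logFrameInv hw _).symm
    refine Hol.congr (Hol.compForm (A := extCoord e S c) h5 ?_) h9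
    filter_upwards [hol_logFrameInv h6] with w hw
    exact DifferentiableAt.comp w
      (ContinuousLinearMap.prodMapL ℂ (Cn n) (Cn n) ℂ ℂ).differentiableAt
      (hw.prodMk (differentiableAt_const _))
  set F : Cn n × ℂ → (Cn n × ℂ) [⋀^Fin k]→L[ℂ] ℂ := fun p => extInChart e c p.1 with hF
  have hFz : Hol F (z, 0) := Hol.comp (f := Prod.fst) (z := ((z, 0) : Cn n × ℂ)) h8
    (Hol.clm (ContinuousLinearMap.fst ℂ (Cn n) ℂ))
  have h10 : ∀ᶠ w in 𝓝 z, ∀ s, extInChart e (dExt c) w = extDeriv F (w, s) := by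
    filter_upwards [h8, e.open_target.mem_nhds h7.1] with w hw hw' s
    exact extInChart_dExt h.1 hw' hw s
  have h11 : (fun p : Cn n × ℂ => extInChart e (dExt c) p.1) =ᶠ[𝓝 (z, 0)] extDeriv F := by
    filter_upwards [(continuousAt_fst (p := ((z, 0) : Cn n × ℂ))).eventually h10] with p hp
    exact hp p.2
  have h12 : Hol (extDeriv F) (z, 0) := hFz.hol_fderiv.clm_comp
    (alternatizeUncurryFinCLM ℂ (Cn n × ℂ) ℂ)
  have h13 : DifferentiableAt ℂ (extInChart e (dExt c)) z := by
    have h14 : DifferentiableAt ℂ (fun w : Cn n => extDeriv F (w, 0)) z :=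
      DifferentiableAt.comp (f := fun w : Cn n => ((w, 0) : Cn n × ℂ)) z h12.differentiableAt
        (differentiableAt_id.prodMk (differentiableAt_const _))
    refine h14.congr_of_eventuallyEq ?_
    filter_upwards [h10] with w hw using hw 0
  have h15 : extInChart e (dExt (dExt c)) z = 0 := by
    rw [extInChart_dExt h.1 h7.1 h13 0, h11.extDeriv_eq]
    exact extDeriv_extDeriv_apply (hFz.contDiffAt_nat 2) (by simp)
  rw [extCoord, h15]
  rfl

lemma Adapted.nabla_nabla (h : Adapted D e S y) {c : ExtForm n k Y}
    (hc : LogHol S (extCoord e S c) (e y)) :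
    ∀ᶠ z in 𝓝[Off S] (e y), nabla S (nabla S (extCoord e S c)) z = 0 := by
  filter_upwards [h.extLogD_extLogD hc, hc.eventually_hol] with z h1 h2
  exact LogSymp.nabla_nabla h2.differentiableAt h2.extLogD.differentiableAt h1

end Twist

/-! ### The foliated differential is well defined -/

section Differential

open ContinuousAlternatingMap Filter

variable {m : ℕ} {X X₁ : Type} [TopologicalSpace X] [ChartedSpace (Cn (m + 1)) X]
  [IsManifold 𝓘(ℂ, Cn (m + 1)) ω X] [TopologicalSpace X₁] [ChartedSpace (Cn m) X₁]
  [IsManifold 𝓘(ℂ, Cn m) ω X₁] {D : Set X} {f : X₁ → X} {N : NormChart (m := m) D f}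
  {i : Fin (m + 1)} {q : X₁} {k : ℕ} {Φ : Form (m + 1) 2 X}
  {a : Cn (m + 1) → (Cn (m + 1)) [⋀^Fin 2]→L[ℂ] ℂ}

/-- The restriction of the contraction of a closed form is closed. -/
lemma fderiv_psiExt_symm {S : Finset (Fin (m + 1))} (hi : i ∈ S) {y : Cn m}
    (ha : Hol a (insL i y)) (hc : logD S a (insL i y) = 0) (v w : Cn m × ℂ) :
    oneForm (fderiv ℂ (psiExt a i) y (logFrame (rest S i) y v.1)) w =
      oneForm (fderiv ℂ (psiExt a i) y (logFrame (rest S i) y w.1)) v := by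
  have h1 : ∀ u w, oneForm (fderiv ℂ (psiExt a i) y u) w =
      oneForm ((fderiv ℂ a (insL i y) (insL i u)).curryLeft (Pi.single i 1)) (insL i w.1) := by
    intro u w
    have h2 : HasFDerivAt (fun y => a (insL i y)) ((fderiv ℂ a (insL i y)).comp (insL i)) y :=
      ha.differentiableAt.hasFDerivAt.comp y (insL i).hasFDerivAt
    have h3 := ((ContinuousAlternatingMap.apply ℂ (Cn (m + 1)) ℂ (Matrix.vecCons
      (Pi.single i (1 : ℂ)) fun _ : Fin 1 => insL i w.1)).hasFDerivAt.comp y h2).fderiv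
    exact (fderiv_form_apply (hol_psiExt ha).differentiableAt u _).trans (DFunLike.congr_fun h3 u)
  have h5 := fderiv_contract_symm hc (Pi.single i 1) (insL i v.1) (insL i w.1)
  -- On the hyperplane the vector `x_i ∂_i` is zero, so the defect of symmetry of the contracted
  -- closed form vanishes there.
  have h6 : logFrame S (insL i y) (Pi.single i 1) = 0 := by
    rw [logFrame_single hi]
    simp [insL]
  rw [h6, _root_.map_zero, logFrame_insL hi, logFrame_insL hi, remL_insL, remL_insL] at h5
  rw [h1, h1]
  exact sub_eq_zero.1 h5

lemma IsFrame.ne_zero {Y : Type} {L : Y → Type} [∀ y, AddCommGroup (L y)] [∀ y, Module ℂ (L y)]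
    [TopologicalSpace Y] {hol : (∀ y, L y) → Y → Prop} {u u' : ∀ y, L y} {y : Y} {g : Y → ℂ}
    (h : IsFrame hol u' y) (hg : ∀ᶠ z in 𝓝 y, u' z = g z • u z) : g y ≠ 0 := fun h0 =>
  h.2 (by rw [hg.self_of_nhds, h0, zero_smul])

namespace NormChart

/-- The connection preserves the annihilator of the foliation. -/
lemma On.wedge_psiExt_nabla (h : N.On i q) (ha : SympCoord Φ N.e N.S (f q) a)
    {A : Cn m → (Cn m × ℂ) [⋀^Fin k]→L[ℂ] ℂ} (hA : LogHol (rest N.S i) A (N.c i q))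
    (h0 : ∀ᶠ y in 𝓝[Off (rest N.S i)] (N.c i q), wedge (psiExt a i y) (A y) = 0) :
    ∀ᶠ y in 𝓝[Off (rest N.S i)] (N.c i q),
      wedge (psiExt a i y) (nabla (rest N.S i) A y) = 0 := by
  have h1 := ha.hol.eventually
  have h2 := ha.closed
  rw [h.e_apply] at h1 h2
  filter_upwards [hA.eventually_hol, eventually_of_Off h0,
    ((tendsto_insL i _).eventually h1).filter_mono nhdsWithin_le_nhds,
    ((tendsto_insL i _).eventually h2).filter_mono nhdsWithin_le_nhds] with y h3 h4 h5 h6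
  -- The restricted `ψ` is closed, hence `ψ ∧ ∇A = -∇(ψ ∧ A)`, and `ψ ∧ A` vanishes identically near
  -- the generic point.
  rw [← neg_eq_zero, ← nabla_wedge_of_symmetric (hol_psiExt h5).differentiableAt
    h3.differentiableAt (fderiv_psiExt_symm h.1 h5 h6), nabla_congr h4, nabla, wedge_zero,
    add_zero, extLogD]
  simp [alternatize_zero]

lemma On.extIdeal_le (h : N.On i q) (ha : SympCoord Φ N.e N.S (f q) a) {C : ExtForm m k X₁}
    (hC : ∀ᶠ y in 𝓝[Off (rest N.S i)] (N.c i q), extCoord (N.c i) (rest N.S i) C y = 0) :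
    C ∈ extIdeal (inducedDivisor f) (psiFoliation (m := m) D Φ f) k q := by
  refine (h.mem_extIdeal_iff ha).2 ⟨(Hol.const 0).logHol.congr hC, ?_⟩
  filter_upwards [hC] with y hy
  rw [hy, wedge_zero]

lemma hol_shear {E F : Type*} [NormedAddCommGroup E] [NormedSpace ℂ E] [NormedAddCommGroup F]
    [NormedSpace ℂ F] {θ : F → E [⋀^Fin 1]→L[ℂ] ℂ} {x : F} (hθ : Hol θ x) (e : E) :
    Hol (fun y => shear (θ y) e) x :=
  Hol.add (h := fun _ => ContinuousLinearMap.id ℂ E) (h' := fun y => (oneForm (θ y)).smulRight e)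
    (Hol.const _)
    (Hol.clm_comp (((ContinuousLinearMap.smulRightL ℂ E E).flip e).comp oneForm) hθ)

lemma On.eventually_twist (h : N.On i q) {g : X₁ → ℂ} (hg : HolFun m g q)
    (C : ExtForm m k X₁) : ∀ᶠ y in 𝓝 (N.c i q), extCoord (N.c i) (rest N.S i) (twist g C) y =
      (extCoord (N.c i) (rest N.S i) C y).compContinuousLinearMap
        (shear (dlogForm (rest N.S i) (fun w => g ((N.c i).symm w)) y) (0, 1)) := by
  filter_upwards [h.adapted₁.nhds, (holFun_iff h.adapted₁.1 h.adapted₁.2.1).1 hg] with y h1 h2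
  exact extCoord_twist h.adapted₁.1 h1.1 h2 C

lemma On.mem_extIdeal_of_nabla (h : N.On i q) (ha : SympCoord Φ N.e N.S (f q) a)
    {C : ExtForm m k X₁} {C' : ExtForm m (k + 1) X₁}
    (hC : C ∈ extIdeal (inducedDivisor f) (psiFoliation (m := m) D Φ f) k q)
    (hC' : ∀ᶠ y in 𝓝[Off (rest N.S i)] (N.c i q), extCoord (N.c i) (rest N.S i) C' y =
      nabla (rest N.S i) (extCoord (N.c i) (rest N.S i) C) y) :
    C' ∈ extIdeal (inducedDivisor f) (psiFoliation (m := m) D Φ f) (k + 1) q := by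
  obtain ⟨h1, h2⟩ := (h.mem_extIdeal_iff ha).1 hC
  refine (h.mem_extIdeal_iff ha).2 ⟨h1.nabla.congr hC', ?_⟩
  filter_upwards [h.wedge_psiExt_nabla ha h1 h2, hC'] with y e1 e2
  rw [e2, e1]

end NormChart

-- The transition rule between two frames is a shear combined with multiplication by `g`, with which
-- the connection is compatible by `nabla_shear`; the error term stays in the ideal because the
-- connection preserves the ideal.
open NormChart in
lemma dPrincipalParts_mem_num (hΦ : IsLogSymplectic D Φ) (hf : IsNormalization (m := m) D f)
    {C : (∀ y, NormalFibre (m := m) f y) → ExtForm m k X₁}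
    (hC : C ∈ (calP (m := m) D Φ f k).num q) :
    dPrincipalParts 1 C ∈ (calP (m := m) D Φ f (k + 1)).num q := by
  intro u hu
  obtain ⟨N, i, h⟩ := hf.exists_on q
  obtain ⟨a, ha⟩ := hΦ.exists_sympCoord h.adapted
  have h1 := (mem_extLogForms_iff h.adapted₁).1 (hC u hu).1
  refine ⟨(mem_extLogForms_iff h.adapted₁).2
    (h1.nabla.congr (h.adapted₁.extCoord_dPrincipalParts h1)), fun u' hu' g hg hgu => ?_⟩
  have h2 := (mem_extLogForms_iff h.adapted₁).1 (hC u' hu').1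
  have hG := (holFun_iff h.adapted₁.1 h.adapted₁.2.1).1 hg
  have hG0 : (fun w => g ((N.c i).symm w)) (N.c i q) ≠ 0 := by
    simpa only [(N.c i).left_inv h.2] using IsFrame.ne_zero hu' hgu
  have h5 : ∀ᶠ y in 𝓝[Off (rest N.S i)] (N.c i q), extCoord (N.c i) (rest N.S i)
      (dPrincipalParts 1 C u - fun z => g z ^ 1 • twist g (dPrincipalParts 1 C u') z) y =
      nabla (rest N.S i) (extCoord (N.c i) (rest N.S i)
        (C u - fun z => g z ^ 1 • twist g (C u') z)) y := by
    filter_upwards [h.adapted₁.extCoord_dPrincipalParts h1,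
      h.adapted₁.extCoord_dPrincipalParts h2, h1.eventually_hol, h2.eventually_hol,
      hG.eventually.filter_mono nhdsWithin_le_nhds,
      (hG.continuousAt.eventually_ne hG0).filter_mono nhdsWithin_le_nhds,
      (h.eventually_twist hg (C u')).eventually_nhds.filter_mono nhdsWithin_le_nhds,
      (h.eventually_twist hg (dPrincipalParts 1 C u')).filter_mono nhdsWithin_le_nhds]
      with y e1 e2 e3 e4 e5 e6 e7 e8
    have e9 : extCoord (N.c i) (rest N.S i) (C u - fun z => g z ^ 1 • twist g (C u') z) =ᶠ[𝓝 y]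
        fun y => extCoord (N.c i) (rest N.S i) (C u) y - g ((N.c i).symm y) •
          (extCoord (N.c i) (rest N.S i) (C u') y).compContinuousLinearMap
            (shear (dlogForm (rest N.S i) (fun w => g ((N.c i).symm w)) y) (0, 1)) := by
      filter_upwards [e7] with w hw
      rw [extCoord_sub, extCoord_fun_smul, pow_one, hw]
    have e10 : DifferentiableAt ℂ (fun y => g ((N.c i).symm y) •
          (extCoord (N.c i) (rest N.S i) (C u') y).compContinuousLinearMap
            (shear (dlogForm (rest N.S i) (fun w => g ((N.c i).symm w)) y) (0, 1))) y :=
      (e5.smul (e4.compForm (hol_shear (e5.dlogForm e6) _))).differentiableAt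
    rw [nabla_congr e9, nabla_sub e3.differentiableAt e10, nabla_shear e5 e6 e4, extCoord_sub,
      extCoord_fun_smul, pow_one, e8, e1, e2]
  exact h.mem_extIdeal_of_nabla ha ((hC u hu).2 u' hu' g hg hgu) h5

open NormChart in
/-- The differential of the principal parts complex. -/
theorem exists_dP (hΦ : IsLogSymplectic D Φ) (hf : IsNormalization (m := m) D f) (k : ℕ) :
    ∃ d : (calP (m := m) D Φ f k).sheaf ⟶ (calP (m := m) D Φ f (k + 1)).sheaf,
      Subquot.Induced d (fun C => dPrincipalParts 1 C) := by
  refine Subquot.exists_induced _ (fun q C hC => dPrincipalParts_mem_num hΦ hf hC)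
    (fun q C _ hC u hu => ?_) (fun q C hC C' hC' u hu => ?_) (fun q c C hC u hu => ?_)
  all_goals
    obtain ⟨N, i, h⟩ := hf.exists_on q
    obtain ⟨a, ha⟩ := hΦ.exists_sympCoord h.adapted
  · have h1 := (h.mem_extIdeal_iff ha).1 (hC u hu)
    have h2 := h.adapted₁.extCoord_dPrincipalParts h1.1
    exact h.mem_extIdeal_of_nabla ha (hC u hu) h2
  · have h1 := (mem_extLogForms_iff h.adapted₁).1 (hC u hu).1
    have h2 := (mem_extLogForms_iff h.adapted₁).1 (hC' u hu).1
    refine h.extIdeal_le ha ?_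
    filter_upwards [h.adapted₁.extCoord_dPrincipalParts h1,
      h.adapted₁.extCoord_dPrincipalParts h2,
      h.adapted₁.extCoord_dPrincipalParts (C := C + C') (u := u) (h1.add h2),
      h1.eventually_hol, h2.eventually_hol] with y h3 h4 h5 h6 h7
    have h8 : extCoord (N.c i) (rest N.S i) ((C + C') u) =
        fun y => extCoord (N.c i) (rest N.S i) (C u) y + extCoord (N.c i) (rest N.S i) (C' u) y :=
      rfl
    rw [h8, nabla_add h6.differentiableAt h7.differentiableAt] at h5
    change extCoord _ _ (dPrincipalParts 1 (C + C') u - dPrincipalParts 1 C u -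
      dPrincipalParts 1 C' u) y = 0
    rw [extCoord_sub, extCoord_sub, h5, h3, h4]
    abel
  · have h1 := (mem_extLogForms_iff h.adapted₁).1 (hC u hu).1
    refine h.extIdeal_le ha ?_
    filter_upwards [h.adapted₁.extCoord_dPrincipalParts h1,
      h.adapted₁.extCoord_dPrincipalParts (C := c • C) (u := u) ((Hol.const c).logHol.smul h1),
      h1.eventually_hol] with y h3 h4 h5
    have h8 : extCoord (N.c i) (rest N.S i) ((c • C) u) =
        fun y => c • extCoord (N.c i) (rest N.S i) (C u) y := rfl
    rw [h8, nabla_const_smul c h5.differentiableAt, ← h3] at h4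
    exact sub_eq_zero.2 h4

open NormChart in
lemma dPrincipalParts_dPrincipalParts (hΦ : IsLogSymplectic D Φ)
    (hf : IsNormalization (m := m) D f) {C : (∀ y, NormalFibre (m := m) f y) → ExtForm m k X₁}
    (hC : C ∈ (calP (m := m) D Φ f k).num q) :
    dPrincipalParts 1 (dPrincipalParts 1 C) ∈ (calP (m := m) D Φ f (k + 1 + 1)).den q := by
  intro u hu
  obtain ⟨N, i, h⟩ := hf.exists_on q
  obtain ⟨a, ha⟩ := hΦ.exists_sympCoord h.adapted
  have h1 := (mem_extLogForms_iff h.adapted₁).1 (hC u hu).1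
  have h2 := h.adapted₁.extCoord_dPrincipalParts h1
  refine h.extIdeal_le ha ?_
  filter_upwards [h.adapted₁.nabla_nabla h1, eventually_of_Off h2,
    h.adapted₁.extCoord_dPrincipalParts (h1.nabla.congr h2)] with y h3 h4 h5
  rw [h5, nabla_congr h4, h3]

end Differential

/-! ### Frames of the branch normal bundle -/

section NormalFrames

open ContinuousAlternatingMap Filter

lemma shear_comp_shear {E : Type*} [NormedAddCommGroup E] [NormedSpace ℂ E]
    {θ η : E [⋀^Fin 1]→L[ℂ] ℂ} {e : E} (h : oneForm θ e = 0) :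
    (shear θ e).comp (shear η e) = shear (θ + η) e := by
  ext v
  rw [ContinuousLinearMap.comp_apply, shear_apply, shear_apply, shear_apply, _root_.map_add,
    map_smul, h, smul_zero, add_zero, _root_.map_add, _root_.add_apply, add_smul]
  abel

lemma dlogForm_mul {n : ℕ} {S : Finset (Fin n)} {G G' : Cn n → ℂ} {z : Cn n}
    (h : DifferentiableAt ℂ G z) (h' : DifferentiableAt ℂ G' z) (h0 : G z ≠ 0) (h0' : G' z ≠ 0) :
    dlogForm S (fun w => G w * G' w) z = dlogForm S G z + dlogForm S G' z := by
  refine oneForm_ext fun w => ?_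
  rw [oneForm_dlogForm, fderiv_fun_mul h h', _root_.map_add]
  simp only [_root_.add_apply, _root_.smul_apply, smul_eq_mul, oneForm_dlogForm]
  field_simp
  ring

variable {m : ℕ} {X X₁ : Type} [TopologicalSpace X] [ChartedSpace (Cn (m + 1)) X]
  [IsManifold 𝓘(ℂ, Cn (m + 1)) ω X] [TopologicalSpace X₁] [ChartedSpace (Cn m) X₁]
  [IsManifold 𝓘(ℂ, Cn m) ω X₁] {D : Set X} {f : X₁ → X} {N : NormChart (m := m) D f}
  {i : Fin (m + 1)} {q : X₁} {k : ℕ} {Φ : Form (m + 1) 2 X}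
  {a : Cn (m + 1) → (Cn (m + 1)) [⋀^Fin 2]→L[ℂ] ℂ}

/-- The frame of the normal bundle of the `i`-th branch given by the `i`-th coordinate field. -/
def NormChart.normal (N : NormChart (m := m) D f) (i : Fin (m + 1)) (q : X₁) :
    NormalFibre (m := m) f q :=
  Submodule.Quotient.mk (fieldOf N.e ∅ (fun _ => Pi.single i 1) (f q))

/-- The coefficient of a normal vector with respect to the frame. -/
def NormChart.coeff (N : NormChart (m := m) D f) (i : Fin (m + 1))
    (u : ∀ q, NormalFibre (m := m) f q) (q : X₁) : ℂ :=
  chartDeriv N.e (f q) (Quotient.out (u q)) i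

namespace NormChart

lemma chartDeriv_normal {x : X} (hx : x ∈ N.e.source) :
    chartDeriv N.e x (fieldOf N.e ∅ (fun _ => Pi.single i 1) x) = Pi.single i 1 := by
  have := chartDeriv_chartInvDeriv N.e_mem (N.e.map_source hx)
    (logFrame ∅ (N.e x) (Pi.single i 1))
  rw [N.e.left_inv hx] at this
  exact this.trans (logFrame_empty _ _)

lemma On.mk_eq (h : N.On i q) (v : Cn (m + 1)) :
    (Submodule.Quotient.mk v : NormalFibre (m := m) f q) =
      chartDeriv N.e (f q) v i • N.normal i q := by
  rw [normal, ← Submodule.Quotient.mk_smul, Submodule.Quotient.eq, h.mem_range_dMap,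
    _root_.map_sub, map_smul, chartDeriv_normal h.maps]
  simp

lemma On.normal_ne_zero (h : N.On i q) : N.normal i q ≠ 0 := by
  rw [normal, Ne, Submodule.Quotient.mk_eq_zero, h.mem_range_dMap, chartDeriv_normal h.maps]
  simp

lemma On.coeff_smul_normal (h : N.On i q) (u : ∀ q, NormalFibre (m := m) f q) :
    u q = N.coeff i u q • N.normal i q := by
  rw [coeff, ← h.mk_eq]
  exact (Quotient.out_eq _).symm

lemma On.coeff_eq (h : N.On i q) {u : ∀ q, NormalFibre (m := m) f q} {c : ℂ}
    (hu : u q = c • N.normal i q) : N.coeff i u q = c :=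
  smul_left_injective ℂ h.normal_ne_zero ((h.coeff_smul_normal u).symm.trans hu)

lemma On.coeff_normal (h : N.On i q) : N.coeff i (N.normal i) q = 1 :=
  h.coeff_eq (one_smul _ _).symm

lemma On.holFun_coeff (h : N.On i q) {u : ∀ q, NormalFibre (m := m) f q}
    (hu : HolNormal f u q) : HolFun m (N.coeff i u) q := by
  obtain ⟨ξ, hξ, hu⟩ := hu
  have h1 := (holField_iff N.e_mem h.maps).1 hξ
  rw [h.e_apply] at h1
  rw [holFun_iff h.adapted₁.1 h.2]
  refine (Hol.clm_comp (ContinuousLinearMap.proj i) h1.insL).congr ?_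
  have h2 := (N.c i).eventually_nhds' (fun q' => N.On i q' ∧ u q' = Submodule.Quotient.mk (ξ (f q')))
    h.2 |>.2 (h.nhds.and hu)
  filter_upwards [h2, (N.c i).open_target.mem_nhds ((N.c i).map_source h.2)] with y h3 h4
  rw [h3.1.mk_eq] at h3
  rw [h3.1.coeff_eq h3.2, h.f_symm h4]
  rfl

lemma On.isFrame_normal (h : N.On i q) : IsFrame (HolNormal (m := m) f) (N.normal i) q := by
  refine ⟨⟨fieldOf N.e ∅ (fun _ => Pi.single i 1), ?_, Eventually.of_forall fun _ => rfl⟩,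
    h.normal_ne_zero⟩
  rw [holField_iff N.e_mem h.maps]
  refine (Hol.const (Pi.single i (1 : ℂ))).congr ?_
  filter_upwards [N.e.open_target.mem_nhds (N.e.map_source h.maps)] with z hz
  rw [vecInChart_fieldOf N.e_mem _ hz, logFrame_empty]

lemma On.coeff_ne_zero (h : N.On i q) {u : ∀ q, NormalFibre (m := m) f q}
    (hu : IsFrame (HolNormal (m := m) f) u q) : N.coeff i u q ≠ 0 := fun h0 =>
  hu.2 (by rw [h.coeff_smul_normal u, h0, zero_smul])

lemma On.eventually_coeff_ne_zero (h : N.On i q) {u : ∀ q, NormalFibre (m := m) f q}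
    (hu : IsFrame (HolNormal (m := m) f) u q) : ∀ᶠ q' in 𝓝 q, N.coeff i u q' ≠ 0 :=
  (h.holFun_coeff hu.1).self_of_nhds.continuousAt.eventually_ne (h.coeff_ne_zero hu)

lemma _root_.LogSymp.HolFun.inv {n : ℕ} {Y : Type} [TopologicalSpace Y] [ChartedSpace (Cn n) Y]
    [IsManifold 𝓘(ℂ, Cn n) ω Y] {g : Y → ℂ} {y : Y} (hg : HolFun n g y) (h0 : g y ≠ 0) :
    HolFun n (fun z => (g z)⁻¹) y := by
  rw [holFun_iff (chartAt_mem y) (mem_chart_source _ y)] at hg ⊢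
  exact hg.inv (by rwa [(chartAt (Cn n) y).left_inv (mem_chart_source _ y)])

lemma On.eventually_smul_twist (h : N.On i q) {g : X₁ → ℂ} (hg : HolFun m g q)
    (C : ExtForm m k X₁) : ∀ᶠ y in 𝓝 (N.c i q),
      extCoord (N.c i) (rest N.S i) (fun z => g z ^ 1 • twist g C z) y =
      g ((N.c i).symm y) • (extCoord (N.c i) (rest N.S i) C y).compContinuousLinearMap
        (shear (dlogForm (rest N.S i) (fun w => g ((N.c i).symm w)) y) (0, 1)) := by
  filter_upwards [h.eventually_twist hg C] with y hy
  rw [extCoord_fun_smul, pow_one, hy]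

lemma On.hol_comp_symm (h : N.On i q) {g : X₁ → ℂ} (hg : HolFun m g q) :
    Hol (fun w => g ((N.c i).symm w)) (N.c i q) :=
  (holFun_iff h.adapted₁.1 h.adapted₁.2.1).1 hg

lemma On.eventually_ne_symm (h : N.On i q) {g : X₁ → ℂ} (hg : HolFun m g q) (h0 : g q ≠ 0) :
    ∀ᶠ y in 𝓝 (N.c i q), g ((N.c i).symm y) ≠ 0 :=
  (h.hol_comp_symm hg).continuousAt.eventually_ne (by rwa [(N.c i).left_inv h.2])

lemma On.smul_twist_mem_extLogForms (h : N.On i q) {g : X₁ → ℂ} (hg : HolFun m g q)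
    (h0 : g q ≠ 0) {C : ExtForm m k X₁} (hC : C ∈ extLogForms (inducedDivisor f) k q) :
    (fun z => g z ^ 1 • twist g C z) ∈ extLogForms (inducedDivisor f) k q := by
  rw [mem_extLogForms_iff h.adapted₁] at hC ⊢
  have h1 := h.hol_comp_symm hg
  have h2 := h1.dlogForm (S := rest N.S i) (by rwa [(N.c i).left_inv h.2])
  exact (h1.logHol.smul (hC.compForm (hol_shear h2 (0, 1)).logHol)).congr
    ((h.eventually_smul_twist hg C).filter_mono nhdsWithin_le_nhds)

/-- The form `psiExt` is pulled back from `X₁` and kills `(0, 1)`, so the shear leaves it fixed.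
Hence the ideal of the foliation does not depend on the frame of the line bundle. -/
lemma wedge_psiExt_shear (y : Cn m) (θ : (Cn m × ℂ) [⋀^Fin 1]→L[ℂ] ℂ)
    (A : (Cn m × ℂ) [⋀^Fin k]→L[ℂ] ℂ) :
    wedge (psiExt a i y) (A.compContinuousLinearMap (shear θ (0, 1))) =
      (wedge (psiExt a i y) A).compContinuousLinearMap (shear θ (0, 1)) := by
  have h : oneForm (psiExt a i y) (0, 1) = 0 := by
    rw [psiExt, oneForm_comp]
    exact (oneForm (psiRes a i y)).map_zero
  rw [wedge_comp_shear, h]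
  congr 1
  refine oneForm_ext fun v => ?_
  simp

lemma On.smul_mem_extIdeal (hΦ : IsLogSymplectic D Φ) (h : N.On i q) {g : X₁ → ℂ}
    (hg : HolFun m g q) {C : ExtForm m k X₁}
    (hC : C ∈ extIdeal (inducedDivisor f) (psiFoliation (m := m) D Φ f) k q) :
    (fun z => g z • C z) ∈ extIdeal (inducedDivisor f) (psiFoliation (m := m) D Φ f) k q := by
  obtain ⟨a, ha⟩ := hΦ.exists_sympCoord h.adapted
  rw [h.mem_extIdeal_iff ha] at hC ⊢
  refine ⟨(h.hol_comp_symm hg).logHol.smul hC.1, ?_⟩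
  filter_upwards [hC.2] with y hy
  rw [extCoord_fun_smul, wedge_smul, hy, smul_zero_form]

lemma On.smul_twist_mem_extIdeal (hΦ : IsLogSymplectic D Φ) (h : N.On i q) {g : X₁ → ℂ}
    (hg : HolFun m g q) (h0 : g q ≠ 0) {C : ExtForm m k X₁}
    (hC : C ∈ extIdeal (inducedDivisor f) (psiFoliation (m := m) D Φ f) k q) :
    (fun z => g z ^ 1 • twist g C z) ∈
      extIdeal (inducedDivisor f) (psiFoliation (m := m) D Φ f) k q := by
  obtain ⟨a, ha⟩ := hΦ.exists_sympCoord h.adapted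
  rw [h.mem_extIdeal_iff ha] at hC ⊢
  refine ⟨?_, ?_⟩
  · rw [← mem_extLogForms_iff h.adapted₁] at hC ⊢
    exact h.smul_twist_mem_extLogForms hg h0 hC.1
  · filter_upwards [hC.2, (h.eventually_smul_twist hg C).filter_mono nhdsWithin_le_nhds]
      with y h1 h2
    rw [h2, wedge_smul, wedge_psiExt_shear, h1]
    exact smul_zero_form _

/-- The section of the principal parts bundle whose value on the frame `normal` is `κ`. -/
def frameFamily (N : NormChart (m := m) D f) (i : Fin (m + 1)) (κ : ExtForm m k X₁)
    (u : ∀ q, NormalFibre (m := m) f q) : ExtForm m k X₁ := fun q =>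
  (N.coeff i u q)⁻¹ ^ 1 • twist (fun q => (N.coeff i u q)⁻¹) κ q

/-- If `u' = g u` then the coefficients are related by the same `g`; logarithmic derivatives add up
and the corresponding shears compose, which is the cocycle condition, exactly and not only modulo
the ideal. -/
lemma On.frameFamily_mem (hΦ : IsLogSymplectic D Φ) (h : N.On i q) {κ : ExtForm m k X₁}
    (hκ : κ ∈ extLogForms (inducedDivisor f) k q) :
    N.frameFamily i κ ∈ (calP (m := m) D Φ f k).num q := by
  obtain ⟨a, ha⟩ := hΦ.exists_sympCoord h.adapted
  intro u hu
  have hc := (h.holFun_coeff hu.1).inv (h.coeff_ne_zero hu)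
  refine ⟨h.smul_twist_mem_extLogForms hc (inv_ne_zero (h.coeff_ne_zero hu)) hκ,
    fun u' hu' g hg hgu => h.extIdeal_le ha ?_⟩
  have hc' := (h.holFun_coeff hu'.1).inv (h.coeff_ne_zero hu')
  have h1 : ∀ᶠ q' in 𝓝 q, (N.coeff i u q')⁻¹ = (N.coeff i u' q')⁻¹ * g q' := by
    filter_upwards [hgu, h.nhds, h.eventually_coeff_ne_zero hu,
      h.eventually_coeff_ne_zero hu'] with q' h2 h3 h4 h5
    have h6 : N.coeff i u' q' = g q' * N.coeff i u q' := h3.coeff_eq (by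
      rw [h2, mul_smul, ← h3.coeff_smul_normal u])
    rw [h6] at h5 ⊢
    have := left_ne_zero_of_mul h5
    field_simp
  have h2 : (fun w => (N.coeff i u ((N.c i).symm w))⁻¹) =ᶠ[𝓝 (N.c i q)]
      fun w => (N.coeff i u' ((N.c i).symm w))⁻¹ * g ((N.c i).symm w) :=
    ((N.c i).eventually_nhds' _ h.2).2 h1
  have h3 : g q ≠ 0 := IsFrame.ne_zero hu' hgu
  refine Eventually.filter_mono nhdsWithin_le_nhds ?_
  filter_upwards [h.eventually_smul_twist hc κ, h.eventually_smul_twist hc' κ,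
    h.eventually_smul_twist hg (N.frameFamily i κ u'), h2.eventuallyEq_nhds,
    h.hol_comp_symm hc', h.hol_comp_symm hg, h.eventually_ne_symm hg h3,
    h.eventually_ne_symm hc' (inv_ne_zero (h.coeff_ne_zero hu'))]
    with y e1 e2 e3 e4 e5 e6 e7 e8
  have e9 : extCoord (N.c i) (rest N.S i) (N.frameFamily i κ u') y = _ := e2
  have e10 : extCoord (N.c i) (rest N.S i) (N.frameFamily i κ u) y = _ := e1
  have e11 : (N.coeff i u ((N.c i).symm y))⁻¹ =
      (N.coeff i u' ((N.c i).symm y))⁻¹ * g ((N.c i).symm y) := e4.self_of_nhds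
  rw [extCoord_sub, e3, e9, e10, sub_eq_zero, e11, dlogForm_congr e4,
    dlogForm_mul e5 e6 e8 e7, ← shear_comp_shear (by simp [oneForm_dlogForm]), mul_comm, mul_smul]
  rfl

lemma On.frameFamily_normal (h : N.On i q) (κ : ExtForm m k X₁) :
    ∀ᶠ y in 𝓝 (N.c i q),
      extCoord (N.c i) (rest N.S i) (N.frameFamily i κ (N.normal i)) y =
      extCoord (N.c i) (rest N.S i) κ y := by
  have hc := (h.holFun_coeff h.isFrame_normal.1).inv (h.coeff_ne_zero h.isFrame_normal)
  have h1 : (fun w => (N.coeff i (N.normal i) ((N.c i).symm w))⁻¹) =ᶠ[𝓝 (N.c i q)] fun _ => 1 := by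
    filter_upwards [((N.c i).eventually_nhds' _ h.2).2 h.nhds] with y hy
    rw [hy.coeff_normal, inv_one]
  filter_upwards [h.eventually_smul_twist hc κ, h1.eventuallyEq_nhds] with y h2 h3
  refine h2.trans ?_
  have h4 : (N.coeff i (N.normal i) ((N.c i).symm y))⁻¹ = 1 := h3.self_of_nhds
  rw [h4, dlogForm_congr h3, one_smul]
  ext v
  simp only [compContinuousLinearMap_apply]
  refine congrArg _ (funext fun j => ?_)
  simp [shear_apply, oneForm_dlogForm]

/-- The transition rule and the invariance of the ideal under twists carry vanishing from one frame
to all frames. -/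
lemma On.mem_den_of_normal (hΦ : IsLogSymplectic D Φ) (h : N.On i q)
    {C : (∀ q, NormalFibre (m := m) f q) → ExtForm m k X₁}
    (hC : C ∈ (calP (m := m) D Φ f k).num q)
    (h0 : C (N.normal i) ∈ extIdeal (inducedDivisor f) (psiFoliation (m := m) D Φ f) k q) :
    C ∈ (calP (m := m) D Φ f k).den q := by
  intro u hu
  have hc := (h.holFun_coeff hu.1).inv (h.coeff_ne_zero hu)
  have h1 := (hC u hu).2 (N.normal i) h.isFrame_normal _ hc (by
    filter_upwards [h.nhds, h.eventually_coeff_ne_zero hu] with q' h2 h3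
    rw [h2.coeff_smul_normal u, inv_smul_smul₀ h3])
  have h2 := h.smul_twist_mem_extIdeal hΦ hc (inv_ne_zero (h.coeff_ne_zero hu)) h0
  have := Submodule.add_mem _ h1 h2
  rwa [sub_add_cancel] at this

end NormChart

end NormalFrames

/-! ### Polar forms as extended forms on the branch -/

section PolarRes

open ContinuousAlternatingMap Filter

variable {m k : ℕ} {i : Fin (m + 1)} {S : Finset (Fin (m + 1))} {y : Cn m}

/-- The identification of `T_y ⊕ ℂ` with the log tangent space along the `i`-th hyperplane, for
which `dlog u` corresponds to `-dlog x_i`. -/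
def branchFrame (i : Fin (m + 1)) : (Cn m × ℂ) →L[ℂ] Cn (m + 1) :=
  (insL i).comp (ContinuousLinearMap.fst ℂ (Cn m) ℂ) -
    (ContinuousLinearMap.snd ℂ (Cn m) ℂ).smulRight (Pi.single i 1)

/-- The inverse of `branchFrame`. -/
def branchFrameInv (i : Fin (m + 1)) : Cn (m + 1) →L[ℂ] Cn m × ℂ :=
  (remL i).prod (-(ContinuousLinearMap.proj i : Cn (m + 1) →L[ℂ] ℂ))

lemma branchFrame_apply (v : Cn m × ℂ) :
    branchFrame i v = insL i v.1 - v.2 • Pi.single i 1 := rfl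

lemma branchFrame_self (v : Cn m × ℂ) : branchFrame i v i = -v.2 := by
  rw [branchFrame_apply, Pi.sub_apply, insL_self, Pi.smul_apply, Pi.single_eq_same]
  simp

lemma branchFrame_comp_inv :
    (branchFrame i).comp (branchFrameInv i) = ContinuousLinearMap.id ℂ (Cn (m + 1)) := by
  refine ContinuousLinearMap.ext fun v => ?_
  change insL i (remL i v) - (-(v i)) • Pi.single i (1 : ℂ) = v
  rw [neg_smul, sub_neg_eq_add, ← eq_insL_add]

lemma branchFrameInv_comp :
    (branchFrameInv i).comp (branchFrame i) = ContinuousLinearMap.id ℂ (Cn m × ℂ) := by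
  refine ContinuousLinearMap.ext fun v => Prod.ext ?_ ?_
  · change remL i (insL i v.1 - v.2 • Pi.single i 1) = v.1
    rw [_root_.map_sub, remL_insL, map_smul]
    ext j
    simp [remL, Fin.succAbove_ne]
  · change -(branchFrame i v i) = v.2
    rw [branchFrame_self, neg_neg]

lemma comp_branchFrame_eq_zero {A : (Cn (m + 1)) [⋀^Fin k]→L[ℂ] ℂ} :
    A.compContinuousLinearMap (branchFrame i) = 0 ↔ A = 0 := by
  refine ⟨fun h => ?_, fun h => by rw [h]; rfl⟩
  have h1 : A = (A.compContinuousLinearMap (branchFrame i)).compContinuousLinearMap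
      (branchFrameInv i) := by
    ext v
    simp only [compContinuousLinearMap_apply]
    refine congrArg A (funext fun j => ?_)
    exact (DFunLike.congr_fun branchFrame_comp_inv (v j)).symm
  rw [h1, h]
  rfl

/-- The polar part of a form with polar log coordinates `h / z i`, as an extended form. -/
def polarRes (h : Cn (m + 1) → (Cn (m + 1)) [⋀^Fin k]→L[ℂ] ℂ) (i : Fin (m + 1)) (y : Cn m) :
    (Cn m × ℂ) [⋀^Fin k]→L[ℂ] ℂ :=
  (h (insL i y)).compContinuousLinearMap (branchFrame i)

variable {h : Cn (m + 1) → (Cn (m + 1)) [⋀^Fin k]→L[ℂ] ℂ}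

lemma hol_polarRes (hh : Hol h (insL i y)) : Hol (polarRes h i) y :=
  Hol.compForm (A := fun y => h (insL i y)) (L := fun _ => branchFrame i) hh.insL (Hol.const _)

/-- Because `ψ_i(v_i) = 0`, pulling `ψ_i` back by `branchFrame` loses its component along `dlog u`
and gives `psiExt`. -/
lemma wedge_psiExt_polarRes (a : Cn (m + 1) → (Cn (m + 1)) [⋀^Fin 2]→L[ℂ] ℂ) (y : Cn m) :
    wedge (psiExt a i y) (polarRes h i y) =
      (wedge ((a (insL i y)).curryLeft (Pi.single i 1)) (h (insL i y))).compContinuousLinearMap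
        (branchFrame i) := by
  rw [wedge_comp]
  congr 1
  refine oneForm_ext fun v => ?_
  rw [oneForm_comp, branchFrame_apply, _root_.map_sub, map_smul, oneForm_curryLeft_self,
    smul_zero, sub_zero]
  rfl

/-- Under `branchFrame` the form `dlog x_i` becomes `-dlog u`, so `-dlog x_i ∧ h` turns into `dlog u
∧ h`. The `i`-th frame vector vanishes on the hyperplane, so only derivatives of `h` along the
branch enter. -/
lemma nabla_polarRes (hi : i ∈ S) (hh : DifferentiableAt ℂ h (insL i y)) :
    nabla (rest S i) (polarRes h i) y =
      polarRes (fun z => logD S h z - wedge (coordForm i) (h z)) i y := by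
  have h1 : ∀ a b : (Cn (m + 1)) [⋀^Fin (k + 1)]→L[ℂ] ℂ, (a - b).compContinuousLinearMap
      (branchFrame i) = a.compContinuousLinearMap (branchFrame i) -
        b.compContinuousLinearMap (branchFrame i) := fun _ _ => rfl
  have h2 : (coordForm i).compContinuousLinearMap (branchFrame i) = -dlogFrame m := by
    refine oneForm_ext fun v => ?_
    rw [oneForm_comp, oneForm_coordForm, branchFrame_apply, _root_.map_neg]
    rw [← branchFrame_apply]
    exact branchFrame_self v
  have h3 : HasFDerivAt (polarRes h i) ((compContinuousLinearMapCLM (branchFrame i)).comp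
      ((fderiv ℂ h (insL i y)).comp (insL i))) y := by
    have h4 : HasFDerivAt (fun y => h (insL i y)) ((fderiv ℂ h (insL i y)).comp (insL i)) y :=
      hh.hasFDerivAt.comp y (insL i).hasFDerivAt
    exact (compContinuousLinearMapCLM (branchFrame i)).hasFDerivAt.comp y h4
  rw [polarRes, h1, wedge_comp, h2, neg_wedge, sub_neg_eq_add, nabla, logD, alternatize_comp,
    extLogD, h3.fderiv]
  congr 2
  refine ContinuousLinearMap.ext fun v => ?_
  simp only [ContinuousLinearMap.comp_apply]
  rw [branchFrame_apply, _root_.map_sub, map_smul, logFrame_single hi, insL_self, zero_smul,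
    smul_zero, sub_zero, logFrame_insL hi, remL_insL]
  rfl

end PolarRes

/-! ### Polar parts on the normalization -/

section PolarTransition

open ContinuousAlternatingMap Filter

variable {m : ℕ} {X X₁ : Type} [TopologicalSpace X] [ChartedSpace (Cn (m + 1)) X]
  [IsManifold 𝓘(ℂ, Cn (m + 1)) ω X] [TopologicalSpace X₁] [ChartedSpace (Cn m) X₁]
  [IsManifold 𝓘(ℂ, Cn m) ω X₁] {D : Set X} {f : X₁ → X} {N N' : NormChart (m := m) D f}
  {i i' : Fin (m + 1)} {q : X₁} {k : ℕ} {Φ : Form (m + 1) 2 X}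

/-- `h / x_i` are the log coordinates of `b` near `f q`. -/
def NormChart.PolarCoord (N : NormChart (m := m) D f) (i : Fin (m + 1)) (q : X₁)
    (b : Form (m + 1) k X) (h : Cn (m + 1) → (Cn (m + 1)) [⋀^Fin k]→L[ℂ] ℂ) : Prop :=
  Hol h (N.e (f q)) ∧ ∀ᶠ z in 𝓝[Off N.S] (N.e (f q)), z i • logCoord N.e N.S b z = h z

/-- The polar part as an extended form on the normalization. -/
def NormChart.polarExt (N : NormChart (m := m) D f) (i : Fin (m + 1))
    (h : Cn (m + 1) → (Cn (m + 1)) [⋀^Fin k]→L[ℂ] ℂ) : ExtForm m k X₁ :=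
  extFormOf (N.c i) (rest N.S i) (polarRes h i)

namespace NormChart

lemma On.extCoord_polarExt (h : N.On i q)
    (g : Cn (m + 1) → (Cn (m + 1)) [⋀^Fin k]→L[ℂ] ℂ) :
    ∀ᶠ y in 𝓝[Off (rest N.S i)] (N.c i q),
      extCoord (N.c i) (rest N.S i) (N.polarExt i g) y = polarRes g i y := by
  filter_upwards [h.adapted₁.nhds.filter_mono nhdsWithin_le_nhds, self_mem_nhdsWithin]
    with y h1 h2 using extCoord_extFormOf h.adapted₁.1 _ h1.1 h2

lemma On.exists_polarCoord (h : N.On i q) {b : Form (m + 1) k X}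
    (hb : b ∈ polarForms (m := m) D f k q) : ∃ g, N.PolarCoord i q b g := by
  obtain ⟨g, h1, h2⟩ := h.mem_polarForms_iff.1 hb
  exact ⟨g, h1, h2⟩

lemma On.hol_polarRes (h : N.On i q) {b : Form (m + 1) k X}
    {g : Cn (m + 1) → (Cn (m + 1)) [⋀^Fin k]→L[ℂ] ℂ} (hg : N.PolarCoord i q b g) :
    Hol (polarRes g i) (N.c i q) :=
  LogSymp.hol_polarRes (by rw [← h.e_apply]; exact hg.1)

lemma On.polarExt_mem (h : N.On i q) {b : Form (m + 1) k X}
    {g : Cn (m + 1) → (Cn (m + 1)) [⋀^Fin k]→L[ℂ] ℂ} (hg : N.PolarCoord i q b g) :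
    N.polarExt i g ∈ extLogForms (inducedDivisor f) k q :=
  (mem_extLogForms_iff h.adapted₁).2 ((h.hol_polarRes hg).logHol.congr (h.extCoord_polarExt g))

/-- The numerator of `𝓔` vanishes in the quotient exactly if its polar part is in the ideal. -/
lemma On.mem_psiForms_iff_polarExt (hΦ : IsLogSymplectic D Φ) (h : N.On i q)
    {b : Form (m + 1) k X} (hb : b ∈ polarForms (m := m) D f k q)
    {g : Cn (m + 1) → (Cn (m + 1)) [⋀^Fin k]→L[ℂ] ℂ} (hg : N.PolarCoord i q b g) :
    b ∈ psiForms (m := m) D Φ f k q ↔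
      N.polarExt i g ∈ extIdeal (inducedDivisor f) (psiFoliation (m := m) D Φ f) k q := by
  obtain ⟨a, ha⟩ := hΦ.exists_sympCoord h.adapted
  have hθ : Hol (fun z => (a z).curryLeft (Pi.single i 1)) (N.e (f q)) :=
    ha.hol.curryLeft (Hol.const _)
  have h1 := (mem_extLogForms_iff h.adapted₁).1 (h.polarExt_mem hg)
  have hψ : Hol (psiExt a i) (N.c i q) := hol_psiExt (by rw [← h.e_apply]; exact ha.hol)
  rw [h.mem_psiForms_iff hΦ, and_iff_right hb, h.mem_extIdeal_iff ha, and_iff_right h1,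
    mem_logForms_iff h.adapted, logHol_iff_vanish h.1 (hθ.wedge hg.1), h.e_apply,
    ← eventually_insL_iff]
  · have h2 : (∀ᶠ y in 𝓝 (N.c i q), wedge (psiExt a i y) (polarRes g i y) = 0) ↔
        ∀ᶠ y in 𝓝[Off (rest N.S i)] (N.c i q), wedge (psiExt a i y)
          (extCoord (N.c i) (rest N.S i) (N.polarExt i g) y) = 0 := by
      constructor
      · intro h3
        filter_upwards [h3.filter_mono nhdsWithin_le_nhds, h.extCoord_polarExt g] with y h4 h5
        rw [h5, h4]
      · intro h3
        refine Hol.eq_of_eq_Off (S := rest N.S i) (hψ.wedge (h.hol_polarRes hg))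
          (Hol.const _) ?_
        filter_upwards [h3, h.extCoord_polarExt g] with y h4 h5
        rw [← h5, h4]
    rw [← h2]
    refine eventually_congr (Eventually.of_forall fun y => ?_)
    rw [wedge_psiExt_polarRes, comp_branchFrame_eq_zero]
  · filter_upwards [hg.2, eventually_logCoord_psi h.maps ha i] with z h2 h3
    rw [logCoord_wedgeForm, h3, ← wedge_smul, h2]

/-- The numerator in `d(h / x_i) = (dh - dlog x_i ∧ h) / x_i`. -/
lemma On.polarCoord_dForm (h : N.On i q) {b : Form (m + 1) k X}
    {g : Cn (m + 1) → (Cn (m + 1)) [⋀^Fin k]→L[ℂ] ℂ} (hg : N.PolarCoord i q b g) :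
    N.PolarCoord i q (dForm b) fun z => logD N.S g z - wedge (coordForm i) (g z) := by
  have hb : Polar N.S i (logCoord N.e N.S b) (N.e (f q)) := ⟨g, hg.1, hg.2⟩
  refine ⟨hg.1.logD.sub ((Hol.const (coordForm i)).wedge hg.1), ?_⟩
  filter_upwards [logD_polar h.1 hg.1 hg.2, h.adapted.logCoord_dForm (hb.genHol h.1)]
    with z h1 h2
  rw [h2, h1]

lemma On.extCoord_polarExt_dForm (h : N.On i q) {b : Form (m + 1) k X}
    {g : Cn (m + 1) → (Cn (m + 1)) [⋀^Fin k]→L[ℂ] ℂ} (hg : N.PolarCoord i q b g) :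
    ∀ᶠ y in 𝓝[Off (rest N.S i)] (N.c i q), extCoord (N.c i) (rest N.S i)
      (N.polarExt i fun z => logD N.S g z - wedge (coordForm i) (g z)) y =
        nabla (rest N.S i) (extCoord (N.c i) (rest N.S i) (N.polarExt i g)) y := by
  have h1 := hg.1
  rw [h.e_apply] at h1
  filter_upwards [h.extCoord_polarExt fun z => logD N.S g z - wedge (coordForm i) (g z),
    eventually_of_Off (h.extCoord_polarExt g),
    h1.insL.filter_mono nhdsWithin_le_nhds,
    ((tendsto_insL i _).eventually h1.eventually).filter_mono nhdsWithin_le_nhds]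
    with y h2 h3 h4 h5
  rw [h2, nabla_congr h3, nabla_polarRes h.1 h5.differentiableAt]

end NormChart

end PolarTransition

/-! ### Independence of the chart -/

section PolarTransition

open ContinuousAlternatingMap Filter

variable {m : ℕ} {X X₁ : Type} [TopologicalSpace X] [ChartedSpace (Cn (m + 1)) X]
  [IsManifold 𝓘(ℂ, Cn (m + 1)) ω X] [TopologicalSpace X₁] [ChartedSpace (Cn m) X₁]
  [IsManifold 𝓘(ℂ, Cn m) ω X₁] {D : Set X} {f : X₁ → X} {N N' : NormChart (m := m) D f}
  {i i' : Fin (m + 1)} {q : X₁} {k : ℕ} {Φ : Form (m + 1) 2 X}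

namespace NormChart

/-- Differentiate `x' = x_i r` in the direction `∂_i` at a point with `x_i = 0`: the normal
component of `∂_i` in the second chart is `r`. -/
lemma On.normal_eq (h : N.On i q) (h' : N'.On i' q) {r : Cn (m + 1) → ℂ}
    (hr : Hol r (N.e (f q)))
    (hφ : ∀ᶠ z in 𝓝 (N.e (f q)), transition N.e N'.e z i' = z i * r z) :
    ∀ᶠ q' in 𝓝 q, N.normal i q' = r (N.e (f q')) • N'.normal i' q' := by
  have hc : ContinuousAt (fun q' => N.e (f q')) q :=
    ContinuousAt.comp (g := N.e) (N.e.continuousAt h.maps) h.continuousAt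
  filter_upwards [h.nhds, h'.nhds, hc.eventually hr, hc.eventually hφ.eventually_nhds,
    hc.eventually (h.adapted.hol_transition h'.adapted),
    hc.eventually (h.adapted.fderiv_transition h'.adapted)] with q' h1 h2 h3 h4 h5 h6
  rw [NormChart.normal, h2.mk_eq]
  congr 1
  set z := N.e (f q') with hz
  have e1 : HasFDerivAt (fun w => transition N.e N'.e w i') ((ContinuousLinearMap.proj i' :
      Cn (m + 1) →L[ℂ] ℂ).comp (fderiv ℂ (transition N.e N'.e) z)) z :=
    (ContinuousLinearMap.proj i' : Cn (m + 1) →L[ℂ] ℂ).hasFDerivAt.comp z h5.hasFDerivAt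
  have e2 : HasFDerivAt (fun w : Cn (m + 1) => w i)
      (ContinuousLinearMap.proj i : Cn (m + 1) →L[ℂ] ℂ) z :=
    (ContinuousLinearMap.proj i : Cn (m + 1) →L[ℂ] ℂ).hasFDerivAt
  have e3 := (e1.congr_of_eventuallyEq (show (fun w : Cn (m + 1) => w i * r w) =ᶠ[𝓝 z] _ by
    filter_upwards [h4] with w hw using hw.symm)).unique (e2.mul h3.hasFDerivAt)
  have e4 := DFunLike.congr_fun e3 (Pi.single i 1)
  rw [h6, hz, N.e.left_inv h1.maps] at e4
  simp only [ContinuousLinearMap.comp_apply, ContinuousLinearMap.proj_apply,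
    _root_.add_apply, _root_.smul_apply, smul_eq_mul, h1.coord_eq_zero, Pi.single_eq_same,
    zero_mul, zero_add, mul_one] at e4
  rw [← e4, fieldOf]
  exact congrArg (fun t => chartDeriv N'.e (f q') (chartInvDeriv N.e (N.e (f q')) t) i')
    (logFrame_empty (N.e (f q')) (Pi.single i 1))

lemma On.transition_insL (h : N.On i q) (h' : N'.On i' q) :
    ∀ᶠ y in 𝓝 (N.c i q), transition N.e N'.e (insL i y) =
      insL i' (transition (N.c i) (N'.c i') y) := by
  filter_upwards [(N.c i).open_target.mem_nhds ((N.c i).map_source h.2),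
    ((N.c i).eventually_nhds' (fun q' => N'.On i' q') h.2).2 h'.nhds] with y h1 h2
  rw [transition, ← h.f_symm h1, h2.e_apply, transition]

/-- The frames of the log tangent spaces along the branch in two charts. -/
lemma On.branchFrame_transition (h : N.On i q) (h' : N'.On i' q)
    {M : Cn (m + 1) → Cn (m + 1) →L[ℂ] Cn (m + 1)}
    (hM : IsLogTransition N.e N.S N'.e N'.S M (N.e (f q)))
    {M₁ : Cn m → Cn m →L[ℂ] Cn m}
    (hM₁ : IsLogTransition (N.c i) (rest N.S i) (N'.c i') (rest N'.S i') M₁ (N.c i q))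
    {r : Cn (m + 1) → ℂ} (hr : Hol r (N.e (f q))) (hr0 : r (N.e (f q)) ≠ 0)
    (hrM : ∀ᶠ z in 𝓝 (N.e (f q)), ∀ v,
      r z * M z v i' = fderiv ℂ r z (logFrame N.S z v) + v i * r z)
    {G : Cn m → ℂ} (hG : ∀ᶠ y in 𝓝 (N.c i q), G y = (r (insL i y))⁻¹) :
    ∀ᶠ y in 𝓝[Off (rest N.S i)] (N.c i q), ∀ v,
      M (insL i y) (branchFrame i v) = branchFrame i' (M₁ y (shear (dlogForm (rest N.S i) G y)
        (0, 1) v).1, (shear (dlogForm (rest N.S i) G y) (0, 1) v).2) := by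
  have ht := tendsto_insL i (N.c i q)
  rw [← h.e_apply] at ht
  have hol := h.adapted.hol_transition h'.adapted
  have hol₁ := h.adapted₁.hol_transition h'.adapted₁
  have hs := h.transition_single h' hM
  refine (show ∀ᶠ y in 𝓝 (N.c i q), y ∈ Off (rest N.S i) → _ from ?_) |> fun H =>
    eventually_nhdsWithin_iff.2 H
  filter_upwards [ht.eventually hs, ht.eventually hrM, ht.eventually hM.2, hM₁.2,
    ht.eventually (hr.continuousAt.eventually_ne hr0), ht.eventually hr, ht.eventually hol, hol₁,
    (h.transition_insL h').eventually_nhds, hG.eventually_nhds,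
    h.adapted₁.eventually_transition h'.adapted₁]
    with y h1 h2 h3 h4 h5 h6 h7 h8 h9 h10 h11 hy v
  have h1 := h1 (insL_self i y)
  -- Tangential part: restricted to the hyperplanes, the change of charts of `X` is that of `X₁`,
  -- and so are the log frames.
  have e1 : ∀ u : Cn m, remL i' (M (insL i y) (insL i u)) = M₁ y u := by
    intro u
    have e2 := h3 (insL i u)
    have e3 : fderiv ℂ (transition N.e N'.e) (insL i y) (insL i (logFrame (rest N.S i) y u)) =
        insL i' (fderiv ℂ (transition (N.c i) (N'.c i')) y (logFrame (rest N.S i) y u)) := by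
      have e4 := h7.hasFDerivAt.comp y (insL i).hasFDerivAt
      have e5 := (insL i').hasFDerivAt.comp y h8.hasFDerivAt
      exact DFunLike.congr_fun ((e4.congr_of_eventuallyEq
        (show (fun y => insL i' (transition (N.c i) (N'.c i') y)) =ᶠ[𝓝 y] _ by
          filter_upwards [h9] with w hw using hw.symm)).unique e5) (logFrame (rest N.S i) y u)
    rw [h9.self_of_nhds, logFrame_insL h'.1, logFrame_insL h.1, remL_insL, e3, ← h4 u] at e2
    have e6 := congrArg (remL i') e2
    rw [remL_insL, remL_insL] at e6
    have e7 := congrArg (logFrameInv (rest N'.S i') (transition (N.c i) (N'.c i') y)) e6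
    rwa [logFrameInv_logFrame (h11.2.2.2.2.1.1 hy),
      logFrameInv_logFrame (h11.2.2.2.2.1.1 hy)] at e7
  -- Normal part: for vectors along the branch it is the logarithmic derivative of `r`, hence minus
  -- that of `G = r⁻¹`. This is the term that the shear supplies.
  have e8 : ∀ u : Cn m, M (insL i y) (insL i u) i' = -((G y)⁻¹ * fderiv ℂ G y
      (logFrame (rest N.S i) y u)) := by
    intro u
    have e9 := h2 (insL i u)
    rw [logFrame_insL h.1, remL_insL, insL_self, zero_mul, add_zero] at e9
    have e10 : HasFDerivAt (fun y => r (insL i y)) ((fderiv ℂ r (insL i y)).comp (insL i)) y :=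
      h6.hasFDerivAt.comp y (insL i).hasFDerivAt
    have e11 := ((hasDerivAt_inv h5).comp_hasFDerivAt y e10).congr_of_eventuallyEq
      (f₁ := G) h10
    rw [e11.fderiv, h10.self_of_nhds, inv_inv]
    change _ = -(r (insL i y) * (-(r (insL i y) ^ 2)⁻¹ * fderiv ℂ r (insL i y)
      (insL i (logFrame (rest N.S i) y u))))
    rw [← e9]
    field_simp
  rw [branchFrame_apply, _root_.map_sub, map_smul, h1, branchFrame_apply,
    eq_insL_add i' (M (insL i y) (insL i v.1)), e1, e8, shear_apply, oneForm_dlogForm]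
  simp only [Prod.fst_add, Prod.snd_add, Prod.smul_fst, Prod.smul_snd, smul_zero, add_zero,
    smul_eq_mul, mul_one]
  rw [neg_smul, add_smul]
  abel

/-- The polar parts in two charts are related by the change of frames of the normal bundle. -/
theorem On.polarExt_transition (h : N.On i q) (h' : N'.On i' q) {b : Form (m + 1) k X}
    {g g' : Cn (m + 1) → (Cn (m + 1)) [⋀^Fin k]→L[ℂ] ℂ}
    (hg : N.PolarCoord i q b g) (hg' : N'.PolarCoord i' q b g') :
    ∃ ρ : X₁ → ℂ, HolFun m ρ q ∧ ρ q ≠ 0 ∧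
      (∀ᶠ q' in 𝓝 q, N'.normal i' q' = ρ q' • N.normal i q') ∧
      ∀ᶠ y in 𝓝[Off (rest N.S i)] (N.c i q),
        extCoord (N.c i) (rest N.S i) (N.polarExt i g) y =
        extCoord (N.c i) (rest N.S i) (fun z => ρ z ^ 1 • twist ρ (N'.polarExt i' g') z) y := by
  obtain ⟨M, hM⟩ := h.adapted.exists_logTransition h'.adapted
  obtain ⟨M₁, hM₁⟩ := h.adapted₁.exists_logTransition h'.adapted₁
  obtain ⟨r, hr, hr0, hφ, hrM⟩ := h.transition_normal h' hM
  have hc : ContinuousAt (fun q' => N.e (f q')) q :=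
    ContinuousAt.comp (g := N.e) (N.e.continuousAt h.maps) h.continuousAt
  have ht := tendsto_insL i (N.c i q)
  rw [← h.e_apply] at ht
  refine ⟨N.coeff i (N'.normal i'), h.holFun_coeff h'.isFrame_normal.1,
    h.coeff_ne_zero h'.isFrame_normal, ?_, ?_⟩
  · filter_upwards [h.nhds] with q' h1 using h1.coeff_smul_normal _
  have hρ : ∀ᶠ y in 𝓝 (N.c i q),
      N.coeff i (N'.normal i') ((N.c i).symm y) = (r (insL i y))⁻¹ := by
    have h1 := h.nhds.and ((h.normal_eq h' hr hφ).and
      (hc.eventually (hr.continuousAt.eventually_ne hr0)))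
    filter_upwards [((N.c i).eventually_nhds' _ h.2).2 h1,
      (N.c i).open_target.mem_nhds ((N.c i).map_source h.2)] with y h2 h3
    obtain ⟨h4, h5, h6⟩ := h2
    rw [h4.e_apply, (N.c i).right_inv h3] at h5 h6
    exact h4.coeff_eq (by rw [h5, inv_smul_smul₀ h6])
  -- The numerators refer to different equations, `z i` and `z i * r`, whence the factor `r`. The
  -- equality is computed off `D` and extended to the branch.
  have key : ∀ᶠ z in 𝓝 (N.e (f q)), r z • g z = (g' (transition N.e N'.e z)).compContinuousLinearMap (M z) := by
    have hg'φ : Hol (fun z => g' (transition N.e N'.e z)) (N.e (f q)) :=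
      Hol.comp (by rw [h.adapted.transition_self]; exact hg'.1)
        (h.adapted.hol_transition h'.adapted)
    refine Hol.eq_of_eq_Off (S := N.S) (hr.smul hg.1) (hg'φ.compForm hM.1) ?_
    filter_upwards [hg.2, (h.adapted.tendsto_transition_Off h'.adapted).eventually hg'.2,
      (h.adapted.logCoord_transition h'.adapted hM).filter_mono nhdsWithin_le_nhds,
      hφ.filter_mono nhdsWithin_le_nhds] with z h1 h2 h3 h4
    rw [← h1, ← h2, h3, h4, smul_smul, mul_comm]
    rfl
  filter_upwards [h.branchFrame_transition h' hM hM₁ hr hr0 hrM hρ, h.extCoord_polarExt g,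
    (h.eventually_smul_twist (h.holFun_coeff h'.isFrame_normal.1)
      (N'.polarExt i' g')).filter_mono nhdsWithin_le_nhds,
    (h.adapted₁.extCoord_transition h'.adapted₁ hM₁).filter_mono nhdsWithin_le_nhds,
    (h.adapted₁.tendsto_transition_Off h'.adapted₁).eventually (h'.extCoord_polarExt g'),
    hρ.filter_mono nhdsWithin_le_nhds, (ht.eventually key).filter_mono nhdsWithin_le_nhds,
    (h.transition_insL h').filter_mono nhdsWithin_le_nhds,
    (ht.eventually (hr.continuousAt.eventually_ne hr0)).filter_mono nhdsWithin_le_nhds]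
    with y h1 h2 h3 h4 h5 h6 h7 h8 h9
  rw [h2, h3, h4, h5, h6, ← inv_smul_smul₀ h9 (polarRes g i y)]
  congr 1
  rw [h8] at h7
  change (r (insL i y) • g (insL i y)).compContinuousLinearMap (branchFrame i) = _
  rw [h7]
  ext v
  simp only [polarRes, compContinuousLinearMap_apply]
  refine congrArg _ (funext fun j => ?_)
  exact h1 (v j)

/-- The comparison in one chart does not depend on the chart. -/
lemma On.sub_polarExt_mem (hΦ : IsLogSymplectic D Φ) (h : N.On i q) (h' : N'.On i' q)
    {b : Form (m + 1) k X} {g g' : Cn (m + 1) → (Cn (m + 1)) [⋀^Fin k]→L[ℂ] ℂ}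
    (hg : N.PolarCoord i q b g) (hg' : N'.PolarCoord i' q b g')
    {C : (∀ q, NormalFibre (m := m) f q) → ExtForm m k X₁}
    (hC : C ∈ (calP (m := m) D Φ f k).num q)
    (h0 : C (N'.normal i') - N'.polarExt i' g' ∈
      extIdeal (inducedDivisor f) (psiFoliation (m := m) D Φ f) k q) :
    C (N.normal i) - N.polarExt i g ∈
      extIdeal (inducedDivisor f) (psiFoliation (m := m) D Φ f) k q := by
  obtain ⟨a, ha⟩ := hΦ.exists_sympCoord h.adapted
  obtain ⟨ρ, hρ, hρ0, hρn, hρe⟩ := h.polarExt_transition h' hg hg'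
  -- Three errors in the ideal are added: the transition rule of `C`, the hypothesis twisted by `ρ`,
  -- and the transition of the polar parts.
  have h1 := (hC _ h.isFrame_normal).2 _ h'.isFrame_normal ρ hρ hρn
  have h2 := h.smul_twist_mem_extIdeal hΦ hρ hρ0 h0
  have h3 : ((fun z => ρ z ^ 1 • twist ρ (N'.polarExt i' g') z) - N.polarExt i g) ∈
      extIdeal (inducedDivisor f) (psiFoliation (m := m) D Φ f) k q := by
    refine h.extIdeal_le ha ?_
    filter_upwards [hρe] with y hy
    rw [extCoord_sub, hy, sub_self]
  convert! Submodule.add_mem _ (Submodule.add_mem _ h1 h2) h3 using 1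
  funext z
  ext v
  simp [twist]
  ring

end NormChart

end PolarTransition

/-! ### The comparison of the complex with the principal parts complex -/

section Iota

open ContinuousAlternatingMap Filter Subquot

variable {m : ℕ} {X X₁ : Type} [TopologicalSpace X] [ChartedSpace (Cn (m + 1)) X]
  [IsManifold 𝓘(ℂ, Cn (m + 1)) ω X] [TopologicalSpace X₁] [ChartedSpace (Cn m) X₁]
  [IsManifold 𝓘(ℂ, Cn m) ω X₁] {D : Set X} {f : X₁ → X} {N N' : NormChart (m := m) D f}
  {i i' : Fin (m + 1)} {q : X₁} {k : ℕ} {Φ : Form (m + 1) 2 X}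
  {b b' : Form (m + 1) k X} {C C' : (∀ q, NormalFibre (m := m) f q) → ExtForm m k X₁}

namespace NormChart

lemma On.eventually_polarCoord (h : N.On i q)
    {g : Cn (m + 1) → (Cn (m + 1)) [⋀^Fin k]→L[ℂ] ℂ} (hg : N.PolarCoord i q b g) :
    ∀ᶠ q' in 𝓝 q, N.PolarCoord i q' b g := by
  have hc : ContinuousAt (fun q' => N.e (f q')) q :=
    ContinuousAt.comp (g := N.e) (N.e.continuousAt h.maps) h.continuousAt
  filter_upwards [hc.eventually hg.1.eventually, hc.eventually (eventually_nhdsWithin_Off hg.2)]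
    with q' h1 h2 using ⟨h1, h2⟩

lemma On.sub_mem_of_eventually (hΦ : IsLogSymplectic D Φ) (h : N.On i q) {c c' : ExtForm m k X₁}
    (hc : ∀ᶠ y in 𝓝[Off (rest N.S i)] (N.c i q),
      extCoord (N.c i) (rest N.S i) c y = extCoord (N.c i) (rest N.S i) c' y) :
    c - c' ∈ extIdeal (inducedDivisor f) (psiFoliation (m := m) D Φ f) k q := by
  obtain ⟨a, ha⟩ := hΦ.exists_sympCoord h.adapted
  refine h.extIdeal_le ha ?_
  filter_upwards [hc] with y hy
  rw [extCoord_sub, hy, sub_self]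

end NormChart

/-- The form `b` and the section `C` of the principal parts bundle have the same polar part. -/
def IotaRel (D : Set X) (Φ : Form (m + 1) 2 X) (f : X₁ → X) (q : X₁) (b : Form (m + 1) k X)
    (C : (∀ q, NormalFibre (m := m) f q) → ExtForm m k X₁) : Prop :=
  b ∈ polarForms (m := m) D f k q ∧ C ∈ (calP (m := m) D Φ f k).num q ∧
    ∃ (N : NormChart (m := m) D f) (i : Fin (m + 1)) (g : _), N.On i q ∧ N.PolarCoord i q b g ∧
      C (N.normal i) - N.polarExt i g ∈
        extIdeal (inducedDivisor f) (psiFoliation (m := m) D Φ f) k q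

/-- The relation asks for a single chart; by independence of the chart it then holds in every chart
and for every numerator. -/
lemma IotaRel.mem (hΦ : IsLogSymplectic D Φ) (H : IotaRel D Φ f q b C) (h : N.On i q)
    {g : Cn (m + 1) → (Cn (m + 1)) [⋀^Fin k]→L[ℂ] ℂ} (hg : N.PolarCoord i q b g) :
    C (N.normal i) - N.polarExt i g ∈
      extIdeal (inducedDivisor f) (psiFoliation (m := m) D Φ f) k q := by
  obtain ⟨-, h1, N', i', g', h', hg', h2⟩ := H
  exact h.sub_polarExt_mem hΦ h' hg hg' h1 h2

lemma IotaRel.zero (hf : IsNormalization (m := m) D f) (q : X₁) :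
    IotaRel D Φ f q (0 : Form (m + 1) k X)
      (0 : (∀ q, NormalFibre (m := m) f q) → ExtForm m k X₁) := by
  obtain ⟨N, i, h⟩ := hf.exists_on q
  refine ⟨(polarForms (m := m) D f k q).zero_mem, ((calP (m := m) D Φ f k).num q).zero_mem, N, i,
    fun _ => 0, h, ⟨Hol.const 0, Eventually.of_forall fun z => smul_zero_form _⟩, ?_⟩
  convert! (extIdeal (inducedDivisor f) (psiFoliation (m := m) D Φ f) k q).zero_mem using 1
  exact sub_self _

lemma IotaRel.add (hΦ : IsLogSymplectic D Φ) (H : IotaRel D Φ f q b C)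
    (H' : IotaRel D Φ f q b' C') : IotaRel D Φ f q (b + b') (C + C') := by
  obtain ⟨h1, h2, N, i, g, h, hg, h3⟩ := H
  obtain ⟨g', hg'⟩ := h.exists_polarCoord H'.1
  have h4 := H'.mem hΦ h hg'
  refine ⟨Submodule.add_mem _ h1 H'.1, Submodule.add_mem _ h2 H'.2.1, N, i,
    fun z => g z + g' z, h, ⟨hg.1.add hg'.1, ?_⟩, ?_⟩
  · filter_upwards [hg.2, hg'.2] with z e1 e2
    rw [logCoord_add, ← e1, ← e2]
    exact smul_add _ _ _
  · have e : (C + C') (N.normal i) - N.polarExt i (fun z => g z + g' z) =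
        (C (N.normal i) - N.polarExt i g) + (C' (N.normal i) - N.polarExt i g') := by
      rw [show N.polarExt i (fun z => g z + g' z) = N.polarExt i g + N.polarExt i g' from rfl,
        Pi.add_apply]
      abel
    rw [e]
    exact Submodule.add_mem _ h3 h4

lemma IotaRel.mul (hΦ : IsLogSymplectic D Φ) (H : IotaRel D Φ f q b C) {G : X → ℂ} {g : X₁ → ℂ}
    (hG : HolFun (m + 1) G (f q)) (hg : HolFun m g q) (hGg : ∀ᶠ q' in 𝓝 q, G (f q') = g q') :
    IotaRel D Φ f q (fun z => G z • b z) fun u z => g z • C u z := by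
  obtain ⟨h1, h2, N, i, c, h, hc, h3⟩ := H
  have h4 : Hol (fun z => G (N.e.symm z)) (N.e (f q)) :=
    (holFun_iff N.e_mem h.maps).1 hG
  have h5 : N.PolarCoord i q (fun z => G z • b z) fun z => G (N.e.symm z) • c z := by
    refine ⟨h4.smul hc.1, ?_⟩
    filter_upwards [hc.2] with z hz
    rw [logCoord_fun_smul, ← hz]
    exact smul_comm _ _ _
  refine ⟨h.mem_polarForms_iff.2 ⟨_, h5.1, h5.2⟩, fun u hu => ⟨?_, fun u' hu' r hr hur => ?_⟩,
    N, i, _, h, h5, ?_⟩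
  · have h6 := (mem_extLogForms_iff h.adapted₁).1 (h2 u hu).1
    exact (mem_extLogForms_iff h.adapted₁).2 ((h.hol_comp_symm hg).logHol.smul h6)
  · convert! h.smul_mem_extIdeal hΦ hg ((h2 u hu).2 u' hu' r hr hur) using 1
    funext z
    ext v
    simp [twist]
    ring
  · have h7 := h.smul_mem_extIdeal hΦ hg h3
    have h8 := h.sub_mem_of_eventually hΦ (c := fun z => g z • N.polarExt i c z)
      (c' := N.polarExt i fun z => G (N.e.symm z) • c z) (by
        filter_upwards [h.extCoord_polarExt c,
          h.extCoord_polarExt fun z => G (N.e.symm z) • c z,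
          (((N.c i).eventually_nhds' _ h.2).2 hGg).filter_mono nhdsWithin_le_nhds,
          ((N.c i).open_target.mem_nhds ((N.c i).map_source h.2) |> fun h =>
            mem_nhdsWithin_of_mem_nhds h)] with y e1 e2 e3 e4
        rw [extCoord_fun_smul, e1, e2, ← e3, h.f_symm e4]
        rfl)
    convert! Submodule.add_mem _ h7 h8 using 1
    funext z
    ext v
    simp
    ring

lemma IotaRel.dForm (hΦ : IsLogSymplectic D Φ) (hf : IsNormalization (m := m) D f)
    (H : IotaRel D Φ f q b C) : IotaRel D Φ f q (dForm b) (dPrincipalParts 1 C) := by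
  obtain ⟨h1, h2, N, i, g, h, hg, h3⟩ := H
  obtain ⟨a, ha⟩ := hΦ.exists_sympCoord h.adapted
  refine ⟨h.dForm_mem_polarForms h1, dPrincipalParts_mem_num hΦ hf h2, N, i, _, h,
    h.polarCoord_dForm hg, h.mem_extIdeal_of_nabla ha h3 ?_⟩
  have h4 := (mem_extLogForms_iff h.adapted₁).1 (h2 _ h.isFrame_normal).1
  have h5 := (mem_extLogForms_iff h.adapted₁).1 (h.polarExt_mem hg)
  filter_upwards [h.adapted₁.extCoord_dPrincipalParts h4, h.extCoord_polarExt_dForm hg,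
    h4.eventually_hol, h5.eventually_hol] with y e1 e2 e3 e4
  rw [extCoord_sub, e1, e2]
  exact (nabla_sub e3.differentiableAt e4.differentiableAt).symm

lemma IotaRel.den (hΦ : IsLogSymplectic D Φ) (H : IotaRel D Φ f q b C)
    (hb : b ∈ psiForms (m := m) D Φ f k q) : C ∈ (calP (m := m) D Φ f k).den q := by
  obtain ⟨h1, h2, N, i, g, h, hg, h3⟩ := H
  refine h.mem_den_of_normal hΦ h2 ?_
  have := Submodule.add_mem _ h3 ((h.mem_psiForms_iff_polarExt hΦ h1 hg).1 hb)
  rwa [sub_add_cancel] at this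

lemma IotaRel.mem_psiForms (hΦ : IsLogSymplectic D Φ) (H : IotaRel D Φ f q b C)
    (hC : C ∈ (calP (m := m) D Φ f k).den q) : b ∈ psiForms (m := m) D Φ f k q := by
  obtain ⟨h1, h2, N, i, g, h, hg, h3⟩ := H
  refine (h.mem_psiForms_iff_polarExt hΦ h1 hg).2 ?_
  have := Submodule.sub_mem _ (hC _ h.isFrame_normal) h3
  rwa [sub_sub_cancel] at this

/-- The family that takes the polar part as its value on the coordinate frame of the normal bundle,
transported to the other frames by the transition rule. -/
lemma exists_iotaRel (hΦ : IsLogSymplectic D Φ) (hf : IsNormalization (m := m) D f)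
    (hb : b ∈ polarForms (m := m) D f k q) :
    ∃ C, ∀ᶠ q' in 𝓝 q, b ∈ polarForms (m := m) D f k q' → IotaRel D Φ f q' b C := by
  obtain ⟨N, i, h⟩ := hf.exists_on q
  obtain ⟨g, hg⟩ := h.exists_polarCoord hb
  refine ⟨N.frameFamily i (N.polarExt i g), ?_⟩
  filter_upwards [h.nhds, h.eventually_polarCoord hg] with q' h1 h2 h3
  exact ⟨h3, h1.frameFamily_mem hΦ (h1.polarExt_mem h2), N, i, g, h1, h2,
    h1.sub_mem_of_eventually hΦ ((h1.frameFamily_normal _).filter_mono nhdsWithin_le_nhds)⟩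

/-- Inverts the passage to polar parts: the value of `C` on the coordinate frame is extended off the
branch independently of `x_i`, carried back by `branchFrameInv`, and divided by `x_i`. -/
lemma exists_iotaRel_of_num (hΦ : IsLogSymplectic D Φ) (hf : IsNormalization (m := m) D f)
    (hC : C ∈ (calP (m := m) D Φ f k).num q) :
    ∃ b, ∀ᶠ q' in 𝓝 q, C ∈ (calP (m := m) D Φ f k).num q' → IotaRel D Φ f q' b C := by
  obtain ⟨N, i, h⟩ := hf.exists_on q
  obtain ⟨A, hA, hCA⟩ := (mem_extLogForms_iff h.adapted₁).1 (hC _ h.isFrame_normal).1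
  set g : Cn (m + 1) → (Cn (m + 1)) [⋀^Fin k]→L[ℂ] ℂ := fun z =>
    (A (remL i z)).compContinuousLinearMap (branchFrameInv i) with hgdef
  have h1 : remL i (N.e (f q)) = N.c i q := by rw [h.e_apply, remL_insL]
  have h2 : Hol (fun z => A (remL i z)) (N.e (f q)) :=
    Hol.comp (f := remL i) (by rwa [h1]) (Hol.clm _)
  have h3 : N.PolarCoord i q (formOf N.e N.S fun z => (z i)⁻¹ • g z) g := by
    refine ⟨Hol.compForm (A := fun z => A (remL i z)) (L := fun _ => branchFrameInv i) h2
      (Hol.const _), ?_⟩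
    filter_upwards [h.adapted.nhds.filter_mono nhdsWithin_le_nhds, self_mem_nhdsWithin]
      with z e1 e2
    rw [logCoord_formOf N.e_mem _ e1.1 e2, smul_inv_smul₀ (e2 i h.1)]
  have h4 : ∀ y, polarRes g i y = A y := by
    intro y
    ext v
    simp only [polarRes, hgdef, remL_insL, compContinuousLinearMap_apply]
    refine congrArg _ (funext fun j => ?_)
    exact DFunLike.congr_fun branchFrameInv_comp (v j)
  refine ⟨formOf N.e N.S fun z => (z i)⁻¹ • g z, ?_⟩
  filter_upwards [h.nhds, h.eventually_polarCoord h3,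
    ((N.c i).continuousAt h.2).eventually (eventually_nhdsWithin_Off hCA)] with q' e1 e2 e3 e4
  refine ⟨e1.mem_polarForms_iff.2 ⟨_, e2.1, e2.2⟩, e4, N, i, g, e1, e2,
    e1.sub_mem_of_eventually hΦ ?_⟩
  filter_upwards [e3, e1.extCoord_polarExt g] with y e5 e6
  rw [e5, e6, h4]

/-- The comparison of representatives. -/
def iotaCorr (hΦ : IsLogSymplectic D Φ) (hf : IsNormalization (m := m) D f) (k : ℕ) :
    Corr (calE (m := m) D Φ f k) (calP (m := m) D Φ f k) (ContinuousMap.id X₁) where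
  rel q :=
    { carrier := {x | IotaRel D Φ f q x.1 x.2}
      zero_mem' := IotaRel.zero hf q
      add_mem' := fun h h' => IotaRel.add hΦ h h'
      smul_mem' := fun c _ h => IotaRel.mul hΦ h (G := fun _ => c) (g := fun _ => c)
        (Eventually.of_forall fun _ => mdifferentiableAt_const)
        (Eventually.of_forall fun _ => mdifferentiableAt_const) (Eventually.of_forall fun _ => rfl) }
  num h := h.2.1
  den h hb := IotaRel.den hΦ h hb
  exists_rel _ _ hb := exists_iotaRel hΦ hf hb

/-- The complexes `𝓔₁` and `P(N_f)` are isomorphic. -/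
theorem exists_iota (hΦ : IsLogSymplectic D Φ) (hf : IsNormalization (m := m) D f)
    {dE : ∀ k, (calE (m := m) D Φ f k).sheaf ⟶ (calE (m := m) D Φ f (k + 1)).sheaf}
    {dP : ∀ k, (calP (m := m) D Φ f k).sheaf ⟶ (calP (m := m) D Φ f (k + 1)).sheaf}
    (hE : ∀ k, Induced (dE k) (fun a => dForm a))
    (hP : ∀ k, Induced (dP k) (fun C => dPrincipalParts 1 C)) :
    ∃ ι : ∀ k, (calE (m := m) D Φ f k).sheaf ≅ (calP (m := m) D Φ f k).sheaf,
      (∀ k, dE k ≫ (ι (k + 1)).hom = (ι k).hom ≫ dP k) ∧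
      ∀ k V (g : X₁ → ℂ) s t, (∀ q ∈ V, HolFun m g q) → IsMulE g s t →
        IsMulPP g (onSec (ι k).hom V s) (onSec (ι k).hom V t) := by
  let R := iotaCorr (m := m) hΦ hf
  have hbij : ∀ k U, Function.Bijective ((R k).secMap U) := fun k U =>
    have inj : ∀ q b, b ∈ (calE (m := m) D Φ f k).num q →
        (∀ q', ContinuousMap.id X₁ q' = q → ∃ C, (b, C) ∈ (R k).rel q' ∧
          C ∈ (calP (m := m) D Φ f k).den q') → b ∈ (calE (m := m) D Φ f k).den q :=
      fun q b _ h => by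
        obtain ⟨C, h1, h2⟩ := h q rfl
        exact IotaRel.mem_psiForms hΦ h1 h2
    ⟨(R k).injective_secMap inj U, (R k).surjective_secMap U (fun t q hq => by
      obtain ⟨C, hC⟩ := exists_eventually_rep t ⟨q, hq⟩
      obtain ⟨b, hb⟩ := exists_iotaRel_of_num hΦ hf (hC.self_of_nhds hq).num
      refine ⟨b, ?_⟩
      filter_upwards [hC, hb, U.2.mem_nhds hq] with q' h1 h2 h3
      have h4 := h2 (h1 h3).num
      exact ⟨h4.1, fun q'' e hq'' => by
        subst e
        exact ⟨C, h1 hq'', h4⟩⟩) inj⟩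
  have := fun k => (R k).isIso_hom (hbij k)
  refine ⟨fun k => asIso (R k).hom, fun k => ?_, fun k V g s t hg hst q => ?_⟩
  · refine hom_ext_of_rep fun V s q => ?_
    obtain ⟨b, C, hb, hbC, hC⟩ := (R k).exists_rep_secMap s q
    exact ⟨dPrincipalParts 1 C, (R (k + 1)).rep_onSec_hom ((hE k).rep hb)
      (IotaRel.dForm hΦ hf hbC), (hP k).rep hC⟩
  · obtain ⟨G, hG, hGg, b, h1, h2⟩ := hst q
    obtain ⟨C, hC⟩ := (R k).exists_rel q.1 b h1.num
    have hbC := hC.self_of_nhds h1.num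
    exact ⟨C, (R k).rep_onSec_hom h1 hbC,
      (R k).rep_onSec_hom h2 (IotaRel.mul hΦ hbC hG (hg _ q.2) hGg)⟩

end Iota

/-! ### The complexes -/

section Complexes

open Subquot

variable {m : ℕ} {X X₁ : Type} [TopologicalSpace X] [ChartedSpace (Cn (m + 1)) X]
  [IsManifold 𝓘(ℂ, Cn (m + 1)) ω X] [TopologicalSpace X₁] [ChartedSpace (Cn m) X₁]
  [IsManifold 𝓘(ℂ, Cn m) ω X₁] {D : Set X} {f : X₁ → X} {Φ : Form (m + 1) 2 X}

lemma comp_dG (hΦ : IsLogSymplectic D Φ) (hf : IsNormalization (m := m) D f)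
    {d : ∀ k, (grOne D Φ k).sheaf ⟶ (grOne D Φ (k + 1)).sheaf}
    (hd : ∀ k, Induced (d k) (fun a => -dForm a)) (k : ℕ) : d k ≫ d (k + 1) = 0 := by
  refine (hd k).comp_eq_zero (hd (k + 1)) fun p a ha => ?_
  obtain ⟨N, hp⟩ := hf.exists_normChart p
  obtain ⟨b, hb⟩ := (N.mem_filt_iff hΦ hp).1 ha
  have h1 := (N.adapted hp).dForm_dForm_mem (hb.genHol hΦ hp)
  -- Moves the inner sign of `-d(-da)` outside, modulo log forms.
  have h2 := (N.adapted hp).dForm_smul_mem ((hb.dForm hΦ hp).genHol hΦ hp) (-1)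
  have e : ∀ {l : ℕ} (x : Form (m + 1) l X), (-1 : ℂ) • x = -x := fun x => by ext; simp
  rw [e, e, neg_neg] at h2
  have h3 := (logForms D (k + 3) p).sub_mem h1 h2
  rwa [sub_sub_cancel] at h3

lemma comp_dE (hΦ : IsLogSymplectic D Φ) (hf : IsNormalization (m := m) D f)
    {d : ∀ k, (calE (m := m) D Φ f k).sheaf ⟶ (calE (m := m) D Φ f (k + 1)).sheaf}
    (hd : ∀ k, Induced (d k) (fun a => dForm a)) (k : ℕ) : d k ≫ d (k + 1) = 0 := by
  refine (hd k).comp_eq_zero (hd (k + 1)) fun q a ha => ?_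
  obtain ⟨N, i, h⟩ := hf.exists_on q
  exact h.logForms_le_psiForms hΦ (h.adapted.dForm_dForm_mem (h.genHol ha))

/-- A contraction of a complex yields one of any complex whose direct image is isomorphic. -/
lemma nonempty_homotopy_of_contraction_iso {𝒱 𝒱' : Type*} [Category 𝒱] [Preadditive 𝒱]
    [Category 𝒱'] [Preadditive 𝒱'] {Ψ : 𝒱' ⥤ 𝒱} [Ψ.Additive] {F : ℕ → 𝒱} {F' : ℕ → 𝒱'}
    {d : ∀ n, F n ⟶ F (n + 1)} {d' : ∀ n, F' n ⟶ F' (n + 1)} (hd : ∀ n, d n ≫ d (n + 1) = 0)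
    {κ : ∀ n, F n ≅ Ψ.obj (F' n)} (hκ : ∀ n, d n ≫ (κ (n + 1)).hom = (κ n).hom ≫ Ψ.map (d' n))
    {h : ∀ n, F' (n + 1) ⟶ F' n} (h0 : d' 0 ≫ h 0 = 𝟙 _)
    (hs : ∀ n, h n ≫ d' n + d' (n + 1) ≫ h (n + 1) = 𝟙 _) :
    Nonempty (Homotopy (𝟙 (CochainComplex.of F d hd)) 0) := by
  have e : ∀ n, Ψ.map (d' n) ≫ (κ (n + 1)).inv = (κ n).inv ≫ d n := fun n => by
    rw [Iso.comp_inv_eq, Category.assoc, hκ, Iso.inv_hom_id_assoc]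
  refine nonempty_homotopy_of_contraction hd
    (fun n => (κ (n + 1)).hom ≫ Ψ.map (h n) ≫ (κ n).inv) ?_ fun n => ?_
  · rw [← Category.assoc, hκ, Category.assoc, ← Functor.map_comp_assoc, h0]
    simp
  · have h1 : ((κ (n + 1)).hom ≫ Ψ.map (h n) ≫ (κ n).inv) ≫ d n =
        (κ (n + 1)).hom ≫ Ψ.map (h n ≫ d' n) ≫ (κ (n + 1)).inv := by
      simp [← e]
    have h2 : d (n + 1) ≫ (κ (n + 1 + 1)).hom ≫ Ψ.map (h (n + 1)) ≫ (κ (n + 1)).inv =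
        (κ (n + 1)).hom ≫ Ψ.map (d' (n + 1) ≫ h (n + 1)) ≫ (κ (n + 1)).inv := by
      rw [← Category.assoc, hκ]
      simp
    rw [h1, h2, ← Preadditive.comp_add, ← Preadditive.add_comp, ← Ψ.map_add, hs]
    simp

instance additive_directImage {X X₁ : Type} [TopologicalSpace X] [TopologicalSpace X₁]
    (f : C(X₁, X)) : (directImage f).Additive where
  map_add := rfl

end Complexes

end LogSymp

end

open LogSymp in
theorem mainTheorem4 {m : ℕ} {X X₁ : Type}
    [TopologicalSpace X] [T2Space X] [ChartedSpace (Cn (m + 1)) X]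
    [IsManifold 𝓘(ℂ, Cn (m + 1)) ω X]
    [TopologicalSpace X₁] [T2Space X₁] [ChartedSpace (Cn m) X₁] [IsManifold 𝓘(ℂ, Cn m) ω X₁]
    (D : Set X) (hD : IsNormalCrossing (m := m + 1) D)
    (Φ : Form (m + 1) 2 X) (hΦ : IsLogSymplectic D Φ)
    (f : C(X₁, X)) (hf : IsNormalization (m := m) D f) :
    -- the differentials of the three complexes, induced by the exterior derivatives
    ∃ (dG : ∀ k, (grOne D Φ k).sheaf ⟶ (grOne D Φ (k + 1)).sheaf)
      (dE : ∀ k, (calE (m := m) D Φ f k).sheaf ⟶ (calE (m := m) D Φ f (k + 1)).sheaf)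
      (dP : ∀ k, (calP (m := m) D Φ f k).sheaf ⟶ (calP (m := m) D Φ f (k + 1)).sheaf)
      (hG : ∀ k, dG k ≫ dG (k + 1) = 0) (hE : ∀ k, dE k ≫ dE (k + 1) = 0)
      (hP : ∀ k, dP k ≫ dP (k + 1) = 0),
      (∀ k, Subquot.Induced (dG k) (fun a => -dForm a)) ∧
      (∀ k, Subquot.Induced (dE k) (fun a => dForm a)) ∧
      (∀ k, Subquot.Induced (dP k) (fun C => dPrincipalParts 1 C)) ∧
      -- the complex `𝓖₁` is the direct image of the complex `𝓔₁`
      (∃ κ : ∀ k, (grOne D Φ k).sheaf ≅ (directImage f).obj (calE (m := m) D Φ f k).sheaf,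
        (∀ k, dG k ≫ (κ (k + 1)).hom = (κ k).hom ≫ (directImage f).map (dE k)) ∧
        ∀ k U (g : X → ℂ) s t, (∀ p ∈ U, HolFun (m + 1) g p) → IsMulG g s t →
          IsMulE (g ∘ f) (onSecDirect (κ k).hom U s) (onSecDirect (κ k).hom U t)) ∧
      -- the complexes `𝓔₁` and `P(N_f)` are isomorphic
      (∃ ι : ∀ k, (calE (m := m) D Φ f k).sheaf ≅ (calP (m := m) D Φ f k).sheaf,
        (∀ k, dE k ≫ (ι (k + 1)).hom = (ι k).hom ≫ dP k) ∧
        ∀ k V (g : X₁ → ℂ) s t, (∀ q ∈ V, HolFun m g q) → IsMulE g s t →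
          IsMulPP g (Subquot.onSec (ι k).hom V s) (Subquot.onSec (ι k).hom V t)) ∧
      -- `𝓔₁` is null-homotopic and exact, and `𝓖₁` is exact
      Nonempty (Homotopy (𝟙 (CochainComplex.of _ dE hE)) 0) ∧
      (CochainComplex.of _ dE hE).Acyclic ∧
      (CochainComplex.of _ dG hG).Acyclic := by
  choose dG hdG using exists_dG (m := m) hΦ hf
  choose dE hdE using exists_dE (m := m) hΦ hf
  choose dP hdP using exists_dP (m := m) hΦ hf
  have hG : ∀ k, dG k ≫ dG (k + 1) = 0 := comp_dG hΦ hf hdG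
  have hE : ∀ k, dE k ≫ dE (k + 1) = 0 := comp_dE hΦ hf hdE
  have hP : ∀ k, dP k ≫ dP (k + 1) = 0 := fun k =>
    (hdP k).comp_eq_zero (hdP (k + 1)) fun _ _ => dPrincipalParts_dPrincipalParts hΦ hf
  obtain ⟨κ, hκ, hκ'⟩ := exists_kappa hΦ hf hdG hdE
  obtain ⟨σ, hσ0, hσ⟩ := exists_homotopyE hΦ hf hdE
  obtain ⟨H⟩ := nonempty_homotopy_of_contraction hE σ hσ0 hσ
  -- The homotopy of `𝓔₁` is pushed forward and transported by `κ`; exactness of `𝓖₁` follows from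
  -- it rather than from exactness of the direct image functor.
  obtain ⟨H'⟩ := nonempty_homotopy_of_contraction_iso hG hκ hσ0 hσ
  exact ⟨dG, dE, dP, hG, hE, hP, hdG, hdE, hdP, ⟨κ, hκ, hκ'⟩, exists_iota hΦ hf hdE hdP, ⟨H⟩,
    acyclic_of_homotopy hE H, acyclic_of_homotopy hG H'⟩
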